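/- Let $d\ge 1$ and $\lambda>0$. For $c,C>0$ put $g_{c,C}(x,t)=c\,t^{-d/2}\exp(-C|x|^2/t)$ for $x\in\mathbb R^d$, $t>0$. There is a constant $\varpi>0$, depending only on $\lambda$ and $d$, such that for all $K_a$ and all $T>0$ there is a constant $\varrho>0$, depending only on $\lambda,d,K_a,T$, with the following property. Let $a:\mathbb R^d\times[0,\infty)\to\mathbb R^{d\times d}$ be a measurable matrix field satisfying (H1) $\lambda^{-1}|\zeta|^2\le a(x,t)\zeta\cdot\zeta\le\lambda|\zeta|^2$ for all $x,\zeta\in\mathbb R^d$, $t\ge 0$; (H2) for every $t\ge 0$ the function $a(\cdot,t)$ is of class $C^1$ on $\mathbb R^d$, and $|\nabla a_{ij}(x,t)|\le K_a$ for all $x,t,i,j$ (no regularity in $t$ beyond measurability is assumed). Then the weak fundamental solution $\Gamma$ of $\partial_t u=\mathrm{div}(a\nabla u)$ on $\mathbb R^d\times(0,T]$ exists, and $\Gamma(\cdot,t,y,s)$ is differentiable on $\mathbb R^d$ with $$|\nabla_x\Gamma(x,t,y,s)|\le\frac{1}{\sqrt{t-s}}\;g_{\varrho,\varpi}(x-y,t-s)\qquad\text{for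 all }x,y\in\mathbb R^d,\ 0\le s<t\le T.$$ Here a weak fundamental solution is a function $\Gamma(x,t,y,s)$, continuous in $(x,t,y)$ on $\{s<t\le T\}$ for each $s\in[0,T)$, such that for each $s\in[0,T)$ and each continuous compactly supported $\varphi$ the function $u(x,t)=\int_{\mathbb R^d}\Gamma(x,t,y,s)\varphi(y)\,dy$ is a weak solution of the Cauchy problem with datum $\varphi$ at time $s$: $u\in L^\infty(s,T;L^2(\mathbb R^d))\cap L^2(s,T;H^1(\mathbb R^d))$ and $$\int_s^T\Big(\int_{\mathbb R^d}\big(a\nabla u\cdot\nabla\eta-u\,\partial_t\eta\big)\,dx\Big)dt=\int_{\mathbb R^d}\varphi(x)\,\eta(x,s)\,dx\qquad\text{for all }\eta\in C_c^\infty(\mathbb R^d\times(-\infty,T)).$$ The estimate holds for every such $\Gamma$. -/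

import Mathlib

open MeasureTheory Set

open scoped ContDiff

noncomputable section

namespace AronsonGradient

/-- The Euclidean space of dimension `d`. -/
abbrev Space (d : ℕ) : Type := EuclideanSpace ℝ (Fin d)

/-- A time-dependent matrix field `a(x,t)`; only its values at times `t ≥ 0` matter. -/
abbrev MatrixField (d : ℕ) : Type := Space d → ℝ → Matrix (Fin d) (Fin d) ℝ

/-- Uniform ellipticity: `λ⁻¹ |ζ|² ≤ a(x,t)ζ·ζ ≤ λ |ζ|²` for all `x`, all `t ≥ 0` and all `ζ`.
No symmetry of `a` is required. -/
def UniformlyElliptic {d : ℕ} (a : MatrixField d) (lam : ℝ) : Prop :=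
  ∀ t : ℝ, 0 ≤ t → ∀ x ζ : Space d,
    lam⁻¹ * ‖ζ‖ ^ 2 ≤ inner ℝ (Matrix.toEuclideanLin (a x t) ζ) ζ ∧
      inner ℝ (Matrix.toEuclideanLin (a x t) ζ) ζ ≤ lam * ‖ζ‖ ^ 2

/-- The field `a` is (jointly) measurable on `ℝᵈ × [0,∞)`, and for every `t ≥ 0` it is of class
`C¹` in `x` with the gradients of its entries bounded by `K`. Nothing beyond measurability is
required in `t`. -/
structure SpatiallyRegular {d : ℕ} (a : MatrixField d) (K : ℝ) : Prop where
  measurable : ∀ i j : Fin d,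
    Measurable ((univ ×ˢ Ici (0 : ℝ)).domRestrict (fun p : Space d × ℝ => a p.1 p.2 i j))
  contDiff : ∀ t : ℝ, 0 ≤ t → ∀ i j : Fin d, ContDiff ℝ 1 (fun x : Space d => a x t i j)
  gradient_le : ∀ t : ℝ, 0 ≤ t → ∀ (x : Space d) (i j : Fin d),
    ‖gradient (fun z : Space d => a z t i j) x‖ ≤ K

/-- The Gaussian function `g_{c,C}(x,t) = c t^{-d/2} exp(-C|x|²/t)`. -/
def gaussianBound {d : ℕ} (c C : ℝ) (x : Space d) (t : ℝ) : ℝ :=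
  c * t ^ (-(d : ℝ) / 2) * Real.exp (-(C * ‖x‖ ^ 2 / t))

/-- The function `η` of `(x,t)` is smooth with compact support contained in `ℝᵈ × J`. -/
structure IsTestFunction {d : ℕ} (J : Set ℝ) (η : Space d × ℝ → ℝ) : Prop where
  smooth : ContDiff ℝ ∞ η
  compact : HasCompactSupport η
  support_subset : tsupport η ⊆ univ ×ˢ J

/-- `G` is the weak (distributional) spatial gradient of `u` on `ℝᵈ × (s,T)`. -/
def IsWeakSpatialGradient {d : ℕ} (s T : ℝ) (u : Space d → ℝ → ℝ) (G : Space d → ℝ → Space d) :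
    Prop :=
  ∀ η : Space d × ℝ → ℝ, IsTestFunction (Ioo s T) η →
    ∫ p in (univ : Set (Space d)) ×ˢ Ioo s T,
        u p.1 p.2 • gradient (fun z : Space d => η (z, p.2)) p.1 =
      -∫ p in (univ : Set (Space d)) ×ˢ Ioo s T, η p • G p.1 p.2

/-- `u` is a weak solution, in the energy class `L^∞(s,T; L²) ∩ L²(s,T; H¹)`, of the Cauchy problem
`∂ₜu = div(a∇u)` in `ℝᵈ × (s,T)`, `u(·,s) = φ`:
for all test functions `η` supported in `ℝᵈ × (-∞,T)`,
`∫ₛᵀ ∫ (a∇u·∇η - u ∂ₜη) dx dt = ∫ φ(x) η(x,s) dx`. The integral over space and time is iterated: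
for almost every `t` the inner integrand is integrable in `x`, whether or not `a`
has an antisymmetric part that is unbounded in time. -/
def IsWeakSolution {d : ℕ} (a : MatrixField d) (s T : ℝ) (φ : Space d → ℝ)
    (u : Space d → ℝ → ℝ) : Prop :=
  MemLp (fun p : Space d × ℝ => u p.1 p.2) 2 (volume.restrict (univ ×ˢ Ioo s T)) ∧
  (∃ M : ℝ, ∀ᵐ t ∂(volume.restrict (Ioo s T)),
    MemLp (fun x => u x t) 2 volume ∧ ∫ x, u x t ^ 2 ≤ M) ∧
  ∃ G : Space d → ℝ → Space d,
    MemLp (fun p : Space d × ℝ => G p.1 p.2) 2 (volume.restrict (univ ×ˢ Ioo s T)) ∧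
    IsWeakSpatialGradient s T u G ∧
    ∀ η : Space d × ℝ → ℝ, IsTestFunction (Iio T) η →
      ∫ t in Ioo s T, ∫ x : Space d,
          (inner ℝ (Matrix.toEuclideanLin (a x t) (G x t)) (gradient (fun z => η (z, t)) x) -
            u x t * deriv (fun τ => η (x, τ)) t) =
        ∫ x, φ x * η (x, s)

/-- `Γ(x,t,y,s)` is a weak fundamental solution of `∂ₜu = div(a∇u)` on `ℝᵈ × (0,T]`: for every
initial time `s ∈ [0,T)` it is continuous in `(x,t,y)` for `s < t ≤ T` (this selects the
representative, so that pointwise values are meaningful), and for every continuous compactly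
supported datum `φ` the function `u(x,t) = ∫ Γ(x,t,y,s) φ(y) dy` is a weak solution of the Cauchy
problem with `u(·,s) = φ`. -/
structure IsWeakFundamentalSolution {d : ℕ} (a : MatrixField d) (T : ℝ)
    (Γ : Space d → ℝ → Space d → ℝ → ℝ) : Prop where
  continuousOn : ∀ s : ℝ, 0 ≤ s → s < T →
    ContinuousOn (fun p : Space d × ℝ × Space d => Γ p.1 p.2.1 p.2.2 s)
      {p | s < p.2.1 ∧ p.2.1 ≤ T}
  cauchy : ∀ s : ℝ, 0 ≤ s → s < T → ∀ φ : Space d → ℝ, Continuous φ → HasCompactSupport φ →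
    IsWeakSolution a s T φ (fun x t => ∫ y, Γ x t y s * φ y)

end AronsonGradient

end

open MeasureTheory Set

set_option linter.unusedSectionVars false

open scoped ContDiff

noncomputable section

namespace AronsonGradient

/-! The proof is Levi's parametrix method, adapted to coefficients that are merely measurable in
time. Only the spatial variable is frozen, at the pole `y`. The frozen kernel `Z` is the Gaussian
whose covariance is proportional to the accumulated matrix `cumMat`, the integral over `(s,t)` of
the symmetric part of `a(y,·)`. This matrix is Lipschitz in `t` and comparable to `(t-s)` times the
identity, and for almost every `t` the kernel solves `∂ₜZ = div(a(y,t)∇Z)`.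

Write `r = t-s` and `ρ = |x-y|/√r`. In the error `R = ∂ₜZ - div(a∇Z)` the second derivatives of `Z`,
of order `1/r`, are multiplied by a difference of coefficients of size `K|x-y| = Kρ√r`. So `R`, like
`∇Z`, has order `r^{-1/2}` times a polynomial in `ρ` times a Gaussian. Half of the exponent `1/(4λ)`
absorbs the polynomial; the other half is the rate `ϖ = 1/(8λ)` (`weighted_matGauss_le`,
`abs_frozenFactor_le`).

The corrected kernel is `Γ = Z + Z ⋆ Φ` with `Φ = -R - R ⋆ Φ`. By the Chapman–Kolmogorov identity a
composition of two kernels keeps the Gaussian rate exactly; it costs only the Gaussian mass and a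
convolution of time weights. With the weight `r^{-1/2} e^{(1+ν)r}` and `ν` large this convolution
gains any prescribed small factor (`exists_timeWeight_convolution`), so the Neumann series for `Φ`
is geometric (`exists_volterra`). The gradient `∇Z + ∇Z ⋆ Φ` inherits the bound `N r^{-1/2}
e^{(1+ν)r}` times the Gaussian, and `T` enters only through the exponential (`exists_levi_kernel`).

The equation for `Γ` is never used pointwise, so no second derivatives of `Z ⋆ Φ` are needed.
Instead `Z` satisfies an adjoint identity with error against every test function (`isAdjointTest`),
and the Volterra equation removes the error after an exchange of integrals
(`integral_pairing_correction`).

Ellipticity does not bound the antisymmetric part of `a`, which may be unbounded in time. Since that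
part cancels against symmetric Hessians, it acts as a first-order drift made of its spatial
derivatives, and these are bounded by `K`. The weak form is therefore rewritten with the symmetric
part and the drift (`integral_weak_form`).

Two points rest on the energy inequality `energy_le`, obtained by mollification in space-time. The
pointwise gradient bound just fails to be square integrable up to the initial time, so the energy
class for `∫ Γ φ` comes from cutoffs in time with uniformly bounded variation
(`integral_norm_grad_le`). And weak solutions are unique (`ae_eq_of_isWeakSolution`). By uniqueness
and continuity every weak fundamental solution coincides with the constructed one
(`eq_of_isWeakFundamentalSolution`), so the estimate holds for all of them. -/

/-- The comparison Gaussian between the space-time points `q` (past) and `p` (future). -/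
def gaussKernel {d : ℕ} (b : ℝ) (p q : Space d × ℝ) : ℝ :=
  if q.2 < p.2 then gaussianBound 1 b (p.1 - q.1) (p.2 - q.2) else 0

/-- The total mass of the comparison Gaussian. -/
def gaussMass (d : ℕ) (b : ℝ) : ℝ := (Real.pi / b) ^ ((d : ℝ) / 2)

/-! ### The comparison Gaussian and its semigroup property. -/

section Gaussian

variable {d : ℕ} {b : ℝ}

lemma gaussMass_pos (hb : 0 < b) : 0 < gaussMass d b :=
  Real.rpow_pos_of_pos (div_pos Real.pi_pos hb) _

lemma gaussianBound_nonneg {c : ℝ} (hc : 0 ≤ c) (x : Space d) {t : ℝ} (ht : 0 ≤ t) :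
    0 ≤ gaussianBound c b x t :=
  mul_nonneg (mul_nonneg hc (Real.rpow_nonneg ht _)) (Real.exp_pos _).le

lemma gaussKernel_nonneg (p q : Space d × ℝ) : 0 ≤ gaussKernel b p q := by
  unfold gaussKernel
  split_ifs with h
  · exact gaussianBound_nonneg zero_le_one _ (by linarith)
  · exact le_rfl

lemma gaussKernel_of_lt {p q : Space d × ℝ} (h : q.2 < p.2) :
    gaussKernel b p q = gaussianBound 1 b (p.1 - q.1) (p.2 - q.2) := if_pos h

lemma gaussKernel_of_le {p q : Space d × ℝ} (h : p.2 ≤ q.2) : gaussKernel b p q = 0 :=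
  if_neg (not_lt.mpr h)

lemma gaussKernel_le (hb : 0 ≤ b) (p q : Space d × ℝ) (h : q.2 < p.2) :
    gaussKernel b p q ≤ (p.2 - q.2) ^ (-(d : ℝ) / 2) := by
  rw [gaussKernel_of_lt h, gaussianBound, one_mul]
  have h0 : 0 < p.2 - q.2 := by linarith
  refine mul_le_of_le_one_right (Real.rpow_nonneg h0.le _) ?_
  rw [Real.exp_le_one_iff]
  have : 0 ≤ b * ‖p.1 - q.1‖ ^ 2 / (p.2 - q.2) := by positivity
  linarith

lemma measurable_gaussKernel :
    Measurable (Function.uncurry (gaussKernel b : Space d × ℝ → Space d × ℝ → ℝ)) := by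
  unfold gaussKernel gaussianBound
  refine Measurable.ite (measurableSet_lt (by fun_prop) (by fun_prop)) ?_ measurable_const
  fun_prop

lemma integrable_exp_sq (hb : 0 < b) :
    Integrable (fun x : Space d => Real.exp (-(b * ‖x‖ ^ 2))) := by
  have h := GaussianFourier.integral_rexp_neg_mul_sq_norm (V := Space d) hb
  refine Integrable.of_integral_ne_zero ?_
  simp only [← neg_mul]
  rw [h]
  exact (Real.rpow_pos_of_pos (div_pos Real.pi_pos hb) _).ne'

lemma integral_gaussianBound (hb : 0 < b) {r : ℝ} (hr : 0 < r) :
    Integrable (fun x : Space d => gaussianBound 1 b x r) ∧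
      ∫ x : Space d, gaussianBound 1 b x r = gaussMass d b := by
  have hbr : 0 < b / r := div_pos hb hr
  have e : (fun x : Space d => gaussianBound 1 b x r) =
      fun x => r ^ (-(d : ℝ) / 2) * Real.exp (-(b / r * ‖x‖ ^ 2)) := by
    ext x; unfold gaussianBound; rw [one_mul]; congr 2; ring
  rw [e]
  refine ⟨(integrable_exp_sq hbr).const_mul _, ?_⟩
  rw [integral_const_mul]
  have h := GaussianFourier.integral_rexp_neg_mul_sq_norm (V := Space d) hbr
  simp only [neg_mul] at h
  rw [h, gaussMass, finrank_euclideanSpace, Fintype.card_fin]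
  have : Real.pi / (b / r) = (Real.pi / b) * r := by field_simp
  rw [this, Real.mul_rpow (div_pos Real.pi_pos hb).le hr.le, neg_div, Real.rpow_neg hr.le]
  have := (Real.rpow_pos_of_pos hr ((d : ℝ) / 2)).ne'
  field_simp

lemma integral_gaussKernel_left (hb : 0 < b) {t : ℝ} {q : Space d × ℝ} (h : q.2 < t) :
    Integrable (fun x : Space d => gaussKernel b (x, t) q) ∧
      ∫ x : Space d, gaussKernel b (x, t) q = gaussMass d b := by
  have h1 := integral_gaussianBound (d := d) hb (sub_pos.mpr h)
  simp only [gaussKernel_of_lt (p := (_, t)) h]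
  refine ⟨h1.1.comp_sub_right q.1, ?_⟩
  rw [integral_sub_right_eq_self (fun x => gaussianBound 1 b x (t - q.2)) q.1, h1.2]

lemma integral_gaussKernel_right (hb : 0 < b) {s : ℝ} {p : Space d × ℝ} (h : s < p.2) :
    Integrable (fun y : Space d => gaussKernel b p (y, s)) ∧
      ∫ y : Space d, gaussKernel b p (y, s) = gaussMass d b := by
  have h1 := integral_gaussianBound (d := d) hb (sub_pos.mpr h)
  simp only [gaussKernel_of_lt (q := (_, s)) h]
  refine ⟨h1.1.comp_sub_left p.1, ?_⟩
  rw [integral_sub_left_eq_self (fun x => gaussianBound 1 b x (p.2 - s)) volume p.1, h1.2]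

/-- Completing the square in `z`: the product of two Gaussians is a Gaussian in `z` centred at a
weighted mean of `x` and `y`, with time parameter `αβ/(α+β)`. The rate `b` is the same on both
sides, which is why compositions never lose decay. -/
lemma gaussianBound_mul {α β : ℝ} (hα : 0 < α) (hβ : 0 < β) (x y z : Space d) :
    gaussianBound 1 b (x - z) α * gaussianBound 1 b (z - y) β =
      gaussianBound 1 b (x - y) (α + β) *
        gaussianBound 1 b (z - (α + β)⁻¹ • (β • x + α • y)) (α * β / (α + β)) := by
  have hs : 0 < α + β := by positivity
  have key : ‖x - z‖ ^ 2 / α + ‖z - y‖ ^ 2 / β = ‖x - y‖ ^ 2 / (α + β) +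
      ‖z - (α + β)⁻¹ • (β • x + α • y)‖ ^ 2 / (α * β / (α + β)) := by
    have e1 : x - y = (x - z) + (z - y) := by abel
    have e2 : z - (α + β)⁻¹ • (β • x + α • y) =
        (α + β)⁻¹ • (α • (z - y) - β • (x - z)) := by
      have : z = (α + β)⁻¹ • ((α + β) • z) := by
        rw [smul_smul, inv_mul_cancel₀ hs.ne', one_smul]
      conv_lhs => rw [this]
      rw [← smul_sub]; congr 1
      simp only [smul_sub, add_smul]; abel
    rw [e1, e2]
    generalize x - z = u
    generalize z - y = v
    rw [norm_smul, mul_pow, norm_add_sq_real, norm_sub_sq_real, norm_smul, norm_smul,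
      inner_smul_left, inner_smul_right, real_inner_comm v u]
    simp only [Real.norm_eq_abs, sq_abs, mul_pow, conj_trivial]
    field_simp
    ring
  simp only [gaussianBound, one_mul]
  rw [Real.div_rpow (by positivity) hs.le, Real.mul_rpow hα.le hβ.le]
  have h1 := (Real.rpow_pos_of_pos hs (-(d : ℝ) / 2)).ne'
  have e3 : Real.exp (-(b * ‖x - z‖ ^ 2 / α)) * Real.exp (-(b * ‖z - y‖ ^ 2 / β)) =
      Real.exp (-(b * ‖x - y‖ ^ 2 / (α + β))) *
      Real.exp (-(b * ‖z - (α + β)⁻¹ • (β • x + α • y)‖ ^ 2 / (α * β / (α + β)))) := by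
    rw [← Real.exp_add, ← Real.exp_add]
    congr 1
    have := congrArg (fun u => -(b * u)) key
    simp only [mul_add, neg_add, mul_div_assoc] at this ⊢
    exact this
  rw [mul_mul_mul_comm, e3]
  field_simp

/-- Chapman–Kolmogorov identity for the comparison Gaussian. -/
lemma integral_gaussKernel_mul (hb : 0 < b) {p q : Space d × ℝ} {τ : ℝ} (h1 : q.2 < τ)
    (h2 : τ < p.2) :
    Integrable (fun z : Space d => gaussKernel b p (z, τ) * gaussKernel b (z, τ) q) ∧
      ∫ z : Space d, gaussKernel b p (z, τ) * gaussKernel b (z, τ) q =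
        gaussMass d b * gaussKernel b p q := by
  have hα : 0 < p.2 - τ := by linarith
  have hβ : 0 < τ - q.2 := by linarith
  have hr : 0 < (p.2 - τ) * (τ - q.2) / (p.2 - τ + (τ - q.2)) := by positivity
  have h := integral_gaussianBound (d := d) hb hr
  rw [gaussKernel_of_lt (h1.trans h2)]
  simp only [gaussKernel_of_lt (p := (_, τ)) h1, gaussKernel_of_lt (q := (_, τ)) h2,
    gaussianBound_mul hα hβ]
  rw [show p.2 - τ + (τ - q.2) = p.2 - q.2 by ring] at *
  refine ⟨(h.1.comp_sub_right _).const_mul _, ?_⟩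
  rw [integral_const_mul, integral_sub_right_eq_self (fun x => gaussianBound 1 b x _), h.2,
    mul_comm]

end Gaussian

/-! ### Convolution of the singular time weights. -/

section TimeWeight

/-- The time weight `r^{-1/2} e^{μ r}`. -/
def timeWeight (μ r : ℝ) : ℝ := (√r)⁻¹ * Real.exp (μ * r)

lemma timeWeight_nonneg (μ r : ℝ) : 0 ≤ timeWeight μ r := by unfold timeWeight; positivity

lemma measurable_timeWeight (μ : ℝ) : Measurable (timeWeight μ) := by
  unfold timeWeight; fun_prop

lemma integral_inv_sqrt_indicator {δ : ℝ} (hδ : 0 ≤ δ) :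
    Integrable ((Ioc 0 δ).indicator fun σ : ℝ => (√σ)⁻¹) ∧
      ∫ σ, (Ioc 0 δ).indicator (fun σ : ℝ => (√σ)⁻¹) σ = 2 * √δ := by
  have e : ∀ σ ∈ Ioc 0 δ, (√σ)⁻¹ = σ ^ (-(1 / 2) : ℝ) := by
    intro σ hσ
    rw [Real.sqrt_eq_rpow, Real.rpow_neg hσ.1.le]
  have e' : (Ioc 0 δ).indicator (fun σ : ℝ => (√σ)⁻¹) =
      (Ioc 0 δ).indicator (fun σ : ℝ => σ ^ (-(1 / 2) : ℝ)) := indicator_congr e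
  have hi := intervalIntegral.intervalIntegrable_rpow' (a := 0) (b := δ)
    (r := (-(1 / 2) : ℝ)) (by norm_num)
  rw [intervalIntegrable_iff_integrableOn_Ioc_of_le hδ] at hi
  rw [e']
  refine ⟨hi.integrable_indicator measurableSet_Ioc, ?_⟩
  rw [integral_indicator measurableSet_Ioc, ← intervalIntegral.integral_of_le hδ,
    integral_rpow (Or.inl (by norm_num)), Real.sqrt_eq_rpow]
  norm_num
  ring

lemma integral_exp_indicator {ν : ℝ} (hν : 0 < ν) :
    Integrable ((Ioi 0).indicator fun σ : ℝ => Real.exp (-ν * σ)) ∧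
      ∫ σ, (Ioi 0).indicator (fun σ : ℝ => Real.exp (-ν * σ)) σ = ν⁻¹ := by
  refine ⟨(integrableOn_exp_mul_Ioi (neg_lt_zero.mpr hν) 0).integrable_indicator
    measurableSet_Ioi, ?_⟩
  rw [integral_indicator measurableSet_Ioi, integral_exp_mul_Ioi (neg_lt_zero.mpr hν)]
  simp

/-- This is `√(A+B) ≤ √A + √B`. With `A = t-τ` and `B = τ-s` it pulls the target singularity out of
the convolution and leaves two one-sided singularities. -/
lemma inv_sqrt_mul_inv_sqrt_le {A B : ℝ} (hA : 0 < A) (hB : 0 < B) :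
    (√A)⁻¹ * (√B)⁻¹ ≤ (√(A + B))⁻¹ * ((√A)⁻¹ + (√B)⁻¹) := by
  have hA' := Real.sqrt_pos.mpr hA
  have hB' := Real.sqrt_pos.mpr hB
  have hs := Real.sqrt_pos.mpr (add_pos hA hB)
  have : √(A + B) ≤ √A + √B := by
    rw [Real.sqrt_le_left (by positivity)]
    nlinarith [Real.sq_sqrt hA.le, Real.sq_sqrt hB.le, mul_pos hA' hB']
  rw [inv_add_inv hA'.ne' hB'.ne', ← mul_inv, ← div_eq_inv_mul, inv_eq_one_div,
    div_div, div_le_div_iff₀ (by positivity) (by positivity)]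
  nlinarith [mul_pos hA' hB']

/-- Convolution in time of the weights gains an arbitrarily small factor. -/
lemma exists_timeWeight_convolution {ε : ℝ} (hε : 0 < ε) :
    ∃ ν : ℝ, 0 < ν ∧ ∀ s t : ℝ, s < t →
      IntegrableOn (fun τ => timeWeight 1 (t - τ) * timeWeight (1 + ν) (τ - s)) (Ioo s t) ∧
      ∫ τ in Ioo s t, timeWeight 1 (t - τ) * timeWeight (1 + ν) (τ - s) ≤
        ε * timeWeight (1 + ν) (t - s) := by
  -- Within distance `δ` of an endpoint the inverse square root has integral `2√δ`; farther away it
  -- is at most `1/√δ` and the surplus exponential has integral `1/ν`. The total `4√δ + 2/(ν√δ)`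
  -- equals `ε/2 + ε/2` for this `δ` and `ν = 32/ε²`.
  set δ : ℝ := (ε / 8) ^ 2 with hδ
  have hsδ : √δ = ε / 8 := Real.sqrt_sq (by positivity)
  have hδ0 : 0 < δ := by positivity
  refine ⟨32 / ε ^ 2, by positivity, fun s t hst => ?_⟩
  set ν : ℝ := 32 / ε ^ 2 with hν
  have hν0 : 0 < ν := by positivity
  obtain ⟨i1, j1⟩ := integral_inv_sqrt_indicator hδ0.le
  obtain ⟨i2, j2⟩ := integral_exp_indicator hν0
  set h1 := (Ioc 0 δ).indicator (fun σ : ℝ => (√σ)⁻¹) with hh1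
  set h2 := (Ioi 0).indicator (fun σ : ℝ => Real.exp (-ν * σ)) with hh2
  have h1n : ∀ σ, 0 ≤ h1 σ := fun σ => indicator_nonneg (fun _ _ => by positivity) σ
  have h2n : ∀ σ, 0 ≤ h2 σ := fun σ => indicator_nonneg (fun _ _ => (Real.exp_pos _).le) σ
  set D : ℝ → ℝ := fun τ => timeWeight (1 + ν) (t - s) *
    (h1 (t - τ) + h1 (τ - s) + 2 * (√δ)⁻¹ * h2 (t - τ)) with hD
  have iD : Integrable D := by
    refine Integrable.const_mul ?_ _
    exact ((i1.comp_sub_left t).add (i1.comp_sub_right s)).add ((i2.comp_sub_left t).const_mul _)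
  have Dn : ∀ τ, 0 ≤ D τ := fun τ => by
    have := h1n (t - τ); have := h1n (τ - s); have := h2n (t - τ)
    have := timeWeight_nonneg (1 + ν) (t - s)
    simp only [hD]; positivity
  have jD : ∫ τ, D τ = ε * timeWeight (1 + ν) (t - s) := by
    simp only [hD]
    rw [integral_const_mul, integral_add (f := fun τ => h1 (t - τ) + h1 (τ - s))
      ((i1.comp_sub_left t).add (i1.comp_sub_right s))
      ((i2.comp_sub_left t).const_mul _), integral_add (i1.comp_sub_left t)
      (i1.comp_sub_right s), integral_const_mul, integral_sub_left_eq_self h1,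
      integral_sub_right_eq_self h1, integral_sub_left_eq_self h2, j1, j2, hsδ, hν]
    field_simp
    ring
  -- One estimate serves both endpoints: `σ` is the distance to the singular endpoint, while `A`
  -- will always be `t-τ`, the quantity in the surplus exponential.
  have split : ∀ σ A : ℝ, 0 < σ → 0 < A →
      (√σ)⁻¹ * Real.exp (-ν * A) ≤ h1 σ + (√δ)⁻¹ * h2 A := by
    intro σ A hσ hA
    have e2 : h2 A = Real.exp (-ν * A) := indicator_of_mem (show A ∈ Ioi 0 from hA) _
    by_cases hc : σ ≤ δ
    · have e1 : h1 σ = (√σ)⁻¹ := indicator_of_mem (show σ ∈ Ioc 0 δ from ⟨hσ, hc⟩) _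
      rw [e1]
      have : (√σ)⁻¹ * Real.exp (-ν * A) ≤ (√σ)⁻¹ := by
        refine mul_le_of_le_one_right (by positivity) (Real.exp_le_one_iff.mpr ?_)
        nlinarith [mul_pos hν0 hA]
      have := h2n A
      have : 0 ≤ (√δ)⁻¹ * h2 A := by positivity
      linarith
    · have : (√σ)⁻¹ ≤ (√δ)⁻¹ :=
        inv_anti₀ (Real.sqrt_pos.mpr hδ0) (Real.sqrt_le_sqrt (le_of_not_ge hc))
      have := mul_le_mul_of_nonneg_right this (Real.exp_pos (-ν * A)).le
      rw [e2]
      linarith [h1n σ]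
  have bound : ∀ τ ∈ Ioo s t, timeWeight 1 (t - τ) * timeWeight (1 + ν) (τ - s) ≤ D τ := by
    intro τ hτ
    have hA : 0 < t - τ := by linarith [hτ.2]
    have hB : 0 < τ - s := by linarith [hτ.1]
    -- The surplus decay comes from `(t-τ) + (1+ν)(τ-s) = (1+ν)(t-s) - ν(t-τ)`.
    have e : timeWeight 1 (t - τ) * timeWeight (1 + ν) (τ - s) =
        ((√(t - τ))⁻¹ * (√(τ - s))⁻¹) * (Real.exp (-ν * (t - τ)) *
          Real.exp ((1 + ν) * (t - s))) := by
      unfold timeWeight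
      rw [mul_mul_mul_comm, ← Real.exp_add, ← Real.exp_add]
      congr 2; ring
    have hAB := inv_sqrt_mul_inv_sqrt_le hA hB
    rw [show t - τ + (τ - s) = t - s by ring] at hAB
    have s1 := split (t - τ) (t - τ) hA hA
    have s2 := split (τ - s) (t - τ) hB hA
    rw [e]
    calc ((√(t - τ))⁻¹ * (√(τ - s))⁻¹) * (Real.exp (-ν * (t - τ)) *
          Real.exp ((1 + ν) * (t - s)))
        ≤ ((√(t - s))⁻¹ * ((√(t - τ))⁻¹ + (√(τ - s))⁻¹)) * (Real.exp (-ν * (t - τ)) *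
          Real.exp ((1 + ν) * (t - s))) := by gcongr
      _ = timeWeight (1 + ν) (t - s) * ((√(t - τ))⁻¹ * Real.exp (-ν * (t - τ)) +
          (√(τ - s))⁻¹ * Real.exp (-ν * (t - τ))) := by unfold timeWeight; ring
      _ ≤ D τ := by
          refine mul_le_mul_of_nonneg_left ?_ (timeWeight_nonneg _ _)
          linarith
  have hm : Measurable fun τ => timeWeight 1 (t - τ) * timeWeight (1 + ν) (τ - s) :=
    ((measurable_timeWeight 1).comp (measurable_const.sub measurable_id)).mul
      ((measurable_timeWeight _).comp (measurable_id.sub measurable_const))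
  have hi : IntegrableOn (fun τ => timeWeight 1 (t - τ) * timeWeight (1 + ν) (τ - s))
      (Ioo s t) := by
    refine Integrable.mono' (iD.integrableOn (s := Ioo s t)) hm.aestronglyMeasurable ?_
    refine (ae_restrict_iff' measurableSet_Ioo).mpr (Filter.Eventually.of_forall fun τ hτ => ?_)
    rw [Real.norm_of_nonneg (mul_nonneg (timeWeight_nonneg _ _) (timeWeight_nonneg _ _))]
    exact bound τ hτ
  refine ⟨hi, ?_⟩
  calc _ ≤ ∫ τ in Ioo s t, D τ := setIntegral_mono_on hi iD.integrableOn measurableSet_Ioo bound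
    _ ≤ ∫ τ, D τ := setIntegral_le_integral iD (Filter.Eventually.of_forall Dn)
    _ = _ := jD

end TimeWeight

/-! ### Composition of kernels with Gaussian bounds. -/

section Star

variable {d : ℕ} {b : ℝ} {F : Type*} [NormedAddCommGroup F] [NormedSpace ℝ F]

/-- The kernel `P` is dominated by the Gaussian of parameter `b` with time weight `w`. -/
def KernelBound (b : ℝ) (w : ℝ → ℝ) (P : Space d × ℝ → Space d × ℝ → F) : Prop :=
  ∀ p q, ‖P p q‖ ≤ w (p.2 - q.2) * gaussKernel b p q

/-- Space-time composition of kernels. -/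
def star (P : Space d × ℝ → Space d × ℝ → F) (Q : Space d × ℝ → Space d × ℝ → ℝ)
    (p q : Space d × ℝ) : F := ∫ r, Q r q • P p r

/-- The comparison Gaussian vanishes unless the pole lies strictly in the past, so the bound alone
forces causality, and compositions only involve intermediate times. -/
lemma KernelBound.eq_zero {w : ℝ → ℝ} {P : Space d × ℝ → Space d × ℝ → F}
    (h : KernelBound b w P) {p q : Space d × ℝ} (hpq : p.2 ≤ q.2) : P p q = 0 := by
  have := h p q
  rw [gaussKernel_of_le hpq, mul_zero] at this
  exact norm_le_zero_iff.mp this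

lemma KernelBound.mono {w w' : ℝ → ℝ} {P : Space d × ℝ → Space d × ℝ → F}
    (h : KernelBound b w P) (hw : ∀ r, 0 < r → w r ≤ w' r) : KernelBound b w' P := by
  intro p q
  by_cases hpq : q.2 < p.2
  · exact (h p q).trans
      (mul_le_mul_of_nonneg_right (hw _ (sub_pos.mpr hpq)) (gaussKernel_nonneg p q))
  · simp [h.eq_zero (not_lt.mp hpq), gaussKernel_of_le (not_lt.mp hpq)]

variable [MeasurableSpace F] [BorelSpace F] [SecondCountableTopology F]
variable {P : Space d × ℝ → Space d × ℝ → F} {Q : Space d × ℝ → Space d × ℝ → ℝ}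
variable {w₁ w₂ : ℝ → ℝ}

lemma norm_kernel_mul_le (hP : KernelBound b w₁ P) (hQ : KernelBound b w₂ Q)
    (p q r : Space d × ℝ) : ‖Q r q • P p r‖ ≤
      w₁ (p.2 - r.2) * w₂ (r.2 - q.2) * (gaussKernel b p r * gaussKernel b r q) := by
  rw [norm_smul]
  calc ‖Q r q‖ * ‖P p r‖ ≤ (w₂ (r.2 - q.2) * gaussKernel b r q) *
        (w₁ (p.2 - r.2) * gaussKernel b p r) :=
        mul_le_mul (hQ r q) (hP p r) (norm_nonneg _) ((norm_nonneg _).trans (hQ r q))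
    _ = _ := by ring

/-- Inside `Ioo q.2 p.2` the time weights are constant on the slice and the Chapman–Kolmogorov
identity integrates the two Gaussians; outside, one of the factors vanishes by causality. -/
lemma star_slice (hb : 0 < b) (hPm : Measurable (Function.uncurry P))
    (hQm : Measurable (Function.uncurry Q)) (hP : KernelBound b w₁ P) (hQ : KernelBound b w₂ Q)
    (p q : Space d × ℝ) (τ : ℝ) :
    Integrable (fun z : Space d => Q (z, τ) q • P p (z, τ)) ∧
      ∫ z : Space d, ‖Q (z, τ) q • P p (z, τ)‖ ≤ (Ioo q.2 p.2).indicator (fun τ =>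
        w₁ (p.2 - τ) * w₂ (τ - q.2) * (gaussMass d b * gaussKernel b p q)) τ := by
  have hm : Measurable fun z : Space d => Q (z, τ) q • P p (z, τ) :=
    (hQm.comp (by fun_prop : Measurable fun z : Space d => ((z, τ), q))).smul
      (hPm.comp (by fun_prop : Measurable fun z : Space d => (p, (z, τ))))
  by_cases h : τ ∈ Ioo q.2 p.2
  · obtain ⟨h1, h2⟩ := integral_gaussKernel_mul hb h.1 h.2
    have h1' := h1.const_mul (w₁ (p.2 - τ) * w₂ (τ - q.2))
    have hi : Integrable (fun z : Space d => Q (z, τ) q • P p (z, τ)) :=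
      h1'.mono' hm.aestronglyMeasurable
        (Filter.Eventually.of_forall fun z => norm_kernel_mul_le hP hQ p q (z, τ))
    refine ⟨hi, ?_⟩
    rw [indicator_of_mem h, ← h2, ← integral_const_mul]
    exact integral_mono hi.norm h1' fun z => norm_kernel_mul_le hP hQ p q (z, τ)
  · have h0 : ∀ z : Space d, Q (z, τ) q • P p (z, τ) = 0 := by
      intro z
      by_cases h1 : q.2 < τ
      · have h2 : p.2 ≤ τ := by
          by_contra hc; exact h ⟨h1, not_le.mp hc⟩
        rw [hP.eq_zero (q := (z, τ)) h2, smul_zero]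
      · rw [hQ.eq_zero (p := (z, τ)) (not_lt.mp h1), zero_smul]
    simp [h0, indicator_of_notMem h]

/-- Tonelli over time slices reduces the question to the integrability of the convolved time
weights. -/
lemma star_integrable (hb : 0 < b) (hPm : Measurable (Function.uncurry P))
    (hQm : Measurable (Function.uncurry Q)) (hP : KernelBound b w₁ P) (hQ : KernelBound b w₂ Q)
    (p q : Space d × ℝ)
    (hw : IntegrableOn (fun τ => w₁ (p.2 - τ) * w₂ (τ - q.2)) (Ioo q.2 p.2)) :
    Integrable (fun r => Q r q • P p r) := by
  have hm : Measurable fun r : Space d × ℝ => Q r q • P p r :=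
    (hQm.comp (by fun_prop : Measurable fun r : Space d × ℝ => (r, q))).smul
      (hPm.comp (by fun_prop : Measurable fun r : Space d × ℝ => (p, r)))
  rw [Measure.volume_eq_prod, integrable_prod_iff' hm.aestronglyMeasurable]
  refine ⟨Filter.Eventually.of_forall fun τ => (star_slice hb hPm hQm hP hQ p q τ).1, ?_⟩
  refine Integrable.mono' ((integrable_indicator_iff measurableSet_Ioo).mpr
    (hw.mul_const (gaussMass d b * gaussKernel b p q))) ?_ (Filter.Eventually.of_forall fun τ => ?_)
  · exact (hm.norm.stronglyMeasurable.integral_prod_left').aestronglyMeasurable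
  · rw [Real.norm_of_nonneg (integral_nonneg fun _ => norm_nonneg _)]
    exact (star_slice hb hPm hQm hP hQ p q τ).2

lemma star_eq_integral_slices (hb : 0 < b) (hPm : Measurable (Function.uncurry P))
    (hQm : Measurable (Function.uncurry Q)) (hP : KernelBound b w₁ P) (hQ : KernelBound b w₂ Q)
    (p q : Space d × ℝ)
    (hw : IntegrableOn (fun τ => w₁ (p.2 - τ) * w₂ (τ - q.2)) (Ioo q.2 p.2)) :
    star P Q p q = ∫ τ, ∫ z : Space d, Q (z, τ) q • P p (z, τ) := by
  have hi := star_integrable hb hPm hQm hP hQ p q hw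
  rw [star, Measure.volume_eq_prod, integral_prod_symm _ hi]

lemma integral_norm_star_le (hb : 0 < b) (hPm : Measurable (Function.uncurry P))
    (hQm : Measurable (Function.uncurry Q)) (hP : KernelBound b w₁ P) (hQ : KernelBound b w₂ Q)
    (p q : Space d × ℝ)
    (hw : IntegrableOn (fun τ => w₁ (p.2 - τ) * w₂ (τ - q.2)) (Ioo q.2 p.2)) :
    ∫ r, ‖Q r q • P p r‖ ≤ gaussMass d b *
      (∫ τ in Ioo q.2 p.2, w₁ (p.2 - τ) * w₂ (τ - q.2)) * gaussKernel b p q := by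
  have hi := star_integrable hb hPm hQm hP hQ p q hw
  rw [Measure.volume_eq_prod, integral_prod_symm _ hi.norm]
  calc ∫ τ, ∫ z : Space d, ‖Q (z, τ) q • P p (z, τ)‖
      ≤ ∫ τ, (Ioo q.2 p.2).indicator (fun τ =>
        w₁ (p.2 - τ) * w₂ (τ - q.2) * (gaussMass d b * gaussKernel b p q)) τ := by
        refine integral_mono ?_ ((integrable_indicator_iff measurableSet_Ioo).mpr (hw.mul_const _))
          fun τ => (star_slice hb hPm hQm hP hQ p q τ).2
        exact hi.norm.integral_prod_right
    _ = _ := by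
        rw [integral_indicator measurableSet_Ioo, integral_mul_const]; ring

lemma norm_star_le (hb : 0 < b) (hPm : Measurable (Function.uncurry P))
    (hQm : Measurable (Function.uncurry Q)) (hP : KernelBound b w₁ P) (hQ : KernelBound b w₂ Q)
    (p q : Space d × ℝ)
    (hw : IntegrableOn (fun τ => w₁ (p.2 - τ) * w₂ (τ - q.2)) (Ioo q.2 p.2)) :
    ‖star P Q p q‖ ≤ gaussMass d b *
      (∫ τ in Ioo q.2 p.2, w₁ (p.2 - τ) * w₂ (τ - q.2)) * gaussKernel b p q :=
  (norm_integral_le_integral_norm _).trans (integral_norm_star_le hb hPm hQm hP hQ p q hw)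

lemma measurable_star (hPm : Measurable (Function.uncurry P))
    (hQm : Measurable (Function.uncurry Q)) : Measurable (Function.uncurry (star P Q)) := by
  have hm : Measurable fun w : ((Space d × ℝ) × (Space d × ℝ)) × (Space d × ℝ) =>
      Q w.2 w.1.2 • P w.1.1 w.2 :=
    (hQm.comp (by fun_prop :
      Measurable fun w : ((Space d × ℝ) × (Space d × ℝ)) × (Space d × ℝ) => (w.2, w.1.2))).smul
    (hPm.comp (by fun_prop :
      Measurable fun w : ((Space d × ℝ) × (Space d × ℝ)) × (Space d × ℝ) => (w.1.1, w.2)))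
  exact (hm.stronglyMeasurable.integral_prod_right').measurable

end Star

/-! ### The Neumann series for the Volterra equation. -/

section Volterra

variable {d : ℕ} {b : ℝ} {F : Type*} [NormedAddCommGroup F] [NormedSpace ℝ F]
variable [MeasurableSpace F] [BorelSpace F] [SecondCountableTopology F]
variable {P : Space d × ℝ → Space d × ℝ → F} {Q : Space d × ℝ → Space d × ℝ → ℝ}
variable {w₁ w₂ w₃ : ℝ → ℝ}

lemma KernelBound.smul_eq_zero (hP : KernelBound b w₁ P) (hQ : KernelBound b w₂ Q)
    {p q r : Space d × ℝ} (h : r.2 ∉ Ioo q.2 p.2) : Q r q • P p r = 0 := by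
  by_cases h1 : q.2 < r.2
  · have h2 : p.2 ≤ r.2 := by
      by_contra hc; exact h ⟨h1, not_le.mp hc⟩
    rw [hP.eq_zero h2, smul_zero]
  · rw [hQ.eq_zero (not_lt.mp h1), zero_smul]

lemma KernelBound.star (hb : 0 < b) (hPm : Measurable (Function.uncurry P))
    (hQm : Measurable (Function.uncurry Q)) (hP : KernelBound b w₁ P) (hQ : KernelBound b w₂ Q)
    (hw : ∀ s t, s < t → IntegrableOn (fun τ => w₁ (t - τ) * w₂ (τ - s)) (Ioo s t) ∧
      ∫ τ in Ioo s t, w₁ (t - τ) * w₂ (τ - s) ≤ w₃ (t - s)) :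
    KernelBound b (fun r => gaussMass d b * w₃ r) (star P Q) := by
  intro p q
  by_cases h : q.2 < p.2
  · obtain ⟨h1, h2⟩ := hw _ _ h
    refine (norm_star_le hb hPm hQm hP hQ p q h1).trans ?_
    refine mul_le_mul_of_nonneg_right ?_ (gaussKernel_nonneg p q)
    exact mul_le_mul_of_nonneg_left h2 (gaussMass_pos hb).le
  · rw [gaussKernel_of_le (not_lt.mp h), mul_zero, AronsonGradient.star]
    have : ∀ r, Q r q • P p r = 0 := fun r =>
      hP.smul_eq_zero hQ fun hr => h (hr.1.trans hr.2)
    simp [this]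

/-- Dominating `Q` uniformly in `y` costs the factor `(τ-s)^{-d/2}`, which need not be integrable in
time. Continuity is therefore proved in two stages: on a fixed slice this factor is a harmless
constant, and the slice integrals are dominated in `τ` through Chapman–Kolmogorov. -/
lemma continuous_star_snd (hb : 0 < b) (hPm : Measurable (Function.uncurry P))
    (hQm : Measurable (Function.uncurry Q)) (hP : KernelBound b w₁ P) (hQ : KernelBound b w₂ Q)
    (hw1 : ∀ r, 0 ≤ w₁ r) (hw2 : ∀ r, 0 ≤ w₂ r)
    (hw : ∀ s t, s < t → IntegrableOn (fun τ => w₁ (t - τ) * w₂ (τ - s)) (Ioo s t))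
    (hQc : ∀ p s, Continuous fun y => Q p (y, s)) (p : Space d × ℝ) (s : ℝ) :
    Continuous fun y => AronsonGradient.star P Q p (y, s) := by
  by_cases h : s < p.2
  swap
  · have : ∀ y r, Q r (y, s) • P p r = 0 := fun y r =>
      hP.smul_eq_zero hQ fun hr => h (hr.1.trans hr.2)
    simp only [AronsonGradient.star, this, integral_zero, continuous_const]
  have e : (fun y => AronsonGradient.star P Q p (y, s)) =
      fun y => ∫ τ, ∫ z : Space d, Q (z, τ) (y, s) • P p (z, τ) := by
    ext y
    exact star_eq_integral_slices hb hPm hQm hP hQ p (y, s) (hw s p.2 h)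
  have hm : Measurable fun w : (Space d × ℝ) × (Space d × ℝ) => Q w.1 w.2 • P p w.1 :=
    hQm.smul (hPm.comp (by fun_prop :
      Measurable fun w : (Space d × ℝ) × (Space d × ℝ) => (p, w.1)))
  rw [e]
  refine continuous_of_dominated (bound := (Ioo s p.2).indicator fun τ =>
    w₁ (p.2 - τ) * w₂ (τ - s) * (gaussMass d b * (p.2 - s) ^ (-(d : ℝ) / 2))) ?_ ?_ ?_ ?_
  · intro y
    have : Measurable fun w : Space d × ℝ => Q w (y, s) • P p w :=
      hm.comp (by fun_prop : Measurable fun w : Space d × ℝ => (w, (y, s)))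
    exact (this.stronglyMeasurable.integral_prod_left').aestronglyMeasurable
  · refine fun y => Filter.Eventually.of_forall fun τ => (norm_integral_le_integral_norm _).trans ?_
    refine (star_slice hb hPm hQm hP hQ p (y, s) τ).2.trans ?_
    refine indicator_le_indicator ?_
    have := mul_nonneg (hw1 (p.2 - τ)) (hw2 (τ - s))
    have := (gaussMass_pos (d := d) hb).le
    have := gaussKernel_le hb.le p (y, s) h
    gcongr
  · exact (integrable_indicator_iff measurableSet_Ioo).mpr ((hw s p.2 h).mul_const _)
  · refine Filter.Eventually.of_forall fun τ => ?_
    by_cases hτ : τ ∈ Ioo s p.2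
    swap
    · have : ∀ y z, Q (z, τ) (y, s) • P p (z, τ) = 0 := fun y z => hP.smul_eq_zero hQ hτ
      simp only [this, integral_zero, continuous_const]
    refine continuous_of_dominated (bound := fun z : Space d =>
      w₂ (τ - s) * (τ - s) ^ (-(d : ℝ) / 2) * (w₁ (p.2 - τ) * gaussKernel b p (z, τ))) ?_ ?_ ?_ ?_
    · intro y
      exact (hm.comp (by fun_prop :
        Measurable fun z : Space d => ((z, τ), (y, s)))).aestronglyMeasurable
    · refine fun y => Filter.Eventually.of_forall fun z => ?_
      rw [norm_smul]
      have h1 := gaussKernel_le hb.le (z, τ) (y, s) hτ.1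
      have h2 := (hQ (z, τ) (y, s)).trans (mul_le_mul_of_nonneg_left h1 (hw2 _))
      exact mul_le_mul h2 (hP p (z, τ)) (norm_nonneg _) ((norm_nonneg _).trans h2)
    · exact ((integral_gaussKernel_right hb hτ.2).1.const_mul _).const_mul _
    · exact Filter.Eventually.of_forall fun z => (hQc (z, τ) s).smul continuous_const

/-- Terms of the Neumann series for the Volterra equation with kernel `-R`. -/
def neumannTerm (R : Space d × ℝ → Space d × ℝ → ℝ) : ℕ → Space d × ℝ → Space d × ℝ → ℝ
  | 0 => fun p q => -R p q
  | n + 1 => fun p q => -AronsonGradient.star R (neumannTerm R n) p q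

lemma timeWeight_mono {μ μ' r : ℝ} (h : μ ≤ μ') (hr : 0 < r) :
    timeWeight μ r ≤ timeWeight μ' r := by
  unfold timeWeight
  gcongr

/-- The Volterra equation `Φ = -R - R ⋆ Φ` has a solution with the same Gaussian decay. -/
theorem exists_volterra (d : ℕ) (hb : 0 < b) {M : ℝ} (hM : 0 ≤ M) :
    ∃ ν : ℝ, 0 < ν ∧
      (∀ s t, s < t →
        IntegrableOn (fun τ => timeWeight 1 (t - τ) * timeWeight (1 + ν) (τ - s)) (Ioo s t) ∧
        ∫ τ in Ioo s t, timeWeight 1 (t - τ) * timeWeight (1 + ν) (τ - s) ≤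
          timeWeight (1 + ν) (t - s)) ∧
      ∀ R : Space d × ℝ → Space d × ℝ → ℝ, Measurable (Function.uncurry R) →
        KernelBound b (fun r => M * timeWeight 1 r) R →
        (∀ p s, Continuous fun y => R p (y, s)) →
        ∃ Φ : Space d × ℝ → Space d × ℝ → ℝ, Measurable (Function.uncurry Φ) ∧
          KernelBound b (fun r => 2 * M * timeWeight (1 + ν) r) Φ ∧
          (∀ p s, Continuous fun y => Φ p (y, s)) ∧
          ∀ p q, Φ p q = -R p q - AronsonGradient.star R Φ p q := by
  set κ := gaussMass d b with hκ
  have hκ0 : 0 < κ := gaussMass_pos hb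
  -- `κMε ≤ 1/2` makes the bound of each Neumann term half of the preceding one; `ε ≤ 1` gives the
  -- plain reproduction of the weight asserted in the conclusion.
  set ε : ℝ := min 1 (1 / (2 * (κ * M + 1))) with hε
  have hε0 : 0 < ε := lt_min one_pos (by positivity)
  have hεM : κ * (M * ε) ≤ 1 / 2 := by
    have h1 : ε ≤ 1 / (2 * (κ * M + 1)) := min_le_right _ _
    calc κ * (M * ε) = (κ * M) * ε := by ring
      _ ≤ (κ * M) * (1 / (2 * (κ * M + 1))) := by gcongr
      _ ≤ 1 / 2 := by
        rw [mul_one_div, div_le_div_iff₀ (by positivity) (by norm_num)]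
        nlinarith
  obtain ⟨ν, hν, hconv⟩ := exists_timeWeight_convolution hε0
  refine ⟨ν, hν, fun s t hst => ⟨(hconv s t hst).1, (hconv s t hst).2.trans ?_⟩, ?_⟩
  · exact mul_le_of_le_one_left (timeWeight_nonneg _ _) (min_le_left _ _)
  intro R hRm hR hRc
  set w : ℝ → ℝ := timeWeight (1 + ν) with hw
  have hw0 : ∀ r, 0 ≤ w r := timeWeight_nonneg _
  have hsm : ∀ c : ℝ, 0 ≤ c → ∀ s t, s < t →
      IntegrableOn (fun τ => (M * timeWeight 1 (t - τ)) * (c * w (τ - s))) (Ioo s t) ∧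
        ∫ τ in Ioo s t, (M * timeWeight 1 (t - τ)) * (c * w (τ - s)) ≤
          M * c * ε * w (t - s) := by
    intro c hc s t hst
    obtain ⟨h1, h2⟩ := hconv s t hst
    have e : (fun τ => (M * timeWeight 1 (t - τ)) * (c * w (τ - s))) =
        fun τ => (M * c) * (timeWeight 1 (t - τ) * w (τ - s)) := by ext; ring
    rw [e]
    refine ⟨Integrable.const_mul h1 _, ?_⟩
    rw [integral_const_mul, mul_assoc (M * c)]
    exact mul_le_mul_of_nonneg_left h2 (mul_nonneg hM hc)
  have hN : ∀ n, Measurable (Function.uncurry (neumannTerm R n)) ∧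
      KernelBound b (fun r => M * (1 / 2) ^ n * w r) (neumannTerm R n) ∧
      ∀ p s, Continuous fun y => neumannTerm R n p (y, s) := by
    intro n
    induction n with
    | zero =>
      refine ⟨hRm.neg, ?_, fun p s => (hRc p s).neg⟩
      have hR' : KernelBound b (fun r => M * timeWeight 1 r) (neumannTerm R 0) := by
        intro p q
        simpa [neumannTerm] using hR p q
      refine hR'.mono fun r hr => ?_
      have := timeWeight_mono (show (1 : ℝ) ≤ 1 + ν by linarith) hr
      simpa using mul_le_mul_of_nonneg_left this hM
    | succ n ih =>
      obtain ⟨h1, h2, h3⟩ := ih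
      have hc : 0 ≤ M * (1 / 2) ^ n := by positivity
      refine ⟨(measurable_star hRm h1).neg, ?_, fun p s => ?_⟩
      · have hs := KernelBound.star (w₃ := fun r => M * (M * (1 / 2) ^ n) * ε * w r)
          hb hRm h1 hR h2 (hsm _ hc)
        have hs' : KernelBound b (fun r => κ * (M * (M * (1 / 2) ^ n) * ε * w r))
            (neumannTerm R (n + 1)) := by
          intro p q
          simpa [neumannTerm] using hs p q
        refine hs'.mono fun r hr => ?_
        calc κ * (M * (M * (1 / 2) ^ n) * ε * w r)
            = (κ * (M * ε)) * (M * (1 / 2) ^ n * w r) := by ring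
          _ ≤ 1 / 2 * (M * (1 / 2) ^ n * w r) :=
              mul_le_mul_of_nonneg_right hεM (mul_nonneg hc (hw0 r))
          _ = M * (1 / 2) ^ (n + 1) * w r := by ring
      · refine (continuous_star_snd hb hRm h1 hR h2 (fun r => ?_) (fun r => ?_)
          (fun s t hst => (hsm _ hc s t hst).1) h3 p s).neg
        · exact mul_nonneg hM (timeWeight_nonneg _ _)
        · exact mul_nonneg hc (hw0 r)
  have hgeo : Summable fun n : ℕ => ((1 : ℝ) / 2) ^ n :=
    summable_geometric_of_lt_one (by norm_num) (by norm_num)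
  -- This geometric majorant sums to twice its first term, whence the factor `2 * M`.
  have hb' : ∀ p q n, ‖neumannTerm R n p q‖ ≤
      (M * w (p.2 - q.2) * gaussKernel b p q) * (1 / 2) ^ n := fun p q n =>
    ((hN n).2.1 p q).trans_eq (by ring)
  have hsum : ∀ p q, Summable fun n => neumannTerm R n p q := fun p q =>
    Summable.of_norm_bounded (hgeo.mul_left _) (hb' p q)
  refine ⟨fun p q => ∑' n, neumannTerm R n p q, ?_, ?_, ?_, ?_⟩
  · refine measurable_of_tendsto_metrizable
      (f := fun N (x : (Space d × ℝ) × (Space d × ℝ)) =>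
        ∑ n ∈ Finset.range N, neumannTerm R n x.1 x.2) ?_ ?_
    · exact fun N => Finset.measurable_fun_sum _ fun n _ => (hN n).1
    · rw [tendsto_pi_nhds]
      exact fun x => (hsum x.1 x.2).hasSum.tendsto_sum_nat
  · intro p q
    have := tsum_of_norm_bounded (hgeo.hasSum.mul_left (M * w (p.2 - q.2) * gaussKernel b p q))
      (hb' p q)
    refine this.trans_eq ?_
    rw [tsum_geometric_two]
    ring
  · intro p s
    by_cases h : s < p.2
    · refine continuous_tsum (fun n => (hN n).2.2 p s)
        (hgeo.mul_left (M * w (p.2 - s) * (p.2 - s) ^ (-(d : ℝ) / 2))) fun n y => ?_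
      refine (hb' p (y, s) n).trans ?_
      have := mul_nonneg hM (hw0 (p.2 - s))
      have := gaussKernel_le hb.le p (y, s) h
      gcongr
    · have : ∀ y n, neumannTerm R n p (y, s) = 0 := fun y n =>
        (hN n).2.1.eq_zero (not_lt.mp h)
      simp only [this, tsum_zero, continuous_const]
  · intro p q
    -- The integrals of the norms are summable, so composition with `R` may be applied termwise. The
    -- Volterra equation is then the shift of the series by one index.
    have hst : AronsonGradient.star R (fun p q => ∑' n, neumannTerm R n p q) p q =
        ∑' n, AronsonGradient.star R (neumannTerm R n) p q := by
      have hint : ∀ n, Integrable (fun r => neumannTerm R n r q • R p r) ∧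
          ∫ r, ‖neumannTerm R n r q • R p r‖ ≤
            (κ * (M * M * ε * w (p.2 - q.2)) * gaussKernel b p q) * (1 / 2) ^ n := by
        intro n
        have hc : 0 ≤ M * (1 / 2) ^ n := by positivity
        by_cases h : q.2 < p.2
        · obtain ⟨h1, h2⟩ := hsm _ hc _ _ h
          refine ⟨star_integrable hb hRm (hN n).1 hR (hN n).2.1 p q h1, ?_⟩
          refine (integral_norm_star_le hb hRm (hN n).1 hR (hN n).2.1 p q h1).trans ?_
          have := mul_le_mul_of_nonneg_right (mul_le_mul_of_nonneg_left h2 hκ0.le)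
            (gaussKernel_nonneg (b := b) p q)
          refine this.trans_eq ?_
          ring
        · have : ∀ r, neumannTerm R n r q • R p r = 0 := fun r =>
            hR.smul_eq_zero (hN n).2.1 fun hr => h (hr.1.trans hr.2)
          simp only [this, gaussKernel_of_le (not_lt.mp h), norm_zero, integral_zero, mul_zero,
            zero_mul, le_refl, and_true]
          exact integrable_zero _ _ _
      have hsn : Summable fun n => ∫ r, ‖neumannTerm R n r q • R p r‖ :=
        Summable.of_nonneg_of_le (fun n => integral_nonneg fun _ => norm_nonneg _)
          (fun n => (hint n).2) (hgeo.mul_left _)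
      have := integral_tsum_of_summable_integral_norm (fun n => (hint n).1) hsn
      unfold AronsonGradient.star
      rw [this]
      refine integral_congr_ae (Filter.Eventually.of_forall fun r => ?_)
      simp only [smul_eq_mul, tsum_mul_right]
    simp only
    rw [hst, (hsum p q).tsum_eq_zero_add]
    simp only [neumannTerm, tsum_neg]
    ring

end Volterra

/-! ### Parametrices, adjoint test functions and removal of the error. -/

section Parametrix

open Filter Topology

/-- Differentiation under the integral sign, carried through the Riesz isometry so that gradients
are integrated as vectors. Domination is required for all `x` at once, which Gaussian bounds at a
fixed positive elapsed time provide. -/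
lemma hasGradientAt_integral_of_dominated {d : ℕ} {α : Type*} [MeasurableSpace α] {μ : Measure α}
    {f : Space d → α → ℝ} {G : Space d → α → Space d} {x₀ : Space d} {bound : α → ℝ}
    (hf : ∀ x, AEStronglyMeasurable (f x) μ) (hi : Integrable (f x₀) μ)
    (hG : AEStronglyMeasurable (G x₀) μ) (hb : ∀ᵐ a ∂μ, ∀ x, ‖G x a‖ ≤ bound a)
    (hbi : Integrable bound μ) (hd : ∀ᵐ a ∂μ, ∀ x, HasGradientAt (fun z => f z a) (G x a) x) :
    HasGradientAt (fun x => ∫ a, f x a ∂μ) (∫ a, G x₀ a ∂μ) x₀ := by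
  set T := InnerProductSpace.toDual ℝ (Space d) with hT
  have hGi : Integrable (G x₀) μ := hbi.mono' hG (hb.mono fun a h => h x₀)
  have hTm : AEStronglyMeasurable (fun a => T (G x₀ a)) μ :=
    T.continuous.comp_aestronglyMeasurable hG
  have h := hasFDerivAt_integral_of_dominated_of_fderiv_le (𝕜 := ℝ) (μ := μ) (F := f)
    (F' := fun x a => T (G x a)) (x₀ := x₀) (s := univ) (bound := bound) univ_mem
    (Eventually.of_forall hf) hi hTm
    (hb.mono fun a h x _ => by simpa using h x) hbi (hd.mono fun a h x _ => h x)
  have hTi : Integrable (fun a => T (G x₀ a)) μ :=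
    hGi.norm.mono' hTm (Eventually.of_forall fun a => by simp)
  have e : T (∫ a, G x₀ a ∂μ) = ∫ a, T (G x₀ a) ∂μ := by
    ext v
    rw [ContinuousLinearMap.integral_apply hTi, hT]
    simp only [InnerProductSpace.toDual_apply_apply]
    rw [real_inner_comm, ← integral_inner hGi]
    simp only [real_inner_comm]
  rw [hasGradientAt_iff_hasFDerivAt, e]
  exact h

variable {d : ℕ} {b M : ℝ}

/-- A parametrix `Z` with spatial gradient `DZ` and error `R`, all with Gaussian bounds. -/
structure IsParametrix (b M : ℝ) (Z : Space d × ℝ → Space d × ℝ → ℝ)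
    (DZ : Space d × ℝ → Space d × ℝ → Space d) (R : Space d × ℝ → Space d × ℝ → ℝ) : Prop where
  measurable_Z : Measurable (Function.uncurry Z)
  measurable_DZ : Measurable (Function.uncurry DZ)
  measurable_R : Measurable (Function.uncurry R)
  bound_Z : KernelBound b (fun _ => M) Z
  bound_DZ : KernelBound b (fun r => M * timeWeight 1 r) DZ
  bound_R : KernelBound b (fun r => M * timeWeight 1 r) R
  hasGradientAt : ∀ p q, q.2 < p.2 → HasGradientAt (fun x => Z (x, p.2) q) (DZ p q) p.1
  continuousAt_Z : ∀ p q, q.2 < p.2 → ContinuousAt (Function.uncurry Z) (p, q)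
  continuous_R : ∀ p s, Continuous fun y => R p (y, s)

/-- The function `η` is represented by pairing `(DZ, Z)` with the flux `V` and the source `W`, up to
the error `R`. -/
structure IsAdjointTest (T : ℝ) (Z : Space d × ℝ → Space d × ℝ → ℝ)
    (DZ : Space d × ℝ → Space d × ℝ → Space d) (R : Space d × ℝ → Space d × ℝ → ℝ)
    (η W : Space d × ℝ → ℝ) (V : Space d × ℝ → Space d) : Prop where
  measurable_η : Measurable η
  measurable_W : Measurable W
  measurable_V : Measurable V
  bounded : ∃ B, 0 ≤ B ∧ ∀ p, |η p| ≤ B ∧ |W p| ≤ B ∧ ‖V p‖ ≤ B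
  vanish : ∀ p, T ≤ p.2 → η p = 0 ∧ W p = 0 ∧ V p = 0
  identity : ∀ q, ∫ p, (inner ℝ (DZ p q) (V p) + Z p q * W p) = η q + ∫ p, R p q * η p

lemma one_le_sqrt_mul_timeWeight {μ : ℝ} (hμ : 0 ≤ μ) {r : ℝ} (hr : 0 < r) :
    1 ≤ √r * timeWeight μ r := by
  unfold timeWeight
  rw [← mul_assoc, mul_inv_cancel₀ (Real.sqrt_pos.mpr hr).ne', one_mul]
  exact Real.one_le_exp (by positivity)

/-- `√r ≤ r + 1 ≤ e^r`. The exponential makes the singular weight bounded below for all times, so a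
constant weight can always be traded for it. -/
lemma one_le_timeWeight {r : ℝ} (hr : 0 < r) : 1 ≤ timeWeight 1 r := by
  unfold timeWeight
  have h0 := Real.sqrt_pos.mpr hr
  rw [← div_eq_inv_mul, le_div_iff₀ h0, one_mul, one_mul]
  have h1 := Real.add_one_le_exp r
  have h2 : √r ≤ r + 1 := by nlinarith [Real.sq_sqrt hr.le, sq_nonneg (√r - 1)]
  linarith

lemma integrableOn_timeWeight (μ s t : ℝ) :
    IntegrableOn (fun τ => timeWeight μ (τ - s)) (Ioo s t) := by
  by_cases hst : s < t
  swap
  · rw [Ioo_eq_empty hst]; exact integrableOn_empty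
  obtain ⟨h1, -⟩ := integral_inv_sqrt_indicator (sub_pos.mpr hst).le
  have h2 := (h1.comp_sub_right s).const_mul (Real.exp (|μ| * (t - s)))
  refine Integrable.mono' (h2.integrableOn (s := Ioo s t))
    ((measurable_timeWeight μ).comp (measurable_id.sub measurable_const)).aestronglyMeasurable ?_
  refine (ae_restrict_iff' measurableSet_Ioo).mpr (Eventually.of_forall fun τ hτ => ?_)
  have hmem : τ - s ∈ Ioc 0 (t - s) := ⟨by linarith [hτ.1], by linarith [hτ.2]⟩
  rw [Real.norm_of_nonneg (timeWeight_nonneg _ _), indicator_of_mem hmem, timeWeight, mul_comm]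
  refine mul_le_mul_of_nonneg_right (Real.exp_le_exp.mpr ?_) (by positivity)
  calc μ * (τ - s) ≤ |μ| * (τ - s) :=
        mul_le_mul_of_nonneg_right (le_abs_self μ) hmem.1.le
    _ ≤ |μ| * (t - s) := mul_le_mul_of_nonneg_left hmem.2 (abs_nonneg μ)

lemma integrable_weight_gaussKernel (hb : 0 < b) {w : ℝ → ℝ} (hw : Measurable w)
    (q : Space d × ℝ) (T : ℝ) (hi : IntegrableOn (fun t => w (t - q.2)) (Ioo q.2 T)) :
    Integrable (fun p : Space d × ℝ =>
      (Ioo q.2 T).indicator (fun t => w (t - q.2)) p.2 * gaussKernel b p q) := by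
  set f := (Ioo q.2 T).indicator (fun t => w (t - q.2)) with hf
  have hfi : Integrable f := (integrable_indicator_iff measurableSet_Ioo).mpr hi
  have hfm : Measurable f :=
    (hw.comp (measurable_id.sub measurable_const)).indicator measurableSet_Ioo
  have hm : Measurable fun p : Space d × ℝ => f p.2 * gaussKernel b p q :=
    (hfm.comp measurable_snd).mul (measurable_gaussKernel.comp
      (by fun_prop : Measurable fun p : Space d × ℝ => (p, q)))
  have hz : ∀ t, t ∉ Ioo q.2 T → f t = 0 := fun t ht => indicator_of_notMem ht _
  rw [Measure.volume_eq_prod, integrable_prod_iff' hm.aestronglyMeasurable]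
  refine ⟨Eventually.of_forall fun t => ?_, ?_⟩
  · by_cases ht : t ∈ Ioo q.2 T
    · exact (integral_gaussKernel_left hb ht.1).1.const_mul (f t)
    · simp only [hz t ht, zero_mul]
      exact integrable_zero _ _ _
  · refine (hfi.norm.mul_const (gaussMass d b)).congr (Eventually.of_forall fun t => ?_)
    by_cases ht : t ∈ Ioo q.2 T
    · simp only [norm_mul]
      rw [integral_const_mul, ← (integral_gaussKernel_left hb ht.1).2]
      congr 2
      ext x
      rw [Real.norm_of_nonneg (gaussKernel_nonneg _ _)]
    · simp [hz t ht]

variable {Z R : Space d × ℝ → Space d × ℝ → ℝ} {DZ : Space d × ℝ → Space d × ℝ → Space d}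
variable {Φ H : Space d × ℝ → Space d × ℝ → ℝ} {ν N C T : ℝ}

/-- The weights of order `-1/2` reproduce under time convolution. -/
def TimeConvolution (ν : ℝ) : Prop := ∀ s t, s < t →
  IntegrableOn (fun τ => timeWeight 1 (t - τ) * timeWeight (1 + ν) (τ - s)) (Ioo s t) ∧
  ∫ τ in Ioo s t, timeWeight 1 (t - τ) * timeWeight (1 + ν) (τ - s) ≤ timeWeight (1 + ν) (t - s)

lemma TimeConvolution.const_mul (h : TimeConvolution ν) (hC : 0 ≤ C) (hN : 0 ≤ N) (s t : ℝ)
    (hst : s < t) :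
    IntegrableOn (fun τ => (C * timeWeight 1 (t - τ)) * (N * timeWeight (1 + ν) (τ - s)))
      (Ioo s t) ∧
    ∫ τ in Ioo s t, (C * timeWeight 1 (t - τ)) * (N * timeWeight (1 + ν) (τ - s)) ≤
      C * N * timeWeight (1 + ν) (t - s) := by
  have e : (fun τ => (C * timeWeight 1 (t - τ)) * (N * timeWeight (1 + ν) (τ - s))) =
      fun τ => (C * N) * (timeWeight 1 (t - τ) * timeWeight (1 + ν) (τ - s)) := by ext; ring
  rw [e]
  refine ⟨Integrable.const_mul (h s t hst).1 _, ?_⟩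
  rw [integral_const_mul]
  exact mul_le_mul_of_nonneg_left (h s t hst).2 (mul_nonneg hC hN)

lemma integrableOn_of_not_lt {f : ℝ → ℝ} {s t : ℝ} (h : s < t → IntegrableOn f (Ioo s t)) :
    IntegrableOn f (Ioo s t) := by
  by_cases hst : s < t
  · exact h hst
  · rw [Ioo_eq_empty hst]; exact integrableOn_empty

/-- Absolute integrability in the final and the intermediate point together, which licenses the
exchanges of integrals in `integral_pairing_correction`. The vanishing of `H` from time `T` on is
needed because the weights grow exponentially. -/
lemma integrable_kernel_mul (hb : 0 < b) (hT : TimeConvolution ν) (hC : 0 ≤ C) (hN : 0 ≤ N)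
    (hHm : Measurable (Function.uncurry H)) (hΦm : Measurable (Function.uncurry Φ))
    (hH : KernelBound b (fun r => C * timeWeight 1 r) H)
    (hΦ : KernelBound b (fun r => N * timeWeight (1 + ν) r) Φ)
    (hHT : ∀ p r, T ≤ p.2 → H p r = 0) (q : Space d × ℝ) :
    Integrable (Function.uncurry fun p r => Φ r q * H p r)
      ((volume : Measure (Space d × ℝ)).prod volume) := by
  have hm : Measurable (Function.uncurry fun p r : Space d × ℝ => Φ r q * H p r) :=
    (hΦm.comp (by fun_prop : Measurable fun w : (Space d × ℝ) × (Space d × ℝ) => (w.2, q))).mul hHm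
  have hw : ∀ p : Space d × ℝ, IntegrableOn (fun τ => (C * timeWeight 1 (p.2 - τ)) *
      (N * timeWeight (1 + ν) (τ - q.2))) (Ioo q.2 p.2) := fun p =>
    integrableOn_of_not_lt fun h => (hT.const_mul hC hN _ _ h).1
  rw [integrable_prod_iff hm.aestronglyMeasurable]
  refine ⟨Eventually.of_forall fun p => star_integrable hb hHm hΦm hH hΦ p q (hw p), ?_⟩
  have hdom := integrable_weight_gaussKernel hb
    (w := fun r => gaussMass d b * (C * N * timeWeight (1 + ν) r))
    (((measurable_timeWeight (1 + ν)).const_mul _).const_mul _) q T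
    (((integrableOn_timeWeight (1 + ν) q.2 T).const_mul _).const_mul _)
  refine hdom.mono' (hm.norm.stronglyMeasurable.integral_prod_right').aestronglyMeasurable
    (Eventually.of_forall fun p => ?_)
  rw [Real.norm_of_nonneg (integral_nonneg fun _ => norm_nonneg _)]
  by_cases hpT : p.2 < T
  swap
  · have e : ∀ r, Function.uncurry (fun p r => Φ r q * H p r) (p, r) = 0 := fun r => by
      simp [hHT p r (not_lt.mp hpT)]
    rw [indicator_of_notMem (fun h => hpT h.2)]
    simp [e]
  by_cases hq : q.2 < p.2
  swap
  · have e : ∀ r, Function.uncurry (fun p r => Φ r q * H p r) (p, r) = 0 := fun r =>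
      hH.smul_eq_zero hΦ (p := p) (q := q) (r := r) fun hr => hq (hr.1.trans hr.2)
    rw [indicator_of_notMem (fun h => hq h.1)]
    simp [e]
  rw [indicator_of_mem (show p.2 ∈ Ioo q.2 T from ⟨hq, hpT⟩)]
  refine (integral_norm_star_le hb hHm hΦm hH hΦ p q (hw p)).trans ?_
  refine mul_le_mul_of_nonneg_right ?_ (gaussKernel_nonneg p q)
  exact mul_le_mul_of_nonneg_left (hT.const_mul hC hN _ _ hq).2 (gaussMass_pos hb).le

/-- Gives `Z` the same weight as its gradient, so that both enter a pairing under a single bound. -/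
lemma IsParametrix.bound_Z' (hM : 0 ≤ M) (h : IsParametrix b M Z DZ R) :
    KernelBound b (fun r => M * timeWeight 1 r) Z :=
  h.bound_Z.mono fun _ hr => le_mul_of_one_le_right hM (one_le_timeWeight hr)

/-- The pairing of a kernel and its gradient with a flux and a source. -/
def pairing (Z : Space d × ℝ → Space d × ℝ → ℝ) (DZ : Space d × ℝ → Space d × ℝ → Space d)
    (V : Space d × ℝ → Space d) (W : Space d × ℝ → ℝ) (p q : Space d × ℝ) : ℝ :=
  inner ℝ (DZ p q) (V p) + Z p q * W p

lemma measurable_pairing {V : Space d × ℝ → Space d} {W : Space d × ℝ → ℝ}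
    (hZ : Measurable (Function.uncurry Z)) (hDZ : Measurable (Function.uncurry DZ))
    (hV : Measurable V) (hW : Measurable W) :
    Measurable (Function.uncurry (pairing Z DZ V W)) :=
  (hDZ.inner (hV.comp measurable_fst)).add (hZ.mul (hW.comp measurable_fst))

lemma KernelBound.pairing {w : ℝ → ℝ} {V : Space d × ℝ → Space d} {W : Space d × ℝ → ℝ} {B : ℝ}
    (hZ : KernelBound b w Z) (hDZ : KernelBound b w DZ)
    (hB : ∀ p, |W p| ≤ B ∧ ‖V p‖ ≤ B) :
    KernelBound b (fun r => 2 * B * w r) (pairing Z DZ V W) := by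
  intro p q
  have h1 : ‖(inner ℝ (DZ p q) (V p) : ℝ)‖ ≤ (w (p.2 - q.2) * gaussKernel b p q) * B :=
    (norm_inner_le_norm _ _).trans
      (mul_le_mul (hDZ p q) (hB p).2 (norm_nonneg _) ((norm_nonneg _).trans (hDZ p q)))
  have h2 : ‖Z p q * W p‖ ≤ (w (p.2 - q.2) * gaussKernel b p q) * B := by
    rw [norm_mul]
    exact mul_le_mul (hZ p q) (hB p).1 (norm_nonneg _) ((norm_nonneg _).trans (hZ p q))
  refine (norm_add_le _ _).trans ((add_le_add h1 h2).trans_eq ?_)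
  ring

lemma integrable_kernel_left (hb : 0 < b) {w : ℝ → ℝ} (hw : Measurable w)
    {P : Space d × ℝ → Space d × ℝ → ℝ} (hPm : Measurable (Function.uncurry P))
    (hP : KernelBound b w P) (hPT : ∀ p r, T ≤ p.2 → P p r = 0) (q : Space d × ℝ)
    (hi : IntegrableOn (fun t => w (t - q.2)) (Ioo q.2 T)) :
    Integrable fun p => P p q := by
  refine (integrable_weight_gaussKernel hb hw q T hi).mono'
    (hPm.comp (by fun_prop : Measurable fun p : Space d × ℝ => (p, q))).aestronglyMeasurable
    (Eventually.of_forall fun p => ?_)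
  by_cases hp : p.2 ∈ Ioo q.2 T
  · rw [indicator_of_mem hp]; exact hP p q
  · have : P p q = 0 := by
      by_cases h1 : q.2 < p.2
      · exact hPT p q (not_lt.mp fun h2 => hp ⟨h1, h2⟩)
      · exact hP.eq_zero (not_lt.mp h1)
    rw [this, indicator_of_notMem hp]; simp

/-- The corrected kernel satisfies the adjoint identity without error. -/
lemma integral_pairing_correction (hb : 0 < b) (hM : 0 ≤ M) (hN : 0 ≤ N) (hT : TimeConvolution ν)
    (hp : IsParametrix b M Z DZ R) (hΦm : Measurable (Function.uncurry Φ))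
    (hΦ : KernelBound b (fun r => N * timeWeight (1 + ν) r) Φ)
    (hvol : ∀ p q, Φ p q = -R p q - AronsonGradient.star R Φ p q)
    {η W : Space d × ℝ → ℝ} {V : Space d × ℝ → Space d} (ht : IsAdjointTest T Z DZ R η W V)
    (q : Space d × ℝ) :
    ∫ p, pairing (fun p q => Z p q + AronsonGradient.star Z Φ p q)
      (fun p q => DZ p q + AronsonGradient.star DZ Φ p q) V W p q = η q := by
  obtain ⟨B, hB0, hB⟩ := ht.bounded
  set H := pairing Z DZ V W with hH
  set H' : Space d × ℝ → Space d × ℝ → ℝ := fun p r => R p r * η p with hH'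
  have hHm : Measurable (Function.uncurry H) :=
    measurable_pairing hp.measurable_Z hp.measurable_DZ ht.measurable_V ht.measurable_W
  have hHm' : Measurable (Function.uncurry H') :=
    hp.measurable_R.mul (ht.measurable_η.comp measurable_fst)
  have hHb : KernelBound b (fun r => 2 * B * M * timeWeight 1 r) H := by
    have := KernelBound.pairing (B := B) (hp.bound_Z' hM) hp.bound_DZ fun p => (hB p).2
    exact this.mono fun r _ => le_of_eq (by ring)
  have hHb' : KernelBound b (fun r => B * M * timeWeight 1 r) H' := by
    intro p q
    rw [hH', norm_mul]
    refine (mul_le_mul (hp.bound_R p q) (hB p).1 (abs_nonneg _)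
      ((norm_nonneg _).trans (hp.bound_R p q))).trans_eq ?_
    ring
  have hv : ∀ p r, T ≤ p.2 → H p r = 0 := fun p r h => by
    simp [hH, pairing, (ht.vanish p h).2.1, (ht.vanish p h).2.2]
  have hv' : ∀ p r, T ≤ p.2 → H' p r = 0 := fun p r h => by
    simp [hH', (ht.vanish p h).1]
  have hC : 0 ≤ 2 * B * M := by positivity
  have hC' : 0 ≤ B * M := by positivity
  have I1 := integrable_kernel_mul hb hT hC hN hHm hΦm hHb hΦ hv q
  have I2 := integrable_kernel_mul hb hT hC' hN hHm' hΦm hHb' hΦ hv' q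
  have hwi : ∀ c : ℝ, IntegrableOn (fun t => c * timeWeight 1 (t - q.2)) (Ioo q.2 T) := fun c =>
    (integrableOn_timeWeight 1 q.2 T).const_mul c
  have J1 : Integrable fun p => H p q :=
    integrable_kernel_left hb ((measurable_timeWeight 1).const_mul _) hHm hHb hv q (hwi _)
  have J2 : Integrable fun p => H' p q :=
    integrable_kernel_left hb ((measurable_timeWeight 1).const_mul _) hHm' hHb' hv' q (hwi _)
  have hΦη : Integrable fun p => Φ p q * η p := by
    have hm : Measurable (Function.uncurry fun p q => Φ p q * η p) :=
      hΦm.mul (ht.measurable_η.comp measurable_fst)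
    refine integrable_kernel_left (T := T) (w := fun r => N * B * timeWeight (1 + ν) r) hb
      ((measurable_timeWeight _).const_mul _) hm ?_ ?_ q
      ((integrableOn_timeWeight (1 + ν) q.2 T).const_mul _)
    · intro p q
      rw [norm_mul]
      refine (mul_le_mul (hΦ p q) (hB p).1 (abs_nonneg _)
        ((norm_nonneg _).trans (hΦ p q))).trans_eq ?_
      ring
    · exact fun p r h => by simp [(ht.vanish p h).1]
  have hw : ∀ p : Space d × ℝ, IntegrableOn (fun τ => (M * timeWeight 1 (p.2 - τ)) *
      (N * timeWeight (1 + ν) (τ - q.2))) (Ioo q.2 p.2) := fun p =>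
    integrableOn_of_not_lt fun h => (hT.const_mul hM hN _ _ h).1
  -- Both corrections are integrals against the same density `Φ`, so the pairing of the corrected
  -- kernel is `H` plus the superposition of `H` over intermediate poles.
  have e1 : ∀ p, pairing (fun p q => Z p q + AronsonGradient.star Z Φ p q)
      (fun p q => DZ p q + AronsonGradient.star DZ Φ p q) V W p q =
      H p q + ∫ r, Φ r q * H p r := by
    intro p
    have i1 := star_integrable hb hp.measurable_Z hΦm (hp.bound_Z' hM) hΦ p q (hw p)
    have i2 := star_integrable hb hp.measurable_DZ hΦm hp.bound_DZ hΦ p q (hw p)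
    have e2 : inner ℝ (AronsonGradient.star DZ Φ p q) (V p) =
        ∫ r, inner ℝ (Φ r q • DZ p r) (V p) := by
      rw [real_inner_comm, AronsonGradient.star, ← integral_inner i2]
      simp only [real_inner_comm]
    have e3 : AronsonGradient.star Z Φ p q * W p = ∫ r, (Φ r q • Z p r) * W p := by
      rw [AronsonGradient.star, integral_mul_const]
    have i3 : Integrable fun r => (inner ℝ (Φ r q • DZ p r) (V p) : ℝ) := i2.inner_const (V p)
    simp only [pairing, inner_add_left, add_mul]
    rw [e2, e3, hH]
    simp only [pairing]
    rw [show inner ℝ (DZ p q) (V p) + (∫ r, inner ℝ (Φ r q • DZ p r) (V p)) +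
      (Z p q * W p + ∫ r, (Φ r q • Z p r) * W p) = inner ℝ (DZ p q) (V p) + Z p q * W p +
      ((∫ r, inner ℝ (Φ r q • DZ p r) (V p)) + ∫ r, (Φ r q • Z p r) * W p) by ring,
      ← integral_add i3 (i1.mul_const _)]
    congr 2
    ext r
    rw [real_inner_smul_left, smul_eq_mul]
    ring
  simp only [e1]
  have L1 : Integrable fun p => ∫ r, Φ r q * H p r := I1.integral_prod_left
  rw [integral_add J1 L1, integral_integral_swap I1]
  simp only [integral_const_mul]
  -- After the exchange of integrals, the adjoint identity of the parametrix applies at every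
  -- intermediate pole `r`.
  have hid : ∀ r, ∫ p, H p r = η r + ∫ p, H' p r := ht.identity
  simp only [hid, mul_add]
  have K2 : Integrable fun r => Φ r q * ∫ p, H' p r := by
    have := I2.integral_prod_right (f := Function.uncurry fun p r => Φ r q * H' p r)
    refine this.congr (Eventually.of_forall fun r => ?_)
    simp only [Function.uncurry]
    rw [integral_const_mul]
  rw [integral_add hΦη K2]
  have sw : ∫ r, Φ r q * ∫ p, H' p r = ∫ p, ∫ r, Φ r q * H' p r := by
    rw [integral_integral_swap I2]
    simp only [integral_const_mul]
  have e4 : ∀ p, ∫ r, Φ r q * H' p r = AronsonGradient.star R Φ p q * η p := by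
    intro p
    rw [AronsonGradient.star, ← integral_mul_const]
    congr 1
    ext r
    simp only [hH', smul_eq_mul]
    ring
  have K3 : Integrable fun p => AronsonGradient.star R Φ p q * η p := by
    have := I2.integral_prod_left (f := Function.uncurry fun p r => Φ r q * H' p r)
    refine this.congr (Eventually.of_forall fun p => ?_)
    simp only [Function.uncurry]
    exact e4 p
  rw [sw]
  simp only [e4]
  have L3 : Integrable fun p => Φ p q * η p + AronsonGradient.star R Φ p q * η p := hΦη.add K3
  rw [add_assoc, ← integral_add hΦη K3, ← integral_add J2 L3]
  -- Everything besides `η q` has collected into `(R + Φ + R ⋆ Φ) η`, which is zero by the Volterra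
  -- equation.
  have : ∀ p, H' p q + (Φ p q * η p + AronsonGradient.star R Φ p q * η p) = 0 := fun p => by
    rw [hvol p q]; simp only [hH']; ring
  simp [this]

end Parametrix

/-! ### Levi's correction: differentiability, continuity and bounds. -/

section Levi

open Filter Topology

variable {d : ℕ} {b M ν N : ℝ}
variable {Z R Φ : Space d × ℝ → Space d × ℝ → ℝ} {DZ : Space d × ℝ → Space d × ℝ → Space d}

/-- From `‖z - y₀‖² ≤ 2‖z - y‖² + 2`: at half the rate, one Gaussian centred at `y₀` dominates all
those centred within distance one, up to a factor depending only on the elapsed time. It is the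
majorant used when the pole moves. -/
lemma gaussKernel_le_shift (hb : 0 < b) {τ s : ℝ} (h : s < τ) (z y y₀ : Space d)
    (hy : ‖y - y₀‖ ≤ 1) :
    gaussKernel b (z, τ) (y, s) ≤ Real.exp (b / (τ - s)) * ((τ - s) ^ (-(d : ℝ) / 2) *
      Real.exp (-(b / (2 * (τ - s)) * ‖z - y₀‖ ^ 2))) := by
  have hr : 0 < τ - s := sub_pos.mpr h
  rw [gaussKernel_of_lt (p := (z, τ)) (q := (y, s)) h, gaussianBound, one_mul, mul_left_comm,
    ← Real.exp_add]
  refine mul_le_mul_of_nonneg_left (Real.exp_le_exp.mpr ?_) (Real.rpow_nonneg hr.le _)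
  have h1 : ‖z - y₀‖ ^ 2 ≤ 2 * ‖z - y‖ ^ 2 + 2 := by
    have h2 : ‖z - y₀‖ ≤ ‖z - y‖ + ‖y - y₀‖ := norm_sub_le_norm_sub_add_norm_sub z y y₀
    nlinarith [norm_nonneg (z - y₀), norm_nonneg (z - y), norm_nonneg (y - y₀),
      sq_nonneg (‖z - y‖ - 1)]
  have h3 : b / (2 * (τ - s)) * ‖z - y₀‖ ^ 2 ≤ b / (2 * (τ - s)) * (2 * ‖z - y‖ ^ 2 + 2) := by
    gcongr
  have h4 : b / (2 * (τ - s)) * (2 * ‖z - y‖ ^ 2 + 2) =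
      b * ‖z - y‖ ^ 2 / (τ - s) + b / (τ - s) := by
    field_simp
  simp only
  linarith

/-- The derivative is taken under the integral first on a time slice, where `t-τ > 0` bounds the
gradient uniformly in `x`, and then in `τ`, where Chapman–Kolmogorov leaves only the convolution of
the time weights. The latter is integrable because the singularities have order `-1/2`. -/
lemma IsParametrix.hasGradientAt_star (hb : 0 < b) (hM : 0 ≤ M) (hN : 0 ≤ N)
    (hT : TimeConvolution ν) (hp : IsParametrix b M Z DZ R) (hΦm : Measurable (Function.uncurry Φ))
    (hΦ : KernelBound b (fun r => N * timeWeight (1 + ν) r) Φ) {p q : Space d × ℝ}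
    (hpq : q.2 < p.2) :
    HasGradientAt (fun x => AronsonGradient.star Z Φ (x, p.2) q)
      (AronsonGradient.star DZ Φ p q) p.1 := by
  obtain ⟨x₀, t⟩ := p
  simp only at hpq ⊢
  have hw : IntegrableOn (fun τ => (M * timeWeight 1 (t - τ)) *
      (N * timeWeight (1 + ν) (τ - q.2))) (Ioo q.2 t) := (hT.const_mul hM hN _ _ hpq).1
  have eZ : (fun x => AronsonGradient.star Z Φ (x, t) q) = fun x =>
      ∫ τ, ∫ z : Space d, Φ (z, τ) q • Z (x, t) (z, τ) := by
    ext x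
    exact star_eq_integral_slices hb hp.measurable_Z hΦm (hp.bound_Z' hM) hΦ (x, t) q hw
  rw [eZ, star_eq_integral_slices hb hp.measurable_DZ hΦm hp.bound_DZ hΦ (x₀, t) q hw]
  have hmZ : ∀ x, Measurable fun w : Space d × ℝ => Φ w q • Z (x, t) w := fun x =>
    (hΦm.comp (by fun_prop : Measurable fun w : Space d × ℝ => (w, q))).smul
      (hp.measurable_Z.comp (by fun_prop : Measurable fun w : Space d × ℝ => ((x, t), w)))
  have hmD : ∀ x, Measurable fun w : Space d × ℝ => Φ w q • DZ (x, t) w := fun x =>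
    (hΦm.comp (by fun_prop : Measurable fun w : Space d × ℝ => (w, q))).smul
      (hp.measurable_DZ.comp (by fun_prop : Measurable fun w : Space d × ℝ => ((x, t), w)))
  have hslice := fun x τ => star_slice hb hp.measurable_DZ hΦm hp.bound_DZ hΦ (x, t) q τ
  have hsliceZ := fun x τ => star_slice hb hp.measurable_Z hΦm (hp.bound_Z' hM) hΦ (x, t) q τ
  refine hasGradientAt_integral_of_dominated (f := fun x τ => ∫ z : Space d,
    Φ (z, τ) q • Z (x, t) (z, τ)) (G := fun x τ => ∫ z : Space d, Φ (z, τ) q • DZ (x, t) (z, τ))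
    (bound := (Ioo q.2 t).indicator fun τ => M * timeWeight 1 (t - τ) *
      (N * timeWeight (1 + ν) (τ - q.2)) * (gaussMass d b * (t - q.2) ^ (-(d : ℝ) / 2)))
    ?_ ?_ ?_ ?_ ?_ ?_
  · exact fun x => ((hmZ x).stronglyMeasurable.integral_prod_left').aestronglyMeasurable
  · exact (star_integrable hb hp.measurable_Z hΦm (hp.bound_Z' hM) hΦ (x₀, t) q hw
      ).integral_prod_right
  · exact ((hmD x₀).stronglyMeasurable.integral_prod_left').aestronglyMeasurable
  · refine Eventually.of_forall fun τ x => (norm_integral_le_integral_norm _).trans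
      ((hslice x τ).2.trans (indicator_le_indicator ?_))
    have h1 := timeWeight_nonneg 1 (t - τ)
    have h2 := timeWeight_nonneg (1 + ν) (τ - q.2)
    have h3 := (gaussMass_pos (d := d) hb).le
    have h4 := gaussKernel_le hb.le (x, t) q hpq
    simp only at h4 ⊢
    gcongr
  · exact (integrable_indicator_iff measurableSet_Ioo).mpr (hw.mul_const _)
  · refine Eventually.of_forall fun τ x => ?_
    by_cases hτ : τ ∈ Ioo q.2 t
    swap
    · have e1 : ∀ x z, Φ (z, τ) q • Z (x, t) (z, τ) = 0 := fun x z =>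
        hp.bound_Z.smul_eq_zero hΦ (p := (x, t)) hτ
      have e2 : ∀ x z, Φ (z, τ) q • DZ (x, t) (z, τ) = 0 := fun x z =>
        hp.bound_DZ.smul_eq_zero hΦ (p := (x, t)) hτ
      simp only [e1, e2, integral_zero]
      exact hasGradientAt_const x 0
    refine hasGradientAt_integral_of_dominated (f := fun x z => Φ (z, τ) q • Z (x, t) (z, τ))
      (G := fun x z => Φ (z, τ) q • DZ (x, t) (z, τ))
      (bound := fun z => N * timeWeight (1 + ν) (τ - q.2) * gaussKernel b (z, τ) q *
        (M * timeWeight 1 (t - τ) * (t - τ) ^ (-(d : ℝ) / 2))) ?_ (hsliceZ x τ).1 ?_ ?_ ?_ ?_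
    · exact fun x => ((hmZ x).comp (by fun_prop :
        Measurable fun z : Space d => (z, τ))).aestronglyMeasurable
    · exact ((hmD x).comp (by fun_prop :
        Measurable fun z : Space d => (z, τ))).aestronglyMeasurable
    · refine Eventually.of_forall fun z x => ?_
      rw [norm_smul]
      have h1 := hΦ (z, τ) q
      have h2 := (hp.bound_DZ (x, t) (z, τ)).trans (mul_le_mul_of_nonneg_left
        (gaussKernel_le hb.le (x, t) (z, τ) hτ.2) (mul_nonneg hM (timeWeight_nonneg _ _)))
      exact mul_le_mul h1 h2 (norm_nonneg _) ((norm_nonneg _).trans h1)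
    · exact ((integral_gaussKernel_left hb hτ.1).1.const_mul _).mul_const _
    · refine Eventually.of_forall fun z x => ?_
      have := (hp.hasGradientAt (x, t) (z, τ) hτ.2).hasFDerivAt.const_smul (Φ (z, τ) q)
      have e : InnerProductSpace.toDual ℝ (Space d) (Φ (z, τ) q • DZ (x, t) (z, τ)) =
          Φ (z, τ) q • InnerProductSpace.toDual ℝ (Space d) (DZ (x, t) (z, τ)) := by
        ext v
        simp
      rw [hasGradientAt_iff_hasFDerivAt, e]
      exact this

/-- Again dominated convergence in two stages, now with the final point and the pole both moving.
For fixed `τ` before the limiting final time the integrand stays away from its singularity in `t-τ`;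
for `τ` after it the slice is eventually zero. -/
lemma IsParametrix.continuousAt_star (hb : 0 < b) (hM : 0 ≤ M) (hN : 0 ≤ N)
    (hp : IsParametrix b M Z DZ R) (hΦm : Measurable (Function.uncurry Φ))
    (hΦ : KernelBound b (fun r => N * timeWeight (1 + ν) r) Φ)
    (hΦc : ∀ p s, Continuous fun y => Φ p (y, s)) {s : ℝ} {w₀ : (Space d × ℝ) × Space d}
    (hw₀ : s < w₀.1.2) :
    ContinuousAt (fun w : (Space d × ℝ) × Space d => AronsonGradient.star Z Φ w.1 (w.2, s)) w₀ := by
  have hint : ∀ t, s < t → IntegrableOn (fun τ => M * (N * timeWeight (1 + ν) (τ - s))) (Ioo s t) :=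
    fun t _ => ((integrableOn_timeWeight (1 + ν) s t).const_mul N).const_mul M
  have eZ : ∀ᶠ w : (Space d × ℝ) × Space d in 𝓝 w₀, (∫ τ, ∫ z : Space d,
      Φ (z, τ) (w.2, s) • Z w.1 (z, τ)) = AronsonGradient.star Z Φ w.1 (w.2, s) := by
    have : ∀ᶠ w : (Space d × ℝ) × Space d in 𝓝 w₀, s < w.1.2 :=
      (continuous_snd.comp continuous_fst).continuousAt.eventually (lt_mem_nhds hw₀)
    filter_upwards [this] with w hw
    exact (star_eq_integral_slices hb hp.measurable_Z hΦm hp.bound_Z hΦ w.1 (w.2, s)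
      (hint _ hw)).symm
  refine ContinuousAt.congr ?_ eZ
  obtain ⟨t₁, h1, h2⟩ := exists_between hw₀
  set t₂ := w₀.1.2 + 1 with ht₂
  have hnear : ∀ᶠ w : (Space d × ℝ) × Space d in 𝓝 w₀, t₁ < w.1.2 ∧ w.1.2 < t₂ := by
    have hc : ContinuousAt (fun w : (Space d × ℝ) × Space d => w.1.2) w₀ :=
      (continuous_snd.comp continuous_fst).continuousAt
    exact (hc.eventually (lt_mem_nhds h2)).and (hc.eventually (gt_mem_nhds (by linarith)))
  have hmw : ∀ w : (Space d × ℝ) × Space d,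
      Measurable fun r : Space d × ℝ => Φ r (w.2, s) • Z w.1 r := fun w =>
    (hΦm.comp (by fun_prop : Measurable fun r : Space d × ℝ => (r, (w.2, s)))).smul
      (hp.measurable_Z.comp (by fun_prop : Measurable fun r : Space d × ℝ => (w.1, r)))
  have hzero : ∀ w : (Space d × ℝ) × Space d, ∀ τ, τ ∉ Ioo s w.1.2 →
      ∀ z, Φ (z, τ) (w.2, s) • Z w.1 (z, τ) = 0 := fun w τ hτ z =>
    hp.bound_Z.smul_eq_zero hΦ (p := w.1) (q := (w.2, s)) (r := (z, τ)) hτ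
  refine continuousAt_of_dominated (bound := (Ioo s t₂).indicator fun τ =>
    M * (N * timeWeight (1 + ν) (τ - s)) * (gaussMass d b * (t₁ - s) ^ (-(d : ℝ) / 2)))
    ?_ ?_ ?_ ?_
  · exact Eventually.of_forall fun w =>
      ((hmw w).stronglyMeasurable.integral_prod_left').aestronglyMeasurable
  · filter_upwards [hnear] with w hw
    refine Eventually.of_forall fun τ => (norm_integral_le_integral_norm _).trans
      ((star_slice hb hp.measurable_Z hΦm hp.bound_Z hΦ w.1 (w.2, s) τ).2.trans ?_)
    have hst : s < w.1.2 := h1.trans hw.1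
    have h3 := (gaussMass_pos (d := d) hb).le
    have h2 := timeWeight_nonneg (1 + ν) (τ - s)
    have h4 : gaussKernel b w.1 (w.2, s) ≤ (t₁ - s) ^ (-(d : ℝ) / 2) := by
      refine (gaussKernel_le hb.le w.1 (w.2, s) hst).trans ?_
      refine Real.rpow_le_rpow_of_nonpos (by linarith) (by simp only; linarith [hw.1]) ?_
      have : (0 : ℝ) ≤ d := Nat.cast_nonneg d
      linarith
    refine (indicator_le_indicator_of_subset (Ioo_subset_Ioo_right hw.2.le) (fun τ => ?_) τ).trans
      (indicator_le_indicator ?_)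
    · have := timeWeight_nonneg (1 + ν) (τ - s)
      have := gaussKernel_nonneg (b := b) w.1 (w.2, s)
      positivity
    · gcongr
  · exact (integrable_indicator_iff measurableSet_Ioo).mpr ((hint t₂ (by linarith)).mul_const _)
  -- The one time at which the slice could be singular is a null set.
  · have hne : ∀ᵐ τ : ℝ, τ ≠ w₀.1.2 := Measure.ae_ne volume _
    filter_upwards [hne] with τ hτ
    by_cases hs : s < τ
    swap
    · have : ∀ w : (Space d × ℝ) × Space d, ∀ z, Φ (z, τ) (w.2, s) • Z w.1 (z, τ) = 0 := fun w z =>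
        hzero w τ (fun h => hs h.1) z
      simp only [this, integral_zero]
      exact continuousAt_const
    have hc : ContinuousAt (fun w : (Space d × ℝ) × Space d => w.1.2) w₀ :=
      (continuous_snd.comp continuous_fst).continuousAt
    rcases lt_or_gt_of_ne hτ with hlt | hgt
    swap
    · have : ∀ᶠ w : (Space d × ℝ) × Space d in 𝓝 w₀, (0 : ℝ) =
          ∫ z : Space d, Φ (z, τ) (w.2, s) • Z w.1 (z, τ) := by
        filter_upwards [hc.eventually (gt_mem_nhds hgt)] with w hw
        simp only [fun z => hzero w τ (fun h => lt_asymm h.2 hw) z, integral_zero]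
      exact continuousAt_const.congr this
    obtain ⟨t₃, h3, h4⟩ := exists_between hlt
    refine continuousAt_of_dominated (bound := fun z : Space d =>
      N * timeWeight (1 + ν) (τ - s) * (Real.exp (b / (τ - s)) * ((τ - s) ^ (-(d : ℝ) / 2) *
        Real.exp (-(b / (2 * (τ - s)) * ‖z - w₀.2‖ ^ 2)))) *
        (M * (t₃ - τ) ^ (-(d : ℝ) / 2))) ?_ ?_ ?_ ?_
    · exact Eventually.of_forall fun w => ((hmw w).comp (by fun_prop :
        Measurable fun z : Space d => (z, τ))).aestronglyMeasurable
    · have hy : ∀ᶠ w : (Space d × ℝ) × Space d in 𝓝 w₀, ‖w.2 - w₀.2‖ ≤ 1 := by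
        have : ContinuousAt (fun w : (Space d × ℝ) × Space d => ‖w.2 - w₀.2‖) w₀ := by fun_prop
        have h0 : ‖w₀.2 - w₀.2‖ < 1 := by simp
        exact (this.eventually (gt_mem_nhds h0)).mono fun w hw => hw.le
      filter_upwards [hy, hc.eventually (lt_mem_nhds h4)] with w hwy hwt
      refine Eventually.of_forall fun z => ?_
      rw [norm_smul]
      have hτs : 0 < τ - s := sub_pos.mpr hs
      have k1 := (hΦ (z, τ) (w.2, s)).trans (mul_le_mul_of_nonneg_left
        (gaussKernel_le_shift hb hs z w.2 w₀.2 hwy)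
        (mul_nonneg hN (timeWeight_nonneg (1 + ν) (τ - s))))
      have k2 : ‖Z w.1 (z, τ)‖ ≤ M * (t₃ - τ) ^ (-(d : ℝ) / 2) := by
        refine (hp.bound_Z w.1 (z, τ)).trans (mul_le_mul_of_nonneg_left ?_ hM)
        refine (gaussKernel_le hb.le w.1 (z, τ) (h3.trans hwt)).trans ?_
        refine Real.rpow_le_rpow_of_nonpos (by linarith) (by simp only; linarith) ?_
        have : (0 : ℝ) ≤ d := Nat.cast_nonneg d
        linarith
      exact mul_le_mul k1 k2 (norm_nonneg _) ((norm_nonneg _).trans k1)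
    · have hpos : 0 < b / (2 * (τ - s)) := by
        have : 0 < τ - s := sub_pos.mpr hs
        positivity
      exact (((((integrable_exp_sq hpos).comp_sub_right w₀.2).const_mul _).const_mul _).const_mul
        _).mul_const _
    · refine Eventually.of_forall fun z => ?_
      have c1 : ContinuousAt (fun w : (Space d × ℝ) × Space d => Φ (z, τ) (w.2, s)) w₀ :=
        ((hΦc (z, τ) s).comp continuous_snd).continuousAt
      have c2 : ContinuousAt (fun w : (Space d × ℝ) × Space d => Z w.1 (z, τ)) w₀ :=
        (hp.continuousAt_Z w₀.1 (z, τ) hlt).comp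
          (f := fun w : (Space d × ℝ) × Space d => (w.1, (z, τ))) (x := w₀) (by fun_prop)
      exact c1.smul c2

/-- Levi's construction: a parametrix can be corrected to a kernel without error. -/
theorem exists_levi_kernel (d : ℕ) (hb : 0 < b) (hM : 0 ≤ M) :
    ∃ ν N : ℝ, 0 < ν ∧ 0 ≤ N ∧
      ∀ (Z R : Space d × ℝ → Space d × ℝ → ℝ) (DZ : Space d × ℝ → Space d × ℝ → Space d),
        IsParametrix b M Z DZ R →
        ∃ (Γ : Space d × ℝ → Space d × ℝ → ℝ) (DΓ : Space d × ℝ → Space d × ℝ → Space d),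
          Measurable (Function.uncurry Γ) ∧ Measurable (Function.uncurry DΓ) ∧
          KernelBound b (fun r => N * Real.exp ((1 + ν) * r)) Γ ∧
          KernelBound b (fun r => N * timeWeight (1 + ν) r) DΓ ∧
          (∀ p q, q.2 < p.2 → HasGradientAt (fun x => Γ (x, p.2) q) (DΓ p q) p.1) ∧
          (∀ s (w : (Space d × ℝ) × Space d), s < w.1.2 →
            ContinuousAt (fun w : (Space d × ℝ) × Space d => Γ w.1 (w.2, s)) w) ∧
          ∀ (T : ℝ) (η W : Space d × ℝ → ℝ) (V : Space d × ℝ → Space d),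
            IsAdjointTest T Z DZ R η W V → ∀ q, ∫ p, pairing Γ DΓ V W p q = η q := by
  obtain ⟨ν, hν, hT, hvol⟩ := exists_volterra d hb hM
  have hT' : TimeConvolution ν := hT
  set κ := gaussMass d b with hκ
  have hκ0 : 0 < κ := gaussMass_pos hb
  -- The parametrix contributes `M`; the composition contributes the Gaussian mass `κ` times the
  -- constants `M` and `2M` of its two factors.
  refine ⟨ν, M + κ * (M * (2 * M)), hν, by positivity, fun Z R DZ hp => ?_⟩
  obtain ⟨Φ, hΦm, hΦ, hΦc, hΦeq⟩ := hvol R hp.measurable_R hp.bound_R hp.continuous_R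
  have hN : 0 ≤ 2 * M := by positivity
  -- For the kernel itself the weight must be nonsingular. Inserting `1 ≤ √(t-s) · timeWeight 1
  -- (t-τ)` brings the integral under the convolution bound, and the factor `√(t-s)` then cancels
  -- the singularity of the result.
  have hw1 : ∀ s t : ℝ, s < t →
      IntegrableOn (fun τ => M * (2 * M * timeWeight (1 + ν) (τ - s))) (Ioo s t) ∧
      ∫ τ in Ioo s t, M * (2 * M * timeWeight (1 + ν) (τ - s)) ≤
        M * (2 * M) * Real.exp ((1 + ν) * (t - s)) := by
    intro s t hst
    have hi := ((integrableOn_timeWeight (1 + ν) s t).const_mul (2 * M)).const_mul M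
    refine ⟨hi, ?_⟩
    have hr : 0 < t - s := sub_pos.mpr hst
    have hq : 0 < √(t - s) := Real.sqrt_pos.mpr hr
    obtain ⟨c1, c2⟩ := hT'.const_mul hM hN s t hst
    have hle : ∫ τ in Ioo s t, M * (2 * M * timeWeight (1 + ν) (τ - s)) ≤
        ∫ τ in Ioo s t, √(t - s) * (M * timeWeight 1 (t - τ) *
          (2 * M * timeWeight (1 + ν) (τ - s))) := by
      refine setIntegral_mono_on hi (c1.const_mul _) measurableSet_Ioo fun τ hτ => ?_
      have h1 : 0 < t - τ := sub_pos.mpr hτ.2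
      have h2 : 1 ≤ √(t - s) * timeWeight 1 (t - τ) :=
        (one_le_sqrt_mul_timeWeight zero_le_one h1).trans
          (mul_le_mul_of_nonneg_right (Real.sqrt_le_sqrt (by linarith [hτ.1]))
            (timeWeight_nonneg _ _))
      have h3 : 0 ≤ M * (2 * M * timeWeight (1 + ν) (τ - s)) :=
        mul_nonneg hM (mul_nonneg hN (timeWeight_nonneg _ _))
      calc _ ≤ (√(t - s) * timeWeight 1 (t - τ)) * (M * (2 * M * timeWeight (1 + ν) (τ - s))) :=
            le_mul_of_one_le_left h3 h2
        _ = _ := by ring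
    refine hle.trans ?_
    rw [integral_const_mul]
    refine (mul_le_mul_of_nonneg_left c2 hq.le).trans_eq ?_
    unfold timeWeight
    field_simp
  refine ⟨fun p q => Z p q + AronsonGradient.star Z Φ p q,
    fun p q => DZ p q + AronsonGradient.star DZ Φ p q,
    hp.measurable_Z.add (measurable_star hp.measurable_Z hΦm),
    hp.measurable_DZ.add (measurable_star hp.measurable_DZ hΦm), ?_, ?_, ?_, ?_, ?_⟩
  · have hs := KernelBound.star (w₃ := fun r => M * (2 * M) * Real.exp ((1 + ν) * r)) hb
      hp.measurable_Z hΦm hp.bound_Z hΦ hw1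
    intro p q
    by_cases hpq : q.2 < p.2
    · refine (norm_add_le _ _).trans ((add_le_add (hp.bound_Z p q) (hs p q)).trans ?_)
      have h1 : (1 : ℝ) ≤ Real.exp ((1 + ν) * (p.2 - q.2)) :=
        Real.one_le_exp (mul_nonneg (by linarith) (by linarith))
      rw [← add_mul]
      refine mul_le_mul_of_nonneg_right ?_ (gaussKernel_nonneg p q)
      have := mul_le_mul_of_nonneg_left h1 hM
      linarith
    · show ‖Z p q + AronsonGradient.star Z Φ p q‖ ≤ _
      rw [hp.bound_Z.eq_zero (not_lt.mp hpq), hs.eq_zero (not_lt.mp hpq),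
        gaussKernel_of_le (not_lt.mp hpq)]
      simp
  · have hs := KernelBound.star (w₃ := fun r => M * (2 * M) * timeWeight (1 + ν) r) hb
      hp.measurable_DZ hΦm hp.bound_DZ hΦ (hT'.const_mul hM hN)
    have hD := hp.bound_DZ.mono (w' := fun r => M * timeWeight (1 + ν) r) fun r hr =>
      mul_le_mul_of_nonneg_left (timeWeight_mono (by linarith) hr) hM
    intro p q
    refine (norm_add_le _ _).trans ((add_le_add (hD p q) (hs p q)).trans_eq ?_)
    ring
  · intro p q hpq
    have h1 := (hp.hasGradientAt p q hpq).hasFDerivAt.add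
      (hp.hasGradientAt_star hb hM hN hT' hΦm hΦ hpq).hasFDerivAt
    rw [hasGradientAt_iff_hasFDerivAt, map_add]
    exact h1
  · intro s w hw
    refine ContinuousAt.add ?_ (hp.continuousAt_star hb hM hN hΦm hΦ hΦc hw)
    exact (hp.continuousAt_Z w.1 (w.2, s) hw).comp
      (f := fun w : (Space d × ℝ) × Space d => (w.1, (w.2, s))) (x := w) (by fun_prop)
  · exact fun T η W V ht q => integral_pairing_correction hb hM hN hT' hp hΦm hΦ hΦeq ht q

end Levi

/-! ### Anisotropic Gaussians attached to positive matrices. -/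

section MatrixGaussian

open Filter Topology Matrix

variable {d : ℕ}

/-- A matrix acting on the Euclidean space. -/
abbrev matVec (M : Matrix (Fin d) (Fin d) ℝ) : Space d →ₗ[ℝ] Space d := Matrix.toEuclideanLin M

lemma matVec_apply (M : Matrix (Fin d) (Fin d) ℝ) (v : Space d) (i : Fin d) :
    matVec M v i = ∑ j, M i j * v j := rfl

lemma inner_eq_sum (v w : Space d) : inner ℝ v w = ∑ i, v i * w i := by
  rw [PiLp.inner_apply]
  exact Finset.sum_congr rfl fun i _ => by simp [mul_comm]

lemma inner_matVec (M : Matrix (Fin d) (Fin d) ℝ) (v w : Space d) :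
    inner ℝ (matVec M v) w = ∑ i, ∑ j, M i j * v j * w i := by
  simp only [inner_eq_sum, matVec_apply, Finset.sum_mul]

lemma abs_apply_le_norm (v : Space d) (i : Fin d) : |v i| ≤ ‖v‖ := PiLp.norm_apply_le v i

lemma inner_matVec_comm {M : Matrix (Fin d) (Fin d) ℝ} (hM : M.IsSymm) (v w : Space d) :
    inner ℝ (matVec M v) w = inner ℝ v (matVec M w) := by
  rw [inner_matVec, real_inner_comm, inner_matVec, Finset.sum_comm]
  refine Finset.sum_congr rfl fun i _ => Finset.sum_congr rfl fun j _ => ?_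
  rw [hM.apply]
  ring

lemma inner_matVec_transpose (M : Matrix (Fin d) (Fin d) ℝ) (v w : Space d) :
    inner ℝ (matVec Mᵀ v) w = inner ℝ v (matVec M w) := by
  rw [inner_matVec, real_inner_comm, inner_matVec, Finset.sum_comm]
  refine Finset.sum_congr rfl fun i _ => Finset.sum_congr rfl fun j _ => ?_
  rw [Matrix.transpose_apply]
  ring

lemma matVec_matVec (M N : Matrix (Fin d) (Fin d) ℝ) (v : Space d) :
    matVec M (matVec N v) = matVec (M * N) v := by
  simp [matVec]

lemma matVec_one (v : Space d) : matVec (1 : Matrix (Fin d) (Fin d) ℝ) v = v := by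
  simp [matVec]

/-- Symmetric matrices whose quadratic form lies between `α` and `β`. -/
structure MatBetween (α β : ℝ) (M : Matrix (Fin d) (Fin d) ℝ) : Prop where
  symm : M.IsSymm
  lower : ∀ v : Space d, α * ‖v‖ ^ 2 ≤ inner ℝ (matVec M v) v
  upper : ∀ v : Space d, inner ℝ (matVec M v) v ≤ β * ‖v‖ ^ 2

variable {α β : ℝ} {M : Matrix (Fin d) (Fin d) ℝ}

lemma MatBetween.posDef (hα : 0 < α) (h : MatBetween α β M) : M.PosDef := by
  refine Matrix.PosDef.of_dotProduct_mulVec_pos ?_ fun x hx => ?_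
  · rw [Matrix.IsHermitian, Matrix.conjTranspose_eq_transpose_of_trivial]; exact h.symm
  · have hv : (WithLp.toLp 2 x : Space d) ≠ 0 := fun h0 => hx (by
      simpa using congrArg WithLp.ofLp h0)
    have h1 := h.lower (WithLp.toLp 2 x)
    have h2 : 0 < α * ‖(WithLp.toLp 2 x : Space d)‖ ^ 2 := by
      have := norm_pos_iff.mpr hv
      positivity
    refine (h2.trans_le h1).trans_eq ?_
    rw [inner_eq_sum]
    simp only [dotProduct]
    exact Finset.sum_congr rfl fun i _ => by
      simp [matVec, Matrix.toLpLin_apply, mul_comm]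

lemma MatBetween.det_pos (hα : 0 < α) (h : MatBetween α β M) : 0 < M.det := (h.posDef hα).det_pos

lemma MatBetween.mul_inv (hα : 0 < α) (h : MatBetween α β M) : M * M⁻¹ = 1 :=
  Matrix.mul_nonsing_inv M (isUnit_iff_ne_zero.mpr (h.det_pos hα).ne')

lemma MatBetween.inv_symm (h : MatBetween α β M) : (M⁻¹).IsSymm := by
  rw [Matrix.IsSymm, Matrix.transpose_nonsing_inv, h.symm.eq]

/-- Coercivity at `w = M⁻¹v` reads `α‖w‖² ≤ ⟨v, w⟩ ≤ ‖v‖‖w‖`. -/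
lemma MatBetween.norm_inv_le (hα : 0 < α) (h : MatBetween α β M) (v : Space d) :
    ‖matVec M⁻¹ v‖ ≤ ‖v‖ / α := by
  set w := matVec M⁻¹ v with hw
  have hv : matVec M w = v := by rw [hw, matVec_matVec, h.mul_inv hα, matVec_one]
  have h1 := h.lower w
  rw [hv] at h1
  have h2 := real_inner_le_norm v w
  rw [le_div_iff₀ hα]
  by_cases h0 : ‖w‖ = 0
  · rw [h0]; simp
  · have h3 : 0 < ‖w‖ := lt_of_le_of_ne (norm_nonneg _) (Ne.symm h0)
    nlinarith

/-- The form of `M` is nonnegative at `M⁻¹v - β⁻¹v`. Expanding, and using the upper bound on `⟨Mv,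
v⟩`, gives the claim without diagonalising. -/
lemma MatBetween.inv_lower (hα : 0 < α) (hβ : 0 < β) (h : MatBetween α β M) (v : Space d) :
    ‖v‖ ^ 2 / β ≤ inner ℝ (matVec M⁻¹ v) v := by
  set w := matVec M⁻¹ v with hw
  have hv : matVec M w = v := by rw [hw, matVec_matVec, h.mul_inv hα, matVec_one]
  have h1 := h.lower (w - β⁻¹ • v)
  have h2 := h.upper v
  have h3 : inner ℝ (matVec M (w - β⁻¹ • v)) (w - β⁻¹ • v) =
      inner ℝ w v - 2 * β⁻¹ * ‖v‖ ^ 2 + β⁻¹ ^ 2 * inner ℝ (matVec M v) v := by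
    rw [map_sub, map_smul, hv]
    simp only [inner_sub_left, inner_sub_right, real_inner_smul_left, real_inner_smul_right]
    rw [inner_matVec_comm h.symm v w, hv, real_inner_self_eq_norm_sq, real_inner_comm v w]
    ring
  have h4 : β⁻¹ ^ 2 * inner ℝ (matVec M v) v ≤ β⁻¹ * ‖v‖ ^ 2 := by
    calc _ ≤ β⁻¹ ^ 2 * (β * ‖v‖ ^ 2) := by gcongr
      _ = _ := by field_simp
  have h5 : 0 ≤ α * ‖w - β⁻¹ • v‖ ^ 2 := by positivity
  rw [div_eq_inv_mul]
  linarith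

lemma norm_single_one (i : Fin d) : ‖(EuclideanSpace.single i (1 : ℝ) : Space d)‖ = 1 := by
  simp

lemma matVec_single (M : Matrix (Fin d) (Fin d) ℝ) (i j : Fin d) :
    matVec M (EuclideanSpace.single j 1) i = M i j := by
  rw [matVec_apply]
  simp

lemma MatBetween.abs_inv_apply_le (hα : 0 < α) (h : MatBetween α β M) (i j : Fin d) :
    |M⁻¹ i j| ≤ 1 / α := by
  have e : M⁻¹ i j = matVec M⁻¹ (EuclideanSpace.single j 1) i := (matVec_single M⁻¹ i j).symm
  rw [e]
  refine (abs_apply_le_norm _ i).trans ((h.norm_inv_le hα _).trans_eq ?_)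
  rw [norm_single_one]

lemma exists_eq_transpose_mul_self {Q : Matrix (Fin d) (Fin d) ℝ} (hQ : Q.PosSemidef) :
    ∃ B : Matrix (Fin d) (Fin d) ℝ, Q = Bᵀ * B := by
  open scoped MatrixOrder Matrix.Norms.L2Operator in
  obtain ⟨B, hB⟩ := CStarAlgebra.nonneg_iff_eq_star_mul_self.mp hQ.nonneg
  refine ⟨B, ?_⟩
  rw [hB, Matrix.star_eq_conjTranspose, Matrix.conjTranspose_eq_transpose_of_trivial]

/-- The normalisation of the Gaussian with covariance proportional to `M`. -/
def gaussNorm (M : Matrix (Fin d) (Fin d) ℝ) : ℝ := √((4 * Real.pi) ^ d * M.det)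

lemma MatBetween.gaussNorm_pos (hα : 0 < α) (h : MatBetween α β M) : 0 < gaussNorm M :=
  Real.sqrt_pos.mpr (mul_pos (by positivity) (h.det_pos hα))

lemma MatBetween.exp_le (hα : 0 < α) (hβ : 0 < β) (h : MatBetween α β M) (x : Space d) :
    Real.exp (-(1 / 4 * inner ℝ (matVec M⁻¹ x) x)) ≤ Real.exp (-(1 / (4 * β) * ‖x‖ ^ 2)) := by
  refine Real.exp_le_exp.mpr ?_
  have := h.inv_lower hα hβ x
  have e : 1 / (4 * β) * ‖x‖ ^ 2 = 1 / 4 * (‖x‖ ^ 2 / β) := by field_simp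
  rw [e]
  linarith

lemma continuous_inner_matVec (M : Matrix (Fin d) (Fin d) ℝ) :
    Continuous fun x : Space d => (inner ℝ (matVec M x) x : ℝ) :=
  (LinearMap.continuous_of_finiteDimensional (matVec M)).inner continuous_id

/-- Factor `M⁻¹ = BᵀB`, so that the exponent is `-‖Bx‖²/4`, and substitute `y = Bx`. The Jacobian
factor is `|det B|⁻¹ = √(det M)`. -/
lemma MatBetween.integral_exp (hα : 0 < α) (hβ : 0 < β) (h : MatBetween α β M) :
    Integrable (fun x : Space d => Real.exp (-(1 / 4 * inner ℝ (matVec M⁻¹ x) x))) ∧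
      ∫ x : Space d, Real.exp (-(1 / 4 * inner ℝ (matVec M⁻¹ x) x)) = gaussNorm M := by
  have hi : Integrable (fun x : Space d => Real.exp (-(1 / 4 * inner ℝ (matVec M⁻¹ x) x))) := by
    refine (integrable_exp_sq (d := d) (show 0 < 1 / (4 * β) by positivity)).mono' ?_ ?_
    · have := continuous_inner_matVec M⁻¹
      exact (by fun_prop : Continuous fun x : Space d =>
        Real.exp (-(1 / 4 * inner ℝ (matVec M⁻¹ x) x))).aestronglyMeasurable
    · refine Eventually.of_forall fun x => ?_
      rw [Real.norm_of_nonneg (Real.exp_pos _).le]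
      exact h.exp_le hα hβ x
  refine ⟨hi, ?_⟩
  obtain ⟨B, hB⟩ := exists_eq_transpose_mul_self (h.posDef hα).inv.posSemidef
  have hq : ∀ x : Space d, (inner ℝ (matVec M⁻¹ x) x : ℝ) = ‖matVec B x‖ ^ 2 := by
    intro x
    rw [hB, ← matVec_matVec, inner_matVec_transpose, real_inner_self_eq_norm_sq]
  have hdet : B.det ^ 2 = M.det⁻¹ := by
    have := congrArg Matrix.det hB
    rw [Matrix.det_mul, Matrix.det_transpose, Matrix.det_nonsing_inv, Ring.inverse_eq_inv'] at this
    rw [this, sq]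
  have hM := h.det_pos hα
  have hB0 : B.det ≠ 0 := by
    intro h0
    rw [h0] at hdet
    have := inv_pos.mpr hM
    rw [← hdet] at this
    simp at this
  have hdl : LinearMap.det (matVec B) = B.det := by
    have : matVec B = Matrix.toLin (PiLp.basisFun 2 ℝ (Fin d)) (PiLp.basisFun 2 ℝ (Fin d)) B :=
      congrArg (fun f => f B) (Matrix.toLpLin_eq_toLin 2 2)
    rw [this, LinearMap.det_toLin]
  have hmap := Measure.map_linearMap_addHaar_eq_smul_addHaar (volume : Measure (Space d))
    (f := matVec B) (by rw [hdl]; exact hB0)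
  have hc : Continuous (matVec B) := LinearMap.continuous_of_finiteDimensional _
  have hg : Continuous fun x : Space d => Real.exp (-(1 / 4 * ‖x‖ ^ 2)) := by fun_prop
  have h1 : ∫ x : Space d, Real.exp (-(1 / 4 * ‖matVec B x‖ ^ 2)) =
      ∫ y, Real.exp (-(1 / 4 * ‖y‖ ^ 2)) ∂(Measure.map (matVec B) (volume : Measure (Space d))) :=
    (integral_map hc.aemeasurable hg.aestronglyMeasurable).symm
  have h2 := GaussianFourier.integral_rexp_neg_mul_sq_norm (V := Space d)
    (show (0 : ℝ) < 1 / 4 by norm_num)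
  simp only [neg_mul] at h2
  simp only [hq]
  rw [h1, hmap, integral_smul_measure, h2, hdl, ENNReal.toReal_ofReal (abs_nonneg _),
    finrank_euclideanSpace, Fintype.card_fin, gaussNorm, smul_eq_mul, Real.sqrt_mul (by positivity)]
  have e1 : |B.det⁻¹| = √M.det := by
    rw [← Real.sqrt_sq_eq_abs, inv_pow, hdet, inv_inv]
  have e2 : (Real.pi / (1 / 4)) ^ ((d : ℝ) / 2) = √((4 * Real.pi) ^ d) := by
    rw [Real.sqrt_eq_rpow, ← Real.rpow_natCast, ← Real.rpow_mul (by positivity)]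
    congr 1
    · ring
    · ring
  rw [e1, e2, mul_comm]

/-- The determinant is bounded below by comparing integrals: the form of `M⁻¹` is at most `‖x‖²/α`,
so the anisotropic Gaussian lies above an isotropic one whose integral is known. -/
lemma MatBetween.gaussNorm_ge (hα : 0 < α) (hβ : 0 < β) (h : MatBetween α β M) :
    (4 * Real.pi * α) ^ ((d : ℝ) / 2) ≤ gaussNorm M := by
  obtain ⟨h1, h2⟩ := h.integral_exp hα hβ
  have hp : 0 < 1 / (4 * α) := by positivity
  have h3 := GaussianFourier.integral_rexp_neg_mul_sq_norm (V := Space d) hp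
  rw [finrank_euclideanSpace, Fintype.card_fin] at h3
  rw [← h2, show 4 * Real.pi * α = Real.pi / (1 / (4 * α)) by field_simp, ← h3]
  simp only [neg_mul]
  refine integral_mono (integrable_exp_sq hp) h1 fun x => Real.exp_le_exp.mpr ?_
  have h4 : (inner ℝ (matVec M⁻¹ x) x : ℝ) ≤ ‖x‖ / α * ‖x‖ :=
    (real_inner_le_norm _ _).trans (mul_le_mul_of_nonneg_right (h.norm_inv_le hα x) (norm_nonneg x))
  have e : 1 / (4 * α) * ‖x‖ ^ 2 = 1 / 4 * (‖x‖ / α * ‖x‖) := by field_simp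
  rw [e]
  linarith

/-- The Gaussian density `(4π)^{-d/2} det(M)^{-1/2} exp(-¼ M⁻¹x·x)`. -/
def matGauss (M : Matrix (Fin d) (Fin d) ℝ) (x : Space d) : ℝ :=
  (gaussNorm M)⁻¹ * Real.exp (-(1 / 4 * inner ℝ (matVec M⁻¹ x) x))

lemma matGauss_nonneg (M : Matrix (Fin d) (Fin d) ℝ) (x : Space d) : 0 ≤ matGauss M x :=
  mul_nonneg (inv_nonneg.mpr (Real.sqrt_nonneg _)) (Real.exp_pos _).le

lemma MatBetween.integral_matGauss (hα : 0 < α) (hβ : 0 < β) (h : MatBetween α β M) :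
    Integrable (matGauss M) ∧ ∫ x, matGauss M x = 1 := by
  obtain ⟨h1, h2⟩ := h.integral_exp hα hβ
  refine ⟨h1.const_mul _, ?_⟩
  simp only [matGauss]
  rw [integral_const_mul, h2, inv_mul_cancel₀ (h.gaussNorm_pos hα).ne']

lemma MatBetween.matGauss_le (hα : 0 < α) (hβ : 0 < β) (h : MatBetween α β M) (x : Space d) :
    matGauss M x ≤ (4 * Real.pi * α) ^ (-(d : ℝ) / 2) * Real.exp (-(1 / (4 * β) * ‖x‖ ^ 2)) := by
  refine mul_le_mul ?_ (h.exp_le hα hβ x) (Real.exp_pos _).le (by positivity)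
  rw [neg_div, Real.rpow_neg (by positivity)]
  exact inv_anti₀ (by positivity) (h.gaussNorm_ge hα hβ)

lemma hasGradientAt_matGauss (hM : (M⁻¹).IsSymm) (x : Space d) :
    HasGradientAt (matGauss M) ((-(1 / 2) * matGauss M x) • matVec M⁻¹ x) x := by
  set L := (matVec M⁻¹).toContinuousLinearMap with hL
  have h1 : HasFDerivAt (fun x => (inner ℝ (L x) x : ℝ)) _ x := L.hasFDerivAt.inner ℝ (hasFDerivAt_id x)
  have h2 := (((h1.const_mul (1 / 4 : ℝ)).neg).exp).const_mul (gaussNorm M)⁻¹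
  rw [hasGradientAt_iff_hasFDerivAt]
  refine HasFDerivAt.congr_fderiv (f := matGauss M) h2 ?_
  ext v
  have e : (inner ℝ (matVec M⁻¹ v) x : ℝ) = inner ℝ (matVec M⁻¹ x) v := by
    rw [real_inner_comm]
    exact (inner_matVec_comm hM x v).symm
  simp only [_root_.smul_apply, InnerProductSpace.toDual_apply_apply, real_inner_smul_left, matGauss]
  simp [fderivInnerCLM_apply, hL, e]
  ring

end MatrixGaussian

/-! ### Derivatives of determinant, inverse and Gaussian along matrix curves. -/

section MatrixCalculus

open Filter Topology Matrix

variable {d : ℕ}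

lemma contDiff_det_of_entries {E : Type*} [NormedAddCommGroup E] [NormedSpace ℝ E]
    {G : E → Matrix (Fin d) (Fin d) ℝ} {n : WithTop ℕ∞}
    (hG : ∀ i j, ContDiff ℝ n fun e => G e i j) : ContDiff ℝ n fun e => (G e).det := by
  simp only [Matrix.det_apply]
  refine ContDiff.sum fun σ _ => ?_
  exact (contDiff_prod fun i _ => hG (σ i) i).const_smul _

lemma contDiff_det_of : ContDiff ℝ 1 fun m : Fin d → Fin d → ℝ => (Matrix.of m).det :=
  contDiff_det_of_entries fun i j => by
    simp only [Matrix.of_apply]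
    fun_prop

lemma contDiff_adjugate_of (i j : Fin d) :
    ContDiff ℝ 1 fun m : Fin d → Fin d → ℝ => (Matrix.of m).adjugate i j := by
  simp only [Matrix.adjugate_apply]
  refine contDiff_det_of_entries fun k l => ?_
  by_cases h : k = j
  · subst h
    simp only [Matrix.updateRow_self]
    exact contDiff_const
  · simp only [Matrix.updateRow_ne h, Matrix.of_apply]
    fun_prop

lemma contDiffAt_inv_of {m : Fin d → Fin d → ℝ} (hm : 0 < (Matrix.of m).det) (i j : Fin d) :
    ContDiffAt ℝ 1 (fun m : Fin d → Fin d → ℝ => (Matrix.of m)⁻¹ i j) m := by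
  have e : (fun m : Fin d → Fin d → ℝ => (Matrix.of m)⁻¹ i j) =
      fun m => ((Matrix.of m).det)⁻¹ * (Matrix.of m).adjugate i j := by
    ext m
    rw [Matrix.inv_def, Ring.inverse_eq_inv', Matrix.smul_apply, smul_eq_mul]
  rw [e]
  exact (contDiff_det_of.contDiffAt.inv hm.ne').mul (contDiff_adjugate_of i j).contDiffAt

lemma contDiffAt_inner_inv_of {m : Fin d → Fin d → ℝ} (hm : 0 < (Matrix.of m).det) (x y : Space d) :
    ContDiffAt ℝ 1 (fun m : Fin d → Fin d → ℝ =>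
      (inner ℝ (matVec (Matrix.of m)⁻¹ x) y : ℝ)) m := by
  simp only [inner_matVec]
  refine ContDiffAt.sum fun i _ => ContDiffAt.sum fun j _ => ?_
  exact ((contDiffAt_inv_of hm i j).mul contDiffAt_const).mul contDiffAt_const

lemma contDiffAt_matGauss_of {m : Fin d → Fin d → ℝ} (hm : 0 < (Matrix.of m).det) (x : Space d) :
    ContDiffAt ℝ 1 (fun m : Fin d → Fin d → ℝ => matGauss (Matrix.of m) x) m := by
  have hp : 0 < (4 * Real.pi) ^ d * (Matrix.of m).det := mul_pos (by positivity) hm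
  have h1 : ContDiffAt ℝ 1 (fun m : Fin d → Fin d → ℝ => (gaussNorm (Matrix.of m))⁻¹) m :=
    ((contDiffAt_const.mul contDiff_det_of.contDiffAt).sqrt hp.ne').inv
      (Real.sqrt_pos.mpr hp).ne'
  exact h1.mul ((contDiffAt_const.mul (contDiffAt_inner_inv_of hm x x)).neg.exp)

/-- Along Lipschitz curves of matrices with positive determinant the Gaussian is Lipschitz. -/
lemma exists_lipschitzOn_matGauss {C : ℝ → Matrix (Fin d) (Fin d) ℝ} {L : NNReal}
    (hC : LipschitzWith L (fun t => (fun i j => C t i j : Fin d → Fin d → ℝ))) {t₁ t₂ : ℝ}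
    (hdet : ∀ t ∈ Icc t₁ t₂, 0 < (C t).det) (x : Space d) :
    ∃ K, LipschitzOnWith K (fun t => matGauss (C t) x) (Icc t₁ t₂) := by
  refine LocallyLipschitzOn.exists_lipschitzOnWith_of_compact isCompact_Icc fun t ht => ?_
  obtain ⟨K, u, hu, hK⟩ :=
    (contDiffAt_matGauss_of (m := fun i j => C t i j) (hdet t ht) x).exists_lipschitzOnWith
  refine ⟨K * L, (fun t => (fun i j => C t i j : Fin d → Fin d → ℝ)) ⁻¹' u,
    mem_nhdsWithin_of_mem_nhds (hC.continuous.continuousAt hu), ?_⟩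
  exact hK.comp (hC.lipschitzOnWith (s := _)) (mapsTo_preimage _ _)

/-- Jacobi's formula: in `M + hS = M(1 + hM⁻¹S)` the determinant of the second factor is a
polynomial in `h` whose linear coefficient is the trace. -/
lemma hasDerivAt_det_line {M S : Matrix (Fin d) (Fin d) ℝ} (hM : M.det ≠ 0) :
    HasDerivAt (fun h : ℝ => (M + h • S).det) (M.det * (M⁻¹ * S).trace) 0 := by
  set p : Polynomial ℝ := (1 + (Polynomial.X : Polynomial ℝ) • (M⁻¹ * S).map Polynomial.C).det
    with hp
  have h1 : ∀ h : ℝ, (M + h • S).det = M.det * p.eval h := by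
    intro h
    have e1 : M + h • S = M * (1 + h • (M⁻¹ * S)) := by
      rw [Matrix.mul_add, Matrix.mul_one, Matrix.mul_smul, ← Matrix.mul_assoc,
        Matrix.mul_nonsing_inv M (isUnit_iff_ne_zero.mpr hM), Matrix.one_mul]
    have e2 : p.eval h = (1 + h • (M⁻¹ * S)).det := by
      rw [hp, ← Polynomial.coe_evalRingHom, RingHom.map_det]
      generalize M⁻¹ * S = N
      congr 1
      ext i j
      by_cases hij : i = j <;> simp [hij] <;> ring
    rw [e1, Matrix.det_mul, e2]
  simp only [h1]
  have h2 := (p.hasDerivAt 0).const_mul M.det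
  rwa [hp, Matrix.derivative_det_one_add_X_smul] at h2

/-- By the chain rule the derivative depends only on the tangent `S`, so it equals the one along the
straight line through `C t`. -/
lemma hasDerivAt_det {C : ℝ → Matrix (Fin d) (Fin d) ℝ} {S : Matrix (Fin d) (Fin d) ℝ} {t : ℝ}
    (hC : ∀ i j, HasDerivAt (fun t => C t i j) (S i j) t) (hdet : (C t).det ≠ 0) :
    HasDerivAt (fun t => (C t).det) ((C t).det * ((C t)⁻¹ * S).trace) t := by
  set f : (Fin d → Fin d → ℝ) → ℝ := fun m => (Matrix.of m).det with hf
  have hfd : DifferentiableAt ℝ f (fun i j => C t i j) :=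
    contDiff_det_of.differentiable one_ne_zero _
  have hcurve : HasDerivAt (fun t => (fun i j => C t i j : Fin d → Fin d → ℝ))
      (fun i j => S i j) t :=
    hasDerivAt_pi.mpr fun i => hasDerivAt_pi.mpr fun j => hC i j
  have h1 : HasDerivAt (fun t => (C t).det) (fderiv ℝ f (fun i j => C t i j) fun i j => S i j) t :=
    hfd.hasFDerivAt.comp_hasDerivAt t hcurve
  have hline : HasDerivAt (fun h : ℝ => (fun i j => (C t + h • S) i j : Fin d → Fin d → ℝ))
      (fun i j => S i j) 0 := by
    refine hasDerivAt_pi.mpr fun i => hasDerivAt_pi.mpr fun j => ?_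
    simp only [Matrix.add_apply, Matrix.smul_apply, smul_eq_mul]
    simpa using ((hasDerivAt_id (0 : ℝ)).mul_const (S i j)).const_add (C t i j)
  have h0 : (fun i j => (C t + (0 : ℝ) • S) i j : Fin d → Fin d → ℝ) = fun i j => C t i j := by
    simp
  have h2 : HasDerivAt (fun h : ℝ => (C t + h • S).det)
      (fderiv ℝ f (fun i j => C t i j) fun i j => S i j) 0 := by
    have hfd' : HasFDerivAt f (fderiv ℝ f (fun i j => C t i j))
        (fun i j => (C t + (0 : ℝ) • S) i j) := by
      rw [h0]; exact hfd.hasFDerivAt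
    exact hfd'.comp_hasDerivAt (0 : ℝ) hline
  rwa [h2.unique (hasDerivAt_det_line hdet)] at h1

/-- With `w = (C t)⁻¹x` and `v = (C τ)⁻¹x`, symmetry gives `⟨v, x⟩ = ⟨w, x⟩ - ⟨(C τ - C t)v, w⟩` for
`τ` near `t`. The factor `C τ - C t` vanishes at `τ = t`, so the derivative of `v` drops out. -/
lemma hasDerivAt_inner_inv {C : ℝ → Matrix (Fin d) (Fin d) ℝ} {S : Matrix (Fin d) (Fin d) ℝ}
    {t : ℝ} (hC : ∀ i j, HasDerivAt (fun t => C t i j) (S i j) t) (hdet : 0 < (C t).det)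
    (hsym : (C t).IsSymm) (x : Space d) :
    HasDerivAt (fun t => (inner ℝ (matVec (C t)⁻¹ x) x : ℝ))
      (-inner ℝ (matVec S (matVec (C t)⁻¹ x)) (matVec (C t)⁻¹ x)) t := by
  have hcurve : HasDerivAt (fun t => (fun i j => C t i j : Fin d → Fin d → ℝ))
      (fun i j => S i j) t :=
    hasDerivAt_pi.mpr fun i => hasDerivAt_pi.mpr fun j => hC i j
  have hw : ∀ j, DifferentiableAt ℝ (fun τ => matVec (C τ)⁻¹ x j) t := by
    intro j
    have h1 := (contDiffAt_inner_inv_of (m := fun i j => C t i j) hdet x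
      (EuclideanSpace.single j 1)).differentiableAt one_ne_zero
    have h2 := (h1.hasFDerivAt.comp_hasDerivAt t hcurve).differentiableAt
    refine h2.congr_of_eventuallyEq (Eventually.of_forall fun τ => ?_)
    simp only [Function.comp, inner_eq_sum]
    simp
    rfl
  set w := matVec (C t)⁻¹ x with hwdef
  have hdc : ContinuousAt (fun τ => (C τ).det) t := by
    have h1 : ContinuousAt (fun m : Fin d → Fin d → ℝ => (Matrix.of m).det) (fun i j => C t i j) :=
      contDiff_det_of.continuous.continuousAt
    exact h1.comp (f := fun τ => (fun i j => C τ i j : Fin d → Fin d → ℝ)) hcurve.continuousAt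
  have heq : (fun τ => (inner ℝ (matVec (C τ)⁻¹ x) x : ℝ)) =ᶠ[𝓝 t] fun τ =>
      inner ℝ w x - ∑ i, ∑ j, ((C τ i j - C t i j) * matVec (C τ)⁻¹ x j) * w i := by
    filter_upwards [hdc.eventually (lt_mem_nhds hdet)] with τ hτ
    have e1 : matVec (C t) w = x := by
      rw [hwdef, matVec_matVec,
        Matrix.mul_nonsing_inv _ (isUnit_iff_ne_zero.mpr hdet.ne'), matVec_one]
    have e2 : matVec (C τ) (matVec (C τ)⁻¹ x) = x := by
      rw [matVec_matVec, Matrix.mul_nonsing_inv _ (isUnit_iff_ne_zero.mpr hτ.ne'), matVec_one]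
    generalize matVec (C τ)⁻¹ x = v at *
    have e3 : (inner ℝ v x : ℝ) = inner ℝ (matVec (C t) v) w := by
      rw [inner_matVec_comm hsym, e1]
    have e4 : (inner ℝ w x : ℝ) = inner ℝ (matVec (C τ) v) w := by
      rw [e2, real_inner_comm]
    rw [e3, e4, inner_matVec, inner_matVec, ← Finset.sum_sub_distrib]
    refine Finset.sum_congr rfl fun i _ => ?_
    rw [← Finset.sum_sub_distrib]
    exact Finset.sum_congr rfl fun j _ => by ring
  refine HasDerivAt.congr_of_eventuallyEq ?_ heq
  have h3 : ∀ i j, HasDerivAt (fun τ => ((C τ i j - C t i j) * matVec (C τ)⁻¹ x j) * w i)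
      (S i j * w j * w i) t := by
    intro i j
    refine ((((hC i j).sub_const (C t i j)).fun_mul (hw j).hasDerivAt).mul_const (w i)).congr_deriv
      ?_
    rw [sub_self, zero_mul, add_zero]
  have h4 := HasDerivAt.fun_sum (u := Finset.univ) fun i _ =>
    HasDerivAt.fun_sum (u := Finset.univ) fun j _ => h3 i j
  have e5 : (inner ℝ (matVec S w) w : ℝ) = ∑ i, ∑ j, S i j * w j * w i := inner_matVec S w w
  rw [e5]
  exact h4.const_sub (inner ℝ w x)

/-- The derivative of the Gaussian along a differentiable curve of matrices. -/
lemma hasDerivAt_matGauss {C : ℝ → Matrix (Fin d) (Fin d) ℝ} {S : Matrix (Fin d) (Fin d) ℝ}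
    {t : ℝ} (hC : ∀ i j, HasDerivAt (fun t => C t i j) (S i j) t) (hdet : 0 < (C t).det)
    (hsym : (C t).IsSymm) (x : Space d) :
    HasDerivAt (fun t => matGauss (C t) x)
      ((-(1 / 2) * ((C t)⁻¹ * S).trace +
        1 / 4 * inner ℝ (matVec S (matVec (C t)⁻¹ x)) (matVec (C t)⁻¹ x)) * matGauss (C t) x) t := by
  have hp : 0 < (4 * Real.pi) ^ d * (C t).det := mul_pos (by positivity) hdet
  have hs := Real.sqrt_pos.mpr hp
  have h1 := (((hasDerivAt_det hC hdet.ne').const_mul ((4 * Real.pi) ^ d)).sqrt hp.ne').inv hs.ne'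
  have h2 := (((hasDerivAt_inner_inv hC hdet hsym x).const_mul (1 / 4 : ℝ)).neg).exp
  refine (h1.mul h2).congr_deriv ?_
  have hsq := Real.sq_sqrt hp.le
  simp only [matGauss, gaussNorm, Pi.neg_apply, Pi.inv_apply, hsq]
  have hd := hdet.ne'
  field_simp

end MatrixCalculus

/-! ### Absorbing polynomial weights into the Gaussian. -/

section MatrixBounds

variable {d : ℕ} {lam r : ℝ} {M : Matrix (Fin d) (Fin d) ℝ}

/-- Both `ρ` and `ρ³` are at most `1 + ρ⁴`, and `ρ⁴ = 128λ² · y²/2` with `y = ρ²/(8λ)`, a multiple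
of the quadratic term of `e^y`. The powers one and three are those produced by the gradient and the
error of the frozen kernel. -/
lemma one_add_pow_le_exp (hlam : 0 < lam) (ρ : ℝ) :
    1 + ρ + ρ ^ 3 ≤ 3 * (1 + 128 * lam ^ 2) * Real.exp (ρ ^ 2 / (8 * lam)) := by
  have h1 : 1 + ρ + ρ ^ 3 ≤ 3 * (1 + ρ ^ 4) := by
    have ha : ρ ≤ 1 + ρ ^ 4 := by nlinarith [sq_nonneg (ρ ^ 2 - 1 / 2), sq_nonneg (ρ - 1 / 2)]
    have hb : ρ ^ 3 ≤ 1 + ρ ^ 4 := by nlinarith [sq_nonneg (ρ ^ 2 - ρ / 2), sq_nonneg (ρ - 1), sq_nonneg ρ, ha]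
    nlinarith [sq_nonneg (ρ ^ 2)]
  have h2 := Real.quadratic_le_exp_of_nonneg (show 0 ≤ ρ ^ 2 / (8 * lam) by positivity)
  have h3 : 1 + ρ ^ 4 ≤ (1 + 128 * lam ^ 2) * Real.exp (ρ ^ 2 / (8 * lam)) := by
    have e : ρ ^ 4 = 128 * lam ^ 2 * ((ρ ^ 2 / (8 * lam)) ^ 2 / 2) := by field_simp; ring
    set y := ρ ^ 2 / (8 * lam)
    have hy : 0 ≤ y := by positivity
    have h4 : (1 + 128 * lam ^ 2) * (1 + y + y ^ 2 / 2) ≤ (1 + 128 * lam ^ 2) * Real.exp y := by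
      gcongr
    rw [e]
    nlinarith [mul_nonneg (sq_nonneg lam) hy, sq_nonneg lam, sq_nonneg y]
  linarith

/-- The constant comparing polynomially weighted anisotropic Gaussians with the isotropic one. -/
def gaussConst (d : ℕ) (lam : ℝ) : ℝ :=
  (4 * Real.pi / lam) ^ (-(d : ℝ) / 2) * (3 * (1 + 128 * lam ^ 2))

lemma gaussConst_pos (hlam : 0 < lam) : 0 < gaussConst d lam := by
  unfold gaussConst; positivity

/-- The anisotropic Gaussian decays at least like `exp(-ρ²/(4λ))`. Half of this exponent pays for
the polynomial; the remaining `1/(8λ)` is the rate of the final estimate. -/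
lemma weighted_matGauss_le (hlam : 0 < lam) (hr : 0 < r) (h : MatBetween (r / lam) (lam * r) M)
    (x : Space d) :
    (1 + ‖x‖ / √r + (‖x‖ / √r) ^ 3) * matGauss M x ≤
      gaussConst d lam * gaussianBound 1 (1 / (8 * lam)) x r := by
  have hα : 0 < r / lam := by positivity
  have hβ : 0 < lam * r := by positivity
  set ρ := ‖x‖ / √r with hρ
  have hρ0 : 0 ≤ ρ := by positivity
  have hρ2 : ρ ^ 2 = ‖x‖ ^ 2 / r := by rw [hρ, div_pow, Real.sq_sqrt hr.le]
  have h1 := one_add_pow_le_exp hlam ρ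
  have h2 := h.matGauss_le hα hβ x
  refine (mul_le_mul h1 h2 (matGauss_nonneg M x) (by positivity)).trans_eq ?_
  have e1 : (4 * Real.pi * (r / lam)) ^ (-(d : ℝ) / 2) =
      (4 * Real.pi / lam) ^ (-(d : ℝ) / 2) * r ^ (-(d : ℝ) / 2) := by
    rw [← Real.mul_rpow (by positivity) hr.le]; congr 1; ring
  have e2 : Real.exp (ρ ^ 2 / (8 * lam)) * Real.exp (-(1 / (4 * (lam * r)) * ‖x‖ ^ 2)) =
      Real.exp (-(1 / (8 * lam) * ‖x‖ ^ 2 / r)) := by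
    rw [← Real.exp_add, hρ2]
    congr 1
    field_simp
    ring
  rw [gaussianBound, gaussConst, e1, ← e2]
  ring

end MatrixBounds

/-! ### The coefficient field, its symmetric and antisymmetric parts, and the accumulated matrix. -/

section Coefficients

open Filter Topology Matrix

variable {d : ℕ}

/-- Elliptic fields with the regularity of the theorem at all real times. -/
structure IsRegularField (a : MatrixField d) (lam K : ℝ) : Prop where
  lower : ∀ t x ζ, lam⁻¹ * ‖ζ‖ ^ 2 ≤ inner ℝ (matVec (a x t) ζ) ζ
  upper : ∀ t x ζ, inner ℝ (matVec (a x t) ζ) ζ ≤ lam * ‖ζ‖ ^ 2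
  measurable : ∀ i j, Measurable fun p : Space d × ℝ => a p.1 p.2 i j
  contDiff : ∀ t i j, ContDiff ℝ 1 fun x => a x t i j
  norm_fderiv_le : ∀ t x i j, ‖fderiv ℝ (fun z => a z t i j) x‖ ≤ K

/-- The partial derivatives of the entries of the field. -/
def partialField (a : MatrixField d) (i j k : Fin d) (x : Space d) (t : ℝ) : ℝ :=
  fderiv ℝ (fun z => a z t i j) x (EuclideanSpace.single k 1)

/-- The symmetric part of the field. -/
def symPart (a : MatrixField d) (x : Space d) (t : ℝ) : Matrix (Fin d) (Fin d) ℝ :=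
  Matrix.of fun i j => (a x t i j + a x t j i) / 2

/-- The antisymmetric part of the field. -/
def skewPart (a : MatrixField d) (x : Space d) (t : ℝ) : Matrix (Fin d) (Fin d) ℝ :=
  Matrix.of fun i j => (a x t i j - a x t j i) / 2

/-- The row divergence of the antisymmetric part. -/
def skewDrift (a : MatrixField d) (x : Space d) (t : ℝ) : Space d :=
  WithLp.toLp 2 fun i => ∑ j, (partialField a i j j x t - partialField a j i j x t) / 2

/-- The column divergence of the field. -/
def fieldDiv (a : MatrixField d) (x : Space d) (t : ℝ) : Space d :=
  WithLp.toLp 2 fun j => ∑ i, partialField a i j i x t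

lemma norm_le_of_abs_le {v : Space d} {c : ℝ} (hv : ∀ i, |v i| ≤ c) : ‖v‖ ≤ d * c := by
  have h1 : v = ∑ i, v i • (EuclideanSpace.single i (1 : ℝ) : Space d) := by
    ext j
    simp [Finset.sum_apply, Pi.single_apply]
  rw [h1]
  refine (norm_sum_le _ _).trans ((Finset.sum_le_sum fun i _ => ?_).trans_eq
    (by simp : ∑ _i : Fin d, c = d * c))
  rw [norm_smul, norm_single_one, mul_one]
  exact hv i

lemma measurable_toSpace {α : Type*} [MeasurableSpace α] {f : α → Space d}
    (hf : ∀ i, Measurable fun a => f a i) : Measurable f :=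
  (WithLp.measurable_toLp 2 (Fin d → ℝ)).comp (measurable_pi_iff.mpr hf)

lemma measurable_coord {α : Type*} [MeasurableSpace α] {f : α → Space d} (hf : Measurable f)
    (i : Fin d) : Measurable fun a => f a i :=
  (measurable_pi_iff.mp ((WithLp.measurable_ofLp 2 (Fin d → ℝ)).comp hf)) i

lemma measurable_matVec {α : Type*} [MeasurableSpace α] {G : α → Matrix (Fin d) (Fin d) ℝ}
    {v : α → Space d} (hG : ∀ i j, Measurable fun a => G a i j) (hv : Measurable v) :
    Measurable fun a => matVec (G a) (v a) := by
  refine measurable_toSpace fun i => ?_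
  simp only [matVec_apply]
  exact Finset.measurable_fun_sum _ fun j _ => (hG i j).mul (measurable_coord hv j)

lemma norm_matVec_le {M : Matrix (Fin d) (Fin d) ℝ} {c : ℝ} (hM : ∀ i j, |M i j| ≤ c)
    (v : Space d) : ‖matVec M v‖ ≤ d * (d * c * ‖v‖) := by
  refine norm_le_of_abs_le fun i => ?_
  rw [matVec_apply]
  refine (Finset.abs_sum_le_sum_abs _ _).trans ((Finset.sum_le_sum fun j _ => ?_).trans_eq
    (by simp [mul_assoc] : ∑ _j : Fin d, c * ‖v‖ = d * c * ‖v‖))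
  rw [abs_mul]
  exact mul_le_mul (hM i j) (abs_apply_le_norm v j) (abs_nonneg _) ((abs_nonneg _).trans (hM i j))

variable {a : MatrixField d} {lam K : ℝ}

namespace IsRegularField

lemma abs_partialField_le (h : IsRegularField a lam K) (i j k : Fin d) (x : Space d) (t : ℝ) :
    |partialField a i j k x t| ≤ K := by
  have h1 := (fderiv ℝ (fun z => a z t i j) x).le_opNorm (EuclideanSpace.single k 1)
  rw [norm_single_one, mul_one] at h1
  exact h1.trans (h.norm_fderiv_le t x i j)

lemma hasFDerivAt (h : IsRegularField a lam K) (t : ℝ) (i j : Fin d) (x : Space d) :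
    HasFDerivAt (fun z => a z t i j) (fderiv ℝ (fun z => a z t i j) x) x :=
  ((h.contDiff t i j).differentiable one_ne_zero x).hasFDerivAt

/-- The partial derivative is the pointwise limit of difference quotients with step `1/(n+1)`, each
jointly measurable; no continuity in time is available. -/
lemma measurable_partialField (h : IsRegularField a lam K) (i j k : Fin d) :
    Measurable fun p : Space d × ℝ => partialField a i j k p.1 p.2 := by
  set e : Space d := EuclideanSpace.single k 1 with he
  refine measurable_of_tendsto_metrizable (f := fun (n : ℕ) (p : Space d × ℝ) =>
    ((n : ℝ) + 1) * (a (p.1 + ((n : ℝ) + 1)⁻¹ • e) p.2 i j - a p.1 p.2 i j)) (fun n => ?_) ?_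
  · have h1 : Measurable fun p : Space d × ℝ => a (p.1 + ((n : ℝ) + 1)⁻¹ • e) p.2 i j :=
      (h.measurable i j).comp (by fun_prop :
        Measurable fun p : Space d × ℝ => (p.1 + ((n : ℝ) + 1)⁻¹ • e, p.2))
    exact measurable_const.mul (h1.sub (h.measurable i j))
  · rw [tendsto_pi_nhds]
    intro p
    have h0 : Tendsto (fun n : ℕ => (n : ℝ) + 1) atTop atTop :=
      tendsto_atTop_add_const_right _ _ tendsto_natCast_atTop_atTop
    exact (h.hasFDerivAt p.2 i j p.1).lim e (c := fun n : ℕ => (n : ℝ) + 1)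
      (tendsto_norm_atTop_atTop.comp h0)

lemma abs_sub_le (h : IsRegularField a lam K) (x y : Space d) (t : ℝ) (i j : Fin d) :
    |a x t i j - a y t i j| ≤ K * ‖x - y‖ := by
  have := Convex.norm_image_sub_le_of_norm_fderiv_le (𝕜 := ℝ) (f := fun z => a z t i j)
    (s := univ) (C := K) (fun z _ => (h.contDiff t i j).differentiable one_ne_zero z)
    (fun z _ => h.norm_fderiv_le t z i j) convex_univ (mem_univ y) (mem_univ x)
  exact this

lemma abs_symPart_sub_le (h : IsRegularField a lam K) (x y : Space d) (t : ℝ) (i j : Fin d) :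
    |symPart a x t i j - symPart a y t i j| ≤ K * ‖x - y‖ := by
  have h1 := h.abs_sub_le x y t i j
  have h2 := h.abs_sub_le x y t j i
  rw [abs_le] at *
  simp only [symPart, Matrix.of_apply]
  constructor <;> linarith [h1.1, h1.2, h2.1, h2.2]

lemma measurable_symPart (h : IsRegularField a lam K) (i j : Fin d) :
    Measurable fun p : Space d × ℝ => symPart a p.1 p.2 i j :=
  ((h.measurable i j).add (h.measurable j i)).div_const 2

lemma continuous_symPart (h : IsRegularField a lam K) (i j : Fin d) (t : ℝ) :
    Continuous fun x => symPart a x t i j :=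
  ((h.contDiff t i j).continuous.add (h.contDiff t j i).continuous).div_const 2

lemma norm_skewDrift_le (h : IsRegularField a lam K) (x : Space d) (t : ℝ) :
    ‖skewDrift a x t‖ ≤ d * (d * K) := by
  refine norm_le_of_abs_le fun i => ?_
  refine (Finset.abs_sum_le_sum_abs _ _).trans ((Finset.sum_le_sum fun j _ => ?_).trans_eq
    (by simp : ∑ _j : Fin d, K = d * K))
  have h1 := h.abs_partialField_le i j j x t
  have h2 := h.abs_partialField_le j i j x t
  rw [abs_le] at *
  constructor <;> linarith [h1.1, h1.2, h2.1, h2.2]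

lemma norm_fieldDiv_le (h : IsRegularField a lam K) (x : Space d) (t : ℝ) :
    ‖fieldDiv a x t‖ ≤ d * (d * K) := by
  refine norm_le_of_abs_le fun j => ?_
  exact (Finset.abs_sum_le_sum_abs _ _).trans ((Finset.sum_le_sum fun i _ =>
    h.abs_partialField_le i j i x t).trans_eq (by simp : ∑ _i : Fin d, K = d * K))

lemma measurable_skewDrift (h : IsRegularField a lam K) :
    Measurable fun p : Space d × ℝ => skewDrift a p.1 p.2 :=
  measurable_toSpace fun i => by
    simpa only [skewDrift, Pi.sub_apply] using Finset.measurable_fun_sum Finset.univ fun j _ =>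
      ((h.measurable_partialField i j j).sub (h.measurable_partialField j i j)).div_const 2

lemma measurable_fieldDiv (h : IsRegularField a lam K) :
    Measurable fun p : Space d × ℝ => fieldDiv a p.1 p.2 :=
  measurable_toSpace fun j => by
    simpa only [fieldDiv] using Finset.measurable_fun_sum Finset.univ fun i _ =>
      h.measurable_partialField i j i

end IsRegularField

lemma symPart_isSymm (a : MatrixField d) (x : Space d) (t : ℝ) : (symPart a x t).IsSymm := by
  ext i j
  simp [symPart, add_comm]

lemma inner_matVec_symPart (a : MatrixField d) (x : Space d) (t : ℝ) (v : Space d) :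
    inner ℝ (matVec (symPart a x t) v) v = inner ℝ (matVec (a x t) v) v := by
  have h1 : ∑ i, ∑ j, a x t j i * v j * v i = ∑ i, ∑ j, a x t i j * v j * v i := by
    rw [Finset.sum_comm]
    exact Finset.sum_congr rfl fun i _ => Finset.sum_congr rfl fun j _ => by ring
  have h2 : ∑ i, ∑ j, symPart a x t i j * v j * v i =
      (∑ i, ∑ j, a x t i j * v j * v i) / 2 + (∑ i, ∑ j, a x t j i * v j * v i) / 2 := by
    simp only [symPart, Matrix.of_apply, Finset.sum_div, ← Finset.sum_add_distrib]
    exact Finset.sum_congr rfl fun i _ => Finset.sum_congr rfl fun j _ => by ring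
  rw [inner_matVec, inner_matVec, h2, h1]
  ring

lemma IsRegularField.matBetween (h : IsRegularField a lam K) (x : Space d) (t : ℝ) :
    MatBetween lam⁻¹ lam (symPart a x t) where
  symm := symPart_isSymm a x t
  lower v := by rw [inner_matVec_symPart]; exact h.lower t x v
  upper v := by rw [inner_matVec_symPart]; exact h.upper t x v

/-- Polarisation: `4⟨M e_j, e_i⟩` is the difference of the quadratic form at `e_j + e_i` and at `e_j
- e_i`. Symmetry is essential: the entries of `a` itself have no such bound, since ellipticity does
not see the antisymmetric part. -/
lemma MatBetween.abs_apply_le {α β : ℝ} {M : Matrix (Fin d) (Fin d) ℝ} (hα : 0 ≤ α)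
    (h : MatBetween α β M) (i j : Fin d) : |M i j| ≤ β := by
  set e : Fin d → Space d := fun i => EuclideanSpace.single i 1 with he
  have h1 : M i j = inner ℝ (matVec M (e j)) (e i) := by
    rw [inner_eq_sum]
    simp [he]
  have hp : inner ℝ (matVec M (e j + e i)) (e j + e i) - inner ℝ (matVec M (e j - e i)) (e j - e i)
      = 4 * inner ℝ (matVec M (e j)) (e i) := by
    simp only [map_add, map_sub, inner_add_left, inner_add_right, inner_sub_left, inner_sub_right]
    rw [inner_matVec_comm h.symm (e i) (e j), real_inner_comm (matVec M (e j)) (e i)]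
    ring
  have u1 := h.upper (e j + e i)
  have u2 := h.upper (e j - e i)
  have l1 := h.lower (e j + e i)
  have l2 := h.lower (e j - e i)
  have n1 := norm_add_sq_real (e j) (e i)
  have n2 := norm_sub_sq_real (e j) (e i)
  have ne : ∀ i, ‖e i‖ = 1 := norm_single_one
  rw [ne, ne] at n1 n2
  have hin : |inner ℝ (e j) (e i)| ≤ 1 := by
    have := abs_real_inner_le_norm (e j) (e i)
    rwa [ne, ne, mul_one] at this
  rw [abs_le] at hin
  have p1 : 0 ≤ α * ‖e j + e i‖ ^ 2 := by positivity
  have p2 : 0 ≤ α * ‖e j - e i‖ ^ 2 := by positivity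
  have hβ : 0 ≤ β := by
    have l := h.lower (e i)
    have u := h.upper (e i)
    rw [ne] at l u
    linarith
  rw [h1, abs_le]
  rw [n1] at u1
  rw [n2] at u2
  constructor <;> nlinarith

lemma IsRegularField.abs_symPart_le (hlam : 0 < lam) (h : IsRegularField a lam K) (x : Space d)
    (t : ℝ) (i j : Fin d) : |symPart a x t i j| ≤ lam :=
  (h.matBetween x t).abs_apply_le (inv_pos.mpr hlam).le i j

/-- The accumulated diffusion at the point `y` between the times `s` and `t`. -/
def cumMat (a : MatrixField d) (y : Space d) (s t : ℝ) : Matrix (Fin d) (Fin d) ℝ :=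
  Matrix.of fun i j => ∫ τ in s..t, symPart a y τ i j

lemma cumMat_isSymm (a : MatrixField d) (y : Space d) (s t : ℝ) : (cumMat a y s t).IsSymm := by
  ext i j
  simp only [cumMat, Matrix.transpose_apply, Matrix.of_apply]
  exact intervalIntegral.integral_congr fun τ _ => (symPart_isSymm a y τ).apply i j

namespace IsRegularField

lemma integrableOn_symPart (hlam : 0 < lam) (h : IsRegularField a lam K) (y : Space d)
    (i j : Fin d) (s t : ℝ) : IntervalIntegrable (fun τ => symPart a y τ i j) volume s t := by
  have hm : Measurable fun τ => symPart a y τ i j :=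
    (h.measurable_symPart i j).comp (by fun_prop : Measurable fun τ : ℝ => (y, τ))
  exact (intervalIntegrable_const (c := lam)).mono_fun hm.aestronglyMeasurable
    (Eventually.of_forall fun τ => by
      exact (h.abs_symPart_le hlam y τ i j).trans (le_abs_self lam))

lemma inner_cumMat (hlam : 0 < lam) (h : IsRegularField a lam K) (y : Space d) (s t : ℝ)
    (v : Space d) :
    IntervalIntegrable (fun τ => inner ℝ (matVec (symPart a y τ) v) v) volume s t ∧
    inner ℝ (matVec (cumMat a y s t) v) v =
      ∫ τ in s..t, inner ℝ (matVec (symPart a y τ) v) v := by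
  have hi : ∀ i j, IntervalIntegrable (fun τ => symPart a y τ i j * v j * v i) volume s t :=
    fun i j => ((h.integrableOn_symPart hlam y i j s t).mul_const _).mul_const _
  simp only [inner_matVec]
  have hj : ∀ i, IntervalIntegrable (fun τ => ∑ j, symPart a y τ i j * v j * v i) volume s t := by
    intro i
    simpa only [Finset.sum_fn] using IntervalIntegrable.sum Finset.univ fun j _ => hi i j
  refine ⟨by simpa only [Finset.sum_fn] using IntervalIntegrable.sum Finset.univ fun i _ => hj i, ?_⟩
  rw [intervalIntegral.integral_finsetSum fun i _ => hj i]
  refine Finset.sum_congr rfl fun i _ => ?_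
  rw [intervalIntegral.integral_finsetSum fun j _ => hi i j]
  refine Finset.sum_congr rfl fun j _ => ?_
  rw [intervalIntegral.integral_mul_const, intervalIntegral.integral_mul_const]
  rfl

lemma cumMat_between (hlam : 0 < lam) (h : IsRegularField a lam K) (y : Space d) {s t : ℝ}
    (hst : s < t) : MatBetween ((t - s) / lam) (lam * (t - s)) (cumMat a y s t) where
  symm := cumMat_isSymm a y s t
  lower v := by
    obtain ⟨hi, e⟩ := h.inner_cumMat hlam y s t v
    rw [e]
    have := intervalIntegral.integral_mono_on hst.le (intervalIntegrable_const (c := lam⁻¹ * ‖v‖ ^ 2))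
      hi fun τ _ => (h.matBetween y τ).lower v
    rw [intervalIntegral.integral_const, smul_eq_mul] at this
    refine le_trans (le_of_eq ?_) this
    field_simp
  upper v := by
    obtain ⟨hi, e⟩ := h.inner_cumMat hlam y s t v
    rw [e]
    have := intervalIntegral.integral_mono_on hst.le hi
      (intervalIntegrable_const (c := lam * ‖v‖ ^ 2)) fun τ _ => (h.matBetween y τ).upper v
    rw [intervalIntegral.integral_const, smul_eq_mul] at this
    refine this.trans (le_of_eq ?_)
    ring

lemma abs_cumMat_sub_le (hlam : 0 < lam) (h : IsRegularField a lam K) (y : Space d) (s t t' : ℝ)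
    (i j : Fin d) : |cumMat a y s t i j - cumMat a y s t' i j| ≤ lam * |t - t'| := by
  simp only [cumMat, Matrix.of_apply]
  rw [intervalIntegral.integral_interval_sub_left (h.integrableOn_symPart hlam y i j s t)
    (h.integrableOn_symPart hlam y i j s t')]
  have := intervalIntegral.norm_integral_le_of_norm_le_const (a := t') (b := t) (C := lam)
    (f := fun τ => symPart a y τ i j) fun τ _ => h.abs_symPart_le hlam y τ i j
  exact this

lemma abs_cumMat_sub_left_le (hlam : 0 < lam) (h : IsRegularField a lam K) (y : Space d)
    (s s' t : ℝ) (i j : Fin d) :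
    |cumMat a y s t i j - cumMat a y s' t i j| ≤ lam * |s - s'| := by
  have e : ∀ s, cumMat a y s t i j = -cumMat a y t s i j := fun s =>
    intervalIntegral.integral_symm _ _
  rw [e, e, neg_sub_neg, abs_sub_comm s]
  exact h.abs_cumMat_sub_le hlam y t s' s i j

/-- Lipschitz in both times with a constant independent of `y`, and continuous in `y` at fixed times
by dominated convergence; together these give joint continuity. -/
lemma continuous_cumMat (hlam : 0 < lam) (h : IsRegularField a lam K) (i j : Fin d) :
    Continuous fun w : Space d × ℝ × ℝ => cumMat a w.1 w.2.1 w.2.2 i j := by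
  refine continuous_iff_continuousAt.mpr fun w₀ => ?_
  have h1 : Tendsto (fun w : Space d × ℝ × ℝ => cumMat a w.1 w₀.2.1 w₀.2.2 i j) (𝓝 w₀)
      (𝓝 (cumMat a w₀.1 w₀.2.1 w₀.2.2 i j)) := by
    have h2 : Continuous fun y => cumMat a y w₀.2.1 w₀.2.2 i j := by
      refine intervalIntegral.continuous_of_dominated_interval (bound := fun _ => lam)
        (fun y => ?_) (fun y => Eventually.of_forall fun τ _ => h.abs_symPart_le hlam y τ i j)
        intervalIntegrable_const (Eventually.of_forall fun τ _ => h.continuous_symPart i j τ)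
      exact ((h.measurable_symPart i j).comp
        (by fun_prop : Measurable fun τ : ℝ => (y, τ))).aestronglyMeasurable
    exact h2.continuousAt.comp continuousAt_fst
  have h3 : Tendsto (fun w : Space d × ℝ × ℝ => cumMat a w.1 w.2.1 w.2.2 i j -
      cumMat a w.1 w₀.2.1 w₀.2.2 i j) (𝓝 w₀) (𝓝 0) := by
    have h4 : Tendsto (fun w : Space d × ℝ × ℝ => lam * |w.2.2 - w₀.2.2| + lam * |w.2.1 - w₀.2.1|)
        (𝓝 w₀) (𝓝 0) := by
      have : Continuous fun w : Space d × ℝ × ℝ =>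
        lam * |w.2.2 - w₀.2.2| + lam * |w.2.1 - w₀.2.1| := by fun_prop
      simpa using this.tendsto w₀
    refine squeeze_zero_norm (fun w => ?_) h4
    rw [Real.norm_eq_abs]
    have := _root_.abs_sub_le (cumMat a w.1 w.2.1 w.2.2 i j) (cumMat a w.1 w.2.1 w₀.2.2 i j)
      (cumMat a w.1 w₀.2.1 w₀.2.2 i j)
    linarith [h.abs_cumMat_sub_le hlam w.1 w.2.1 w.2.2 w₀.2.2 i j,
      h.abs_cumMat_sub_left_le hlam w.1 w.2.1 w₀.2.1 w₀.2.2 i j]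
  have := h1.add h3
  simpa [ContinuousAt] using this

/-- Lebesgue differentiation. The exceptional set of times depends on the pole only, so a single one
serves all `x`. -/
lemma ae_hasDerivAt_cumMat (hlam : 0 < lam) (h : IsRegularField a lam K) (y : Space d) (s : ℝ) :
    ∀ᵐ t, ∀ i j, HasDerivAt (fun τ => cumMat a y s τ i j) (symPart a y t i j) t := by
  refine ae_all_iff.mpr fun i => ae_all_iff.mpr fun j => ?_
  have hl : LocallyIntegrable (fun τ => symPart a y τ i j) := by
    intro t
    refine ⟨Icc (t - 1) (t + 1), Icc_mem_nhds (by linarith) (by linarith), ?_⟩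
    rw [integrableOn_Icc_iff_integrableOn_Ioc]
    exact (h.integrableOn_symPart hlam y i j (t - 1) (t + 1)).1
  filter_upwards [LocallyIntegrable.ae_hasDerivAt_integral hl] with t ht
  exact ht s

end IsRegularField

end Coefficients

/-! ### The Gaussian frozen at the pole is a parametrix. -/

section FrozenGaussian

open Filter Topology Matrix

variable {d : ℕ}

section Regularity

variable {α : Type*} [TopologicalSpace α] {C : α → Matrix (Fin d) (Fin d) ℝ} {v w : α → Space d}
  {z : α}

lemma continuousAt_toSpace {f : α → Space d} (hf : ∀ i, ContinuousAt (fun a => f a i) z) :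
    ContinuousAt f z :=
  ContinuousAt.comp (g := WithLp.toLp 2) (f := fun a i => f a i)
    (PiLp.continuous_toLp 2 (fun _ : Fin d => ℝ)).continuousAt (continuousAt_pi.mpr hf)

lemma continuousAt_matVec (hC : ∀ i j, ContinuousAt (fun a => C a i j) z) (hv : ContinuousAt v z) :
    ContinuousAt (fun a => matVec (C a) (v a)) z := by
  refine continuousAt_toSpace fun i => ?_
  simp only [matVec_apply]
  refine tendsto_finsetSum _ fun j _ => (hC i j).mul ?_
  exact (by fun_prop : Continuous fun x : Space d => x j).continuousAt.comp hv

lemma continuousAt_entries (hC : ∀ i j, ContinuousAt (fun a => C a i j) z) :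
    ContinuousAt (fun a => (fun i j => C a i j : Fin d → Fin d → ℝ)) z :=
  continuousAt_pi.mpr fun i => continuousAt_pi.mpr fun j => hC i j

lemma continuousAt_inv (hC : ∀ i j, ContinuousAt (fun a => C a i j) z) (hz : 0 < (C z).det)
    (i j : Fin d) : ContinuousAt (fun a => (C a)⁻¹ i j) z :=
  ContinuousAt.comp (g := fun m : Fin d → Fin d → ℝ => (Matrix.of m)⁻¹ i j)
    (contDiffAt_inv_of (m := fun i j => C z i j) hz i j).continuousAt (continuousAt_entries hC)

lemma continuousAt_det (hC : ∀ i j, ContinuousAt (fun a => C a i j) z) :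
    ContinuousAt (fun a => (C a).det) z :=
  ContinuousAt.comp (g := fun m : Fin d → Fin d → ℝ => (Matrix.of m).det)
    contDiff_det_of.continuous.continuousAt (continuousAt_entries hC)

lemma continuousAt_matGauss (hC : ∀ i j, ContinuousAt (fun a => C a i j) z) (hz : 0 < (C z).det)
    (hv : ContinuousAt v z) : ContinuousAt (fun a => matGauss (C a) (v a)) z := by
  have h1 : ContinuousAt (fun a => gaussNorm (C a)) z :=
    (continuousAt_const.mul (continuousAt_det hC)).sqrt
  have h2 : gaussNorm (C z) ≠ 0 := (Real.sqrt_pos.mpr (by positivity)).ne'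
  exact (h1.inv₀ h2).mul ((continuousAt_const.mul
    ((continuousAt_matVec (continuousAt_inv hC hz) hv).inner hv)).neg.rexp)

end Regularity

section Measurability

variable {α : Type*} [MeasurableSpace α] {C : α → Matrix (Fin d) (Fin d) ℝ} {v w : α → Space d}

lemma measurable_det (hC : ∀ i j, Measurable fun a => C a i j) : Measurable fun a => (C a).det :=
  (contDiff_det_of (d := d)).continuous.measurable.comp
    (measurable_pi_iff.mpr fun i => measurable_pi_iff.mpr fun j => hC i j)

lemma measurable_inv (hC : ∀ i j, Measurable fun a => C a i j) (i j : Fin d) :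
    Measurable fun a => (C a)⁻¹ i j := by
  have h1 : Measurable fun a => (C a).adjugate i j :=
    (contDiff_adjugate_of (d := d) i j).continuous.measurable.comp
      (measurable_pi_iff.mpr fun i => measurable_pi_iff.mpr fun j => hC i j)
  simp only [Matrix.inv_def, Matrix.smul_apply, Ring.inverse_eq_inv', smul_eq_mul]
  exact (measurable_det hC).inv.mul h1

lemma measurable_matGauss (hC : ∀ i j, Measurable fun a => C a i j) (hv : Measurable v) :
    Measurable fun a => matGauss (C a) (v a) :=
  ((measurable_const.mul (measurable_det hC)).sqrt.inv).mul ((measurable_const.mul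
    ((measurable_matVec (measurable_inv hC) hv).inner hv)).neg.exp)

end Measurability

variable {a : MatrixField d} {lam K : ℝ}

/-- The heat kernel of the field frozen at the pole. -/
def frozenGauss (a : MatrixField d) (p q : Space d × ℝ) : ℝ :=
  if q.2 < p.2 then matGauss (cumMat a q.1 q.2 p.2) (p.1 - q.1) else 0

/-- The logarithmic slope of the frozen kernel. -/
def frozenVec (a : MatrixField d) (p q : Space d × ℝ) : Space d :=
  matVec (cumMat a q.1 q.2 p.2)⁻¹ (p.1 - q.1)

/-- The spatial gradient of the frozen kernel. -/
def frozenGrad (a : MatrixField d) (p q : Space d × ℝ) : Space d :=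
  (-(1 / 2) * frozenGauss a p q) • frozenVec a p q

/-- The factor by which the frozen kernel fails to solve the equation. -/
def frozenFactor (a : MatrixField d) (p q : Space d × ℝ) : ℝ :=
  1 / 2 * ((cumMat a q.1 q.2 p.2)⁻¹ * (symPart a p.1 p.2 - symPart a q.1 p.2)).trace
    - 1 / 4 * inner ℝ (matVec (symPart a p.1 p.2 - symPart a q.1 p.2) (frozenVec a p q))
      (frozenVec a p q)
    + 1 / 2 * inner ℝ (fieldDiv a p.1 p.2) (frozenVec a p q)

/-- The error of the frozen kernel in the equation. -/
def frozenError (a : MatrixField d) (p q : Space d × ℝ) : ℝ :=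
  frozenFactor a p q * frozenGauss a p q

lemma frozenGauss_nonneg (a : MatrixField d) (p q : Space d × ℝ) : 0 ≤ frozenGauss a p q := by
  unfold frozenGauss
  split_ifs
  exacts [matGauss_nonneg _ _, le_rfl]

/-- The size of the frozen kernel relative to the comparison Gaussian. -/
def frozenConst (d : ℕ) (lam K : ℝ) : ℝ := gaussConst d lam * (1 + lam + d * (d * K) * lam * (1 + lam))

lemma norm_inner_matVec_le {M : Matrix (Fin d) (Fin d) ℝ} {c : ℝ} (hM : ∀ i j, |M i j| ≤ c)
    (v : Space d) : |inner ℝ (matVec M v) v| ≤ d * (d * c) * ‖v‖ ^ 2 := by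
  refine (abs_real_inner_le_norm _ _).trans ?_
  calc ‖matVec M v‖ * ‖v‖ ≤ (d * (d * c * ‖v‖)) * ‖v‖ :=
        mul_le_mul_of_nonneg_right (norm_matVec_le hM v) (norm_nonneg _)
    _ = _ := by ring

lemma abs_trace_mul_le {M N : Matrix (Fin d) (Fin d) ℝ} {c e : ℝ} (hM : ∀ i j, |M i j| ≤ c)
    (hN : ∀ i j, |N i j| ≤ e) : |(M * N).trace| ≤ d * (d * (c * e)) := by
  simp only [Matrix.trace, Matrix.diag_apply, Matrix.mul_apply]
  refine (Finset.abs_sum_le_sum_abs _ _).trans ((Finset.sum_le_sum fun i _ => ?_).trans_eq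
    (by simp : ∑ _j : Fin d, (d * (c * e) : ℝ) = d * (d * (c * e))))
  refine (Finset.abs_sum_le_sum_abs _ _).trans ((Finset.sum_le_sum fun j _ => ?_).trans_eq
    (by simp : ∑ _j : Fin d, c * e = d * (c * e)))
  rw [abs_mul]
  exact mul_le_mul (hM i j) (hN j i) (abs_nonneg _) ((abs_nonneg _).trans (hM i j))

namespace IsRegularField

variable {p q : Space d × ℝ}

lemma norm_frozenVec_le (hlam : 0 < lam) (h : IsRegularField a lam K) (hpq : q.2 < p.2) :
    ‖frozenVec a p q‖ ≤ lam * (‖p.1 - q.1‖ / √(p.2 - q.2)) * (√(p.2 - q.2))⁻¹ := by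
  have hr := sub_pos.mpr hpq
  have h1 := (h.cumMat_between hlam q.1 hpq).norm_inv_le (div_pos hr hlam) (p.1 - q.1)
  refine h1.trans (le_of_eq ?_)
  have h2 := Real.sq_sqrt hr.le
  have h3 := (Real.sqrt_pos.mpr hr).ne'
  generalize √(p.2 - q.2) = σ at *
  rw [← h2]
  field_simp

/-- With `r` the elapsed time and `ρ = |x-y|/√r`, the inverse accumulated matrix has size `1/r` and
`frozenVec` has size `ρ/√r`. The difference of symmetric parts has size `Kρ√r` and so gains half a
power of `r`: the trace term is of order `ρ/√r` and the quadratic term of order `ρ³/√r`. The last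
term is a bounded drift times `ρ/√r`. -/
lemma abs_frozenFactor_le (hlam : 0 < lam) (hK : 0 ≤ K) (h : IsRegularField a lam K)
    (hpq : q.2 < p.2) : |frozenFactor a p q| ≤ (√(p.2 - q.2))⁻¹ * (d * (d * K) * lam * (1 + lam)) *
      (1 + ‖p.1 - q.1‖ / √(p.2 - q.2) + (‖p.1 - q.1‖ / √(p.2 - q.2)) ^ 3) := by
  have hr := sub_pos.mpr hpq
  have hs := Real.sqrt_pos.mpr hr
  have hC := h.cumMat_between hlam q.1 hpq
  have hw := h.norm_frozenVec_le hlam hpq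
  have hb := h.norm_fieldDiv_le p.1 p.2
  set w := frozenVec a p q with hwd
  set σ := √(p.2 - q.2) with hσ
  have hrσ : p.2 - q.2 = σ ^ 2 := (Real.sq_sqrt hr.le).symm
  set ρ := ‖p.1 - q.1‖ / σ with hρ
  have hρ0 : 0 ≤ ρ := by positivity
  have hx : ‖p.1 - q.1‖ = ρ * σ := by rw [hρ]; field_simp
  have hΔ : ∀ i j, |(symPart a p.1 p.2 - symPart a q.1 p.2) i j| ≤ K * (ρ * σ) := fun i j => by
    rw [Matrix.sub_apply, ← hx]
    exact h.abs_symPart_sub_le _ _ _ i j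
  have hI : ∀ i j, |(cumMat a q.1 q.2 p.2)⁻¹ i j| ≤ lam / σ ^ 2 := fun i j => by
    have := hC.abs_inv_apply_le (div_pos hr hlam) i j
    rwa [one_div_div, hrσ] at this
  have e1 := abs_trace_mul_le hI hΔ
  have e2 := norm_inner_matVec_le hΔ w
  have e3 := abs_real_inner_le_norm (fieldDiv a p.1 p.2) w
  have hd : (0 : ℝ) ≤ d := d.cast_nonneg
  have f1 : d * (d * (lam / σ ^ 2 * (K * (ρ * σ)))) = σ⁻¹ * (d * (d * K) * lam) * ρ := by
    field_simp
  have f2 : d * (d * (K * (ρ * σ))) * ‖w‖ ^ 2 ≤ σ⁻¹ * (d * (d * K) * lam) * (lam * ρ ^ 3) := by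
    calc d * (d * (K * (ρ * σ))) * ‖w‖ ^ 2 ≤ d * (d * (K * (ρ * σ))) * (lam * ρ * σ⁻¹) ^ 2 := by
          gcongr
      _ = _ := by field_simp
  have f3 : ‖fieldDiv a p.1 p.2‖ * ‖w‖ ≤ σ⁻¹ * (d * (d * K) * lam) * ρ := by
    calc ‖fieldDiv a p.1 p.2‖ * ‖w‖ ≤ d * (d * K) * (lam * ρ * σ⁻¹) := by gcongr
      _ = _ := by ring
  have hA : 0 ≤ σ⁻¹ * (d * (d * K) * lam) := by positivity
  have t : |frozenFactor a p q| ≤ 1 / 2 * (σ⁻¹ * (d * (d * K) * lam) * ρ)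
      + 1 / 4 * (σ⁻¹ * (d * (d * K) * lam) * (lam * ρ ^ 3))
      + 1 / 2 * (σ⁻¹ * (d * (d * K) * lam) * ρ) := by
    rw [f1] at e1
    have e2' := e2.trans f2
    have e3' := e3.trans f3
    unfold frozenFactor
    rw [abs_le] at *
    constructor <;> linarith [e1.1, e1.2, e2'.1, e2'.2, e3'.1, e3'.2]
  refine t.trans ?_
  have : σ⁻¹ * (d * (d * K) * lam * (1 + lam)) * (1 + ρ + ρ ^ 3) =
      σ⁻¹ * (d * (d * K) * lam) * ((1 + lam) * (1 + ρ + ρ ^ 3)) := by ring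
  rw [this]
  have h4 : ρ + lam * ρ ^ 3 / 4 ≤ (1 + lam) * (1 + ρ + ρ ^ 3) := by
    have : 0 ≤ ρ ^ 3 := by positivity
    nlinarith [mul_nonneg hlam.le this, mul_nonneg hlam.le hρ0]
  have := mul_le_mul_of_nonneg_left h4 hA
  linarith

lemma weighted_frozenGauss_le (hlam : 0 < lam) (h : IsRegularField a lam K) (hpq : q.2 < p.2) :
    (1 + ‖p.1 - q.1‖ / √(p.2 - q.2) + (‖p.1 - q.1‖ / √(p.2 - q.2)) ^ 3) * frozenGauss a p q ≤
      gaussConst d lam * gaussKernel (1 / (8 * lam)) p q := by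
  rw [frozenGauss, if_pos hpq, gaussKernel_of_lt hpq]
  exact weighted_matGauss_le hlam (sub_pos.mpr hpq) (h.cumMat_between hlam q.1 hpq) _

lemma frozenGauss_bound (hlam : 0 < lam) (hK : 0 ≤ K) (h : IsRegularField a lam K) :
    KernelBound (1 / (8 * lam)) (fun _ => frozenConst d lam K) (frozenGauss a) := by
  intro p q
  have hg := gaussKernel_nonneg (b := 1 / (8 * lam)) p q
  by_cases hpq : q.2 < p.2
  · have h1 := h.weighted_frozenGauss_le hlam hpq
    have h0 := frozenGauss_nonneg a p q
    rw [Real.norm_of_nonneg h0]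
    have hG := gaussConst_pos (d := d) hlam
    have : 1 * frozenGauss a p q ≤ _ := (mul_le_mul_of_nonneg_right (by
      have : 0 ≤ ‖p.1 - q.1‖ / √(p.2 - q.2) := by positivity
      have : 0 ≤ (‖p.1 - q.1‖ / √(p.2 - q.2)) ^ 3 := by positivity
      linarith) h0).trans h1
    rw [one_mul] at this
    refine this.trans (mul_le_mul_of_nonneg_right ?_ hg)
    refine le_mul_of_one_le_right hG.le ?_
    have : 0 ≤ d * (d * K) * lam * (1 + lam) := by positivity
    linarith
  · simp [frozenGauss, hpq, gaussKernel]

/-- Turns the polynomial in `ρ` into the comparison Gaussian and `r^{-1/2}` into the time weight. It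
is used with `B = λ` for the gradient and `B = d²Kλ(1+λ)` for the error; `frozenConst` contains both
and an extra `1`, so one constant serves all three bounds. -/
lemma bound_of_le_weight (hlam : 0 < lam) (h : IsRegularField a lam K) (hpq : q.2 < p.2) {A B : ℝ}
    (hB0 : 0 ≤ B) (hB : B ≤ 1 + lam + d * (d * K) * lam * (1 + lam))
    (hA : A ≤ (√(p.2 - q.2))⁻¹ * B *
      (1 + ‖p.1 - q.1‖ / √(p.2 - q.2) + (‖p.1 - q.1‖ / √(p.2 - q.2)) ^ 3)) :
    A * frozenGauss a p q ≤ frozenConst d lam K * timeWeight 1 (p.2 - q.2) *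
      gaussKernel (1 / (8 * lam)) p q := by
  have hr := sub_pos.mpr hpq
  have hg := gaussKernel_nonneg (b := 1 / (8 * lam)) p q
  have h1 := h.weighted_frozenGauss_le hlam hpq
  have h0 := frozenGauss_nonneg a p q
  have hG := gaussConst_pos (d := d) hlam
  have ht : (√(p.2 - q.2))⁻¹ ≤ timeWeight 1 (p.2 - q.2) := by
    unfold timeWeight
    exact le_mul_of_one_le_right (by positivity) (Real.one_le_exp (by linarith))
  refine (mul_le_mul_of_nonneg_right hA h0).trans ?_
  rw [mul_assoc]
  calc _ ≤ (√(p.2 - q.2))⁻¹ * B * (gaussConst d lam * gaussKernel (1 / (8 * lam)) p q) :=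
        mul_le_mul_of_nonneg_left h1 (by positivity)
    _ = (√(p.2 - q.2))⁻¹ * (B * gaussConst d lam) * gaussKernel (1 / (8 * lam)) p q := by ring
    _ ≤ timeWeight 1 (p.2 - q.2) *
        ((1 + lam + d * (d * K) * lam * (1 + lam)) * gaussConst d lam) *
        gaussKernel (1 / (8 * lam)) p q := by gcongr; exact timeWeight_nonneg _ _
    _ = _ := by unfold frozenConst; ring

lemma frozenGrad_bound (hlam : 0 < lam) (hK : 0 ≤ K) (h : IsRegularField a lam K) :
    KernelBound (1 / (8 * lam)) (fun r => frozenConst d lam K * timeWeight 1 r)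
      (frozenGrad a) := by
  intro p q
  by_cases hpq : q.2 < p.2
  · have h0 := frozenGauss_nonneg a p q
    rw [frozenGrad, norm_smul, Real.norm_eq_abs, abs_mul, abs_of_nonneg h0, mul_right_comm]
    refine h.bound_of_le_weight hlam hpq (B := lam) hlam.le ?_ ?_
    · have : 0 ≤ d * (d * K) * lam * (1 + lam) := by positivity
      linarith
    · have hw := h.norm_frozenVec_le hlam hpq
      have hs : 0 ≤ (√(p.2 - q.2))⁻¹ := by positivity
      have hρ : 0 ≤ ‖p.1 - q.1‖ / √(p.2 - q.2) := by positivity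
      set ρ := ‖p.1 - q.1‖ / √(p.2 - q.2)
      set σ := (√(p.2 - q.2))⁻¹
      have e : |(-(1 / 2) : ℝ)| = 1 / 2 := by norm_num
      rw [e]
      have : 0 ≤ σ * lam := by positivity
      have h3 : 0 ≤ ρ ^ 3 := by positivity
      nlinarith [mul_nonneg this h3, mul_nonneg this hρ]
  · simp [frozenGrad, frozenGauss, hpq, gaussKernel]

lemma frozenError_bound (hlam : 0 < lam) (hK : 0 ≤ K) (h : IsRegularField a lam K) :
    KernelBound (1 / (8 * lam)) (fun r => frozenConst d lam K * timeWeight 1 r)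
      (frozenError a) := by
  intro p q
  by_cases hpq : q.2 < p.2
  · have h0 := frozenGauss_nonneg a p q
    rw [frozenError, norm_mul, Real.norm_eq_abs, Real.norm_of_nonneg h0]
    exact h.bound_of_le_weight hlam hpq (B := d * (d * K) * lam * (1 + lam)) (by positivity)
      (by linarith) (h.abs_frozenFactor_le hlam hK hpq)
  · simp [frozenError, frozenGauss, hpq, gaussKernel]

lemma measurable_cumMat_pair (hlam : 0 < lam) (h : IsRegularField a lam K) (i j : Fin d) :
    Measurable fun w : (Space d × ℝ) × (Space d × ℝ) => cumMat a w.2.1 w.2.2 w.1.2 i j :=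
  ((h.continuous_cumMat hlam i j).comp (by fun_prop :
    Continuous fun w : (Space d × ℝ) × (Space d × ℝ) => (w.2.1, w.2.2, w.1.2))).measurable

lemma measurable_frozenVec (hlam : 0 < lam) (h : IsRegularField a lam K) :
    Measurable (Function.uncurry (frozenVec a)) :=
  measurable_matVec (measurable_inv (h.measurable_cumMat_pair hlam)) (by fun_prop)

lemma measurable_frozenGauss (hlam : 0 < lam) (h : IsRegularField a lam K) :
    Measurable (Function.uncurry (frozenGauss a)) :=
  Measurable.ite (measurableSet_lt (by fun_prop) (by fun_prop))
    (measurable_matGauss (h.measurable_cumMat_pair hlam) (by fun_prop)) measurable_const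

lemma measurable_frozenGrad (hlam : 0 < lam) (h : IsRegularField a lam K) :
    Measurable (Function.uncurry (frozenGrad a)) :=
  (measurable_const.mul (h.measurable_frozenGauss hlam)).smul (h.measurable_frozenVec hlam)

lemma measurable_frozenError (hlam : 0 < lam) (h : IsRegularField a lam K) :
    Measurable (Function.uncurry (frozenError a)) := by
  have hΔ : ∀ i j, Measurable fun w : (Space d × ℝ) × (Space d × ℝ) =>
      (symPart a w.1.1 w.1.2 - symPart a w.2.1 w.1.2) i j := fun i j =>
    ((h.measurable_symPart i j).comp measurable_fst).sub ((h.measurable_symPart i j).comp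
      (by fun_prop : Measurable fun w : (Space d × ℝ) × (Space d × ℝ) => (w.2.1, w.1.2)))
  have hw := h.measurable_frozenVec hlam
  have h1 : Measurable fun w : (Space d × ℝ) × (Space d × ℝ) =>
      ((cumMat a w.2.1 w.2.2 w.1.2)⁻¹ * (symPart a w.1.1 w.1.2 - symPart a w.2.1 w.1.2)).trace := by
    simp only [Matrix.trace, Matrix.diag_apply, Matrix.mul_apply]
    exact Finset.measurable_fun_sum _ fun i _ => Finset.measurable_fun_sum _ fun j _ =>
      (measurable_inv (h.measurable_cumMat_pair hlam) i j).mul (hΔ j i)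
  exact (((measurable_const.mul h1).sub (measurable_const.mul
    ((measurable_matVec hΔ hw).inner hw))).add (measurable_const.mul
    ((h.measurable_fieldDiv.comp measurable_fst).inner hw))).mul (h.measurable_frozenGauss hlam)

lemma hasGradientAt_frozenGauss (hlam : 0 < lam) (h : IsRegularField a lam K) (hpq : q.2 < p.2) :
    HasGradientAt (fun x => frozenGauss a (x, p.2) q) (frozenGrad a p q) p.1 := by
  have h1 := hasGradientAt_matGauss (h.cumMat_between hlam q.1 hpq).inv_symm (p.1 - q.1)
  have h2 : HasGradientAt (fun x => matGauss (cumMat a q.1 q.2 p.2) (x - q.1))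
      ((-(1 / 2) * matGauss (cumMat a q.1 q.2 p.2) (p.1 - q.1)) •
        matVec (cumMat a q.1 q.2 p.2)⁻¹ (p.1 - q.1)) p.1 := by
    rw [hasGradientAt_iff_hasFDerivAt] at *
    exact h1.comp p.1 (hasFDerivAt_sub_const q.1)
  simpa [frozenGauss, frozenGrad, frozenVec, hpq] using h2

lemma continuousAt_frozenGauss (hlam : 0 < lam) (h : IsRegularField a lam K) (hpq : q.2 < p.2) :
    ContinuousAt (Function.uncurry (frozenGauss a)) (p, q) := by
  have h1 : ContinuousAt (fun w : (Space d × ℝ) × (Space d × ℝ) =>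
      matGauss (cumMat a w.2.1 w.2.2 w.1.2) (w.1.1 - w.2.1)) (p, q) := by
    refine continuousAt_matGauss (fun i j => ?_)
      ((h.cumMat_between hlam q.1 hpq).det_pos (div_pos (sub_pos.mpr hpq) hlam)) (by fun_prop)
    exact ((h.continuous_cumMat hlam i j).comp (by fun_prop :
      Continuous fun w : (Space d × ℝ) × (Space d × ℝ) => (w.2.1, w.2.2, w.1.2))).continuousAt
  refine h1.congr ?_
  have : {w : (Space d × ℝ) × (Space d × ℝ) | w.2.2 < w.1.2} ∈ 𝓝 (p, q) :=
    (isOpen_lt (by fun_prop) (by fun_prop)).mem_nhds hpq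
  filter_upwards [this] with w hw
  exact (if_pos hw).symm

lemma continuous_frozenError (hlam : 0 < lam) (h : IsRegularField a lam K) (p : Space d × ℝ)
    (s : ℝ) : Continuous fun y => frozenError a p (y, s) := by
  by_cases hs : s < p.2
  swap
  · have : (fun y => frozenError a p (y, s)) = fun _ => 0 := by
      ext y
      simp [frozenError, frozenGauss, hs]
    rw [this]
    exact continuous_const
  refine continuous_iff_continuousAt.mpr fun y => ?_
  have hC : ∀ i j, ContinuousAt (fun y => cumMat a y s p.2 i j) y := fun i j =>
    ((h.continuous_cumMat hlam i j).comp (by fun_prop :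
      Continuous fun y : Space d => (y, s, p.2))).continuousAt
  have hdet := (h.cumMat_between hlam y hs).det_pos (div_pos (sub_pos.mpr hs) hlam)
  have hv : ContinuousAt (fun y : Space d => p.1 - y) y := by fun_prop
  have hw : ContinuousAt (fun y => frozenVec a p (y, s)) y :=
    continuousAt_matVec (continuousAt_inv hC hdet) hv
  have hΔ : ∀ i j, ContinuousAt (fun y => (symPart a p.1 p.2 - symPart a y p.2) i j) y := fun i j =>
    continuousAt_const.sub (h.continuous_symPart i j p.2).continuousAt
  have h1 : ContinuousAt (fun y => ((cumMat a y s p.2)⁻¹ *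
      (symPart a p.1 p.2 - symPart a y p.2)).trace) y := by
    simp only [Matrix.trace, Matrix.diag_apply, Matrix.mul_apply]
    exact tendsto_finsetSum _ fun i _ => tendsto_finsetSum _ fun j _ =>
      (continuousAt_inv hC hdet i j).mul (hΔ j i)
  have hG : ContinuousAt (fun y => frozenGauss a p (y, s)) y := by
    simp only [frozenGauss, hs, if_true]
    exact continuousAt_matGauss hC hdet hv
  exact (((continuousAt_const.mul h1).sub (continuousAt_const.mul
    ((continuousAt_matVec hΔ hw).inner hw))).add (continuousAt_const.mul
    (continuousAt_const.inner hw))).mul hG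

theorem isParametrix (hlam : 0 < lam) (hK : 0 ≤ K) (h : IsRegularField a lam K) :
    IsParametrix (1 / (8 * lam)) (frozenConst d lam K) (frozenGauss a) (frozenGrad a)
      (frozenError a) where
  measurable_Z := h.measurable_frozenGauss hlam
  measurable_DZ := h.measurable_frozenGrad hlam
  measurable_R := h.measurable_frozenError hlam
  bound_Z := h.frozenGauss_bound hlam hK
  bound_DZ := h.frozenGrad_bound hlam hK
  bound_R := h.frozenError_bound hlam hK
  hasGradientAt _ _ hpq := h.hasGradientAt_frozenGauss hlam hpq
  continuousAt_Z _ _ hpq := h.continuousAt_frozenGauss hlam hpq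
  continuous_R := h.continuous_frozenError hlam

end IsRegularField

end FrozenGaussian

/-! ### The spatial equation for the frozen kernel in weak form. -/

section Divergence

open Filter Topology Matrix

variable {d : ℕ}

/-- The coordinate vectors. -/
abbrev basisVec (i : Fin d) : Space d := EuclideanSpace.single i 1

/-- Integration by parts against the constant function one. -/
lemma integral_fderiv_eq_zero {E : Type*} [NormedAddCommGroup E] [NormedSpace ℝ E]
    [FiniteDimensional ℝ E] [MeasurableSpace E] [BorelSpace E] {μ : Measure E} [μ.IsAddHaarMeasure]
    {g : E → ℝ} (hg : ContDiff ℝ 1 g) (hc : HasCompactSupport g) (v : E) :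
    Integrable (fun x => fderiv ℝ g x v) μ ∧ ∫ x, fderiv ℝ g x v ∂μ = 0 := by
  have h1 : Integrable (fun x => fderiv ℝ g x v) μ :=
    ((hg.continuous_fderiv one_ne_zero).clm_apply continuous_const).integrable_of_hasCompactSupport
      (hc.fderiv_apply ℝ v)
  refine ⟨h1, ?_⟩
  have h2 := integral_mul_fderiv_eq_neg_fderiv_mul_of_integrable (μ := μ)
    (f := fun _ => (1 : ℝ)) (g := g) (v := v) (by simp) (by simpa using h1)
    (by simpa using hg.continuous.integrable_of_hasCompactSupport hc)
    (fun x _ => differentiableAt_const _) (fun x _ => hg.differentiable one_ne_zero x)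
  simpa using h2

lemma fderiv_mul_mul_apply {E : Type*} [NormedAddCommGroup E] [NormedSpace ℝ E] {f g h : E → ℝ}
    {x : E} (hf : DifferentiableAt ℝ f x)
    (hg : DifferentiableAt ℝ g x) (hh : DifferentiableAt ℝ h x) (v : E) :
    fderiv ℝ (fun x => f x * g x * h x) x v = fderiv ℝ f x v * g x * h x +
      f x * fderiv ℝ g x v * h x + f x * g x * fderiv ℝ h x v := by
  have := ((hf.hasFDerivAt.mul hg.hasFDerivAt).mul hh.hasFDerivAt).fderiv
  have e : (fun x => f x * g x * h x) = f * g * h := rfl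
  rw [e, this]
  simp only [Pi.mul_apply, _root_.add_apply, _root_.smul_apply, smul_eq_mul]
  ring

lemma contDiff_fderiv_apply {f : Space d → ℝ} (hf : ContDiff ℝ 2 f) (v : Space d) :
    ContDiff ℝ 1 fun x => fderiv ℝ f x v :=
  (hf.fderiv_right (m := 1) (by norm_num)).clm_apply contDiff_const

lemma fderiv_fderiv_comm {f : Space d → ℝ} (hf : ContDiff ℝ 2 f) (x v w : Space d) :
    fderiv ℝ (fun x => fderiv ℝ f x v) x w = fderiv ℝ (fun x => fderiv ℝ f x w) x v := by
  have hd : DifferentiableAt ℝ (fderiv ℝ f) x :=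
    (hf.fderiv_right (m := 1) (by norm_num)).differentiable one_ne_zero x
  have h1 : ∀ v w, fderiv ℝ (fun x => fderiv ℝ f x v) x w = fderiv ℝ (fderiv ℝ f) x w v := by
    intro v w
    rw [fderiv_clm_apply hd (differentiableAt_const _)]
    simp
  rw [h1, h1]
  exact (hf.contDiffAt.isSymmSndFDerivAt (by simp)).eq w v

/-- Exchange the two indices. With `X` a Hessian this cancellation keeps the antisymmetric part of
the coefficients out of every second-order term. -/
lemma sum_skew_mul_eq_zero (A : Fin d → Fin d → ℝ) {X : Fin d → Fin d → ℝ}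
    (hX : ∀ i j, X i j = X j i) : ∑ i, ∑ j, (A i j - A j i) / 2 * X i j = 0 := by
  have h1 : ∑ i, ∑ j, A j i / 2 * X i j = ∑ i, ∑ j, A i j / 2 * X i j := by
    rw [Finset.sum_comm]
    exact Finset.sum_congr rfl fun i _ => Finset.sum_congr rfl fun j _ => by rw [hX]
  have h2 : ∑ i, ∑ j, (A i j - A j i) / 2 * X i j =
      ∑ i, ∑ j, A i j / 2 * X i j - ∑ i, ∑ j, A j i / 2 * X i j := by
    simp only [← Finset.sum_sub_distrib]
    exact Finset.sum_congr rfl fun i _ => Finset.sum_congr rfl fun j _ => by ring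
  rw [h2, h1, sub_self]

/-- Integration by parts for `div(A∇f)` against `ψ`, with the antisymmetric part of `A` moved into
a first-order term. -/
lemma integral_divergence_form {A : Space d → Matrix (Fin d) (Fin d) ℝ}
    (hA : ∀ i j, ContDiff ℝ 1 fun x => A x i j) {f ψ : Space d → ℝ} (hf : ContDiff ℝ 2 f)
    (hψ : ContDiff ℝ 2 ψ) (hc : HasCompactSupport ψ) :
    ∫ x, ∑ i, ∑ j, ((A x i j + A x j i) / 2 * fderiv ℝ f x (basisVec j) *
        fderiv ℝ ψ x (basisVec i) -
      f x * ((fderiv ℝ (fun z => A z i j) x (basisVec j) -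
        fderiv ℝ (fun z => A z j i) x (basisVec j)) / 2) * fderiv ℝ ψ x (basisVec i) +
      (fderiv ℝ (fun z => A z i j) x (basisVec i) * fderiv ℝ f x (basisVec j) +
        A x i j * fderiv ℝ (fun z => fderiv ℝ f z (basisVec j)) x (basisVec i)) * ψ x) = 0 := by
  have hdf := fun v => contDiff_fderiv_apply hf v
  have hdψ := fun v => contDiff_fderiv_apply hψ v
  have hψ1 : ContDiff ℝ 1 ψ := hψ.of_le (by norm_num)
  have hf1 : ContDiff ℝ 1 f := hf.of_le (by norm_num)
  have hB : ∀ i j, ContDiff ℝ 1 fun x => (A x i j - A x j i) / 2 := fun i j =>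
    ((hA i j).sub (hA j i)).div_const 2
  -- Two families of compactly supported products: the flux `A∇f` times `ψ`, and the antisymmetric
  -- part times `f∇ψ`. Subtracting the derivatives of the second from those of the first symmetrises
  -- the matrix in the pairing of `∇f` with `∇ψ`.
  have hg₁ : ∀ i j, ContDiff ℝ 1 fun x => A x i j * fderiv ℝ f x (basisVec j) * ψ x := fun i j =>
    ((hA i j).mul (hdf _)).mul hψ1
  have hg₂ : ∀ i j, ContDiff ℝ 1 fun x =>
      (A x i j - A x j i) / 2 * f x * fderiv ℝ ψ x (basisVec i) := fun i j =>
    ((hB i j).mul hf1).mul (hdψ _)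
  have k₁ := fun i j => integral_fderiv_eq_zero (μ := volume) (hg₁ i j) (hc.mul_left) (basisVec i)
  have k₂ := fun i j => integral_fderiv_eq_zero (μ := volume) (hg₂ i j) (hc.fderiv_apply ℝ _).mul_left (basisVec j)
  have key : ∀ x, ∑ i, ∑ j, ((A x i j + A x j i) / 2 * fderiv ℝ f x (basisVec j) *
        fderiv ℝ ψ x (basisVec i) -
      f x * ((fderiv ℝ (fun z => A z i j) x (basisVec j) -
        fderiv ℝ (fun z => A z j i) x (basisVec j)) / 2) * fderiv ℝ ψ x (basisVec i) +
      (fderiv ℝ (fun z => A z i j) x (basisVec i) * fderiv ℝ f x (basisVec j) +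
        A x i j * fderiv ℝ (fun z => fderiv ℝ f z (basisVec j)) x (basisVec i)) * ψ x) =
      ∑ i, ∑ j, (fderiv ℝ (fun x => A x i j * fderiv ℝ f x (basisVec j) * ψ x) x (basisVec i) -
        fderiv ℝ (fun x => (A x i j - A x j i) / 2 * f x * fderiv ℝ ψ x (basisVec i)) x
          (basisVec j)) := by
    intro x
    -- Differentiating the second family produces the Hessian of `ψ` contracted with the
    -- antisymmetric part, which is zero.
    have h0 := sum_skew_mul_eq_zero (fun i j => A x i j)
      (X := fun i j => f x * fderiv ℝ (fun z => fderiv ℝ ψ z (basisVec i)) x (basisVec j))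
      (fun i j => by rw [fderiv_fderiv_comm hψ])
    rw [← sub_zero (∑ i, ∑ j, _), ← h0]
    simp only [← Finset.sum_sub_distrib]
    refine Finset.sum_congr rfl fun i _ => Finset.sum_congr rfl fun j _ => ?_
    have d1 := fun i j => (hA i j).differentiable one_ne_zero x
    rw [fderiv_mul_mul_apply (d1 i j) ((hdf _).differentiable one_ne_zero x)
        (hψ1.differentiable one_ne_zero x),
      fderiv_mul_mul_apply ((hB i j).differentiable one_ne_zero x)
        (hf1.differentiable one_ne_zero x) ((hdψ _).differentiable one_ne_zero x)]
    have e : fderiv ℝ (fun z => (A z i j - A z j i) / 2) x (basisVec j) =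
        (fderiv ℝ (fun z => A z i j) x (basisVec j) -
          fderiv ℝ (fun z => A z j i) x (basisVec j)) / 2 := by
      have := (((d1 i j).hasFDerivAt.fun_sub (d1 j i).hasFDerivAt).mul_const (2⁻¹ : ℝ)).fderiv
      simp only [div_eq_mul_inv]
      rw [this]
      simp [mul_comm]
    rw [e]
    ring
  simp only [key]
  have ki : ∀ i j, Integrable fun x =>
      fderiv ℝ (fun x => A x i j * fderiv ℝ f x (basisVec j) * ψ x) x (basisVec i) -
        fderiv ℝ (fun x => (A x i j - A x j i) / 2 * f x * fderiv ℝ ψ x (basisVec i)) x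
          (basisVec j) := fun i j => (k₁ i j).1.sub (k₂ i j).1
  rw [integral_finsetSum _ fun i _ => integrable_finsetSum _ fun j _ => ki i j]
  refine Finset.sum_eq_zero fun i _ => ?_
  rw [integral_finsetSum _ fun j _ => ki i j]
  refine Finset.sum_eq_zero fun j _ => ?_
  have := integral_sub (k₁ i j).1 (k₂ i j).1
  rw [(k₁ i j).2, (k₂ i j).2, sub_zero] at this
  exact this

lemma contDiff_matGauss (M : Matrix (Fin d) (Fin d) ℝ) {n : WithTop ℕ∞} :
    ContDiff ℝ n (matGauss M) :=
  contDiff_const.mul ((contDiff_const.mul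
    ((LinearMap.toContinuousLinearMap (matVec M⁻¹)).contDiff.inner ℝ contDiff_id)).neg.exp)

lemma fderiv_basisVec_of_hasGradientAt {f : Space d → ℝ} {G x : Space d} (h : HasGradientAt f G x)
    (i : Fin d) : fderiv ℝ f x (basisVec i) = G i := by
  rw [h.hasFDerivAt.fderiv, InnerProductSpace.toDual_apply_apply, inner_eq_sum]
  simp

lemma gradient_apply {f : Space d → ℝ} {x : Space d} (h : DifferentiableAt ℝ f x) (i : Fin d) :
    gradient f x i = fderiv ℝ f x (basisVec i) :=
  (fderiv_basisVec_of_hasGradientAt h.hasGradientAt i).symm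

lemma hasFDerivAt_matVec_sub_apply (M : Matrix (Fin d) (Fin d) ℝ) (y x : Space d) (j : Fin d) :
    DifferentiableAt ℝ (fun x => matVec M (x - y) j) x ∧ ∀ i,
      fderiv ℝ (fun x => matVec M (x - y) j) x (basisVec i) = M j i := by
  set L : Space d →L[ℝ] ℝ := (EuclideanSpace.proj j).comp (LinearMap.toContinuousLinearMap (matVec M))
  have h1 : HasFDerivAt (fun x => matVec M (x - y) j) L x :=
    L.hasFDerivAt.comp x (hasFDerivAt_sub_const y)
  refine ⟨h1.differentiableAt, fun i => ?_⟩
  rw [h1.fderiv]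
  exact matVec_single M j i

variable {a : MatrixField d} {lam K : ℝ} {p q : Space d × ℝ}

/-- The factor `div(a∇Z)/Z` for the frozen kernel `Z`. -/
def frozenOperator (a : MatrixField d) (p q : Space d × ℝ) : ℝ :=
  -(1 / 2) * inner ℝ (fieldDiv a p.1 p.2) (frozenVec a p q)
    - 1 / 2 * ((cumMat a q.1 q.2 p.2)⁻¹ * symPart a p.1 p.2).trace
    + 1 / 4 * inner ℝ (matVec (symPart a p.1 p.2) (frozenVec a p q)) (frozenVec a p q)

/-- The equation for the frozen kernel in space, tested with `ψ`. -/
lemma IsRegularField.integral_frozen_slice (hlam : 0 < lam) (h : IsRegularField a lam K) {t : ℝ}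
    (hpq : q.2 < t) {ψ : Space d → ℝ} (hψ : ContDiff ℝ 2 ψ) (hc : HasCompactSupport ψ) :
    ∫ x, (inner ℝ (frozenGrad a (x, t) q) (matVec (symPart a x t) (gradient ψ x)) -
      frozenGauss a (x, t) q * inner ℝ (skewDrift a x t) (gradient ψ x) +
      frozenOperator a (x, t) q * frozenGauss a (x, t) q * ψ x) = 0 := by
  set C := cumMat a q.1 q.2 t with hC
  have hb := h.cumMat_between hlam q.1 hpq
  set f : Space d → ℝ := fun x => matGauss C (x - q.1) with hf
  have hfc : ContDiff ℝ 2 f := (contDiff_matGauss C).comp (contDiff_id.sub contDiff_const)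
  rw [← integral_divergence_form (A := fun x => a x t) (h.contDiff t) hfc hψ hc]
  congr 1
  ext x
  set w := matVec C⁻¹ (x - q.1) with hw
  have hz : frozenGauss a (x, t) q = f x := if_pos hpq
  have hv : frozenVec a (x, t) q = w := rfl
  have hg : ∀ x, HasGradientAt f ((-(1 / 2) * f x) • matVec C⁻¹ (x - q.1)) x := fun x => by
    have := h.hasGradientAt_frozenGauss (p := (x, t)) hlam hpq
    simpa only [frozenGrad, frozenGauss, frozenVec, hpq, if_true] using this
  have hfj : ∀ x j, fderiv ℝ f x (basisVec j) = -(1 / 2) * f x * matVec C⁻¹ (x - q.1) j :=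
    fun x j => by rw [fderiv_basisVec_of_hasGradientAt (hg x)]; rfl
  have hfij : ∀ i j, fderiv ℝ (fun z => fderiv ℝ f z (basisVec j)) x (basisVec i) =
      (1 / 4 * (w i * w j) - 1 / 2 * C⁻¹ j i) * f x := fun i j => by
    simp only [hfj]
    rw [fderiv_mul_mul_apply (differentiableAt_const _) (hg x).differentiableAt
      (hasFDerivAt_matVec_sub_apply _ _ _ _).1, hfj, (hasFDerivAt_matVec_sub_apply _ _ _ _).2]
    simp only [fderiv_fun_const, Pi.zero_apply, _root_.zero_apply]
    ring
  have hψd := (hψ.differentiable (by norm_num)) x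
  have e1 : inner ℝ (frozenGrad a (x, t) q) (matVec (symPart a x t) (gradient ψ x)) =
      ∑ i, ∑ j, (a x t i j + a x t j i) / 2 * fderiv ℝ f x (basisVec j) *
        fderiv ℝ ψ x (basisVec i) := by
    rw [← inner_matVec_comm (symPart_isSymm a x t), inner_matVec]
    refine Finset.sum_congr rfl fun i _ => Finset.sum_congr rfl fun j _ => ?_
    rw [gradient_apply hψd, hfj, frozenGrad, hz, hv]
    rfl
  have e2 : f x * inner ℝ (skewDrift a x t) (gradient ψ x) =
      ∑ i, ∑ j, f x * ((fderiv ℝ (fun z => a z t i j) x (basisVec j) -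
        fderiv ℝ (fun z => a z t j i) x (basisVec j)) / 2) * fderiv ℝ ψ x (basisVec i) := by
    rw [inner_eq_sum, Finset.mul_sum]
    refine Finset.sum_congr rfl fun i _ => ?_
    rw [gradient_apply hψd, ← mul_assoc, ← Finset.sum_mul, ← Finset.mul_sum]
    rfl
  have e3 : frozenOperator a (x, t) q * f x * ψ x =
      ∑ i, ∑ j, (fderiv ℝ (fun z => a z t i j) x (basisVec i) * fderiv ℝ f x (basisVec j) +
        a x t i j * fderiv ℝ (fun z => fderiv ℝ f z (basisVec j)) x (basisVec i)) * ψ x := by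
    have s1 : inner ℝ (fieldDiv a x t) w =
        ∑ i, ∑ j, fderiv ℝ (fun z => a z t i j) x (basisVec i) * w j := by
      rw [inner_eq_sum, Finset.sum_comm]
      refine Finset.sum_congr rfl fun i _ => ?_
      rw [← Finset.sum_mul]
      rfl
    have s2 : (C⁻¹ * symPart a x t).trace = ∑ i, ∑ j, symPart a x t i j * C⁻¹ j i := by
      rw [Matrix.trace_mul_comm]
      simp only [Matrix.trace, Matrix.diag_apply, Matrix.mul_apply]
    -- The Hessian of the frozen Gaussian is `f` times `w ⊗ w / 4 - C⁻¹ / 2`, a symmetric matrix, so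
    -- only the symmetric part of `a` enters here.
    have s3 := sum_skew_mul_eq_zero (fun i j => a x t i j)
      (X := fun i j => 1 / 4 * (w i * w j) - 1 / 2 * C⁻¹ j i)
      (fun i j => by rw [hb.inv_symm.apply i j]; ring)
    simp only [frozenOperator, hv, s1, inner_matVec]
    rw [show (cumMat a q.1 q.2 (x, t).2)⁻¹ = C⁻¹ from rfl, s2, mul_assoc, ← sub_zero (_ * (f x * ψ x)),
      ← zero_mul (-(f x * ψ x)), ← s3]
    simp only [Finset.mul_sum, Finset.sum_mul, ← Finset.sum_sub_distrib, ← Finset.sum_add_distrib]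
    refine Finset.sum_congr rfl fun i _ => Finset.sum_congr rfl fun j _ => ?_
    rw [hfij, hfj]
    simp only [symPart, Matrix.of_apply]
    ring
  rw [hz, e1, e2, e3]
  simp only [← Finset.sum_sub_distrib, ← Finset.sum_add_distrib]

end Divergence

/-! ### Derivatives of space-time test functions. -/

section TestFunctions

open Filter Topology

variable {d : ℕ}

/-- The spatial gradient of a function of space and time. -/
def spaceGrad (η : Space d × ℝ → ℝ) (p : Space d × ℝ) : Space d :=
  gradient (fun z => η (z, p.2)) p.1

/-- The time derivative of a function of space and time. -/
def timeDeriv (η : Space d × ℝ → ℝ) (p : Space d × ℝ) : ℝ := deriv (fun τ => η (p.1, τ)) p.2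

variable {η : Space d × ℝ → ℝ}

lemma hasGradientAt_slice (hη : ContDiff ℝ ∞ η) (p : Space d × ℝ) :
    HasGradientAt (fun z => η (z, p.2)) (spaceGrad η p) p.1 := by
  have h : ContDiff ℝ ∞ fun z => η (z, p.2) := hη.comp (contDiff_id.prodMk contDiff_const)
  exact (h.differentiable (by simp) p.1).hasGradientAt

lemma hasDerivAt_slice (hη : ContDiff ℝ ∞ η) (p : Space d × ℝ) :
    HasDerivAt (fun τ => η (p.1, τ)) (timeDeriv η p) p.2 := by
  have h : ContDiff ℝ ∞ fun τ => η (p.1, τ) := hη.comp (contDiff_const.prodMk contDiff_id)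
  exact (h.differentiable (by simp) p.2).hasDerivAt

lemma spaceGrad_apply (hη : ContDiff ℝ ∞ η) (p : Space d × ℝ) (i : Fin d) :
    spaceGrad η p i = fderiv ℝ η p (basisVec i, 0) := by
  rw [← fderiv_basisVec_of_hasGradientAt (hasGradientAt_slice hη p) i]
  have h1 : HasFDerivAt (fun z => η (z, p.2)) ((fderiv ℝ η p).comp
      (ContinuousLinearMap.inl ℝ (Space d) ℝ)) p.1 :=
    (hη.differentiable (by simp) p).hasFDerivAt.comp p.1 (hasFDerivAt_prodMk_left p.1 p.2)
  rw [h1.fderiv]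
  rfl

lemma timeDeriv_eq (hη : ContDiff ℝ ∞ η) (p : Space d × ℝ) :
    timeDeriv η p = fderiv ℝ η p (0, 1) := by
  have h1 : HasFDerivAt (fun τ => η (p.1, τ)) ((fderiv ℝ η p).comp
      (ContinuousLinearMap.inr ℝ (Space d) ℝ)) p.2 :=
    (hη.differentiable (by simp) p).hasFDerivAt.comp p.2 (hasFDerivAt_prodMk_right p.1 p.2)
  rw [(hasDerivAt_slice hη p).unique h1.hasDerivAt]
  rfl

lemma contDiff_fderiv_const (hη : ContDiff ℝ ∞ η) (v : Space d × ℝ) :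
    ContDiff ℝ ∞ fun p => fderiv ℝ η p v :=
  (hη.fderiv_right (m := ∞) (by simp)).clm_apply contDiff_const

lemma continuous_spaceGrad (hη : ContDiff ℝ ∞ η) : Continuous (spaceGrad η) := by
  refine continuous_iff_continuousAt.mpr fun p => continuousAt_toSpace fun i => ?_
  simp only [spaceGrad_apply hη]
  exact (contDiff_fderiv_const hη _).continuous.continuousAt

lemma continuous_timeDeriv (hη : ContDiff ℝ ∞ η) : Continuous (timeDeriv η) := by
  rw [show timeDeriv η = _ from funext (timeDeriv_eq hη)]
  exact (contDiff_fderiv_const hη _).continuous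

lemma hasCompactSupport_spaceGrad (hη : ContDiff ℝ ∞ η) (hc : HasCompactSupport η) :
    HasCompactSupport (spaceGrad η) := by
  refine (hc.fderiv ℝ).mono fun p hp => ?_
  contrapose! hp
  rw [Function.notMem_support] at *
  ext i
  rw [spaceGrad_apply hη, hp]
  rfl

lemma hasCompactSupport_timeDeriv (hη : ContDiff ℝ ∞ η) (hc : HasCompactSupport η) :
    HasCompactSupport (timeDeriv η) := by
  rw [show timeDeriv η = _ from funext (timeDeriv_eq hη)]
  exact hc.fderiv_apply ℝ _

lemma hasCompactSupport_slice (hc : HasCompactSupport η) (t : ℝ) :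
    HasCompactSupport fun x => η (x, t) := by
  refine HasCompactSupport.intro (hc.isCompact.image continuous_fst) fun x hx => ?_
  exact image_eq_zero_of_notMem_tsupport fun h => hx ⟨(x, t), h, rfl⟩

lemma exists_bound_testFunction (hη : ContDiff ℝ ∞ η) (hc : HasCompactSupport η) :
    ∃ B, 0 ≤ B ∧ ∀ p, |η p| ≤ B ∧ |timeDeriv η p| ≤ B ∧ ‖spaceGrad η p‖ ≤ B := by
  obtain ⟨B₁, h₁⟩ := hc.exists_bound_of_continuous hη.continuous
  obtain ⟨B₂, h₂⟩ :=
    (hasCompactSupport_timeDeriv hη hc).exists_bound_of_continuous (continuous_timeDeriv hη)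
  obtain ⟨B₃, h₃⟩ :=
    (hasCompactSupport_spaceGrad hη hc).exists_bound_of_continuous (continuous_spaceGrad hη)
  have n₁ := (norm_nonneg _).trans (h₁ 0)
  have n₂ := (norm_nonneg _).trans (h₂ 0)
  have n₃ := (norm_nonneg _).trans (h₃ 0)
  exact ⟨B₁ + B₂ + B₃, by positivity, fun p => ⟨(h₁ p).trans (by linarith),
    (h₂ p).trans (by linarith), (h₃ p).trans (by linarith)⟩⟩

lemma IsTestFunction.eq_zero {J : Set ℝ} (h : IsTestFunction J η) {p : Space d × ℝ}
    (hp : p.2 ∉ J) : η p = 0 ∧ timeDeriv η p = 0 ∧ spaceGrad η p = 0 := by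
  have hn : p ∉ tsupport η := fun hm => hp (h.support_subset hm).2
  have h0 : fderiv ℝ η p = 0 := image_eq_zero_of_notMem_tsupport fun hm =>
    hn (tsupport_fderiv_subset ℝ hm)
  refine ⟨image_eq_zero_of_notMem_tsupport hn, ?_, ?_⟩
  · rw [timeDeriv_eq h.smooth, h0]; rfl
  · ext i
    rw [spaceGrad_apply h.smooth, h0]
    rfl

end TestFunctions

/-! ### Differentiating the frozen kernel in time. -/

section TimeDerivative

open Filter Topology Matrix

variable {d : ℕ} {a : MatrixField d} {lam K : ℝ} {p q : Space d × ℝ}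

/-- The logarithmic time derivative of the frozen kernel. -/
def frozenRate (a : MatrixField d) (p q : Space d × ℝ) : ℝ :=
  -(1 / 2) * ((cumMat a q.1 q.2 p.2)⁻¹ * symPart a q.1 p.2).trace
    + 1 / 4 * inner ℝ (matVec (symPart a q.1 p.2) (frozenVec a p q)) (frozenVec a p q)

/-- Relative to the kernel, the error is the time derivative minus `div(a∇·)`: the time derivative
sees the coefficients at the pole, the spatial operator those at `p`. -/
lemma frozenFactor_add_frozenOperator (a : MatrixField d) (p q : Space d × ℝ) :
    frozenFactor a p q + frozenOperator a p q = frozenRate a p q := by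
  unfold frozenFactor frozenOperator frozenRate
  rw [Matrix.mul_sub, Matrix.trace_sub, matVec, map_sub, LinearMap.sub_apply, inner_sub_left]
  ring

namespace IsRegularField

/-- Without a difference of coefficients the order is only `1/r`, which is not integrable at the
pole. This is why the identities below are first written at distance `ε` in time from it. -/
lemma abs_frozenRate_le (hlam : 0 < lam) (h : IsRegularField a lam K) (hpq : q.2 < p.2) :
    |frozenRate a p q| ≤ (p.2 - q.2)⁻¹ * (d * d * lam ^ 2 * (1 + lam)) *
      (1 + ‖p.1 - q.1‖ / √(p.2 - q.2) + (‖p.1 - q.1‖ / √(p.2 - q.2)) ^ 3) := by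
  have hr := sub_pos.mpr hpq
  have hC := h.cumMat_between hlam q.1 hpq
  have hw := h.norm_frozenVec_le hlam hpq
  have hσ2 := Real.sq_sqrt hr.le
  have hs := Real.sqrt_pos.mpr hr
  set w := frozenVec a p q with hwd
  set ρ := ‖p.1 - q.1‖ / √(p.2 - q.2) with hρ
  have hρ0 : 0 ≤ ρ := by positivity
  have hS := h.abs_symPart_le hlam q.1 p.2
  have hI : ∀ i j, |(cumMat a q.1 q.2 p.2)⁻¹ i j| ≤ lam / (p.2 - q.2) := fun i j => by
    have := hC.abs_inv_apply_le (div_pos hr hlam) i j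
    rwa [one_div_div] at this
  have e1 := abs_trace_mul_le hI hS
  have e2 := norm_inner_matVec_le hS w
  have f2 : d * (d * lam) * ‖w‖ ^ 2 ≤ (p.2 - q.2)⁻¹ * (d * d * lam ^ 2) * (lam * ρ ^ 2) := by
    calc d * (d * lam) * ‖w‖ ^ 2 ≤ d * (d * lam) * (lam * ρ * (√(p.2 - q.2))⁻¹) ^ 2 := by gcongr
      _ = _ := by rw [mul_pow, inv_pow, hσ2]; ring
  have f1 : d * (d * (lam / (p.2 - q.2) * lam)) = (p.2 - q.2)⁻¹ * (d * d * lam ^ 2) := by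
    field_simp
  have t : |frozenRate a p q| ≤ 1 / 2 * ((p.2 - q.2)⁻¹ * (d * d * lam ^ 2))
      + 1 / 4 * ((p.2 - q.2)⁻¹ * (d * d * lam ^ 2) * (lam * ρ ^ 2)) := by
    rw [f1] at e1
    have e2' := e2.trans f2
    unfold frozenRate
    rw [abs_le] at *
    constructor <;> linarith [e1.1, e1.2, e2'.1, e2'.2]
  refine t.trans ?_
  have hA : 0 ≤ (p.2 - q.2)⁻¹ * (d * d * lam ^ 2) := by positivity
  have h3 : 0 ≤ ρ ^ 3 := by positivity
  have h2 : ρ ^ 2 ≤ 1 + ρ + ρ ^ 3 := by nlinarith [mul_nonneg hρ0 (sq_nonneg (ρ - 1))]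
  have h4 : 1 / 2 + lam * ρ ^ 2 / 4 ≤ (1 + lam) * (1 + ρ + ρ ^ 3) := by
    nlinarith [mul_le_mul_of_nonneg_left h2 hlam.le, mul_nonneg hlam.le h3, mul_nonneg hlam.le hρ0,
      mul_nonneg hlam.le (sq_nonneg ρ)]
  have := mul_le_mul_of_nonneg_left h4 hA
  linarith

lemma measurable_frozenRate (hlam : 0 < lam) (h : IsRegularField a lam K) :
    Measurable (Function.uncurry (frozenRate a)) := by
  have hS : ∀ i j, Measurable fun w : (Space d × ℝ) × (Space d × ℝ) =>
      symPart a w.2.1 w.1.2 i j := fun i j => (h.measurable_symPart i j).comp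
      (by fun_prop : Measurable fun w : (Space d × ℝ) × (Space d × ℝ) => (w.2.1, w.1.2))
  have hw := h.measurable_frozenVec hlam
  have h1 : Measurable fun w : (Space d × ℝ) × (Space d × ℝ) =>
      ((cumMat a w.2.1 w.2.2 w.1.2)⁻¹ * symPart a w.2.1 w.1.2).trace := by
    simp only [Matrix.trace, Matrix.diag_apply, Matrix.mul_apply]
    exact Finset.measurable_fun_sum _ fun i _ => Finset.measurable_fun_sum _ fun j _ =>
      (measurable_inv (h.measurable_cumMat_pair hlam) i j).mul (hS j i)
  exact (measurable_const.mul h1).add (measurable_const.mul ((measurable_matVec hS hw).inner hw))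

lemma lipschitzWith_cumMat (hlam : 0 < lam) (h : IsRegularField a lam K) (y : Space d) (s : ℝ) :
    LipschitzWith lam.toNNReal (fun t => (fun i j => cumMat a y s t i j : Fin d → Fin d → ℝ)) := by
  refine LipschitzWith.of_dist_le_mul fun t t' => ?_
  rw [Real.coe_toNNReal _ hlam.le]
  have h0 : 0 ≤ lam * dist t t' := mul_nonneg hlam.le dist_nonneg
  exact (dist_pi_le_iff h0).mpr fun i => (dist_pi_le_iff h0).mpr fun j => by
    rw [Real.dist_eq, Real.dist_eq]
    exact h.abs_cumMat_sub_le hlam y s t t' i j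

/-- Integration by parts in time for the frozen kernel. -/
lemma integral_frozenRate_mul (hlam : 0 < lam) (h : IsRegularField a lam K) {g : ℝ → ℝ}
    (hg : ContDiff ℝ 1 g) (x : Space d) {t₁ T : ℝ} (h₁ : q.2 < t₁) (hT : t₁ ≤ T) :
    ∫ t in t₁..T, (frozenRate a (x, t) q * frozenGauss a (x, t) q * g t +
      frozenGauss a (x, t) q * deriv g t) =
    frozenGauss a (x, T) q * g T - frozenGauss a (x, t₁) q * g t₁ := by
  set f : ℝ → ℝ := fun t => matGauss (cumMat a q.1 q.2 t) (x - q.1) with hf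
  have hfz : ∀ t, q.2 < t → frozenGauss a (x, t) q = f t := fun t ht => if_pos ht
  -- The accumulated matrix is differentiable only for almost every time. Away from the pole the
  -- Gaussian is Lipschitz along it, hence absolutely continuous, so integration by parts in time
  -- remains valid.
  obtain ⟨L, hL⟩ := exists_lipschitzOn_matGauss (h.lipschitzWith_cumMat hlam q.1 q.2)
    (t₁ := t₁) (t₂ := T) (fun t ht => (h.cumMat_between hlam q.1 (h₁.trans_le ht.1)).det_pos
      (div_pos (sub_pos.mpr (h₁.trans_le ht.1)) hlam)) (x - q.1)
  have hfa : AbsolutelyContinuousOnInterval f t₁ T := by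
    refine LipschitzOnWith.absolutelyContinuousOnInterval (K := L) ?_
    rwa [uIcc_of_le hT]
  have hga : AbsolutelyContinuousOnInterval g t₁ T :=
    hg.contDiffOn.absolutelyContinuousOnInterval
  rw [hfz T (h₁.trans_le hT), hfz t₁ h₁, ← hfa.integral_deriv_mul_eq_sub hga]
  refine intervalIntegral.integral_congr_ae ?_
  filter_upwards [h.ae_hasDerivAt_cumMat hlam q.1 q.2] with t ht hmem
  rw [uIoc_of_le hT] at hmem
  have hqt : q.2 < t := h₁.trans hmem.1
  have hC := h.cumMat_between hlam q.1 hqt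
  have hd := hasDerivAt_matGauss (C := fun t => cumMat a q.1 q.2 t) ht
    (hC.det_pos (div_pos (sub_pos.mpr hqt) hlam)) hC.symm (x - q.1)
  rw [hfz t hqt, hd.deriv]
  rfl

end IsRegularField

end TimeDerivative

/-! ### The adjoint identity for the frozen kernel. -/

section AdjointIdentity

open Filter Topology Matrix

variable {d : ℕ} {a : MatrixField d} {lam K T : ℝ} {η : Space d × ℝ → ℝ}

/-- The flux paired with the gradient of a solution when testing with `η`. -/
def testFlux (a : MatrixField d) (η : Space d × ℝ → ℝ) (p : Space d × ℝ) : Space d :=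
  matVec (symPart a p.1 p.2) (spaceGrad η p)

/-- The source paired with a solution when testing with `η`. -/
def testSource (a : MatrixField d) (η : Space d × ℝ → ℝ) (p : Space d × ℝ) : ℝ :=
  -inner ℝ (skewDrift a p.1 p.2) (spaceGrad η p) - timeDeriv η p

/-- The remainder kernel of the time integration by parts, cut off near the pole. -/
def rateKernel (a : MatrixField d) (η : Space d × ℝ → ℝ) (ε : ℝ) (p q : Space d × ℝ) : ℝ :=
  if q.2 + ε < p.2 then
    frozenRate a p q * frozenGauss a p q * η p + frozenGauss a p q * timeDeriv η p else 0

namespace IsRegularField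

lemma measurable_testFlux (h : IsRegularField a lam K) (hη : ContDiff ℝ ∞ η) :
    Measurable (testFlux a η) :=
  measurable_matVec h.measurable_symPart (continuous_spaceGrad hη).measurable

lemma measurable_testSource (h : IsRegularField a lam K) (hη : ContDiff ℝ ∞ η) :
    Measurable (testSource a η) :=
  ((h.measurable_skewDrift.inner (continuous_spaceGrad hη).measurable).neg).sub
    (continuous_timeDeriv hη).measurable

lemma exists_bound_test (hlam : 0 < lam) (hK : 0 ≤ K) (h : IsRegularField a lam K)
    (hη : ContDiff ℝ ∞ η) (hc : HasCompactSupport η) :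
    ∃ B, 0 ≤ B ∧ ∀ p, |η p| ≤ B ∧ |testSource a η p| ≤ B ∧ ‖testFlux a η p‖ ≤ B := by
  obtain ⟨B, hB0, hB⟩ := exists_bound_testFunction hη hc
  have hd : (0 : ℝ) ≤ d := d.cast_nonneg
  refine ⟨B + (d * (d * K) * B + B) + d * (d * lam * B), by positivity, fun p => ?_⟩
  obtain ⟨h1, h2, h3⟩ := hB p
  have f1 : ‖testFlux a η p‖ ≤ d * (d * lam * B) :=
    (norm_matVec_le (h.abs_symPart_le hlam p.1 p.2) _).trans (by gcongr)
  have f2 : |testSource a η p| ≤ d * (d * K) * B + B := by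
    refine (abs_sub _ _).trans (add_le_add ?_ h2)
    rw [abs_neg]
    exact (abs_real_inner_le_norm _ _).trans (mul_le_mul (h.norm_skewDrift_le p.1 p.2) h3
      (norm_nonneg _) (by positivity))
  have n1 : 0 ≤ d * (d * lam * B) := by positivity
  have n2 : 0 ≤ d * (d * K) * B + B := by positivity
  exact ⟨by linarith, by linarith, by linarith⟩

/-- On the region left by the cutoff the factor `1/r` is at most `1/ε`. -/
lemma integrable_rateKernel (hlam : 0 < lam) (hK : 0 ≤ K) (h : IsRegularField a lam K)
    (hη : IsTestFunction (Iio T) η) {ε : ℝ} (hε : 0 < ε) (q : Space d × ℝ) :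
    Integrable fun p => rateKernel a η ε p q := by
  obtain ⟨B, hB0, hB⟩ := exists_bound_testFunction hη.smooth hη.compact
  set A : ℝ := (d * d * lam ^ 2 * (1 + lam)) with hA
  have hA0 : 0 ≤ A := by positivity
  have hG := gaussConst_pos (d := d) hlam
  have hF : 0 ≤ frozenConst d lam K := by unfold frozenConst; positivity
  refine integrable_kernel_left (b := 1 / (8 * lam)) (T := T)
    (w := fun _ => ε⁻¹ * A * gaussConst d lam * B + frozenConst d lam K * B) (by positivity)
    measurable_const ?_ ?_ ?_ q (by simp)
  · refine Measurable.ite (measurableSet_lt (by fun_prop) (by fun_prop)) ?_ measurable_const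
    have hz := h.measurable_frozenGauss hlam
    exact (((h.measurable_frozenRate hlam).mul hz).mul
      (hη.smooth.continuous.measurable.comp measurable_fst)).add
      (hz.mul ((continuous_timeDeriv hη.smooth).measurable.comp measurable_fst))
  · intro p q
    have hg := gaussKernel_nonneg (b := 1 / (8 * lam)) p q
    unfold rateKernel
    split_ifs with hpq
    · have hlt : q.2 < p.2 := by linarith
      have hr := sub_pos.mpr hlt
      have h0 := frozenGauss_nonneg a p q
      have b1 := h.abs_frozenRate_le hlam hlt
      have b2 := h.weighted_frozenGauss_le hlam hlt
      have b3 := h.frozenGauss_bound hlam hK p q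
      rw [Real.norm_of_nonneg h0] at b3
      have hinv : (p.2 - q.2)⁻¹ ≤ ε⁻¹ := inv_anti₀ hε (by linarith)
      have c1 : |frozenRate a p q| * frozenGauss a p q ≤
          ε⁻¹ * A * gaussConst d lam * gaussKernel (1 / (8 * lam)) p q := by
        refine (mul_le_mul_of_nonneg_right b1 h0).trans ?_
        rw [mul_assoc]
        calc _ ≤ (p.2 - q.2)⁻¹ * A * (gaussConst d lam * gaussKernel (1 / (8 * lam)) p q) :=
              mul_le_mul_of_nonneg_left b2 (by positivity)
          _ ≤ ε⁻¹ * A * (gaussConst d lam * gaussKernel (1 / (8 * lam)) p q) := by gcongr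
          _ = _ := by ring
      refine (norm_add_le _ _).trans ?_
      rw [norm_mul, norm_mul, norm_mul, Real.norm_of_nonneg h0, Real.norm_eq_abs, Real.norm_eq_abs,
        Real.norm_eq_abs, add_mul]
      refine add_le_add ?_ ?_
      · calc _ ≤ (ε⁻¹ * A * gaussConst d lam * gaussKernel (1 / (8 * lam)) p q) * B :=
              mul_le_mul c1 (hB p).1 (abs_nonneg _) (by positivity)
          _ = _ := by ring
      · calc _ ≤ (frozenConst d lam K * gaussKernel (1 / (8 * lam)) p q) * B :=
              mul_le_mul b3 (hB p).2.1 (abs_nonneg _) (by positivity)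
          _ = _ := by ring
    · rw [norm_zero]; positivity
  · intro p r hp
    obtain ⟨h1, h2, -⟩ := hη.eq_zero (p := p) (not_lt.mpr hp)
    simp [rateKernel, h1, h2]

/-- Integrate in time first, at fixed `x`. The endpoint `T` contributes nothing because `η` vanishes
there, so only the boundary term at `q.2 + ε` survives. -/
lemma integral_rateKernel (hlam : 0 < lam) (hK : 0 ≤ K) (h : IsRegularField a lam K)
    (hη : IsTestFunction (Iio T) η) {ε : ℝ} (hε : 0 < ε) (q : Space d × ℝ) (hT : q.2 + ε ≤ T) :
    ∫ p, rateKernel a η ε p q =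
      -∫ x, frozenGauss a (x, q.2 + ε) q * η (x, q.2 + ε) := by
  have hi := h.integrable_rateKernel hlam hK hη hε q
  rw [Measure.volume_eq_prod] at hi ⊢
  rw [integral_prod _ hi, ← integral_neg]
  congr 1
  ext x
  have hg : ContDiff ℝ 1 fun t => η (x, t) :=
    (hη.smooth.comp (contDiff_const.prodMk contDiff_id)).of_le (by norm_cast)
  have h1 := h.integral_frozenRate_mul (q := q) hlam hg x (t₁ := q.2 + ε) (by linarith) hT
  have hTz : η (x, T) = 0 := (hη.eq_zero (p := (x, T)) (by simp)).1
  rw [hTz, mul_zero, zero_sub] at h1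
  rw [← h1, intervalIntegral.integral_of_le hT]
  rw [← integral_indicator measurableSet_Ioc]
  congr 1
  ext t
  by_cases ht : q.2 + ε < t
  · by_cases htT : t ≤ T
    · have hm : t ∈ Ioc (q.2 + ε) T := ⟨ht, htT⟩
      rw [indicator_of_mem hm]
      exact if_pos ht
    · rw [indicator_of_notMem fun hm => htT hm.2]
      obtain ⟨h1, h2, -⟩ := hη.eq_zero (p := (x, t)) (not_lt.mpr (not_le.mp htT).le)
      simp [rateKernel, h1, h2]
  · rw [indicator_of_notMem fun hm => ht hm.1]
    exact if_neg ht

/-- The integrand of the pole identity. -/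
lemma integrable_frozen_pairing (hlam : 0 < lam) (hK : 0 ≤ K) (h : IsRegularField a lam K)
    (hη : IsTestFunction (Iio T) η) (q : Space d × ℝ) :
    (Integrable fun p => pairing (frozenGauss a) (frozenGrad a) (testFlux a η) (testSource a η) p q)
    ∧ Integrable fun p => frozenError a p q * η p := by
  obtain ⟨B, hB0, hB⟩ := h.exists_bound_test hlam hK hη.smooth hη.compact
  have hP := h.isParametrix hlam hK
  have hF : 0 ≤ frozenConst d lam K := by
    have := gaussConst_pos (d := d) hlam
    unfold frozenConst; positivity
  have hwi : ∀ c : ℝ, IntegrableOn (fun t => c * timeWeight 1 (t - q.2)) (Ioo q.2 T) := fun c =>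
    (integrableOn_timeWeight 1 q.2 T).const_mul c
  have hb : (0 : ℝ) < 1 / (8 * lam) := by positivity
  have hZ : KernelBound (1 / (8 * lam)) (fun r => frozenConst d lam K * timeWeight 1 r)
      (frozenGauss a) := by
    intro p q
    refine (hP.bound_Z p q).trans ?_
    by_cases hpq : q.2 < p.2
    · exact mul_le_mul_of_nonneg_right (le_mul_of_one_le_right hF
        (one_le_timeWeight (sub_pos.mpr hpq))) (gaussKernel_nonneg _ _)
    · simp [gaussKernel, hpq]
  constructor
  · have hk := KernelBound.pairing hZ hP.bound_DZ (fun p => (hB p).2)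
    refine integrable_kernel_left (T := T) hb
      (((measurable_timeWeight 1).const_mul _).const_mul _)
      (measurable_pairing hP.measurable_Z hP.measurable_DZ (h.measurable_testFlux hη.smooth)
        (h.measurable_testSource hη.smooth)) hk ?_ q ?_
    · intro p r hp
      obtain ⟨-, h2, h3⟩ := hη.eq_zero (p := p) (not_lt.mpr hp)
      simp [pairing, testFlux, testSource, h2, h3]
    · exact ((integrableOn_timeWeight 1 q.2 T).const_mul _).const_mul _
  · refine integrable_kernel_left (T := T) (P := fun p q => frozenError a p q * η p) hb
      (w := fun r => frozenConst d lam K * B * timeWeight 1 r)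
      ((measurable_timeWeight 1).const_mul _)
      (hP.measurable_R.mul (hη.smooth.continuous.measurable.comp measurable_fst)) ?_ ?_ q (hwi _)
    · intro p q
      rw [norm_mul]
      refine (mul_le_mul (hP.bound_R p q) (hB p).1 (abs_nonneg _)
        ((norm_nonneg _).trans (hP.bound_R p q))).trans_eq ?_
      ring
    · exact fun p r hp => by simp [(hη.eq_zero (p := p) (not_lt.mpr hp)).1]

/-- By `frozenFactor_add_frozenOperator`, adding the rate kernel to the integrand produces on each
slice the integrand of the spatial identity, whose integral is zero. What remains is the endpoint
term of the integration by parts in time. -/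
lemma integral_frozen_pairing_cutoff (hlam : 0 < lam) (hK : 0 ≤ K) (h : IsRegularField a lam K)
    (hη : IsTestFunction (Iio T) η) {ε : ℝ} (hε : 0 < ε) (q : Space d × ℝ) (hT : q.2 + ε ≤ T) :
    ∫ p in {p : Space d × ℝ | q.2 + ε < p.2},
      (pairing (frozenGauss a) (frozenGrad a) (testFlux a η) (testSource a η) p q -
        frozenError a p q * η p) =
      ∫ x, frozenGauss a (x, q.2 + ε) q * η (x, q.2 + ε) := by
  obtain ⟨i1, i2⟩ := h.integrable_frozen_pairing hlam hK hη q
  have i3 := h.integrable_rateKernel hlam hK hη hε q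
  have hm : MeasurableSet {p : Space d × ℝ | q.2 + ε < p.2} :=
    measurableSet_lt measurable_const measurable_snd
  have i4 : Integrable ({p : Space d × ℝ | q.2 + ε < p.2}.indicator fun p =>
      pairing (frozenGauss a) (frozenGrad a) (testFlux a η) (testSource a η) p q -
        frozenError a p q * η p) := (i1.sub i2).indicator hm
  have key : ∫ p, ({p : Space d × ℝ | q.2 + ε < p.2}.indicator (fun p =>
      pairing (frozenGauss a) (frozenGrad a) (testFlux a η) (testSource a η) p q -
        frozenError a p q * η p) p + rateKernel a η ε p q) = 0 := by
    have i5 := i4.add i3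
    rw [Measure.volume_eq_prod] at i5 ⊢
    refine (integral_prod_symm _ i5).trans ?_
    refine integral_eq_zero_of_ae (Eventually.of_forall fun t => ?_)
    by_cases ht : q.2 + ε < t
    · have hψ : ContDiff ℝ 2 fun x => η (x, t) :=
        (hη.smooth.comp (contDiff_id.prodMk contDiff_const)).of_le (by norm_cast)
      have := h.integral_frozen_slice (q := q) hlam (by linarith) hψ
        (hasCompactSupport_slice hη.compact t)
      refine Eq.trans (integral_congr_ae (Eventually.of_forall fun x => ?_)) this
      have e : (x, t) ∈ {p : Space d × ℝ | q.2 + ε < p.2} := ht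
      simp only [Pi.add_apply]
      rw [indicator_of_mem e, rateKernel, if_pos ht, ← frozenFactor_add_frozenOperator]
      simp only [pairing, testFlux, testSource, frozenError, spaceGrad]
      ring
    · simp only [Pi.add_apply, Pi.zero_apply]
      refine integral_eq_zero_of_ae (Eventually.of_forall fun x => ?_)
      simp only [Pi.zero_apply]
      have e : (x, t) ∉ {p : Space d × ℝ | q.2 + ε < p.2} := ht
      rw [indicator_of_notMem e, rateKernel, if_neg ht]
      simp
  rw [integral_add i4 i3, integral_indicator hm, h.integral_rateKernel hlam hK hη hε q hT] at key
  linarith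

/-- The frozen kernel converges to the Dirac mass. -/
lemma tendsto_integral_frozenGauss (hlam : 0 < lam) (h : IsRegularField a lam K)
    (hη : ContDiff ℝ ∞ η) (hc : HasCompactSupport η) (q : Space d × ℝ) :
    Tendsto (fun ε => ∫ x, frozenGauss a (x, q.2 + ε) q * η (x, q.2 + ε)) (𝓝[>] 0) (𝓝 (η q)) := by
  obtain ⟨L, hL⟩ := hη.lipschitzWith_of_hasCompactSupport hc (by simp)
  set A := gaussConst d lam * gaussMass d (1 / (8 * lam)) with hA
  have hb : (0 : ℝ) < 1 / (8 * lam) := by positivity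
  have hlim : Tendsto (fun ε : ℝ => L * (√ε * A + ε)) (𝓝[>] 0) (𝓝 0) := by
    have : Continuous fun ε : ℝ => L * (√ε * A + ε) := by fun_prop
    have := this.tendsto 0
    simp only [Real.sqrt_zero, zero_mul, add_zero, mul_zero] at this
    exact this.mono_left nhdsWithin_le_nhds
  rw [tendsto_iff_norm_sub_tendsto_zero]
  refine squeeze_zero' (Eventually.of_forall fun _ => norm_nonneg _) ?_ hlim
  filter_upwards [self_mem_nhdsWithin] with ε hε
  replace hε : 0 < ε := hε
  have hlt : q.2 < q.2 + ε := by linarith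
  have hC := h.cumMat_between hlam q.1 hlt
  have hr : q.2 + ε - q.2 = ε := by ring
  obtain ⟨i1, e1⟩ := hC.integral_matGauss (div_pos (by linarith) hlam) (mul_pos hlam (by linarith))
  have i2 : Integrable fun x => frozenGauss a (x, q.2 + ε) q := by
    simp only [frozenGauss, hlt, if_true]
    exact i1.comp_sub_right q.1
  have e2 : ∫ x, frozenGauss a (x, q.2 + ε) q = 1 := by
    simp only [frozenGauss, hlt, if_true]
    rw [← e1, integral_sub_right_eq_self (matGauss _) q.1]
  have hη0 : Continuous fun x => η (x, q.2 + ε) :=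
    hη.continuous.comp (continuous_id.prodMk continuous_const)
  obtain ⟨B, hB⟩ := hc.exists_bound_of_continuous hη.continuous
  have i3 : Integrable fun x => frozenGauss a (x, q.2 + ε) q * η (x, q.2 + ε) :=
    i2.mul_bdd hη0.aestronglyMeasurable (Eventually.of_forall fun x => hB _)
  have e3 : (∫ x, frozenGauss a (x, q.2 + ε) q * η (x, q.2 + ε)) - η q =
      ∫ x, frozenGauss a (x, q.2 + ε) q * (η (x, q.2 + ε) - η q) := by
    simp only [mul_sub]
    rw [integral_sub i3 (i2.mul_const _), integral_mul_const, e2, one_mul]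
  obtain ⟨i4, e4⟩ := integral_gaussKernel_left (d := d) hb hlt
  -- Lipschitz continuity of `η` gives a factor `‖x - q.1‖ + ε`; the first summand is `√ε` times a
  -- weight that the comparison Gaussian absorbs.
  have hbound : ∀ x, ‖frozenGauss a (x, q.2 + ε) q * (η (x, q.2 + ε) - η q)‖ ≤
      L * (√ε * gaussConst d lam * gaussKernel (1 / (8 * lam)) (x, q.2 + ε) q +
        ε * frozenGauss a (x, q.2 + ε) q) := by
    intro x
    have h0 := frozenGauss_nonneg a (x, q.2 + ε) q
    have h1 : ‖η (x, q.2 + ε) - η q‖ ≤ L * (‖x - q.1‖ + ε) := by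
      rw [← dist_eq_norm]
      refine (hL.dist_le_mul _ _).trans (mul_le_mul_of_nonneg_left ?_ L.2)
      rw [Prod.dist_eq, dist_eq_norm, Real.dist_eq]
      refine max_le (by linarith) ?_
      rw [show q.2 + ε - q.2 = ε by ring, abs_of_pos hε]
      linarith [norm_nonneg (x - q.1)]
    have h2 := h.weighted_frozenGauss_le (p := (x, q.2 + ε)) hlam hlt
    simp only [hr] at h2
    have hs := Real.sqrt_pos.mpr hε
    have h3 : ‖x - q.1‖ * frozenGauss a (x, q.2 + ε) q ≤
        √ε * (gaussConst d lam * gaussKernel (1 / (8 * lam)) (x, q.2 + ε) q) := by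
      have e : ‖x - q.1‖ = √ε * (‖x - q.1‖ / √ε) := by field_simp
      rw [e, mul_assoc]
      refine mul_le_mul_of_nonneg_left (le_trans ?_ h2) hs.le
      refine mul_le_mul_of_nonneg_right ?_ h0
      have : 0 ≤ (‖x - q.1‖ / √ε) ^ 3 := by positivity
      linarith
    rw [norm_mul, Real.norm_of_nonneg h0]
    refine (mul_le_mul_of_nonneg_left h1 h0).trans ?_
    have := mul_le_mul_of_nonneg_left h3 L.coe_nonneg
    linarith
  rw [e3]
  refine (norm_integral_le_of_norm_le (((i4.const_mul _).add (i2.const_mul _)).const_mul _)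
    (Eventually.of_forall hbound)).trans (le_of_eq ?_)
  rw [integral_const_mul, integral_add' (i4.const_mul _) (i2.const_mul _), integral_const_mul,
    integral_const_mul, e2, e4]
  ring

/-- The pairing and the error have singularities of order `-1/2` in time and are integrable, so the
cutoff is removed by dominated convergence as `ε → 0`, while the endpoint term tends to `η q`. If
the pole is not before `T`, both sides vanish. -/
theorem isAdjointTest (hlam : 0 < lam) (hK : 0 ≤ K) (h : IsRegularField a lam K)
    (hη : IsTestFunction (Iio T) η) :
    IsAdjointTest T (frozenGauss a) (frozenGrad a) (frozenError a) η (testSource a η)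
      (testFlux a η) where
  measurable_η := hη.smooth.continuous.measurable
  measurable_W := h.measurable_testSource hη.smooth
  measurable_V := h.measurable_testFlux hη.smooth
  bounded := h.exists_bound_test hlam hK hη.smooth hη.compact
  vanish p hp := by
    obtain ⟨h1, h2, h3⟩ := hη.eq_zero (p := p) (not_lt.mpr hp)
    simp [testFlux, testSource, h1, h2, h3]
  identity q := by
    obtain ⟨i1, i2⟩ := h.integrable_frozen_pairing hlam hK hη q
    suffices hs : ∫ p, (pairing (frozenGauss a) (frozenGrad a) (testFlux a η) (testSource a η) p q -
        frozenError a p q * η p) = η q by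
      rw [integral_sub i1 i2] at hs
      exact sub_eq_iff_eq_add.mp hs
    set F := fun p : Space d × ℝ =>
      pairing (frozenGauss a) (frozenGrad a) (testFlux a η) (testSource a η) p q -
        frozenError a p q * η p with hF
    have hF0 : ∀ p : Space d × ℝ, p.2 ≤ q.2 → F p = 0 := fun p hp => by
      simp [hF, pairing, frozenGrad, frozenError, frozenGauss, not_lt.mpr hp]
    by_cases hqT : T ≤ q.2
    · have hFz : ∀ p, F p = 0 := fun p => by
        rcases le_total p.2 q.2 with hp | hp
        · exact hF0 p hp
        · obtain ⟨h1, h2, h3⟩ := hη.eq_zero (p := p) (not_lt.mpr (hqT.trans hp))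
          simp [hF, pairing, testFlux, testSource, h1, h2, h3]
      change ∫ p, F p = η q
      simp only [hFz, integral_zero]
      exact (hη.eq_zero (p := q) (not_lt.mpr hqT)).1.symm
    have hqT' := not_le.mp hqT
    have lim1 := h.tendsto_integral_frozenGauss hlam hη.smooth hη.compact q
    have lim2 : Tendsto (fun ε => ∫ p, {p : Space d × ℝ | q.2 + ε < p.2}.indicator F p) (𝓝[>] 0)
        (𝓝 (∫ p, F p)) := by
      refine tendsto_integral_filter_of_dominated_convergence (fun p => ‖F p‖)
        (Eventually.of_forall fun ε => ((i1.sub i2).indicator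
          (measurableSet_lt measurable_const measurable_snd)).aestronglyMeasurable)
        (Eventually.of_forall fun ε => Eventually.of_forall fun p =>
          norm_indicator_le_norm_self _ _) (i1.sub i2).norm (Eventually.of_forall fun p => ?_)
      by_cases hp : q.2 < p.2
      · refine tendsto_const_nhds.congr' ?_
        have : Iio (p.2 - q.2) ∈ 𝓝 (0 : ℝ) := Iio_mem_nhds (sub_pos.mpr hp)
        filter_upwards [mem_nhdsWithin_of_mem_nhds this] with ε hε
        have : p ∈ {p : Space d × ℝ | q.2 + ε < p.2} := by
          simp only [mem_ofPred_eq]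
          linarith [mem_Iio.mp hε]
        rw [indicator_of_mem this]
      · have : ∀ s : Set (Space d × ℝ), s.indicator F p = F p := fun s => by
          by_cases hs : p ∈ s
          · rw [indicator_of_mem hs]
          · rw [indicator_of_notMem hs, hF0 p (not_lt.mp hp)]
        simp only [this]
        exact tendsto_const_nhds
    refine tendsto_nhds_unique lim2 (lim1.congr' ?_)
    have : Iio (T - q.2) ∈ 𝓝 (0 : ℝ) := Iio_mem_nhds (sub_pos.mpr hqT')
    filter_upwards [self_mem_nhdsWithin, mem_nhdsWithin_of_mem_nhds this] with ε hε hεT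
    rw [integral_indicator (measurableSet_lt measurable_const measurable_snd)]
    exact (h.integral_frozen_pairing_cutoff hlam hK hη hε q (by linarith [mem_Iio.mp hεT])).symm

end IsRegularField

end AdjointIdentity

/-! ### Mollification in space-time and its convergence in `L²`. -/

section Mollification

open Filter Topology ENNReal

variable {d : ℕ}

instance : (volume : Measure (Space d × ℝ)).IsAddHaarMeasure :=
  inferInstanceAs ((volume : Measure (Space d)).prod (volume : Measure ℝ)).IsAddHaarMeasure

/-- The bump functions on space-time shrinking to the origin. -/
def bump (d n : ℕ) : ContDiffBump (0 : Space d × ℝ) where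
  rIn := 1 / (2 * (n + 1))
  rOut := 1 / (n + 1)
  rIn_pos := by positivity
  rIn_lt_rOut := by
    apply one_div_lt_one_div_of_lt <;> linarith [n.cast_nonneg (α := ℝ)]

/-- Approximate identities on space-time. -/
def mollifier (n : ℕ) : Space d × ℝ → ℝ := (bump d n).normed volume

/-- Regularization in space and time. -/
def mollify (n : ℕ) (g : Space d × ℝ → ℝ) : Space d × ℝ → ℝ :=
  convolution (mollifier n) g (ContinuousLinearMap.lsmul ℝ ℝ) volume

lemma mollifier_nonneg (n : ℕ) (p : Space d × ℝ) : 0 ≤ mollifier n p := (bump d n).nonneg_normed p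

lemma contDiff_mollifier (n : ℕ) : ContDiff ℝ ∞ (mollifier (d := d) n) :=
  (bump d n).contDiff_normed

lemma hasCompactSupport_mollifier (n : ℕ) : HasCompactSupport (mollifier (d := d) n) :=
  (bump d n).hasCompactSupport_normed

lemma tsupport_mollifier (n : ℕ) :
    tsupport (mollifier (d := d) n) = Metric.closedBall 0 (1 / (n + 1)) :=
  (bump d n).tsupport_normed_eq

variable {f g : Space d × ℝ → ℝ}

lemma mollify_eq (n : ℕ) (g : Space d × ℝ → ℝ) (p : Space d × ℝ) :
    mollify n g p = ∫ q, mollifier n (p - q) * g q := by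
  unfold mollify
  rw [convolution_eq_swap]
  rfl

lemma integrable_mul_of_compact {ρ : Space d × ℝ → ℝ} (hρ : Continuous ρ)
    (hc : HasCompactSupport ρ) (hg : LocallyIntegrable g) (p : Space d × ℝ) :
    Integrable fun q => ρ (p - q) * g q := by
  have h1 : HasCompactSupport fun q => ρ (p - q) :=
    hc.comp_homeomorph (Homeomorph.subLeft p)
  exact hg.integrable_smul_left_of_hasCompactSupport
    (hρ.comp (continuous_const.sub continuous_id)) h1

lemma contDiff_mollify (n : ℕ) (hg : LocallyIntegrable g) : ContDiff ℝ ∞ (mollify n g) :=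
  (hasCompactSupport_mollifier n).contDiff_convolution_left _ (contDiff_mollifier n) hg

lemma fderiv_mollify (n : ℕ) (hg : LocallyIntegrable g) (p v : Space d × ℝ) :
    fderiv ℝ (mollify n g) p v = ∫ q, fderiv ℝ (mollifier n) (p - q) v * g q := by
  have h1 := (hasCompactSupport_mollifier (d := d) n).hasFDerivAt_convolution_left
    (μ := volume) (ContinuousLinearMap.lsmul ℝ ℝ)
    ((contDiff_mollifier n).of_le (by norm_cast)) hg p
  have h2 : fderiv ℝ (mollify n g) p = _ := h1.fderiv
  rw [h2, convolution_eq_swap, ContinuousLinearMap.integral_apply]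
  · rfl
  · have h3 := ((hasCompactSupport_mollifier (d := d) n).fderiv ℝ).convolutionExists_left
      (μ := volume) ((ContinuousLinearMap.lsmul ℝ ℝ (E := ℝ)).precompL (Space d × ℝ))
      ((contDiff_mollifier n).continuous_fderiv (by simp)) hg p
    exact h3.integrable_swap

lemma mollify_sub (n : ℕ) (hf : LocallyIntegrable f) (hg : LocallyIntegrable g) :
    mollify n (f - g) = mollify n f - mollify n g := by
  ext p
  have h1 := integrable_mul_of_compact (contDiff_mollifier n).continuous
    (hasCompactSupport_mollifier n) hf p
  have h2 := integrable_mul_of_compact (contDiff_mollifier n).continuous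
    (hasCompactSupport_mollifier n) hg p
  rw [Pi.sub_apply, mollify_eq, mollify_eq, mollify_eq, ← integral_sub h1 h2]
  simp only [Pi.sub_apply, mul_sub]

lemma integral_mollifier_sub (n : ℕ) (p : Space d × ℝ) : ∫ q, mollifier n (p - q) = 1 := by
  rw [integral_sub_left_eq_self (mollifier n) volume p]
  exact (bump d n).integral_normed

/-- Jensen's inequality, as nonnegativity of the variance of `g` about its mollified value under the
mollifier. -/
lemma sq_mollify_le (n : ℕ) (hg : MemLp g 2) (p : Space d × ℝ) :
    mollify n g p ^ 2 ≤ mollify n (fun q => g q ^ 2) p := by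
  have hc := (contDiff_mollifier (d := d) n).continuous
  have hs := hasCompactSupport_mollifier (d := d) n
  have h1 := integrable_mul_of_compact hc hs (hg.locallyIntegrable (by norm_num)) p
  have h2 := integrable_mul_of_compact hc hs hg.integrable_sq.locallyIntegrable p
  have h0 : Integrable fun q => mollifier n (p - q) := by
    simpa using integrable_mul_of_compact (g := fun _ => 1) hc hs
      (continuous_const.locallyIntegrable) p
  have e1 := mollify_eq n g p
  rw [mollify_eq n (fun q => g q ^ 2)]
  set m := mollify n g p
  have h3 : 0 ≤ ∫ q, mollifier n (p - q) * (g q - m) ^ 2 :=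
    integral_nonneg fun q => mul_nonneg (mollifier_nonneg n _) (sq_nonneg _)
  have e : (fun q => mollifier n (p - q) * (g q - m) ^ 2) = fun q =>
      mollifier n (p - q) * g q ^ 2 - 2 * m * (mollifier n (p - q) * g q) +
        m ^ 2 * mollifier n (p - q) := by
    ext q
    ring
  have h12 : Integrable fun q => mollifier n (p - q) * g q ^ 2 -
      2 * m * (mollifier n (p - q) * g q) := h2.sub (h1.const_mul _)
  rw [e, integral_add h12 (h0.const_mul _), integral_sub h2 (h1.const_mul _), integral_const_mul, integral_const_mul, ← e1,
    integral_mollifier_sub] at h3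
  nlinarith

lemma integral_mollify (n : ℕ) (hg : Integrable g) :
    Integrable (mollify n g) ∧ ∫ p, mollify n g p = ∫ p, g p := by
  have hi : Integrable (mollifier (d := d) n) := (bump d n).integrable_normed
  refine ⟨hi.integrable_convolution _ hg, ?_⟩
  have := integral_convolution (μ := volume) (ν := volume) (ContinuousLinearMap.lsmul ℝ ℝ) hi hg
  refine this.trans ?_
  rw [show ∫ x, mollifier (d := d) n x = 1 from (bump d n).integral_normed]
  simp

/-- Integrate the pointwise Jensen inequality; mollification preserves the integral of `g²`. -/
lemma memLp_mollify (n : ℕ) (hg : MemLp g 2) :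
    MemLp (mollify n g) 2 ∧ ∫ p, mollify n g p ^ 2 ≤ ∫ p, g p ^ 2 := by
  have hm := (contDiff_mollify n (hg.locallyIntegrable (by norm_num))).continuous
  obtain ⟨h1, h2⟩ := integral_mollify n hg.integrable_sq
  have h3 : Integrable fun p => mollify n g p ^ 2 :=
    h1.mono' (hm.pow 2).aestronglyMeasurable (Eventually.of_forall fun p => by
      rw [Real.norm_of_nonneg (sq_nonneg _)]
      exact sq_mollify_le n hg p)
  refine ⟨(memLp_two_iff_integrable_sq hm.aestronglyMeasurable).mpr h3, ?_⟩
  rw [← h2]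
  exact integral_mono h3 h1 (sq_mollify_le n hg)

lemma eLpNorm_le_of_integral_sq_le (hf : MemLp f 2) (hg : MemLp g 2)
    (h : ∫ p, f p ^ 2 ≤ ∫ p, g p ^ 2) : eLpNorm f 2 volume ≤ eLpNorm g 2 volume := by
  rw [hf.eLpNorm_eq_integral_rpow_norm (by norm_num) (by norm_num),
    hg.eLpNorm_eq_integral_rpow_norm (by norm_num) (by norm_num)]
  refine ENNReal.ofReal_le_ofReal (Real.rpow_le_rpow (by positivity) ?_ (by norm_num))
  simpa using h

/-- Uniform continuity makes the difference uniformly small, and it is supported in the unit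
thickening of the support of `g`, because the bumps have radius at most one. -/
lemma tendsto_mollify_of_continuous (hg : Continuous g) (hc : HasCompactSupport g) :
    Tendsto (fun n => eLpNorm (mollify n g - g) 2 volume) atTop (𝓝 0) := by
  set S := Metric.cthickening 1 (tsupport g) with hS
  have hSc : IsCompact S := hc.isCompact.cthickening
  have hfin : volume S ^ (1 / (2 : ℝ≥0∞).toReal) ≠ ⊤ :=
    ENNReal.rpow_ne_top_of_nonneg (by norm_num) hSc.measure_lt_top.ne
  rw [ENNReal.tendsto_nhds_zero]
  intro ε hε
  by_cases hεt : ε = ⊤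
  · exact Eventually.of_forall fun n => by rw [hεt]; exact le_top
  obtain ⟨δ, hδ0, hδ⟩ : ∃ δ : ℝ, 0 < δ ∧
      ENNReal.ofReal δ * volume S ^ (1 / (2 : ℝ≥0∞).toReal) ≤ ε := by
    set A := (volume S ^ (1 / (2 : ℝ≥0∞).toReal)).toReal with hA
    have hA0 : 0 ≤ A := ENNReal.toReal_nonneg
    have he : 0 < ε.toReal := ENNReal.toReal_pos hε.ne' hεt
    refine ⟨ε.toReal / (A + 1), by positivity, ?_⟩
    rw [← ENNReal.ofReal_toReal hfin, ← ENNReal.ofReal_mul (by positivity),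
      ← ENNReal.ofReal_toReal hεt]
    refine ENNReal.ofReal_le_ofReal ?_
    rw [← hA, ENNReal.toReal_ofReal he.le, div_mul_eq_mul_div, div_le_iff₀ (by positivity)]
    nlinarith
  obtain ⟨r, hr0, hr⟩ := Metric.uniformContinuous_iff.mp
    (hc.uniformContinuous_of_continuous hg) δ hδ0
  have h1 : ∀ᶠ n : ℕ in atTop, (1 : ℝ) / (n + 1) < r :=
    tendsto_one_div_add_atTop_nhds_zero_nat.eventually_lt_const hr0
  filter_upwards [h1] with n hn
  have hpt : ∀ p, ‖(mollify n g - g) p‖ ≤ ‖S.indicator (fun _ => δ) p‖ := by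
    intro p
    have h2 : dist (mollify n g p) (g p) ≤ δ := by
      refine (bump d n).dist_normed_convolution_le (μ := volume) hg.aestronglyMeasurable
        fun q hq => ?_
      exact (hr (lt_trans (Metric.mem_ball.mp hq) hn)).le
    by_cases hp : p ∈ S
    · rw [indicator_of_mem hp, Real.norm_of_nonneg hδ0.le, Pi.sub_apply, ← dist_eq_norm]
      exact h2
    · have hball : ∀ q ∈ Metric.ball p (bump d n).rOut, g q = g p := by
        intro q hq
        have hd : dist q p < 1 := by
          refine (Metric.mem_ball.mp hq).trans_le ?_
          change (1 : ℝ) / (n + 1) ≤ 1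
          rw [div_le_one (by positivity)]
          linarith [n.cast_nonneg (α := ℝ)]
        have hp' : p ∉ tsupport g := fun h => hp (Metric.self_subset_cthickening _ h)
        have hq' : q ∉ tsupport g := fun h => hp
          (Metric.mem_cthickening_of_dist_le p q 1 _ h (by rw [dist_comm]; exact hd.le))
        rw [image_eq_zero_of_notMem_tsupport hp', image_eq_zero_of_notMem_tsupport hq']
      have : mollify n g p = g p := by
        unfold mollify mollifier
        rw [(bump d n).normed_convolution_eq_right hball]
      simp [this]
  refine (eLpNorm_mono hpt).trans ?_
  rw [eLpNorm_indicator_const hSc.measurableSet (by norm_num) (by norm_num)]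
  refine le_trans (le_of_eq ?_) hδ
  rw [Real.enorm_of_nonneg hδ0.le]

/-- Mollifications of square integrable functions converge in `L²`. -/
theorem tendsto_mollify (hg : MemLp g 2) :
    Tendsto (fun n => eLpNorm (mollify n g - g) 2 volume) atTop (𝓝 0) := by
  rw [ENNReal.tendsto_nhds_zero]
  intro ε hε
  have hε3 : ε / 3 ≠ 0 := (ENNReal.div_pos hε.ne' (by norm_num)).ne'
  obtain ⟨h, hc, hgh, hcont, hh⟩ := hg.exists_hasCompactSupport_eLpNorm_sub_le (by norm_num) hε3
  filter_upwards [(ENNReal.tendsto_nhds_zero.mp (tendsto_mollify_of_continuous hcont hc)) (ε / 3)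
    (pos_iff_ne_zero.mpr hε3)] with n hn
  have hgl := hg.locallyIntegrable (by norm_num)
  have hhl := hh.locallyIntegrable (by norm_num)
  -- Approximation by continuous compactly supported functions; the contraction property
  -- `memLp_mollify` controls the first term uniformly in `n`.
  have e : mollify n g - g = (mollify n (g - h) + (mollify n h - h)) - (g - h) := by
    rw [mollify_sub n hgl hhl]
    abel
  obtain ⟨m1, m2⟩ := memLp_mollify n (hg.sub hh)
  have m3 := (memLp_mollify n hh).1.sub hh
  rw [e]
  refine (eLpNorm_sub_le (m1.1.add m3.1) (hg.sub hh).1 (by norm_num)).trans ?_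
  refine (add_le_add (eLpNorm_add_le m1.1 m3.1 (by norm_num)) hgh).trans ?_
  refine (add_le_add (add_le_add
    ((eLpNorm_le_of_integral_sq_le m1 (hg.sub hh) m2).trans hgh) hn) le_rfl).trans ?_
  rw [ENNReal.add_thirds]

/-- Products of `L²`-convergent sequences against a bounded weight. -/
lemma tendsto_integral_mul_mul {k : Space d × ℝ → ℝ} {c : ℝ} (hk : AEStronglyMeasurable k volume)
    (hkb : ∀ p, ‖k p‖ ≤ c) {f g : Space d × ℝ → ℝ} {fn gn : ℕ → Space d × ℝ → ℝ} (hf : MemLp f 2)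
    (hg : MemLp g 2) (hfn : ∀ n, MemLp (fn n) 2) (hgn : ∀ n, MemLp (gn n) 2)
    (lf : Tendsto (fun n => eLpNorm (fn n - f) 2 volume) atTop (𝓝 0))
    (lg : Tendsto (fun n => eLpNorm (gn n - g) 2 volume) atTop (𝓝 0)) :
    Tendsto (fun n => ∫ p, k p * fn n p * gn n p) atTop (𝓝 (∫ p, k p * f p * g p)) := by
  have hkm : ∀ {h : Space d × ℝ → ℝ}, MemLp h 2 → MemLp (fun p => k p * h p) 2 := fun hh =>
    hh.of_le_mul (hk.mul hh.1) (Eventually.of_forall fun p => by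
      rw [norm_mul]
      exact mul_le_mul_of_nonneg_right (hkb p) (norm_nonneg _))
  have lk : Tendsto (fun n => eLpNorm ((fun p => k p * fn n p) - fun p => k p * f p) 2 volume)
      atTop (𝓝 0) := by
    have : Tendsto (fun n => ENNReal.ofReal c * eLpNorm (fn n - f) 2 volume) atTop (𝓝 0) := by
      simpa using ENNReal.Tendsto.const_mul lf (Or.inr ENNReal.ofReal_ne_top)
    refine tendsto_of_tendsto_of_tendsto_of_le_of_le tendsto_const_nhds this (fun _ => zero_le)
      fun n => ?_
    refine eLpNorm_le_mul_eLpNorm_of_ae_le_mul (Eventually.of_forall fun p => ?_) 2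
    simp only [Pi.sub_apply, ← mul_sub]
    rw [norm_mul]
    exact mul_le_mul_of_nonneg_right (hkb p) (norm_nonneg _)
  have t1 := (Lp.tendsto_Lp_iff_tendsto_eLpNorm'' (fun n p => k p * fn n p)
    (fun n => hkm (hfn n)) (fun p => k p * f p) (hkm hf)).mpr lk
  have t2 := (Lp.tendsto_Lp_iff_tendsto_eLpNorm'' gn hgn g hg).mpr lg
  have t3 := t2.inner (𝕜 := ℝ) t1
  have key : ∀ {h₁ h₂ : Space d × ℝ → ℝ} (m₁ : MemLp h₁ 2 (volume : Measure (Space d × ℝ)))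
      (m₂ : MemLp h₂ 2 (volume : Measure (Space d × ℝ))),
      inner ℝ (m₁.toLp h₁) (m₂.toLp h₂) = ∫ p, h₂ p * h₁ p := by
    intro h₁ h₂ m₁ m₂
    rw [L2.inner_def]
    refine integral_congr_ae ?_
    filter_upwards [m₁.coeFn_toLp, m₂.coeFn_toLp] with p e₁ e₂
    rw [e₁, e₂]
    rfl
  simpa only [key] using t3

end Mollification

/-! ### The energy identity for equations in divergence form. -/

section Energy

open Filter Topology

variable {d : ℕ} {α β : ℝ} {u : Space d × ℝ → ℝ} {G F : Fin d → Space d × ℝ → ℝ}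

/-- The coordinate directions of space in space-time. -/
abbrev spaceDir (i : Fin d) : Space d × ℝ := (basisVec i, 0)

/-- `G` is the weak spatial gradient of `u` between the times `α` and `β`, both being square
integrable on the whole space-time. -/
structure IsWeakGradient (α β : ℝ) (u : Space d × ℝ → ℝ) (G : Fin d → Space d × ℝ → ℝ) :
    Prop where
  memLp : MemLp u 2
  memLp_grad : ∀ i, MemLp (G i) 2
  grad : ∀ η, IsTestFunction (Ioo α β) η → ∀ i,
    ∫ p, fderiv ℝ η p (spaceDir i) * u p = -∫ p, η p * G i p

/-- The weak equation `∂ₜu = div F` between the times `α` and `β`. -/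
structure IsWeakDivergence (α β : ℝ) (u : Space d × ℝ → ℝ) (F : Fin d → Space d × ℝ → ℝ) :
    Prop where
  memLp : MemLp u 2
  memLp_flux : ∀ i, MemLp (F i) 2
  time : ∀ η, IsTestFunction (Ioo α β) η →
    ∫ p, fderiv ℝ η p (0, 1) * u p = ∑ i, ∫ p, fderiv ℝ η p (spaceDir i) * F i p

/-- The mollifier reflected and centred at `p` is admissible in the weak formulation as soon as the
time of `p` is farther than the mollification radius from both ends. Mollified equations therefore
hold pointwise there. -/
lemma isTestFunction_mollifier {n : ℕ} {p : Space d × ℝ} (h₁ : α < p.2 - 1 / (n + 1))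
    (h₂ : p.2 + 1 / (n + 1) < β) :
    IsTestFunction (Ioo α β) fun q => mollifier n (p - q) where
  smooth := (contDiff_mollifier n).comp (contDiff_const.sub contDiff_id)
  compact := (hasCompactSupport_mollifier n).comp_homeomorph (Homeomorph.subLeft p)
  support_subset := by
    intro q hq
    have h3 : tsupport (fun q => mollifier n (p - q)) ⊆
        (fun q => p - q) ⁻¹' Metric.closedBall 0 (1 / ((n : ℝ) + 1)) := by
      rw [← tsupport_mollifier]
      exact tsupport_comp_subset_preimage _ (continuous_const.sub continuous_id)
    have h4 : ‖p - q‖ ≤ 1 / ((n : ℝ) + 1) := by simpa using h3 hq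
    have h5 : |p.2 - q.2| ≤ 1 / ((n : ℝ) + 1) := (norm_snd_le (p - q)).trans h4
    rw [abs_le] at h5
    exact ⟨mem_univ _, by constructor <;> linarith [h5.1, h5.2]⟩

lemma fderiv_mollifier_sub (n : ℕ) (p q v : Space d × ℝ) :
    fderiv ℝ (fun q => mollifier n (p - q)) q v = -fderiv ℝ (mollifier n) (p - q) v := by
  have h1 : HasFDerivAt (mollifier n) (fderiv ℝ (mollifier n) (p - q)) (p - q) :=
    ((contDiff_mollifier n).differentiable (by simp) _).hasFDerivAt
  have h2 := h1.comp q ((hasFDerivAt_id q).const_sub p)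
  have h3 : fderiv ℝ (fun q => mollifier n (p - q)) q = _ := h2.fderiv
  rw [h3]
  simp

/-- Test the weak gradient with the reflected mollifier: the sign from the reflection cancels that
of the integration by parts. -/
lemma IsWeakGradient.fderiv_mollify (h : IsWeakGradient α β u G) {n : ℕ} {p : Space d × ℝ}
    (h₁ : α < p.2 - 1 / (n + 1)) (h₂ : p.2 + 1 / (n + 1) < β) (i : Fin d) :
    fderiv ℝ (mollify n u) p (spaceDir i) = mollify n (G i) p := by
  have h3 := h.grad _ (isTestFunction_mollifier h₁ h₂) i
  simp only [fderiv_mollifier_sub, neg_mul, integral_neg, neg_inj] at h3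
  rw [AronsonGradient.fderiv_mollify n (h.memLp.locallyIntegrable (by norm_num)), h3, mollify_eq]

lemma IsWeakDivergence.fderiv_mollify (h : IsWeakDivergence α β u F) {n : ℕ} {p : Space d × ℝ}
    (h₁ : α < p.2 - 1 / (n + 1)) (h₂ : p.2 + 1 / (n + 1) < β) :
    fderiv ℝ (mollify n u) p (0, 1) = ∑ i, fderiv ℝ (mollify n (F i)) p (spaceDir i) := by
  have h3 := h.time _ (isTestFunction_mollifier h₁ h₂)
  simp only [fderiv_mollifier_sub, neg_mul, integral_neg, Finset.sum_neg_distrib, neg_inj] at h3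
  rw [AronsonGradient.fderiv_mollify n (h.memLp.locallyIntegrable (by norm_num)), h3]
  exact Finset.sum_congr rfl fun i _ =>
    (AronsonGradient.fderiv_mollify n ((h.memLp_flux i).locallyIntegrable (by norm_num)) _ _).symm

lemma integrable_mul_mul {k f g : Space d × ℝ → ℝ} {c : ℝ} (hk : AEStronglyMeasurable k volume)
    (hkb : ∀ p, ‖k p‖ ≤ c) (hf : MemLp f 2) (hg : MemLp g 2) :
    Integrable fun p => k p * f p * g p := by
  have h1 : MemLp (fun p => k p * f p) 2 := hf.of_le_mul (hk.mul hf.1)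
    (Eventually.of_forall fun p => by
      rw [norm_mul]
      exact mul_le_mul_of_nonneg_right (hkb p) (norm_nonneg _))
  exact h1.integrable_mul hg

/-- The set of times in the support is compact in an open interval, hence keeps a positive distance
from its ends. -/
lemma IsTestFunction.eventually_mollify {ζ : Space d × ℝ → ℝ} (h : IsTestFunction (Ioo α β) ζ) :
    ∀ᶠ n : ℕ in atTop, ∀ p ∈ tsupport ζ, α < p.2 - 1 / ((n : ℝ) + 1) ∧ p.2 + 1 / ((n : ℝ) + 1) < β := by
  have hK : IsCompact (Prod.snd '' tsupport ζ) := h.compact.isCompact.image continuous_snd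
  obtain ⟨δ, hδ, hsub⟩ := hK.exists_cthickening_subset_open isOpen_Ioo
    (by rintro _ ⟨p, hp, rfl⟩; exact (h.support_subset hp).2)
  have h1 : ∀ᶠ n : ℕ in atTop, (1 : ℝ) / (n + 1) < δ :=
    tendsto_one_div_add_atTop_nhds_zero_nat.eventually_lt_const hδ
  filter_upwards [h1] with n hn p hp
  have hp' : p.2 ∈ Prod.snd '' tsupport ζ := ⟨p, hp, rfl⟩
  have hpos : (0 : ℝ) < 1 / (n + 1) := by positivity
  have m1 := hsub (Metric.mem_cthickening_of_dist_le (p.2 - 1 / ((n : ℝ) + 1)) p.2 δ _ hp' (by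
    rw [Real.dist_eq, sub_sub_cancel_left, abs_neg, abs_of_pos hpos]
    exact hn.le))
  have m2 := hsub (Metric.mem_cthickening_of_dist_le (p.2 + 1 / ((n : ℝ) + 1)) p.2 δ _ hp' (by
    rw [Real.dist_eq, add_sub_cancel_left, abs_of_pos hpos]
    exact hn.le))
  exact ⟨m1.1, m2.2⟩

lemma exists_bound_fderiv {ζ : Space d × ℝ → ℝ} (hζ : ContDiff ℝ ∞ ζ) (hc : HasCompactSupport ζ)
    (v : Space d × ℝ) : Continuous (fun p => fderiv ℝ ζ p v) ∧
      ∃ c, ∀ p, ‖fderiv ℝ ζ p v‖ ≤ c := by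
  have h1 := (contDiff_fderiv_const hζ v).continuous
  exact ⟨h1, (hc.fderiv_apply ℝ v).exists_bound_of_continuous h1⟩

/-- The energy identity localized by a test function. -/
lemma integral_local_energy (hG : IsWeakGradient α β u G) (hF : IsWeakDivergence α β u F)
    {ζ : Space d × ℝ → ℝ} (hζ : IsTestFunction (Ioo α β) ζ) :
    ∫ p, fderiv ℝ ζ p (0, 1) * u p * u p =
      2 * ∑ i, ((∫ p, fderiv ℝ ζ p (spaceDir i) * u p * F i p) + ∫ p, ζ p * G i p * F i p) := by
  obtain ⟨ct, c₀, hc₀⟩ := exists_bound_fderiv hζ.smooth hζ.compact (0, 1)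
  have cs := fun i => exists_bound_fderiv hζ.smooth hζ.compact (spaceDir i)
  obtain ⟨c₁, hc₁⟩ := hζ.compact.exists_bound_of_continuous hζ.smooth.continuous
  have hu := fun n => (memLp_mollify n hG.memLp).1
  have hg := fun i n => (memLp_mollify n (hG.memLp_grad i)).1
  have hf := fun i n => (memLp_mollify n (hF.memLp_flux i)).1
  have l1 := tendsto_integral_mul_mul ct.aestronglyMeasurable hc₀ hG.memLp hG.memLp hu hu
    (tendsto_mollify hG.memLp) (tendsto_mollify hG.memLp)
  have l2 := fun i => tendsto_integral_mul_mul (cs i).1.aestronglyMeasurable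
    (cs i).2.choose_spec hG.memLp (hF.memLp_flux i) hu (hf i) (tendsto_mollify hG.memLp)
    (tendsto_mollify (hF.memLp_flux i))
  have l3 := fun i => tendsto_integral_mul_mul hζ.smooth.continuous.aestronglyMeasurable hc₁
    (hG.memLp_grad i) (hF.memLp_flux i) (hg i) (hf i) (tendsto_mollify (hG.memLp_grad i))
    (tendsto_mollify (hF.memLp_flux i))
  have l4 := (tendsto_finsetSum Finset.univ fun i _ => (l2 i).add (l3 i)).const_mul 2
  refine tendsto_nhds_unique l1 (l4.congr' ?_)
  filter_upwards [hζ.eventually_mollify] with n hn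
  have su := contDiff_mollify n (hG.memLp.locallyIntegrable (by norm_num))
  have sf := fun i => contDiff_mollify n ((hF.memLp_flux i).locallyIntegrable (by norm_num))
  -- With `uₙ`, `Fₙ` mollified, the derivatives of `ζuₙ²` in time and of `ζuₙFₙ` in space integrate
  -- to zero. In their combination the terms with `∂ₜuₙ` and `div Fₙ` cancel by the mollified
  -- equation; the surviving terms converge by `L²` convergence of each factor.
  have t0 := integral_fderiv_eq_zero (μ := (volume : Measure (Space d × ℝ)))
    (((hζ.smooth.mul su).mul su).of_le (by norm_cast)) (hζ.compact.mul_right.mul_right) (0, 1)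
  have ti := fun i => integral_fderiv_eq_zero (μ := (volume : Measure (Space d × ℝ)))
    (((hζ.smooth.mul su).mul (sf i)).of_le (by norm_cast)) (hζ.compact.mul_right.mul_right)
    (spaceDir i)
  have j1 := integrable_mul_mul ct.aestronglyMeasurable hc₀ (hu n) (hu n)
  have j2 := fun i => integrable_mul_mul (cs i).1.aestronglyMeasurable (cs i).2.choose_spec (hu n)
    (hf i n)
  have j3 := fun i => integrable_mul_mul hζ.smooth.continuous.aestronglyMeasurable hc₁ (hg i n)
    (hf i n)
  have j23 : ∀ i, Integrable fun p => fderiv ℝ ζ p (spaceDir i) * mollify n u p * mollify n (F i) p +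
      ζ p * mollify n (G i) p * mollify n (F i) p := fun i => (j2 i).add (j3 i)
  have key : ∫ p, (fderiv ℝ ζ p (0, 1) * mollify n u p * mollify n u p -
      2 * ∑ i, (fderiv ℝ ζ p (spaceDir i) * mollify n u p * mollify n (F i) p +
        ζ p * mollify n (G i) p * mollify n (F i) p)) =
      ∫ p, (fderiv ℝ (fun p => ζ p * mollify n u p * mollify n u p) p (0, 1) -
        2 * ∑ i, fderiv ℝ (fun p => ζ p * mollify n u p * mollify n (F i) p) p (spaceDir i)) := by
    refine integral_congr_ae (Eventually.of_forall fun p => ?_)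
    have dζ := hζ.smooth.differentiable (by simp) p
    have du := su.differentiable (by simp) p
    have df := fun i => (sf i).differentiable (by simp) p
    beta_reduce
    rw [fderiv_mul_mul_apply dζ du du]
    simp only [fun i => fderiv_mul_mul_apply dζ du (df i) (spaceDir i)]
    by_cases hp : p ∈ tsupport ζ
    · obtain ⟨h1, h2⟩ := hn p hp
      rw [hF.fderiv_mollify h1 h2]
      simp only [fun i => hG.fderiv_mollify h1 h2 i, Finset.sum_add_distrib, ← Finset.mul_sum]
      ring
    · simp [image_eq_zero_of_notMem_tsupport hp]
  have e1 : ∫ p, (fderiv ℝ (fun p => ζ p * mollify n u p * mollify n u p) p (0, 1) -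
      2 * ∑ i, fderiv ℝ (fun p => ζ p * mollify n u p * mollify n (F i) p) p (spaceDir i)) = 0 := by
    rw [integral_sub t0.1 ((integrable_finsetSum _ fun i _ => (ti i).1).const_mul 2),
      integral_const_mul, integral_finsetSum _ fun i _ => (ti i).1]
    have : ∫ p, fderiv ℝ (fun p => ζ p * mollify n u p * mollify n u p) p (0, 1) = 0 := t0.2
    rw [this, Finset.sum_eq_zero fun i _ => (ti i).2]
    simp
  rw [e1, integral_sub j1 ((integrable_finsetSum _ fun i _ => j23 i).const_mul 2),
    integral_const_mul, integral_finsetSum _ fun i _ => j23 i,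
    Finset.sum_congr rfl fun i _ => integral_add (j2 i) (j3 i)] at key
  linarith

lemma isTestFunction_mul {J : Set ℝ} {θ : ℝ → ℝ} {χ : Space d → ℝ} (hθ : ContDiff ℝ ∞ θ)
    (hχ : ContDiff ℝ ∞ χ) (cθ : HasCompactSupport θ) (cχ : HasCompactSupport χ)
    (hJ : tsupport θ ⊆ J) : IsTestFunction J fun p : Space d × ℝ => θ p.2 * χ p.1 where
  smooth := (hθ.comp contDiff_snd).mul (hχ.comp contDiff_fst)
  compact := by
    refine HasCompactSupport.intro (cχ.isCompact.prod cθ.isCompact) fun p hp => ?_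
    by_cases h1 : p.1 ∈ tsupport χ
    · have h2 : p.2 ∉ tsupport θ := fun h2 => hp ⟨h1, h2⟩
      rw [image_eq_zero_of_notMem_tsupport h2, zero_mul]
    · rw [image_eq_zero_of_notMem_tsupport h1, mul_zero]
  support_subset := by
    refine (closure_minimal (t := univ ×ˢ tsupport θ) (fun p hp => ⟨mem_univ _, ?_⟩)
      (isClosed_univ.prod (isClosed_tsupport θ))).trans (prod_mono_right hJ)
    by_contra h
    exact hp (by simp [image_eq_zero_of_notMem_tsupport h])

/-- The energy identity with a weight in time. -/
theorem integral_energy (hG : IsWeakGradient α β u G) (hF : IsWeakDivergence α β u F)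
    {θ : ℝ → ℝ} (hθ : ContDiff ℝ ∞ θ) (cθ : HasCompactSupport θ) (sθ : tsupport θ ⊆ Ioo α β) :
    ∫ p, deriv θ p.2 * u p * u p = 2 * ∑ i, ∫ p, θ p.2 * G i p * F i p := by
  -- Dilated spatial cutoffs `χ(x/(n+1))` tend to one, and their gradients are of order `1/n`, so
  -- the cross terms with `u` and `F` disappear in the limit.
  set χ : ContDiffBump (0 : Space d) := ⟨1, 2, by norm_num, by norm_num⟩ with hχd
  have sχ : ContDiff ℝ ∞ χ := χ.contDiff
  set r : ℕ → ℝ := fun n => 1 / ((n : ℝ) + 1) with hr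
  have hr0 : ∀ n, 0 < r n := fun n => by simp only [hr]; positivity
  have hr1 : ∀ n, r n ≤ 1 := fun n => by
    simp only [hr]
    rw [div_le_one (by positivity)]
    linarith [n.cast_nonneg (α := ℝ)]
  have hrl : Tendsto r atTop (𝓝 0) := tendsto_one_div_add_atTop_nhds_zero_nat
  set X : ℕ → Space d → ℝ := fun n x => χ (r n • x) with hX
  have sX : ∀ n, ContDiff ℝ ∞ (X n) := fun n => sχ.comp (contDiff_const_smul (r n))
  have cX : ∀ n, HasCompactSupport (X n) := fun n =>
    χ.hasCompactSupport.comp_homeomorph (Homeomorph.smulOfNeZero (r n) (hr0 n).ne')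
  have dX : ∀ n x i, fderiv ℝ (X n) x (basisVec i) = r n * fderiv ℝ χ (r n • x) (basisVec i) := by
    intro n x i
    have h1 : HasFDerivAt χ (fderiv ℝ χ (r n • x)) (r n • x) :=
      (sχ.differentiable (by simp) _).hasFDerivAt
    have h2 : fderiv ℝ (X n) x = _ := (h1.comp x ((hasFDerivAt_id x).const_smul (r n))).fderiv
    rw [h2]
    simp
  have tζ := fun n => isTestFunction_mul hθ (sX n) cθ (cX n) sθ
  have dζ : ∀ n p, HasFDerivAt (fun p : Space d × ℝ => θ p.2 * X n p.1) _ p := fun n p =>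
    ((hθ.differentiable (by simp) p.2).hasFDerivAt.comp p hasFDerivAt_snd).mul
      (((sX n).differentiable (by simp) p.1).hasFDerivAt.comp p hasFDerivAt_fst)
  have d0 : ∀ n p, fderiv ℝ (fun p : Space d × ℝ => θ p.2 * X n p.1) p (0, 1) =
      deriv θ p.2 * X n p.1 := by
    intro n p
    rw [(dζ n p).fderiv]
    simp [mul_comm]
  have di : ∀ n p i, fderiv ℝ (fun p : Space d × ℝ => θ p.2 * X n p.1) p (spaceDir i) =
      θ p.2 * (r n * fderiv ℝ χ (r n • p.1) (basisVec i)) := by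
    intro n p i
    rw [(dζ n p).fderiv, ← dX]
    simp
  obtain ⟨c₀, h₀⟩ := cθ.exists_bound_of_continuous hθ.continuous
  have hdθ : Continuous (deriv θ) := hθ.continuous_deriv (by simp)
  obtain ⟨c₁, h₁⟩ := cθ.deriv.exists_bound_of_continuous hdθ
  have hb : ∀ i, Continuous fun x : Space d => fderiv ℝ χ x (basisVec i) := fun i =>
    (sχ.continuous_fderiv (by simp)).clm_apply continuous_const
  have hc₂ := fun i => (χ.hasCompactSupport.fderiv_apply ℝ (basisVec i)).exists_bound_of_continuous
    (hb i)
  choose c₂ h₂ using hc₂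
  have hχ1 : ∀ x, ‖χ x‖ ≤ 1 := fun x => by
    rw [Real.norm_of_nonneg χ.nonneg]; exact χ.le_one
  have lX : ∀ x, Tendsto (fun n => X n x) atTop (𝓝 1) := by
    intro x
    have h3 : Tendsto (fun n => r n • x) atTop (𝓝 0) := by
      simpa using hrl.smul_const x
    have h4 := (sχ.continuous.tendsto 0).comp h3
    have h5 : χ (0 : Space d) = 1 :=
      χ.one_of_mem_closedBall (Metric.mem_closedBall_self (by norm_num))
    rw [h5] at h4
    exact h4
  have cn0 : 0 ≤ c₀ := (norm_nonneg _).trans (h₀ 0)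
  have cn1 : 0 ≤ c₁ := (norm_nonneg _).trans (h₁ 0)
  have L1 : Tendsto (fun n => ∫ p, deriv θ p.2 * X n p.1 * u p * u p) atTop
      (𝓝 (∫ p, deriv θ p.2 * u p * u p)) := by
    have kb : ∀ n (p : Space d × ℝ), ‖deriv θ p.2 * X n p.1‖ ≤ c₁ := fun n p => by
      rw [norm_mul]
      calc _ ≤ c₁ * 1 := mul_le_mul (h₁ _) (hχ1 _) (norm_nonneg _) cn1
        _ = c₁ := mul_one _
    refine tendsto_integral_of_dominated_convergence (fun p => c₁ * (‖u p‖ * ‖u p‖))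
      (fun n => (integrable_mul_mul ((hdθ.comp continuous_snd).mul
        ((sX n).continuous.comp continuous_fst)).aestronglyMeasurable (kb n) hG.memLp
        hG.memLp).aestronglyMeasurable)
      ((hG.memLp.norm.integrable_mul hG.memLp.norm).const_mul _)
      (fun n => Eventually.of_forall fun p => ?_) (Eventually.of_forall fun p => ?_)
    · rw [norm_mul, norm_mul, mul_assoc]
      exact mul_le_mul_of_nonneg_right (kb n p) (by positivity)
    · have := (((lX p.1).const_mul (deriv θ p.2)).mul_const (u p)).mul_const (u p)
      rwa [mul_one] at this
  have L2 : ∀ i, Tendsto (fun n => ∫ p : Space d × ℝ,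
      θ p.2 * (r n * fderiv ℝ χ (r n • p.1) (basisVec i)) * u p * F i p) atTop (𝓝 0) := by
    intro i
    have kb : ∀ n (p : Space d × ℝ),
        ‖θ p.2 * (r n * fderiv ℝ χ (r n • p.1) (basisVec i))‖ ≤ c₀ * (r n * c₂ i) := fun n p => by
      rw [norm_mul, norm_mul, Real.norm_of_nonneg (hr0 n).le]
      exact mul_le_mul (h₀ _) (mul_le_mul_of_nonneg_left (h₂ i _) (hr0 n).le)
        (mul_nonneg (hr0 n).le (norm_nonneg _)) cn0
    have hI := (hG.memLp.norm.integrable_mul (hF.memLp_flux i).norm)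
    refine squeeze_zero_norm (a := fun n => c₀ * (r n * c₂ i) * ∫ p, ‖u p‖ * ‖F i p‖) (fun n => ?_) ?_
    · rw [← integral_const_mul]
      refine norm_integral_le_of_norm_le (hI.const_mul _) (Eventually.of_forall fun p => ?_)
      rw [norm_mul, norm_mul, mul_assoc]
      exact mul_le_mul_of_nonneg_right (kb n p) (by positivity)
    · have := ((hrl.mul_const (c₂ i)).const_mul c₀).mul_const (∫ p, ‖u p‖ * ‖F i p‖)
      simpa using this
  have L3 : ∀ i, Tendsto (fun n => ∫ p, θ p.2 * X n p.1 * G i p * F i p) atTop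
      (𝓝 (∫ p, θ p.2 * G i p * F i p)) := by
    intro i
    have kb : ∀ n (p : Space d × ℝ), ‖θ p.2 * X n p.1‖ ≤ c₀ := fun n p => by
      rw [norm_mul]
      calc _ ≤ c₀ * 1 := mul_le_mul (h₀ _) (hχ1 _) (norm_nonneg _) cn0
        _ = c₀ := mul_one _
    refine tendsto_integral_of_dominated_convergence (fun p => c₀ * (‖G i p‖ * ‖F i p‖))
      (fun n => (integrable_mul_mul ((hθ.continuous.comp continuous_snd).mul
        ((sX n).continuous.comp continuous_fst)).aestronglyMeasurable (kb n) (hG.memLp_grad i)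
        (hF.memLp_flux i)).aestronglyMeasurable)
      (((hG.memLp_grad i).norm.integrable_mul (hF.memLp_flux i).norm).const_mul _)
      (fun n => Eventually.of_forall fun p => ?_) (Eventually.of_forall fun p => ?_)
    · rw [norm_mul, norm_mul, mul_assoc]
      exact mul_le_mul_of_nonneg_right (kb n p) (by positivity)
    · have := (((lX p.1).const_mul (θ p.2)).mul_const (G i p)).mul_const (F i p)
      rwa [mul_one] at this
  have L4 := (tendsto_finsetSum Finset.univ fun i _ => (L2 i).add (L3 i)).const_mul 2
  simp only [zero_add] at L4
  refine tendsto_nhds_unique L1 (L4.congr fun n => ?_)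
  have := integral_local_energy hG hF (tζ n)
  simp only [d0, di] at this
  exact this.symm

end Energy

/-! ### The antisymmetric part of the coefficients as a drift. -/

section SkewPart

open Filter Topology Matrix

variable {d : ℕ}

/-- The antisymmetric part of a matrix field acts as a drift. -/
lemma integral_skew_form {A : Space d → Matrix (Fin d) (Fin d) ℝ}
    (hA : ∀ i j, ContDiff ℝ 1 fun x => A x i j) {v ψ : Space d → ℝ} (hv : ContDiff ℝ 1 v)
    (hψ : ContDiff ℝ 2 ψ) (hc : HasCompactSupport ψ) :
    ∫ x, ∑ i, ∑ j, ((A x i j - A x j i) / 2 * fderiv ℝ ψ x (basisVec i) *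
        fderiv ℝ v x (basisVec j) +
      (fderiv ℝ (fun z => A z i j) x (basisVec j) - fderiv ℝ (fun z => A z j i) x (basisVec j)) / 2 *
        fderiv ℝ ψ x (basisVec i) * v x) = 0 := by
  have hdψ := fun v => contDiff_fderiv_apply hψ v
  have hB : ∀ i j, ContDiff ℝ 1 fun x => (A x i j - A x j i) / 2 := fun i j =>
    ((hA i j).sub (hA j i)).div_const 2
  have hg : ∀ i j, ContDiff ℝ 1 fun x =>
      (A x i j - A x j i) / 2 * fderiv ℝ ψ x (basisVec i) * v x := fun i j =>
    ((hB i j).mul (hdψ _)).mul hv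
  have k := fun i j => integral_fderiv_eq_zero (μ := (volume : Measure (Space d))) (hg i j)
    ((hc.fderiv_apply ℝ _).mul_left).mul_right (basisVec j)
  have key : ∀ x, ∑ i, ∑ j, ((A x i j - A x j i) / 2 * fderiv ℝ ψ x (basisVec i) *
        fderiv ℝ v x (basisVec j) +
      (fderiv ℝ (fun z => A z i j) x (basisVec j) - fderiv ℝ (fun z => A z j i) x (basisVec j)) / 2 *
        fderiv ℝ ψ x (basisVec i) * v x) =
      ∑ i, ∑ j, fderiv ℝ (fun x => (A x i j - A x j i) / 2 * fderiv ℝ ψ x (basisVec i) * v x) x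
          (basisVec j) := by
    intro x
    have h0 := sum_skew_mul_eq_zero (fun i j => A x i j)
      (X := fun i j => fderiv ℝ (fun z => fderiv ℝ ψ z (basisVec i)) x (basisVec j) * v x)
      (fun i j => by rw [fderiv_fderiv_comm hψ])
    rw [← add_zero (∑ i, ∑ j, (_ + _)), ← h0]
    simp only [← Finset.sum_add_distrib]
    refine Finset.sum_congr rfl fun i _ => Finset.sum_congr rfl fun j _ => ?_
    have d1 := fun i j => (hA i j).differentiable one_ne_zero x
    rw [fderiv_mul_mul_apply ((hB i j).differentiable one_ne_zero x)
        ((hdψ _).differentiable one_ne_zero x) (hv.differentiable one_ne_zero x)]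
    have e : fderiv ℝ (fun z => (A z i j - A z j i) / 2) x (basisVec j) =
        (fderiv ℝ (fun z => A z i j) x (basisVec j) -
          fderiv ℝ (fun z => A z j i) x (basisVec j)) / 2 := by
      have := (((d1 i j).hasFDerivAt.fun_sub (d1 j i).hasFDerivAt).mul_const (2⁻¹ : ℝ)).fderiv
      simp only [div_eq_mul_inv]
      rw [this]
      simp [mul_comm]
    rw [e]
    ring
  simp only [key]
  rw [integral_finsetSum _ fun i _ => integrable_finsetSum _ fun j _ => (k i j).1]
  refine Finset.sum_eq_zero fun i _ => ?_
  rw [integral_finsetSum _ fun j _ => (k i j).1]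
  exact Finset.sum_eq_zero fun j _ => (k i j).2

variable {a : MatrixField d} {lam K α β : ℝ} {u η : Space d × ℝ → ℝ} {G : Fin d → Space d × ℝ → ℝ}

lemma matVec_eq_symPart_add_skewPart (a : MatrixField d) (x : Space d) (t : ℝ) (v : Space d) :
    matVec (a x t) v = matVec (symPart a x t) v + matVec (skewPart a x t) v := by
  ext i
  rw [PiLp.add_apply, matVec_apply, matVec_apply, matVec_apply, ← Finset.sum_add_distrib]
  refine Finset.sum_congr rfl fun j _ => ?_
  simp only [symPart, skewPart, Matrix.of_apply]
  ring

/-- The coefficient of the gradient in the antisymmetric part of the weak form. -/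
def skewCoeff (a : MatrixField d) (η : Space d × ℝ → ℝ) (i j : Fin d) (p : Space d × ℝ) : ℝ :=
  skewPart a p.1 p.2 i j * fderiv ℝ η p (spaceDir i)

/-- The drift term in the antisymmetric part of the weak form. -/
def driftCoeff (a : MatrixField d) (η : Space d × ℝ → ℝ) (p : Space d × ℝ) : ℝ :=
  inner ℝ (skewDrift a p.1 p.2) (spaceGrad η p)

/-- A weight in time making the antisymmetric part bounded on compact sets. -/
def skewWeight (a : MatrixField d) (t : ℝ) : ℝ := (1 + ∑ i, ∑ j, |skewPart a 0 t i j|)⁻¹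

lemma skewWeight_pos (a : MatrixField d) (t : ℝ) : 0 < skewWeight a t := by
  unfold skewWeight
  positivity

lemma fderiv_slice {f : Space d × ℝ → ℝ} (hf : ContDiff ℝ ∞ f) (p : Space d × ℝ) (i : Fin d) :
    fderiv ℝ (fun z => f (z, p.2)) p.1 (basisVec i) = fderiv ℝ f p (spaceDir i) := by
  rw [fderiv_basisVec_of_hasGradientAt (hasGradientAt_slice hf p), spaceGrad_apply hf]

namespace IsRegularField

lemma measurable_skewPart (h : IsRegularField a lam K) (i j : Fin d) :
    Measurable fun p : Space d × ℝ => skewPart a p.1 p.2 i j :=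
  ((h.measurable i j).sub (h.measurable j i)).div_const 2

lemma measurable_skewWeight (h : IsRegularField a lam K) : Measurable (skewWeight a) := by
  refine (measurable_const.add (Finset.measurable_fun_sum _ fun i _ =>
    Finset.measurable_fun_sum _ fun j _ => ?_)).inv
  exact measurable_abs.comp ((h.measurable_skewPart i j).comp
    (by fun_prop : Measurable fun t : ℝ => ((0 : Space d), t)))

/-- Entries at `x` and at the origin differ by at most `K‖x‖` at every time, so it is enough to
divide by the size at the origin. The weight depends on time only and can later be divided out slice
by slice. -/
lemma skewWeight_mul_le (hK : 0 ≤ K) (h : IsRegularField a lam K) (x : Space d) (t : ℝ)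
    (i j : Fin d) : skewWeight a t * |skewPart a x t i j| ≤ 1 + K * ‖x‖ := by
  set σ := ∑ i, ∑ j, |skewPart a 0 t i j| with hσ
  have hσ0 : 0 ≤ σ := by positivity
  have h1 : |skewPart a 0 t i j| ≤ σ :=
    (Finset.single_le_sum (f := fun j => |skewPart a 0 t i j|) (fun _ _ => abs_nonneg _)
      (Finset.mem_univ j)).trans (Finset.single_le_sum (f := fun i => ∑ j, |skewPart a 0 t i j|)
      (fun _ _ => Finset.sum_nonneg fun _ _ => abs_nonneg _) (Finset.mem_univ i))
  have h2 : |skewPart a x t i j - skewPart a 0 t i j| ≤ K * ‖x‖ := by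
    have h1 := h.abs_sub_le x 0 t i j
    have h2 := h.abs_sub_le x 0 t j i
    rw [sub_zero] at h1 h2
    rw [abs_le] at *
    simp only [skewPart, Matrix.of_apply]
    constructor <;> linarith [h1.1, h1.2, h2.1, h2.2]
  have h3 : |skewPart a x t i j| ≤ σ + K * ‖x‖ := by
    have := abs_sub_abs_le_abs_sub (skewPart a x t i j) (skewPart a 0 t i j)
    linarith
  have h4 : 0 ≤ K * ‖x‖ := by positivity
  unfold skewWeight
  rw [← hσ, inv_mul_le_iff₀ (by positivity)]
  nlinarith

/-- For smooth functions the antisymmetric part acts as a drift on each time slice. -/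
lemma integral_skew_slice (h : IsRegularField a lam K) (hη : ContDiff ℝ ∞ η)
    (hc : HasCompactSupport η) {v : Space d × ℝ → ℝ} (hv : ContDiff ℝ ∞ v) (t : ℝ) :
    ∫ x, (∑ i, ∑ j, skewCoeff a η i j (x, t) * fderiv ℝ v (x, t) (spaceDir j) +
      driftCoeff a η (x, t) * v (x, t)) = 0 := by
  have sη : ContDiff ℝ 2 fun x => η (x, t) :=
    (hη.comp (contDiff_id.prodMk contDiff_const)).of_le (by norm_cast)
  have sv : ContDiff ℝ 1 fun x => v (x, t) :=
    (hv.comp (contDiff_id.prodMk contDiff_const)).of_le (by norm_cast)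
  rw [← integral_skew_form (A := fun x => a x t) (h.contDiff t) sv sη (hasCompactSupport_slice hc t)]
  refine integral_congr_ae (Eventually.of_forall fun x => ?_)
  simp only [fderiv_slice hη (x, t), fderiv_slice hv (x, t), skewCoeff, driftCoeff,
    Finset.sum_add_distrib]
  congr 1
  rw [inner_eq_sum, Finset.sum_mul]
  refine Finset.sum_congr rfl fun i _ => ?_
  rw [spaceGrad_apply hη, ← Finset.sum_mul, ← Finset.sum_mul]
  rfl

lemma measurable_skewCoeff (h : IsRegularField a lam K) (hη : ContDiff ℝ ∞ η) (i j : Fin d) :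
    Measurable (skewCoeff a η i j) :=
  (h.measurable_skewPart i j).mul (contDiff_fderiv_const hη _).continuous.measurable

lemma measurable_driftCoeff (h : IsRegularField a lam K) (hη : ContDiff ℝ ∞ η) :
    Measurable (driftCoeff a η) :=
  h.measurable_skewDrift.inner (continuous_spaceGrad hη).measurable

lemma exists_bound_skewCoeff (hK : 0 ≤ K) (h : IsRegularField a lam K) (hη : ContDiff ℝ ∞ η)
    (hc : HasCompactSupport η) :
    ∃ c, 0 ≤ c ∧ ∀ p, (∀ i j, |skewWeight a p.2 * skewCoeff a η i j p| ≤ c) ∧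
      |skewWeight a p.2 * driftCoeff a η p| ≤ c := by
  obtain ⟨B, hB0, hB⟩ := exists_bound_testFunction hη hc
  obtain ⟨ρ, hρ0, hρ⟩ : ∃ ρ : ℝ, 0 ≤ ρ ∧ ∀ p ∈ tsupport η, ‖p.1‖ ≤ ρ := by
    obtain ⟨ρ, hρ⟩ := hc.isCompact.isBounded.exists_norm_le
    exact ⟨|ρ|, abs_nonneg _, fun p hp => ((norm_fst_le p).trans (hρ p hp)).trans (le_abs_self _)⟩
  have hd : (0 : ℝ) ≤ d := d.cast_nonneg
  have hw1 : ∀ t, skewWeight a t ≤ 1 := fun t => inv_le_one_of_one_le₀ (by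
    have : 0 ≤ ∑ i, ∑ j, |skewPart a 0 t i j| := by positivity
    linarith)
  refine ⟨(1 + K * ρ) * B + d * (d * K) * B, by positivity, fun p => ⟨fun i j => ?_, ?_⟩⟩
  · have n1 : 0 ≤ d * (d * K) * B := by positivity
    by_cases hp : p ∈ tsupport η
    · have h1 := h.skewWeight_mul_le hK p.1 p.2 i j
      have h2 : |fderiv ℝ η p (spaceDir i)| ≤ B := by
        rw [← spaceGrad_apply hη]
        exact (abs_apply_le_norm _ _).trans (hB p).2.2
      rw [skewCoeff, ← mul_assoc, abs_mul, abs_mul, abs_of_pos (skewWeight_pos a p.2)]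
      have h3 : 1 + K * ‖p.1‖ ≤ 1 + K * ρ := by gcongr; exact hρ p hp
      have := mul_le_mul (h1.trans h3) h2 (abs_nonneg _) (by positivity)
      linarith
    · have h0 : fderiv ℝ η p = 0 := image_eq_zero_of_notMem_tsupport fun hm =>
        hp (tsupport_fderiv_subset ℝ hm)
      rw [skewCoeff, h0]
      simp only [_root_.zero_apply, mul_zero, abs_zero]
      positivity
  · have n1 : 0 ≤ (1 + K * ρ) * B := by positivity
    rw [abs_mul, abs_of_pos (skewWeight_pos a p.2)]
    have h1 : |driftCoeff a η p| ≤ d * (d * K) * B :=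
      (abs_real_inner_le_norm _ _).trans (mul_le_mul (h.norm_skewDrift_le p.1 p.2) (hB p).2.2
        (norm_nonneg _) (by positivity))
    have := mul_le_mul (hw1 p.2) h1 (abs_nonneg _) zero_le_one
    linarith

end IsRegularField

end SkewPart

/-! ### Weak formulation with the symmetric part and the drift. -/

section WeakForm

open Filter Topology Matrix

variable {d : ℕ} {a : MatrixField d} {lam K α β : ℝ} {u η : Space d × ℝ → ℝ}
  {G : Fin d → Space d × ℝ → ℝ}

/-- The antisymmetric part of the weak form applied to a function and its gradient. -/
def skewForm (a : MatrixField d) (η u : Space d × ℝ → ℝ) (G : Fin d → Space d × ℝ → ℝ)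
    (p : Space d × ℝ) : ℝ :=
  ∑ i, ∑ j, skewCoeff a η i j p * G j p + driftCoeff a η p * u p

lemma memLp_indicator_tsupport (hc : HasCompactSupport η) :
    MemLp ((tsupport η).indicator fun _ => (1 : ℝ)) 2 (volume : Measure (Space d × ℝ)) :=
  memLp_indicator_const 2 (isClosed_tsupport η).measurableSet 1
    (Or.inr hc.isCompact.measure_lt_top.ne)

/-- The coefficients vanish off the support of `η`, so the indicator may be inserted freely. It
supplies the second square integrable factor that `tendsto_integral_mul_mul` requires. -/
lemma skewForm_mul_indicator (hη : ContDiff ℝ ∞ η) (k : ℝ) (p : Space d × ℝ) :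
    k * skewForm a η u G p =
      ∑ i, ∑ j, k * skewCoeff a η i j p * G j p * (tsupport η).indicator (fun _ => (1 : ℝ)) p +
      k * driftCoeff a η p * u p * (tsupport η).indicator (fun _ => (1 : ℝ)) p := by
  unfold skewForm
  by_cases hp : p ∈ tsupport η
  · simp only [indicator_of_mem hp, mul_one, mul_add, Finset.mul_sum, mul_assoc]
  · have h0 : fderiv ℝ η p = 0 := image_eq_zero_of_notMem_tsupport fun hm =>
      hp (tsupport_fderiv_subset ℝ hm)
    have h1 : spaceGrad η p = 0 := by
      ext i
      rw [spaceGrad_apply hη, h0]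
      rfl
    simp [indicator_of_notMem hp, skewCoeff, driftCoeff, h0, h1]

namespace IsRegularField

lemma exists_bound_weighted (hK : 0 ≤ K) (h : IsRegularField a lam K)
    (hη : ContDiff ℝ ∞ η) (hc : HasCompactSupport η) {I : Set ℝ} (hI : MeasurableSet I) :
    ∃ c, (∀ i j, AEStronglyMeasurable (fun p : Space d × ℝ =>
        I.indicator (skewWeight a) p.2 * skewCoeff a η i j p) volume ∧
        ∀ p : Space d × ℝ, ‖I.indicator (skewWeight a) p.2 * skewCoeff a η i j p‖ ≤ c) ∧
      AEStronglyMeasurable (fun p : Space d × ℝ =>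
        I.indicator (skewWeight a) p.2 * driftCoeff a η p) volume ∧
        ∀ p : Space d × ℝ, ‖I.indicator (skewWeight a) p.2 * driftCoeff a η p‖ ≤ c := by
  obtain ⟨c, hc0, hcb⟩ := h.exists_bound_skewCoeff hK hη hc
  have hw : Measurable fun p : Space d × ℝ => I.indicator (skewWeight a) p.2 :=
    (h.measurable_skewWeight.indicator hI).comp measurable_snd
  refine ⟨c, fun i j => ⟨(hw.mul (h.measurable_skewCoeff hη i j)).aestronglyMeasurable, fun p => ?_⟩,
    (hw.mul (h.measurable_driftCoeff hη)).aestronglyMeasurable, fun p => ?_⟩ <;>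
  by_cases hp : p.2 ∈ I
  · rw [indicator_of_mem hp]
    exact (hcb p).1 i j
  · rw [indicator_of_notMem hp, zero_mul, norm_zero]
    exact hc0
  · rw [indicator_of_mem hp]
    exact (hcb p).2
  · rw [indicator_of_notMem hp, zero_mul, norm_zero]
    exact hc0

lemma integral_weighted_skewForm (hK : 0 ≤ K) (h : IsRegularField a lam K)
    (hη : ContDiff ℝ ∞ η) (hc : HasCompactSupport η) {I : Set ℝ} (hI : MeasurableSet I)
    (hu : MemLp u 2) (hG : ∀ i, MemLp (G i) 2) :
    Integrable (fun p : Space d × ℝ => I.indicator (skewWeight a) p.2 * skewForm a η u G p) ∧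
    ∫ p : Space d × ℝ, I.indicator (skewWeight a) p.2 * skewForm a η u G p =
      ∑ i, ∑ j, (∫ p : Space d × ℝ, I.indicator (skewWeight a) p.2 * skewCoeff a η i j p * G j p *
        (tsupport η).indicator (fun _ => (1 : ℝ)) p) +
      ∫ p : Space d × ℝ, I.indicator (skewWeight a) p.2 * driftCoeff a η p * u p *
        (tsupport η).indicator (fun _ => (1 : ℝ)) p := by
  obtain ⟨c, h1, h2, h3⟩ := h.exists_bound_weighted hK hη hc hI
  have hχ := memLp_indicator_tsupport (d := d) hc
  have j1 := fun i j => integrable_mul_mul (h1 i j).1 (h1 i j).2 (hG j) hχ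
  have j2 := integrable_mul_mul h2 h3 hu hχ
  have j3 := integrable_finsetSum Finset.univ fun i _ => integrable_finsetSum Finset.univ fun j _ =>
    j1 i j
  simp only [skewForm_mul_indicator hη]
  refine ⟨j3.add j2, ?_⟩
  rw [integral_add j3 j2, integral_finsetSum _ fun i _ =>
    integrable_finsetSum Finset.univ fun j _ => j1 i j]
  congr 1
  exact Finset.sum_congr rfl fun i _ => integral_finsetSum _ fun j _ => j1 i j

/-- For mollified functions the identity holds on each slice, provided the mollification radius is
below the margin `δ`, so that the mollified `G` is a classical gradient on `I`. The weighted
coefficients are bounded, which allows the passage to the limit. -/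
lemma integral_weighted_skewForm_eq_zero (hK : 0 ≤ K) (h : IsRegularField a lam K)
    (hη : ContDiff ℝ ∞ η) (hc : HasCompactSupport η) (hG : IsWeakGradient α β u G) {I : Set ℝ}
    (hI : MeasurableSet I) {δ : ℝ} (hδ : 0 < δ) (hsub : I ⊆ Icc (α + δ) (β - δ)) :
    ∫ p : Space d × ℝ, I.indicator (skewWeight a) p.2 * skewForm a η u G p = 0 := by
  obtain ⟨c, h1, h2, h3⟩ := h.exists_bound_weighted hK hη hc hI
  have hχ := memLp_indicator_tsupport (d := d) hc
  have lχ : Tendsto (fun _ : ℕ => eLpNorm ((tsupport η).indicator (fun _ => (1 : ℝ)) -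
      (tsupport η).indicator fun _ => (1 : ℝ)) 2 (volume : Measure (Space d × ℝ))) atTop (𝓝 0) := by
    simp
  have mu := fun n => (memLp_mollify n hG.memLp).1
  have mg := fun i n => (memLp_mollify n (hG.memLp_grad i)).1
  have l1 := fun i j => tendsto_integral_mul_mul (h1 i j).1 (h1 i j).2 (hG.memLp_grad j) hχ (mg j)
    (fun _ => hχ) (tendsto_mollify (hG.memLp_grad j)) lχ
  have l2 := tendsto_integral_mul_mul h2 h3 hG.memLp hχ mu (fun _ => hχ)
    (tendsto_mollify hG.memLp) lχ
  have l3 := (tendsto_finsetSum Finset.univ fun i _ =>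
    tendsto_finsetSum Finset.univ fun j _ => l1 i j).add l2
  rw [(h.integral_weighted_skewForm hK hη hc hI hG.memLp hG.memLp_grad).2]
  refine tendsto_nhds_unique l3 (tendsto_const_nhds.congr' ?_)
  have hn : ∀ᶠ n : ℕ in atTop, (1 : ℝ) / (n + 1) < δ :=
    tendsto_one_div_add_atTop_nhds_zero_nat.eventually_lt_const hδ
  filter_upwards [hn] with n hn
  obtain ⟨j, e⟩ := h.integral_weighted_skewForm hK hη hc hI (mu n) fun i => mg i n
  rw [← e]
  rw [Measure.volume_eq_prod] at j ⊢
  rw [integral_prod_symm _ j]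
  refine (integral_eq_zero_of_ae (Eventually.of_forall fun t => ?_)).symm
  by_cases ht : t ∈ I
  · have hv := contDiff_mollify n (hG.memLp.locallyIntegrable (by norm_num))
    have e2 := h.integral_skew_slice hη hc hv t
    simp only [indicator_of_mem ht, Pi.zero_apply]
    rw [integral_const_mul]
    refine mul_eq_zero_of_right _ (Eq.trans ?_ e2)
    refine integral_congr_ae (Eventually.of_forall fun x => ?_)
    have ha : α < (x, t).2 - 1 / ((n : ℝ) + 1) := by
      have := (hsub ht).1
      change α < t - _
      linarith
    have hb : (x, t).2 + 1 / ((n : ℝ) + 1) < β := by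
      have := (hsub ht).2
      change t + _ < β
      linarith
    simp only [skewForm, fun j => hG.fderiv_mollify ha hb j]
  · simp [indicator_of_notMem ht]

/-- For almost every time the antisymmetric part acts on weakly differentiable functions as a
drift. -/
lemma ae_integral_skewForm (hK : 0 ≤ K) (h : IsRegularField a lam K)
    (hη : ContDiff ℝ ∞ η) (hc : HasCompactSupport η) (hG : IsWeakGradient α β u G) :
    ∀ᵐ t : ℝ, (Integrable fun x => skewForm a η u G (x, t)) ∧
      (t ∈ Ioo α β → ∫ x, skewForm a η u G (x, t) = 0) := by
  have e0 : ∀ᵐ t : ℝ, Integrable fun x => skewForm a η u G (x, t) := by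
    have j := (h.integral_weighted_skewForm hK hη hc MeasurableSet.univ hG.memLp hG.memLp_grad).1
    rw [Measure.volume_eq_prod] at j
    filter_upwards [j.prod_left_ae] with t ht
    simp only [indicator_univ] at ht
    have := ht.const_mul (skewWeight a t)⁻¹
    refine this.congr (Eventually.of_forall fun x => ?_)
    exact inv_mul_cancel_left₀ (skewWeight_pos a t).ne' _
  -- The open interval is exhausted by closed ones, each leaving the margin that mollification
  -- needs.
  have e1 : ∀ m : ℕ, ∀ᵐ t : ℝ, t ∈ Icc (α + 1 / ((m : ℝ) + 1)) (β - 1 / ((m : ℝ) + 1)) →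
      ∫ x, skewForm a η u G (x, t) = 0 := by
    intro m
    set J := Icc (α + 1 / ((m : ℝ) + 1)) (β - 1 / ((m : ℝ) + 1)) with hJ
    have hJm : MeasurableSet J := measurableSet_Icc
    set H : ℝ → ℝ := fun t => J.indicator (skewWeight a) t * ∫ x, skewForm a η u G (x, t) with hH
    have hi : Integrable H := by
      have j := (h.integral_weighted_skewForm hK hη hc hJm hG.memLp hG.memLp_grad).1
      rw [Measure.volume_eq_prod] at j
      refine j.integral_prod_right.congr (Eventually.of_forall fun t => ?_)
      exact integral_const_mul (J.indicator (skewWeight a) t) (fun x => skewForm a η u G (x, t))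
    -- Since `I` was arbitrary, the identity may be restricted to any measurable set of times; it
    -- therefore holds for almost every time, and the positive weight is divided out.
    have hz : H =ᵐ[volume] 0 := by
      refine hi.ae_eq_zero_of_forall_setIntegral_eq_zero fun A hA _ => ?_
      have hm := hA.inter hJm
      have e2 := h.integral_weighted_skewForm_eq_zero hK hη hc hG hm
        (δ := 1 / ((m : ℝ) + 1)) (by positivity) inter_subset_right
      have j := (h.integral_weighted_skewForm hK hη hc hm hG.memLp hG.memLp_grad).1
      rw [Measure.volume_eq_prod] at e2 j
      rw [integral_prod_symm _ j] at e2
      rw [← integral_indicator hA, ← e2]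
      congr 1
      ext t
      simp only
      rw [integral_const_mul, ← indicator_indicator]
      by_cases ht : t ∈ A
      · rw [indicator_of_mem ht, indicator_of_mem ht]
      · rw [indicator_of_notMem ht, indicator_of_notMem ht, zero_mul]
    filter_upwards [hz] with t ht hmem
    simp only [hH, indicator_of_mem hmem, Pi.zero_apply] at ht
    exact (mul_eq_zero.mp ht).resolve_left (skewWeight_pos a t).ne'
  filter_upwards [e0, ae_all_iff.mpr e1] with t h0 ht
  refine ⟨h0, fun hmem => ?_⟩
  have h1 : ∀ᶠ m : ℕ in atTop, (1 : ℝ) / (m + 1) < min (t - α) (β - t) :=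
    tendsto_one_div_add_atTop_nhds_zero_nat.eventually_lt_const
      (lt_min (by linarith [hmem.1]) (by linarith [hmem.2]))
  obtain ⟨m, hm⟩ := h1.exists
  rw [lt_min_iff] at hm
  exact ht m ⟨by linarith [hm.1], by linarith [hm.2]⟩

/-- Joint integrability holds in this form because only the symmetric part and the drift enter, both
of which are bounded. -/
lemma integrable_weak_form (hlam : 0 < lam) (hK : 0 ≤ K) (h : IsRegularField a lam K)
    (hη : ContDiff ℝ ∞ η) (hc : HasCompactSupport η) (hu : MemLp u 2) {V : Space d × ℝ → Space d}
    (hV : ∀ i, MemLp (fun p => V p i) 2) :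
    Integrable fun p => inner ℝ (V p) (testFlux a η p) + u p * testSource a η p := by
  obtain ⟨B, hB0, hB⟩ := h.exists_bound_test hlam hK hη hc
  have hχ := memLp_indicator_tsupport (d := d) hc
  have j1 := integrable_mul_mul (h.measurable_testSource hη).aestronglyMeasurable
    (fun p => (hB p).2.1) hu hχ
  have j2 := fun i => integrable_mul_mul
    (measurable_coord (h.measurable_testFlux hη) i).aestronglyMeasurable
    (fun p => (abs_apply_le_norm _ i).trans (hB p).2.2) (hV i) hχ
  refine ((integrable_finsetSum Finset.univ fun i _ => j2 i).add j1).congr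
    (Eventually.of_forall fun p => ?_)
  simp only [Pi.add_apply]
  by_cases hp : p ∈ tsupport η
  · simp only [indicator_of_mem hp, mul_one, inner_eq_sum]
    congr 1
    · exact Finset.sum_congr rfl fun i _ => mul_comm _ _
    · exact mul_comm _ _
  · have h0 : fderiv ℝ η p = 0 := image_eq_zero_of_notMem_tsupport fun hm =>
      hp (tsupport_fderiv_subset ℝ hm)
    have h1 : spaceGrad η p = 0 := by
      ext i
      rw [spaceGrad_apply hη, h0]
      rfl
    have h2 : timeDeriv η p = 0 := by rw [timeDeriv_eq hη, h0]; rfl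
    simp [indicator_of_notMem hp, testFlux, testSource, h1, h2]

/-- The iterated weak form with the full matrix is the joint weak form with the symmetric part and
the drift. -/
theorem integral_weak_form (hlam : 0 < lam) (hK : 0 ≤ K) (h : IsRegularField a lam K)
    (hη : ContDiff ℝ ∞ η) (hc : HasCompactSupport η) {V : Space d × ℝ → Space d}
    (hG : IsWeakGradient α β u fun i p => V p i) :
    ∫ t in Ioo α β, ∫ x, (inner ℝ (matVec (a x t) (V (x, t))) (spaceGrad η (x, t)) -
        u (x, t) * timeDeriv η (x, t)) =
      ∫ p in (univ : Set (Space d)) ×ˢ Ioo α β,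
        (inner ℝ (V p) (testFlux a η p) + u p * testSource a η p) := by
  have j := h.integrable_weak_form hlam hK hη hc hG.memLp hG.memLp_grad
  have e : (volume : Measure (Space d × ℝ)).restrict (univ ×ˢ Ioo α β) =
      (volume : Measure (Space d)).prod (volume.restrict (Ioo α β)) := by
    rw [Measure.volume_eq_prod, ← Measure.prod_restrict, Measure.restrict_univ]
  have j1 := j.integrableOn (s := (univ : Set (Space d)) ×ˢ Ioo α β)
  rw [IntegrableOn, e] at j1
  rw [e, integral_prod_symm _ j1]
  refine setIntegral_congr_ae measurableSet_Ioo ?_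
  rw [Measure.volume_eq_prod] at j
  filter_upwards [h.ae_integral_skewForm hK hη hc hG, j.prod_left_ae] with t ht hjt hmem
  -- Adding the slice integral of `skewForm`, which is zero, restores the full matrix.
  have e2 := integral_add hjt ht.1
  rw [ht.2 hmem, add_zero] at e2
  rw [← e2]
  refine integral_congr_ae (Eventually.of_forall fun x => ?_)
  simp only [testFlux, testSource, skewForm, driftCoeff]
  rw [matVec_eq_symPart_add_skewPart, inner_add_left,
    inner_matVec_comm (symPart_isSymm a x t), inner_matVec (skewPart a x t)]
  have e3 : ∑ i, ∑ j, skewPart a x t i j * (V (x, t)) j * (spaceGrad η (x, t)) i =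
      ∑ i, ∑ j, skewCoeff a η i j (x, t) * V (x, t) j := by
    refine Finset.sum_congr rfl fun i _ => Finset.sum_congr rfl fun j _ => ?_
    rw [spaceGrad_apply hη, skewCoeff]
    ring
  rw [e3]
  ring

end IsRegularField

end WeakForm

/-! ### The energy inequality for the given equation. -/

section EnergyInequality

open Filter Topology Matrix

variable {d : ℕ} {a : MatrixField d} {lam K α β : ℝ} {u η : Space d × ℝ → ℝ}
  {V : Space d × ℝ → Space d}

/-- The flux of a solution, in which the antisymmetric part enters as a drift. -/
def driftFlux (a : MatrixField d) (u : Space d × ℝ → ℝ) (V : Space d × ℝ → Space d) (i : Fin d)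
    (p : Space d × ℝ) : ℝ :=
  ∑ j, symPart a p.1 p.2 i j * V p j - skewDrift a p.1 p.2 i * u p

lemma memLp_bounded_mul {k f : Space d × ℝ → ℝ} {c : ℝ} (hk : AEStronglyMeasurable k volume)
    (hkb : ∀ p, |k p| ≤ c) (hf : MemLp f 2) : MemLp (fun p => k p * f p) 2 :=
  hf.of_le_mul (hk.mul hf.1) (Eventually.of_forall fun p => by
    rw [norm_mul]
    exact mul_le_mul_of_nonneg_right (hkb p) (norm_nonneg _))

lemma sum_mul_driftFlux (a : MatrixField d) (u : Space d × ℝ → ℝ) (V : Space d × ℝ → Space d)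
    (p : Space d × ℝ) (w : Space d) : ∑ i, w i * driftFlux a u V i p =
      inner ℝ (matVec (symPart a p.1 p.2) (V p)) w - u p * inner ℝ (skewDrift a p.1 p.2) w := by
  rw [inner_eq_sum, inner_eq_sum, Finset.mul_sum, ← Finset.sum_sub_distrib]
  refine Finset.sum_congr rfl fun i _ => ?_
  rw [matVec_apply, driftFlux]
  ring

namespace IsRegularField

lemma memLp_driftFlux (hlam : 0 < lam) (h : IsRegularField a lam K)
    (hu : MemLp u 2) (hV : ∀ i, MemLp (fun p => V p i) 2) (i : Fin d) :
    MemLp (driftFlux a u V i) 2 := by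
  refine MemLp.sub (memLp_finsetSum Finset.univ fun j _ => ?_) ?_
  · exact memLp_bounded_mul (h.measurable_symPart i j).aestronglyMeasurable
      (fun p => h.abs_symPart_le hlam _ _ _ _) (hV j)
  · exact memLp_bounded_mul (measurable_coord h.measurable_skewDrift i).aestronglyMeasurable
      (fun p => (abs_apply_le_norm _ i).trans (h.norm_skewDrift_le _ _)) hu

/-- Solutions of the joint weak form solve an equation in divergence form. -/
lemma isWeakDivergence (hlam : 0 < lam) (h : IsRegularField a lam K)
    (hG : IsWeakGradient α β u fun i p => V p i)
    (hV : ∀ η, IsTestFunction (Ioo α β) η →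
      ∫ p, (inner ℝ (V p) (testFlux a η p) + u p * testSource a η p) = 0) :
    IsWeakDivergence α β u (driftFlux a u V) where
  memLp := hG.memLp
  memLp_flux := h.memLp_driftFlux hlam hG.memLp hG.memLp_grad
  time := by
    intro η hη
    have m : ∀ v, MemLp (fun p => fderiv ℝ η p v) 2 := fun v =>
      (contDiff_fderiv_const hη.smooth v).continuous.memLp_of_hasCompactSupport
        (hη.compact.fderiv_apply ℝ v)
    have j1 : ∀ i, Integrable fun p => fderiv ℝ η p (spaceDir i) * driftFlux a u V i p := fun i =>
      (m _).integrable_mul (h.memLp_driftFlux hlam hG.memLp hG.memLp_grad i)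
    have j2 : Integrable fun p => fderiv ℝ η p (0, 1) * u p := (m _).integrable_mul hG.memLp
    rw [← integral_finsetSum _ fun i _ => j1 i, ← sub_eq_zero,
      ← integral_sub j2 (integrable_finsetSum _ fun i _ => j1 i), ← neg_eq_zero, ← integral_neg,
      ← hV η hη]
    refine integral_congr_ae (Eventually.of_forall fun p => ?_)
    have e := sum_mul_driftFlux a u V p (spaceGrad η p)
    simp only [spaceGrad_apply hη.smooth] at e
    simp only [testFlux, testSource, timeDeriv_eq hη.smooth]
    rw [e, inner_matVec_comm (symPart_isSymm a p.1 p.2)]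
    ring

/-- The energy inequality with a nonnegative weight in time. -/
theorem energy_le (hlam : 0 < lam) (h : IsRegularField a lam K)
    (hG : IsWeakGradient α β u fun i p => V p i)
    (hV : ∀ η, IsTestFunction (Ioo α β) η →
      ∫ p, (inner ℝ (V p) (testFlux a η p) + u p * testSource a η p) = 0)
    {θ : ℝ → ℝ} (hθ : ContDiff ℝ ∞ θ) (cθ : HasCompactSupport θ) (sθ : tsupport θ ⊆ Ioo α β)
    (hθ0 : ∀ t, 0 ≤ θ t) :
    (Integrable fun p : Space d × ℝ => θ p.2 * ‖V p‖ ^ 2) ∧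
    (Integrable fun p : Space d × ℝ => (deriv θ p.2 + lam * (d * (d * K)) ^ 2 * θ p.2) * u p ^ 2) ∧
    lam⁻¹ * ∫ p : Space d × ℝ, θ p.2 * ‖V p‖ ^ 2 ≤
      ∫ p : Space d × ℝ, (deriv θ p.2 + lam * (d * (d * K)) ^ 2 * θ p.2) * u p ^ 2 := by
  obtain ⟨c₀, h₀⟩ := cθ.exists_bound_of_continuous hθ.continuous
  have hdθ : Continuous (deriv θ) := hθ.continuous_deriv (by simp)
  obtain ⟨c₁, h₁⟩ := cθ.deriv.exists_bound_of_continuous hdθ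
  have a0 : AEStronglyMeasurable (fun p : Space d × ℝ => θ p.2) volume :=
    (hθ.continuous.comp continuous_snd).aestronglyMeasurable
  have a1 : AEStronglyMeasurable (fun p : Space d × ℝ => deriv θ p.2) volume :=
    (hdθ.comp continuous_snd).aestronglyMeasurable
  have mF := h.memLp_driftFlux hlam hG.memLp hG.memLp_grad
  have j0 := fun i => integrable_mul_mul a0 (fun p => h₀ p.2) (hG.memLp_grad i) (mF i)
  have j1 := integrable_mul_mul a1 (fun p => h₁ p.2) hG.memLp hG.memLp
  have j2 := integrable_mul_mul a0 (fun p => h₀ p.2) hG.memLp hG.memLp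
  have j3 := fun i => integrable_mul_mul a0 (fun p => h₀ p.2) (hG.memLp_grad i) (hG.memLp_grad i)
  have i1 : Integrable fun p : Space d × ℝ => θ p.2 * ‖V p‖ ^ 2 := by
    refine (integrable_finsetSum Finset.univ fun i _ => j3 i).congr
      (Eventually.of_forall fun p => ?_)
    simp only [EuclideanSpace.real_norm_sq_eq, Finset.mul_sum]
    exact Finset.sum_congr rfl fun i _ => by ring
  have i2 : Integrable fun p : Space d × ℝ =>
      (deriv θ p.2 + lam * (d * (d * K)) ^ 2 * θ p.2) * u p ^ 2 := by
    refine (j1.add (j2.const_mul (lam * (d * (d * K)) ^ 2))).congr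
      (Eventually.of_forall fun p => ?_)
    simp only [Pi.add_apply]
    ring
  refine ⟨i1, i2, ?_⟩
  have e := integral_energy hG (h.isWeakDivergence hlam hG hV) hθ cθ sθ
  rw [← integral_finsetSum _ fun i _ => j0 i] at e
  have e2 : ∫ p : Space d × ℝ, (deriv θ p.2 + lam * (d * (d * K)) ^ 2 * θ p.2) * u p ^ 2 =
      ∫ p : Space d × ℝ, (2 * (∑ i, θ p.2 * V p i * driftFlux a u V i p) +
        lam * (d * (d * K)) ^ 2 * (θ p.2 * u p * u p)) := by
    rw [integral_add ((integrable_finsetSum _ fun i _ => j0 i).const_mul 2) (j2.const_mul _),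
      integral_const_mul, ← e, ← integral_add j1 (j2.const_mul _)]
    exact integral_congr_ae (Eventually.of_forall fun p => by ring)
  rw [e2, ← integral_const_mul]
  refine integral_mono (i1.const_mul _)
    (((integrable_finsetSum _ fun i _ => j0 i).const_mul 2).add (j2.const_mul _)) fun p => ?_
  simp only [mul_assoc, ← Finset.mul_sum, sum_mul_driftFlux]
  have b1 := (h.matBetween p.1 p.2).lower (V p)
  have b2 : u p * inner ℝ (skewDrift a p.1 p.2) (V p) ≤ |u p| * (d * (d * K) * ‖V p‖) := by
    refine (le_abs_self _).trans ?_
    rw [abs_mul]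
    refine mul_le_mul_of_nonneg_left ((abs_real_inner_le_norm _ _).trans ?_) (abs_nonneg _)
    exact mul_le_mul_of_nonneg_right (h.norm_skewDrift_le _ _) (norm_nonneg _)
  set C := (d : ℝ) * (d * K)
  set N := ‖V p‖
  -- Young's inequality as a square: the drift term `2C|u|N` is absorbed by one of the two copies of
  -- `λ⁻¹N²` that ellipticity provides, at the cost of `λC²u²`.
  have b3 : 0 ≤ lam⁻¹ * (N - lam * C * |u p|) ^ 2 := by positivity
  have b4 : lam⁻¹ * (N - lam * C * |u p|) ^ 2 =
      lam⁻¹ * N ^ 2 - 2 * C * |u p| * N + lam * C ^ 2 * |u p| ^ 2 := by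
    field_simp
    ring
  rw [sq_abs] at b4
  have b5 : lam⁻¹ * N ^ 2 ≤ 2 * (inner ℝ (matVec (symPart a p.1 p.2) (V p)) (V p) -
      u p * inner ℝ (skewDrift a p.1 p.2) (V p)) + lam * C ^ 2 * u p ^ 2 := by
    nlinarith
  have := mul_le_mul_of_nonneg_left b5 (hθ0 p.2)
  calc lam⁻¹ * (θ p.2 * N ^ 2) = θ p.2 * (lam⁻¹ * N ^ 2) := by ring
    _ ≤ _ := this
    _ = _ := by ring

end IsRegularField

end EnergyInequality

/-! ### Superposition of kernels weighted with an initial datum. -/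

section Datum

open Filter Topology

variable {d : ℕ} {b s t : ℝ} {w : ℝ → ℝ} {φ : Space d → ℝ}
  {F : Type*} [NormedAddCommGroup F] [NormedSpace ℝ F] [MeasurableSpace F] [BorelSpace F]
  [SecondCountableTopology F] {P : Space d × ℝ → Space d × ℝ → F}

/-- The superposition of the kernels with poles at time `s`, weighted with a datum. -/
def datumIntegral (P : Space d × ℝ → Space d × ℝ → F) (s : ℝ) (φ : Space d → ℝ)
    (p : Space d × ℝ) : F :=
  ∫ y, φ y • P p (y, s)

lemma measurable_datum_integrand (hP : Measurable (Function.uncurry P)) (hφ : Continuous φ) :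
    Measurable fun w : (Space d × ℝ) × Space d => φ w.2 • P w.1 (w.2, s) :=
  (hφ.measurable.comp measurable_snd).smul
    (hP.comp (by fun_prop : Measurable fun w : (Space d × ℝ) × Space d => (w.1, (w.2, s))))

lemma measurable_datumIntegral (hP : Measurable (Function.uncurry P)) (hφ : Continuous φ) :
    StronglyMeasurable (datumIntegral P s φ) :=
  (measurable_datum_integrand hP hφ).stronglyMeasurable.integral_prod_right

lemma datumIntegral_eq_zero (hb : KernelBound b w P) {p : Space d × ℝ} (hp : p.2 ≤ s) :
    datumIntegral P s φ p = 0 := by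
  unfold datumIntegral
  simp [fun y => hb.eq_zero (p := p) (q := (y, s)) hp]

lemma integrable_norm_mul_gaussKernel (hφ : Continuous φ) (hc : HasCompactSupport φ) (hb : 0 < b)
    (p : Space d × ℝ) : Integrable fun y => ‖φ y‖ * gaussKernel b p (y, s) := by
  by_cases hp : s < p.2
  · obtain ⟨B, hB⟩ := hc.exists_bound_of_continuous hφ
    refine (integral_gaussKernel_right hb hp).1.bdd_mul hφ.norm.aestronglyMeasurable
      (Eventually.of_forall fun y => ?_) (c := B)
    rw [norm_norm]
    exact hB y
  · simp [fun y => gaussKernel_of_le (b := b) (p := p) (q := (y, s)) (not_lt.mp hp)]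

lemma norm_datumIntegral_le (hφ : Continuous φ) (hc : HasCompactSupport φ) (hb : 0 < b)
    (hP : KernelBound b w P) (p : Space d × ℝ) :
    ‖datumIntegral P s φ p‖ ≤ w (p.2 - s) * ∫ y, ‖φ y‖ * gaussKernel b p (y, s) := by
  rw [← integral_const_mul]
  refine norm_integral_le_of_norm_le ((integrable_norm_mul_gaussKernel hφ hc hb p).const_mul _)
    (Eventually.of_forall fun y => ?_)
  rw [norm_smul, mul_left_comm]
  exact mul_le_mul_of_nonneg_left (hP p (y, s)) (norm_nonneg _)

lemma integral_norm_mul_gaussKernel_nonneg (p : Space d × ℝ) :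
    0 ≤ ∫ y, ‖φ y‖ * gaussKernel b p (y, s) :=
  integral_nonneg fun _ => mul_nonneg (norm_nonneg _) (gaussKernel_nonneg _ _)

lemma integral_norm_mul_gaussKernel_le (hφ : Continuous φ) (hc : HasCompactSupport φ) (hb : 0 < b)
    {B : ℝ} (hB : ∀ y, ‖φ y‖ ≤ B) (p : Space d × ℝ) :
    ∫ y, ‖φ y‖ * gaussKernel b p (y, s) ≤ B * gaussMass d b := by
  have hB0 : 0 ≤ B := (norm_nonneg _).trans (hB 0)
  by_cases hp : s < p.2
  · obtain ⟨h1, h2⟩ := integral_gaussKernel_right (d := d) hb hp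
    rw [← h2, ← integral_const_mul]
    exact integral_mono (integrable_norm_mul_gaussKernel hφ hc hb p) (h1.const_mul _) fun y =>
      mul_le_mul_of_nonneg_right (hB y) (gaussKernel_nonneg _ _)
  · simp only [fun y => gaussKernel_of_le (b := b) (p := p) (q := (y, s)) (not_lt.mp hp), mul_zero,
      integral_zero]
    exact mul_nonneg hB0 (gaussMass_pos hb).le

/-- Tonelli, with the mass of the Gaussian in its forward variable. -/
lemma integral_slice_norm_mul_gaussKernel (hφ : Continuous φ) (hc : HasCompactSupport φ)
    (hb : 0 < b) (hst : s < t) :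
    (Integrable fun x => ∫ y, ‖φ y‖ * gaussKernel b (x, t) (y, s)) ∧
      ∫ x, ∫ y, ‖φ y‖ * gaussKernel b (x, t) (y, s) = gaussMass d b * ∫ y, ‖φ y‖ := by
  have hm : Measurable fun w : Space d × Space d => ‖φ w.2‖ * gaussKernel b (w.1, t) (w.2, s) :=
    (hφ.norm.measurable.comp measurable_snd).mul (measurable_gaussKernel.comp
      (by fun_prop : Measurable fun w : Space d × Space d => ((w.1, t), (w.2, s))))
  have h1 := fun y => integral_gaussKernel_left (d := d) (t := t) (q := (y, s)) hb hst
  have hφi : Integrable fun y => ‖φ y‖ := (hφ.integrable_of_hasCompactSupport hc).norm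
  have hi : Integrable (fun w : Space d × Space d => ‖φ w.2‖ * gaussKernel b (w.1, t) (w.2, s))
      (volume.prod volume) := by
    refine (integrable_prod_iff' hm.aestronglyMeasurable).mpr
      ⟨Eventually.of_forall fun y => (h1 y).1.const_mul ‖φ y‖, ?_⟩
    refine (hφi.mul_const (gaussMass d b)).congr (Eventually.of_forall fun y => ?_)
    simp only [norm_mul, norm_norm, Real.norm_of_nonneg (gaussKernel_nonneg _ _)]
    rw [integral_const_mul, (h1 y).2]
  refine ⟨hi.integral_prod_left, ?_⟩
  rw [integral_integral_swap hi]
  simp only [integral_const_mul, (h1 _).2]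
  rw [integral_mul_const, mul_comm]

/-- Square integrability on time slices. -/
lemma exists_slice_bound (hφ : Continuous φ) (hc : HasCompactSupport φ) (hb : 0 < b) (s : ℝ) :
    ∃ E, 0 ≤ E ∧ ∀ (w : ℝ → ℝ) (P : Space d × ℝ → Space d × ℝ → F),
      Measurable (Function.uncurry P) → KernelBound b w P → ∀ t,
      (Integrable fun x => ‖datumIntegral P s φ (x, t)‖ ^ 2) ∧
        ∫ x, ‖datumIntegral P s φ (x, t)‖ ^ 2 ≤ w (t - s) ^ 2 * E := by
  obtain ⟨B, hB⟩ := hc.exists_bound_of_continuous hφ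
  have hB0 : 0 ≤ B := (norm_nonneg _).trans (hB 0)
  have hm := gaussMass_pos (d := d) hb
  have hφ0 : 0 ≤ ∫ y, ‖φ y‖ := integral_nonneg fun _ => norm_nonneg _
  -- The square is estimated by supremum times `L¹` norm: the superposed Gaussian is at most `B`
  -- times the mass and has integral the mass times `∫ ‖φ‖`. The constant depends neither on the
  -- kernel nor on its weight.
  refine ⟨B * gaussMass d b * (gaussMass d b * ∫ y, ‖φ y‖), by positivity, fun w P hPm hP t => ?_⟩
  by_cases hst : s < t
  swap
  · simp only [fun x => datumIntegral_eq_zero (φ := φ) hP (p := (x, t)) (not_lt.mp hst), norm_zero]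
    refine ⟨by simp, ?_⟩
    simp only [ne_eq, OfNat.ofNat_ne_zero, not_false_eq_true, zero_pow, integral_zero]
    positivity
  obtain ⟨h1, h2⟩ := integral_slice_norm_mul_gaussKernel (d := d) hφ hc hb hst
  have hle : ∀ x, ‖datumIntegral P s φ (x, t)‖ ^ 2 ≤ w (t - s) ^ 2 * (B * gaussMass d b *
      ∫ y, ‖φ y‖ * gaussKernel b (x, t) (y, s)) := fun x => by
    have h3 := norm_datumIntegral_le hφ hc hb hP (x, t) (s := s)
    have h4 := integral_norm_mul_gaussKernel_le hφ hc hb hB (x, t) (s := s)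
    have h5 := integral_norm_mul_gaussKernel_nonneg (φ := φ) (b := b) (s := s) (x, t)
    calc _ ≤ (w (t - s) * ∫ y, ‖φ y‖ * gaussKernel b (x, t) (y, s)) ^ 2 :=
          pow_le_pow_left₀ (norm_nonneg _) h3 2
      _ = w (t - s) ^ 2 * ((∫ y, ‖φ y‖ * gaussKernel b (x, t) (y, s)) *
          ∫ y, ‖φ y‖ * gaussKernel b (x, t) (y, s)) := by ring
      _ ≤ _ := by gcongr
  have hi := (h1.const_mul (B * gaussMass d b)).const_mul (w (t - s) ^ 2)
  have hmeas : AEStronglyMeasurable (fun x => ‖datumIntegral P s φ (x, t)‖ ^ 2) volume :=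
    (((measurable_datumIntegral hPm hφ).comp_measurable
      (by fun_prop : Measurable fun x : Space d => (x, t))).norm.pow 2).aestronglyMeasurable
  have hi2 := hi.mono' hmeas (Eventually.of_forall fun x => by
    rw [Real.norm_of_nonneg (by positivity)]
    exact hle x)
  refine ⟨hi2, (integral_mono hi2 hi hle).trans_eq ?_⟩
  rw [integral_const_mul, integral_const_mul, h2]

/-- Square integrability on time slabs. -/
lemma memLp_indicator_datumIntegral (hφ : Continuous φ) (hc : HasCompactSupport φ) (hb : 0 < b)
    (hPm : Measurable (Function.uncurry P)) (hP : KernelBound b w P) {I : Set ℝ}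
    (hI : MeasurableSet I) (hIv : volume I ≠ ⊤) {C : ℝ} (hw : ∀ t ∈ I, |w (t - s)| ≤ C) :
    MemLp (((univ : Set (Space d)) ×ˢ I).indicator (datumIntegral P s φ)) 2 := by
  have hsm := measurable_datumIntegral (s := s) hPm hφ
  have hm : StronglyMeasurable (((univ : Set (Space d)) ×ˢ I).indicator (datumIntegral P s φ)) :=
    hsm.indicator (MeasurableSet.univ.prod hI)
  rw [memLp_two_iff_integrable_sq_norm hm.aestronglyMeasurable, Measure.volume_eq_prod]
  obtain ⟨E, hE0, hE⟩ := exists_slice_bound (F := F) hφ hc hb s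
  have hsl : ∀ x t, ‖((univ : Set (Space d)) ×ˢ I).indicator (datumIntegral P s φ) (x, t)‖ ^ 2 =
      I.indicator (fun _ => (1 : ℝ)) t * ‖datumIntegral P s φ (x, t)‖ ^ 2 := fun x t => by
    by_cases ht : t ∈ I
    · rw [indicator_of_mem ht, indicator_of_mem (show (x, t) ∈ univ ×ˢ I from ⟨mem_univ _, ht⟩),
        one_mul]
    · rw [indicator_of_notMem ht, indicator_of_notMem fun h => ht h.2]
      simp
  have hm2 : StronglyMeasurable fun p =>
      ‖((univ : Set (Space d)) ×ˢ I).indicator (datumIntegral P s φ) p‖ ^ 2 := hm.norm.pow 2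
  refine (integrable_prod_iff' hm2.aestronglyMeasurable).mpr
    ⟨Eventually.of_forall fun t => ?_, ?_⟩
  · simp only [hsl]
    exact ((hE w P hPm hP t).1).const_mul _
  · refine Integrable.mono' (g := I.indicator fun _ => C ^ 2 * E)
      ((integrable_indicator_iff hI).mpr (integrableOn_const hIv))
      (hm2.norm.integral_prod_left (μ := volume)).aestronglyMeasurable
      (Eventually.of_forall fun t => ?_)
    simp only [hsl, norm_mul, norm_pow, norm_norm]
    rw [Real.norm_of_nonneg (integral_nonneg fun _ => by positivity)]
    by_cases ht : t ∈ I
    · simp only [indicator_of_mem ht, norm_one, one_mul]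
      refine (hE w P hPm hP t).2.trans (mul_le_mul_of_nonneg_right ?_ hE0)
      rw [← sq_abs]
      exact pow_le_pow_left₀ (abs_nonneg _) (hw t ht) 2
    · simp [indicator_of_notMem ht]

/-- Fubini for the superposition of kernels. -/
lemma integral_datumIntegral (hφ : Continuous φ) (hc : HasCompactSupport φ) (hb : 0 < b)
    (hw : Measurable w) {P : Space d × ℝ → Space d × ℝ → ℝ} (hPm : Measurable (Function.uncurry P))
    (hP : KernelBound b w P) {T : ℝ} (hPT : ∀ p q, T ≤ p.2 → P p q = 0)
    (hi : IntegrableOn (fun t => w (t - s)) (Ioo s T)) :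
    ∫ p, datumIntegral P s φ p = ∫ y, φ y * ∫ p, P p (y, s) := by
  set f := (Ioo s T).indicator fun t => w (t - s) with hf
  have hfm : Measurable f :=
    (hw.comp (measurable_id.sub measurable_const)).indicator measurableSet_Ioo
  have hfi : Integrable f := (integrable_indicator_iff measurableSet_Ioo).mpr hi
  have hi1 := fun y : Space d => integrable_weight_gaussKernel hb hw (y, s) T hi
  have e1 : ∀ y : Space d, ∫ p : Space d × ℝ, ‖f p.2 * gaussKernel b p (y, s)‖ =
      (∫ t, ‖f t‖) * gaussMass d b := by
    intro y
    have h1 := (hi1 y).norm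
    rw [Measure.volume_eq_prod] at h1 ⊢
    rw [integral_prod_symm _ h1, ← integral_mul_const]
    refine integral_congr_ae (Eventually.of_forall fun t => ?_)
    simp only [norm_mul, Real.norm_of_nonneg (gaussKernel_nonneg _ _)]
    rw [integral_const_mul]
    by_cases ht : s < t
    · rw [(integral_gaussKernel_left hb (q := (y, s)) ht).2]
    · rw [hf, indicator_of_notMem fun h => ht h.1]
      simp
  have hj : Integrable (fun w : (Space d × ℝ) × Space d =>
      φ w.2 * (f w.1.2 * gaussKernel b w.1 (w.2, s))) (volume.prod volume) := by
    have hm : Measurable fun w : (Space d × ℝ) × Space d =>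
        φ w.2 * (f w.1.2 * gaussKernel b w.1 (w.2, s)) :=
      (hφ.measurable.comp measurable_snd).mul
        ((hfm.comp (by fun_prop)).mul (measurable_gaussKernel.comp
          (by fun_prop : Measurable fun w : (Space d × ℝ) × Space d => (w.1, (w.2, s)))))
    refine (integrable_prod_iff' hm.aestronglyMeasurable).mpr
      ⟨Eventually.of_forall fun y => (hi1 y).const_mul (φ y), ?_⟩
    refine ((hφ.integrable_of_hasCompactSupport hc).norm.mul_const
      ((∫ t, ‖f t‖) * gaussMass d b)).congr (Eventually.of_forall fun y => ?_)
    simp only [norm_mul (φ y)]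
    rw [integral_const_mul, e1]
  have hk : Integrable (fun w : (Space d × ℝ) × Space d => φ w.2 * P w.1 (w.2, s))
      (volume.prod volume) := by
    refine hj.mono (measurable_datum_integrand hPm hφ).aestronglyMeasurable
      (Eventually.of_forall fun w => ?_)
    rw [norm_mul, norm_mul (φ w.2)]
    refine mul_le_mul_of_nonneg_left ?_ (norm_nonneg _)
    by_cases hm : w.1.2 ∈ Ioo s T
    · rw [hf, indicator_of_mem hm]
      exact (hP _ _).trans (le_abs_self _)
    · have : P w.1 (w.2, s) = 0 := by
        by_cases h1 : s < w.1.2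
        · exact hPT _ _ (not_lt.mp fun h2 => hm ⟨h1, h2⟩)
        · exact hP.eq_zero (not_lt.mp h1)
      rw [this, norm_zero]
      exact norm_nonneg _
  unfold datumIntegral
  simp only [smul_eq_mul]
  rw [integral_integral_swap hk]
  simp only [integral_const_mul]

end Datum

/-! ### Zero extension in time and weak gradients. -/

section WeakGradient

open Filter Topology

variable {d : ℕ} {s T : ℝ}

/-- The extension by zero of a function outside the time interval `(s,T)`. -/
def slabExtend {F : Type*} [Zero F] (s T : ℝ) (f : Space d × ℝ → F) : Space d × ℝ → F :=
  ((univ : Set (Space d)) ×ˢ Ioo s T).indicator f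

lemma measurableSet_slab : MeasurableSet ((univ : Set (Space d)) ×ˢ Ioo s T) :=
  MeasurableSet.univ.prod measurableSet_Ioo

lemma slabExtend_of_mem {F : Type*} [Zero F] {f : Space d × ℝ → F} {p : Space d × ℝ}
    (hp : p.2 ∈ Ioo s T) : slabExtend s T f p = f p :=
  indicator_of_mem (show p ∈ univ ×ˢ Ioo s T from ⟨mem_univ _, hp⟩) f

lemma slabExtend_of_notMem {F : Type*} [Zero F] {f : Space d × ℝ → F} {p : Space d × ℝ}
    (hp : p.2 ∉ Ioo s T) : slabExtend s T f p = 0 :=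
  indicator_of_notMem (fun h => hp h.2) f

lemma memLp_slabExtend_iff {F : Type*} [NormedAddCommGroup F] {f : Space d × ℝ → F} :
    MemLp (slabExtend s T f) 2 ↔ MemLp f 2 (volume.restrict (univ ×ˢ Ioo s T)) :=
  memLp_indicator_iff_restrict measurableSet_slab

lemma _root_.MeasureTheory.MemLp.coord {V : Space d × ℝ → Space d} {μ : Measure (Space d × ℝ)}
    (h : MemLp V 2 μ) (i : Fin d) : MemLp (fun p => V p i) 2 μ :=
  (EuclideanSpace.proj i : Space d →L[ℝ] ℝ).comp_memLp' h

/-- Zero extension turns the integrals over the slab into integrals over all space-time, the setting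
in which mollification is available. -/
lemma isWeakGradient_slabExtend_iff {u : Space d → ℝ → ℝ} {G : Space d → ℝ → Space d}
    (hu : MemLp (fun p : Space d × ℝ => u p.1 p.2) 2 (volume.restrict (univ ×ˢ Ioo s T)))
    (hG : MemLp (fun p : Space d × ℝ => G p.1 p.2) 2 (volume.restrict (univ ×ˢ Ioo s T))) :
    IsWeakGradient s T (slabExtend s T fun p => u p.1 p.2)
      (fun i p => slabExtend s T (fun p => G p.1 p.2) p i) ↔ IsWeakSpatialGradient s T u G := by
  have mu := memLp_slabExtend_iff.mpr hu
  have mG := memLp_slabExtend_iff.mpr hG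
  have key : ∀ η, IsTestFunction (Ioo s T) η → ∀ i,
      (∫ p in (univ : Set (Space d)) ×ˢ Ioo s T,
        u p.1 p.2 • gradient (fun z : Space d => η (z, p.2)) p.1) i =
        ∫ p, fderiv ℝ η p (spaceDir i) * slabExtend s T (fun p => u p.1 p.2) p ∧
      (-∫ p in (univ : Set (Space d)) ×ˢ Ioo s T, η p • G p.1 p.2) i =
        -∫ p, η p * slabExtend s T (fun p => G p.1 p.2) p i := by
    intro η hη i
    have m1 : MemLp (spaceGrad η) 2 (volume.restrict ((univ : Set (Space d)) ×ˢ Ioo s T)) :=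
      ((continuous_spaceGrad hη.smooth).memLp_of_hasCompactSupport
        (hasCompactSupport_spaceGrad hη.smooth hη.compact)).restrict _
    have m2 : MemLp η 2 (volume.restrict ((univ : Set (Space d)) ×ˢ Ioo s T)) :=
      (hη.smooth.continuous.memLp_of_hasCompactSupport hη.compact).restrict _
    have i1 : Integrable (fun p : Space d × ℝ => u p.1 p.2 • spaceGrad η p)
      (volume.restrict (univ ×ˢ Ioo s T)) := memLp_one_iff_integrable.mp (m1.smul hu)
    have i2 : Integrable (fun p : Space d × ℝ => η p • G p.1 p.2)
      (volume.restrict (univ ×ˢ Ioo s T)) := memLp_one_iff_integrable.mp (hG.smul m2)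
    have e1 := (EuclideanSpace.proj i : Space d →L[ℝ] ℝ).integral_comp_comm i1
    have e2 := (EuclideanSpace.proj i : Space d →L[ℝ] ℝ).integral_comp_comm i2
    constructor
    · refine e1.symm.trans ?_
      rw [← integral_indicator measurableSet_slab]
      refine integral_congr_ae (Eventually.of_forall fun p => ?_)
      by_cases hp : p.2 ∈ Ioo s T
      · simp only [slabExtend_of_mem hp]
        rw [indicator_of_mem (show p ∈ univ ×ˢ Ioo s T from ⟨mem_univ _, hp⟩), ← spaceGrad_apply hη.smooth]
        exact mul_comm _ _
      · simp only [slabExtend_of_notMem hp]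
        rw [indicator_of_notMem fun h => hp h.2, mul_zero]
    · rw [PiLp.neg_apply, neg_inj]
      refine e2.symm.trans ?_
      rw [← integral_indicator measurableSet_slab]
      refine integral_congr_ae (Eventually.of_forall fun p => ?_)
      by_cases hp : p.2 ∈ Ioo s T
      · simp only [slabExtend_of_mem hp]
        rw [indicator_of_mem (show p ∈ univ ×ˢ Ioo s T from ⟨mem_univ _, hp⟩)]
        rfl
      · simp only [slabExtend_of_notMem hp]
        rw [indicator_of_notMem fun h => hp h.2]
        simp
  constructor
  · intro h η hη
    ext i
    rw [(key η hη i).1, (key η hη i).2, h.grad η hη i]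
  · intro h
    refine ⟨mu, fun i => mG.coord i, fun η hη i => ?_⟩
    rw [← (key η hη i).1, ← (key η hη i).2, h η hη]

/-- A classical spatial gradient is a weak one. -/
lemma isWeakGradient_of_hasGradientAt {u : Space d × ℝ → ℝ} {V : Space d × ℝ → Space d}
    (hu : MemLp (slabExtend s T u) 2) (hV : MemLp (slabExtend s T V) 2)
    (hd : ∀ p : Space d × ℝ, p.2 ∈ Ioo s T → HasGradientAt (fun x => u (x, p.2)) (V p) p.1) :
    IsWeakGradient s T (slabExtend s T u) fun i p => slabExtend s T V p i where
  memLp := hu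
  memLp_grad i := hV.coord i
  grad := by
    intro η hη i
    have m1 : MemLp (fun p => fderiv ℝ η p (spaceDir i)) 2 :=
      (contDiff_fderiv_const hη.smooth _).continuous.memLp_of_hasCompactSupport
        (hη.compact.fderiv_apply ℝ _)
    have m2 : MemLp η 2 := hη.smooth.continuous.memLp_of_hasCompactSupport hη.compact
    have j1 : Integrable fun p => fderiv ℝ η p (spaceDir i) * slabExtend s T u p :=
      m1.integrable_mul hu
    have j2 : Integrable fun p => η p * slabExtend s T V p i := m2.integrable_mul (hV.coord i)
    rw [Measure.volume_eq_prod] at j1 j2 ⊢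
    rw [integral_prod_symm _ j1, integral_prod_symm _ j2, ← integral_neg]
    refine integral_congr_ae ?_
    filter_upwards [j2.prod_left_ae] with t ht
    by_cases hm : t ∈ Ioo s T
    swap
    · simp only [fun x => slabExtend_of_notMem (f := u) (p := (x, t)) hm,
        fun x => slabExtend_of_notMem (f := V) (p := (x, t)) hm]
      simp
    simp only [fun x => slabExtend_of_mem (f := u) (p := (x, t)) hm,
      fun x => slabExtend_of_mem (f := V) (p := (x, t)) hm, ← fderiv_slice hη.smooth (_, t)] at ht ⊢
    have hg := fun x => hd (x, t) hm
    have sη : ContDiff ℝ ∞ fun x => η (x, t) := hη.smooth.comp (contDiff_id.prodMk contDiff_const)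
    have cη := hasCompactSupport_slice hη.compact t
    have hdu : Differentiable ℝ fun x => u (x, t) := fun x => (hg x).differentiableAt
    have hdη : Differentiable ℝ fun x => η (x, t) := sη.differentiable (by simp)
    have hV' : ∀ x, fderiv ℝ (fun z => u (z, t)) x (basisVec i) = V (x, t) i := fun x =>
      fderiv_basisVec_of_hasGradientAt (hg x) i
    have e := integral_mul_fderiv_eq_neg_fderiv_mul_of_integrable (μ := (volume : Measure (Space d)))
      (f := fun x => η (x, t)) (g := fun x => u (x, t)) (v := basisVec i)
      ((((sη.continuous_fderiv (by simp)).clm_apply continuous_const).mul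
        hdu.continuous).integrable_of_hasCompactSupport (cη.fderiv_apply ℝ _).mul_right)
      (by simpa only [hV'] using ht)
      ((hdη.continuous.mul hdu.continuous).integrable_of_hasCompactSupport cη.mul_right)
      (fun x _ => hdη x) (fun x _ => hdu x)
    simp only [hV'] at e
    rw [e, neg_neg]

end WeakGradient

/-! ### Kernels solving the equation with a Dirac mass at the pole. -/

section FundamentalKernel

open Filter Topology

variable {d : ℕ} {a : MatrixField d} {lam K b N μ s T : ℝ} {φ : Space d → ℝ}
  {Γ : Space d × ℝ → Space d × ℝ → ℝ} {DΓ : Space d × ℝ → Space d × ℝ → Space d}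

/-- A kernel with Gaussian bounds for itself and its gradient that solves the equation with a
Dirac mass at the pole. -/
structure IsFundamentalKernel (a : MatrixField d) (b N μ : ℝ)
    (Γ : Space d × ℝ → Space d × ℝ → ℝ) (DΓ : Space d × ℝ → Space d × ℝ → Space d) : Prop where
  measurable : Measurable (Function.uncurry Γ)
  measurable_grad : Measurable (Function.uncurry DΓ)
  bound : KernelBound b (fun r => N * Real.exp (μ * r)) Γ
  bound_grad : KernelBound b (fun r => N * timeWeight μ r) DΓ
  hasGradientAt : ∀ p q, q.2 < p.2 → HasGradientAt (fun x => Γ (x, p.2) q) (DΓ p q) p.1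
  continuousAt : ∀ s (w : (Space d × ℝ) × Space d), s < w.1.2 →
    ContinuousAt (fun w : (Space d × ℝ) × Space d => Γ w.1 (w.2, s)) w
  pole : ∀ T η, IsTestFunction (Iio T) η → ∀ q,
    ∫ p, pairing Γ DΓ (testFlux a η) (testSource a η) p q = η q

lemma integrable_datum_integrand {F : Type*} [NormedAddCommGroup F] [NormedSpace ℝ F]
    [MeasurableSpace F] [BorelSpace F] [SecondCountableTopology F] {w : ℝ → ℝ}
    {P : Space d × ℝ → Space d × ℝ → F} (hφ : Continuous φ) (hc : HasCompactSupport φ) (hb : 0 < b)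
    (hPm : Measurable (Function.uncurry P)) (hP : KernelBound b w P) (p : Space d × ℝ) :
    Integrable fun y => φ y • P p (y, s) := by
  refine ((integrable_norm_mul_gaussKernel (s := s) hφ hc hb p).const_mul (w (p.2 - s))).mono'
    ((measurable_datum_integrand hPm hφ).comp
      (by fun_prop : Measurable fun y : Space d => (p, y))).aestronglyMeasurable
    (Eventually.of_forall fun y => ?_)
  rw [norm_smul, mul_left_comm]
  exact mul_le_mul_of_nonneg_left (hP p (y, s)) (norm_nonneg _)

namespace IsFundamentalKernel

lemma hasGradientAt_datumIntegral (hb : 0 < b) (hN : 0 ≤ N) (h : IsFundamentalKernel a b N μ Γ DΓ)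
    (hφ : Continuous φ) (hc : HasCompactSupport φ) {p : Space d × ℝ} (hp : s < p.2) :
    HasGradientAt (fun x => datumIntegral Γ s φ (x, p.2)) (datumIntegral DΓ s φ p) p.1 := by
  refine hasGradientAt_integral_of_dominated (f := fun x y => φ y • Γ (x, p.2) (y, s))
    (G := fun x y => φ y • DΓ (x, p.2) (y, s))
    (bound := fun y => ‖φ y‖ * (N * timeWeight μ (p.2 - s) * (p.2 - s) ^ (-(d : ℝ) / 2)))
    (fun x => (integrable_datum_integrand hφ hc hb h.measurable h.bound _).aestronglyMeasurable)
    (integrable_datum_integrand hφ hc hb h.measurable h.bound _)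
    (integrable_datum_integrand hφ hc hb h.measurable_grad h.bound_grad _).aestronglyMeasurable
    (Eventually.of_forall fun y x => ?_)
    ((hφ.integrable_of_hasCompactSupport hc).norm.mul_const _)
    (Eventually.of_forall fun y x => ?_)
  · rw [norm_smul]
    refine mul_le_mul_of_nonneg_left ((h.bound_grad (x, p.2) (y, s)).trans ?_) (norm_nonneg _)
    exact mul_le_mul_of_nonneg_left (gaussKernel_le hb.le (x, p.2) (y, s) hp)
      (mul_nonneg hN (timeWeight_nonneg _ _))
  · have h1 := h.hasGradientAt (x, p.2) (y, s) hp
    rw [hasGradientAt_iff_hasFDerivAt] at h1 ⊢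
    rw [map_smul]
    exact h1.const_smul (φ y)

/-- The pole identity is superposed over the poles `(y, s)` with density `φ`. The bounded weight
`e^{μr}` is weakened to `timeWeight (μ + 1)`, so that kernel and gradient share one weight in the
pairing. -/
lemma integral_datum_test (hlam : 0 < lam) (hK : 0 ≤ K) (ha : IsRegularField a lam K) (hb : 0 < b)
    (hN : 0 ≤ N) (h : IsFundamentalKernel a b N μ Γ DΓ) (hφ : Continuous φ)
    (hc : HasCompactSupport φ) {η : Space d × ℝ → ℝ} (hη : IsTestFunction (Iio T) η) (s : ℝ) :
    ∫ p, (inner ℝ (datumIntegral DΓ s φ p) (testFlux a η p) +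
      datumIntegral Γ s φ p * testSource a η p) = ∫ y, φ y * η (y, s) := by
  obtain ⟨B, hB0, hB⟩ := ha.exists_bound_test hlam hK hη.smooth hη.compact
  have hexp : ∀ r, 0 < r → N * Real.exp (μ * r) ≤ N * timeWeight (μ + 1) r := fun r hr => by
    refine mul_le_mul_of_nonneg_left ?_ hN
    have := one_le_timeWeight hr
    unfold timeWeight at this ⊢
    calc Real.exp (μ * r) = Real.exp (μ * r) * 1 := (mul_one _).symm
      _ ≤ Real.exp (μ * r) * ((√r)⁻¹ * Real.exp (1 * r)) := by gcongr
      _ = (√r)⁻¹ * Real.exp ((μ + 1) * r) := by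
        rw [add_mul, Real.exp_add]
        ring
  have b1 := h.bound.mono hexp
  have b2 := h.bound_grad.mono (w' := fun r => N * timeWeight (μ + 1) r) fun r hr =>
    mul_le_mul_of_nonneg_left (timeWeight_mono (by linarith) hr) hN
  have b3 := b1.pairing b2 (fun p => (hB p).2)
  have m3 := measurable_pairing h.measurable h.measurable_grad (ha.measurable_testFlux hη.smooth)
    (ha.measurable_testSource hη.smooth)
  have e := integral_datumIntegral (s := s) (T := T) hφ hc hb
    (((measurable_timeWeight (μ + 1)).const_mul N).const_mul (2 * B)) m3 b3
    (fun p q hp => by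
      obtain ⟨-, h2, h3⟩ := hη.eq_zero (p := p) (not_lt.mpr hp)
      simp [pairing, testFlux, testSource, h2, h3])
    (((integrableOn_timeWeight (μ + 1) s T).const_mul N).const_mul (2 * B))
  simp only [h.pole T η hη] at e
  rw [← e]
  refine integral_congr_ae (Eventually.of_forall fun p => ?_)
  have k1 := integrable_datum_integrand (s := s) hφ hc hb h.measurable h.bound p
  have k2 := integrable_datum_integrand (s := s) hφ hc hb h.measurable_grad h.bound_grad p
  simp only [datumIntegral, pairing, smul_eq_mul, mul_add]
  have k3 : Integrable fun y => φ y * inner ℝ (DΓ p (y, s)) (testFlux a η p) := by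
    refine (k2.inner_const (testFlux a η p)).congr (Eventually.of_forall fun y => ?_)
    exact real_inner_smul_left _ _ _
  have k4 : Integrable fun y => φ y * (Γ p (y, s) * testSource a η p) := by
    refine (k1.mul_const (testSource a η p)).congr (Eventually.of_forall fun y => ?_)
    exact mul_assoc _ _ _
  rw [integral_add k3 k4, real_inner_comm, ← integral_inner k2, ← integral_mul_const]
  congr 1
  · refine integral_congr_ae (Eventually.of_forall fun y => ?_)
    simp only
    rw [real_inner_smul_right, real_inner_comm]
  · refine integral_congr_ae (Eventually.of_forall fun y => ?_)
    exact mul_assoc _ _ _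

end IsFundamentalKernel

end FundamentalKernel

/-! ### Cutoffs in time of uniformly bounded variation. -/

section Existence

open Filter Topology
open Real (smoothTransition)

variable {d : ℕ} {a : MatrixField d} {lam K b N μ s T : ℝ} {φ : Space d → ℝ}
  {Γ : Space d × ℝ → Space d × ℝ → ℝ} {DΓ : Space d × ℝ → Space d × ℝ → Space d}

lemma deriv_smoothTransition_eq_zero {x : ℝ} (hx : x ∉ Icc (0 : ℝ) 1) :
    deriv smoothTransition x = 0 := by
  rw [mem_Icc, not_and_or, not_le, not_le] at hx
  rcases hx with h | h
  · have : smoothTransition =ᶠ[𝓝 x] fun _ => 0 := by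
      filter_upwards [Iio_mem_nhds h] with y hy
      exact Real.smoothTransition.zero_of_nonpos (le_of_lt hy)
    rw [this.deriv_eq, deriv_const]
  · have : smoothTransition =ᶠ[𝓝 x] fun _ => 1 := by
      filter_upwards [Ioi_mem_nhds h] with y hy
      exact Real.smoothTransition.one_of_one_le (le_of_lt hy)
    rw [this.deriv_eq, deriv_const]

lemma integrable_abs_deriv_smoothTransition : Integrable fun x => |deriv smoothTransition x| := by
  have h1 : Continuous (deriv smoothTransition) :=
    (Real.smoothTransition.contDiff (n := 1)).continuous_deriv le_rfl
  refine h1.abs.integrable_of_hasCompactSupport (HasCompactSupport.intro isCompact_Icc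
    (K := Icc 0 1) fun x hx => ?_)
  rw [deriv_smoothTransition_eq_zero hx, abs_zero]

/-- Cutoff functions in time whose upward variation is controlled independently of the distance to
the initial time. -/
lemma exists_time_cutoff (s T : ℝ) {C : ℝ} (hC : 0 ≤ C) (hsT : s < T) :
    ∃ A, ∀ δ, 0 < δ → ∃ θ m : ℝ → ℝ, ContDiff ℝ ∞ θ ∧ HasCompactSupport θ ∧
      tsupport θ ⊆ Ioo (s + δ / 4) (T + 3) ∧ (∀ t, 0 ≤ θ t) ∧ (∀ t ∈ Ioo (s + δ) T, θ t = 1) ∧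
      Integrable m ∧ (∀ t, 0 ≤ m t) ∧ (∀ t, deriv θ t + C * θ t ≤ m t) ∧ ∫ t, m t ≤ A := by
  set k : ℝ → ℝ := fun x => |deriv smoothTransition x| with hk
  have ki : Integrable k := integrable_abs_deriv_smoothTransition
  -- The rise of the cutoff has slope of order `1/δ` over a time of order `δ`, so its contribution
  -- `∫ k` does not depend on `δ`. The second `∫ k` is the descent after `T`, the last term `C`
  -- times the length of the interval.
  refine ⟨(∫ x, k x) + (∫ x, k x) + C * (T + 2 - s), fun δ hδ => ?_⟩
  -- The first factor of `θ` rises from zero at `s + δ/2` to one at `s + δ`; the second falls from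
  -- one at `T + 1` to zero at `T + 2`.
  set f : ℝ → ℝ := fun t => 2 / δ * (t - (s + δ / 2)) with hf
  set g : ℝ → ℝ := fun t => T + 2 - t with hg
  set θ : ℝ → ℝ := fun t => smoothTransition (f t) * smoothTransition (g t) with hθ
  have h2δ : 0 < 2 / δ := by positivity
  have sθ : ContDiff ℝ ∞ θ := by
    refine (Real.smoothTransition.contDiff.comp ?_).mul (Real.smoothTransition.contDiff.comp ?_)
    · exact contDiff_const.mul (contDiff_id.sub contDiff_const)
    · exact contDiff_const.sub contDiff_id
  have hz : ∀ t, t ∉ Icc (s + δ / 2) (T + 2) → θ t = 0 := by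
    intro t ht
    rw [mem_Icc, not_and_or, not_le, not_le] at ht
    simp only [hθ]
    rcases ht with h | h
    · rw [Real.smoothTransition.zero_of_nonpos, zero_mul]
      exact mul_nonpos_of_nonneg_of_nonpos h2δ.le (by linarith)
    · rw [Real.smoothTransition.zero_of_nonpos (x := g t), mul_zero]
      simp only [hg]; linarith
  have hτ := Real.smoothTransition.nonneg
  have hτ1 := Real.smoothTransition.le_one
  have hdt : ∀ t, HasDerivAt θ (deriv smoothTransition (f t) * (2 / δ) * smoothTransition (g t) +
      smoothTransition (f t) * (deriv smoothTransition (g t) * (-1))) t := by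
    intro t
    have hd : ∀ x, HasDerivAt smoothTransition (deriv smoothTransition x) x := fun x =>
      ((Real.smoothTransition.contDiff (n := 1)).differentiable one_ne_zero x).hasDerivAt
    have hf' : HasDerivAt f (2 / δ) t := by
      simpa using ((hasDerivAt_id t).sub_const (s + δ / 2)).const_mul (2 / δ)
    have hg' : HasDerivAt g (-1) t := by
      simpa using (hasDerivAt_id t).const_sub (T + 2)
    exact ((hd _).comp t hf').mul ((hd _).comp t hg')
  refine ⟨θ, fun t => 2 / δ * k (f t) + k (g t) + C * (Icc s (T + 2)).indicator (fun _ => 1) t, sθ,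
    HasCompactSupport.intro isCompact_Icc hz, ?_, fun t => mul_nonneg (hτ _) (hτ _), ?_, ?_, ?_, ?_, ?_⟩
  · refine (closure_minimal (fun t ht => ?_) isClosed_Icc).trans
      (Icc_subset_Ioo (by linarith) (by linarith) : Icc (s + δ / 2) (T + 2) ⊆ _)
    by_contra hn
    exact ht (hz t hn)
  · intro t ht
    simp only [hθ]
    rw [Real.smoothTransition.one_of_one_le, Real.smoothTransition.one_of_one_le, one_mul]
    · simp only [hg]; linarith [ht.2]
    · simp only [hf]
      rw [div_mul_eq_mul_div, le_div_iff₀ hδ]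
      linarith [ht.1]
  · refine (((ki.comp_mul_left' h2δ.ne').comp_sub_right (s + δ / 2)).const_mul _ |>.add
      (ki.comp_sub_left (T + 2))).add (Integrable.const_mul ?_ C)
    exact (integrable_indicator_iff measurableSet_Icc).mpr (integrableOn_const (by simp))
  · intro t
    have h1 : 0 ≤ k (f t) := abs_nonneg _
    have h2 : 0 ≤ k (g t) := abs_nonneg _
    have h3 : 0 ≤ (Icc s (T + 2)).indicator (fun _ => (1 : ℝ)) t :=
      indicator_nonneg (fun _ _ => zero_le_one) t
    positivity
  · intro t
    rw [(hdt t).deriv]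
    have h1 : deriv smoothTransition (f t) * (2 / δ) * smoothTransition (g t) ≤ 2 / δ * k (f t) := by
      calc _ = 2 / δ * (deriv smoothTransition (f t) * smoothTransition (g t)) := by ring
        _ ≤ 2 / δ * (k (f t) * 1) := by
          refine mul_le_mul_of_nonneg_left ?_ h2δ.le
          exact mul_le_mul (le_abs_self _) (hτ1 _) (hτ _) (abs_nonneg _)
        _ = _ := by ring
    have h2 : smoothTransition (f t) * (deriv smoothTransition (g t) * (-1)) ≤ k (g t) := by
      calc _ ≤ |smoothTransition (f t) * (deriv smoothTransition (g t) * (-1))| := le_abs_self _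
        _ = smoothTransition (f t) * k (g t) := by
          rw [abs_mul, abs_mul, abs_neg, abs_one, mul_one, abs_of_nonneg (hτ _)]
        _ ≤ 1 * k (g t) := mul_le_mul_of_nonneg_right (hτ1 _) (abs_nonneg _)
        _ = _ := one_mul _
    have h3 : θ t ≤ (Icc s (T + 2)).indicator (fun _ => 1) t := by
      by_cases ht : t ∈ Icc s (T + 2)
      · rw [indicator_of_mem ht]
        exact mul_le_one₀ (hτ1 _) (hτ _) (hτ1 _)
      · rw [indicator_of_notMem ht, hz t fun h => ht ⟨by linarith [h.1], h.2⟩]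
    have := mul_le_mul_of_nonneg_left h3 hC
    linarith
  · have i1 : Integrable fun t => 2 / δ * k (f t) :=
      ((ki.comp_mul_left' h2δ.ne').comp_sub_right (s + δ / 2)).const_mul (2 / δ)
    have i2 : Integrable fun t => k (g t) := ki.comp_sub_left (T + 2)
    have i3 : Integrable ((Icc s (T + 2)).indicator fun _ => (1 : ℝ)) :=
      (integrable_indicator_iff measurableSet_Icc).mpr (integrableOn_const (by simp))
    have e1 : ∫ t, 2 / δ * k (f t) = ∫ x, k x := by
      rw [integral_const_mul]
      have h1 := integral_sub_right_eq_self (μ := volume) (fun x => k (2 / δ * x)) (s + δ / 2)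
      have h2 := Measure.integral_comp_mul_left k (2 / δ)
      simp only [hf]
      rw [h1, h2, abs_of_pos (inv_pos.mpr h2δ), smul_eq_mul, mul_inv_cancel_left₀ h2δ.ne']
    have e2 : ∫ t, k (g t) = ∫ x, k x := integral_sub_left_eq_self k volume (T + 2)
    have e3 : ∫ t, (Icc s (T + 2)).indicator (fun _ => (1 : ℝ)) t = T + 2 - s := by
      rw [integral_indicator measurableSet_Icc, setIntegral_const, smul_eq_mul, mul_one,
        Measure.real, Real.volume_Icc, ENNReal.toReal_ofReal (by linarith)]
    have i12 : Integrable fun t => 2 / δ * k (f t) + k (g t) := i1.add i2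
    rw [integral_add i12 (i3.const_mul C), integral_add i1 i2, integral_const_mul C, e1, e2, e3]

end Existence

/-! ### The superposition lies in the energy class. -/

section Cauchy

open Filter Topology

variable {d : ℕ} {a : MatrixField d} {lam K b N μ s s' T : ℝ} {φ : Space d → ℝ}
  {Γ : Space d × ℝ → Space d × ℝ → ℝ} {DΓ : Space d × ℝ → Space d × ℝ → Space d}

namespace IsFundamentalKernel

lemma memLp_datumIntegral (hb : 0 < b) (hN : 0 ≤ N) (hμ : 0 ≤ μ)
    (h : IsFundamentalKernel a b N μ Γ DΓ) (hφ : Continuous φ) (hc : HasCompactSupport φ)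
    (s s' T : ℝ) : MemLp (slabExtend s' T (datumIntegral Γ s φ)) 2 := by
  refine memLp_indicator_datumIntegral hφ hc hb h.measurable h.bound measurableSet_Ioo
    (by simp) (C := N * Real.exp (μ * (T - s))) fun t ht => ?_
  rw [abs_of_nonneg (by positivity)]
  have := ht.2
  gcongr

/-- Starting at `s' > s` keeps the time weight bounded; the case `s' = s` needs the energy estimate.
-/
lemma memLp_datumIntegral_grad (hb : 0 < b) (hN : 0 ≤ N) (hμ : 0 ≤ μ)
    (h : IsFundamentalKernel a b N μ Γ DΓ) (hφ : Continuous φ) (hc : HasCompactSupport φ)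
    (hs : s < s') (T : ℝ) : MemLp (slabExtend s' T (datumIntegral DΓ s φ)) 2 := by
  refine memLp_indicator_datumIntegral hφ hc hb h.measurable_grad h.bound_grad measurableSet_Ioo
    (by simp) (C := N * ((√(s' - s))⁻¹ * Real.exp (μ * (T - s)))) fun t ht => ?_
  have h0 : 0 < √(s' - s) := Real.sqrt_pos.mpr (by linarith)
  rw [abs_of_nonneg (mul_nonneg hN (timeWeight_nonneg _ _)), timeWeight]
  have h1 := ht.1
  have h2 := ht.2
  gcongr

lemma isWeakGradient_datumIntegral (hb : 0 < b) (hN : 0 ≤ N) (hμ : 0 ≤ μ)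
    (h : IsFundamentalKernel a b N μ Γ DΓ) (hφ : Continuous φ) (hc : HasCompactSupport φ)
    (hs : s ≤ s') (hV : MemLp (slabExtend s' T (datumIntegral DΓ s φ)) 2) :
    IsWeakGradient s' T (slabExtend s' T (datumIntegral Γ s φ))
      fun i p => slabExtend s' T (datumIntegral DΓ s φ) p i :=
  isWeakGradient_of_hasGradientAt (h.memLp_datumIntegral hb hN hμ hφ hc s s' T) hV fun _ hp =>
    h.hasGradientAt_datumIntegral hb hN hφ hc (hs.trans_lt hp.1)

/-- Zero extension does not alter the pairing: from `T` on the test data vanish, and up to `s`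
either the solution or the test data do. -/
lemma testPairing_slabExtend {u : Space d × ℝ → ℝ} {V : Space d × ℝ → Space d}
    {η : Space d × ℝ → ℝ} (hη : IsTestFunction (Iio T) η) (p : Space d × ℝ)
    (hp : p.2 ≤ s → (u p = 0 ∧ V p = 0) ∨ (testFlux a η p = 0 ∧ testSource a η p = 0)) :
    inner ℝ (slabExtend s T V p) (testFlux a η p) + slabExtend s T u p * testSource a η p =
      inner ℝ (V p) (testFlux a η p) + u p * testSource a η p := by
  by_cases hm : p.2 ∈ Ioo s T
  · rw [slabExtend_of_mem hm, slabExtend_of_mem hm]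
  rw [slabExtend_of_notMem hm, slabExtend_of_notMem hm]
  by_cases h1 : p.2 ≤ s
  · rcases hp h1 with ⟨h2, h3⟩ | ⟨h2, h3⟩ <;> simp [h2, h3]
  · obtain ⟨-, h2, h3⟩ := hη.eq_zero (p := p) fun h => hm ⟨not_le.mp h1, h⟩
    simp [testFlux, testSource, h2, h3]

/-- The kernel bound only yields `‖∇u(t)‖²` of order `1/(t-s)`, whose time integral diverges
logarithmically. The energy inequality, with cutoffs whose upward variation does not depend on `δ`,
bounds the integral by the uniform `L²` bound on `u(t)` instead. -/
lemma integral_norm_grad_le (hlam : 0 < lam) (hK : 0 ≤ K) (ha : IsRegularField a lam K)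
    (hb : 0 < b) (hN : 0 ≤ N) (hμ : 0 ≤ μ) (h : IsFundamentalKernel a b N μ Γ DΓ)
    (hφ : Continuous φ) (hc : HasCompactSupport φ) (hsT : s < T) :
    ∃ A, ∀ δ, 0 < δ →
      IntegrableOn (fun p => ‖datumIntegral DΓ s φ p‖ ^ 2) (univ ×ˢ Ioo (s + δ) T) ∧
      ∫ p in (univ : Set (Space d)) ×ˢ Ioo (s + δ) T, ‖datumIntegral DΓ s φ p‖ ^ 2 ≤ A := by
  set C := lam * (d * (d * K)) ^ 2 with hC
  have hC0 : 0 ≤ C := by positivity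
  obtain ⟨A, hA⟩ := exists_time_cutoff s T hC0 hsT
  obtain ⟨E, hE0, hE⟩ := exists_slice_bound (F := ℝ) hφ hc hb s
  set E' := (N * Real.exp (μ * (T + 3 - s))) ^ 2 * E with hE'
  have hE'0 : 0 ≤ E' := by positivity
  refine ⟨lam * (A * E'), fun δ hδ => ?_⟩
  obtain ⟨θ, m, sθ, cθ, tθ, hθ0, hθ1, hm, hm0, hle, hmA⟩ := hA δ hδ
  set s' := s + δ / 4 with hs'
  have hss : s < s' := by rw [hs']; linarith
  set u := slabExtend s' (T + 3) (datumIntegral Γ s φ) with hu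
  set V := slabExtend s' (T + 3) (datumIntegral DΓ s φ) with hV
  have hVm := h.memLp_datumIntegral_grad hb hN hμ hφ hc hss (T + 3)
  have hG := h.isWeakGradient_datumIntegral hb hN hμ hφ hc hss.le hVm
  -- Test functions supported after `s` do not see the datum, so the superposition solves the
  -- homogeneous weak equation there.
  have hweak : ∀ η, IsTestFunction (Ioo s' (T + 3)) η →
      ∫ p, (inner ℝ (V p) (testFlux a η p) + u p * testSource a η p) = 0 := by
    intro η hη
    have hη' : IsTestFunction (Iio (T + 3)) η := ⟨hη.smooth, hη.compact,
      hη.support_subset.trans (prod_mono_right fun t ht => ht.2)⟩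
    have e := h.integral_datum_test hlam hK ha hb hN hφ hc hη' s
    rw [integral_eq_zero_of_ae (f := fun y => φ y * η (y, s)) (Eventually.of_forall fun y => by
      simp [(hη.eq_zero (p := (y, s)) fun hm => (hss.trans hm.1).false).1])] at e
    rw [← e]
    refine integral_congr_ae (Eventually.of_forall fun p => ?_)
    refine testPairing_slabExtend hη' p fun hp => Or.inr ?_
    obtain ⟨-, h2, h3⟩ := hη.eq_zero (p := p) fun hm => (hp.trans_lt hm.1).false
    simp [testFlux, testSource, h2, h3]
  obtain ⟨i1, i2, hen⟩ := ha.energy_le hlam hG hweak sθ cθ tθ hθ0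
  have hup : ∫ p : Space d × ℝ, (deriv θ p.2 + C * θ p.2) * u p ^ 2 ≤ A * E' := by
    have hj : Integrable (fun p : Space d × ℝ => (deriv θ p.2 + C * θ p.2) * u p ^ 2) := i2
    rw [Measure.volume_eq_prod] at hj ⊢
    rw [integral_prod_symm _ hj]
    have hd0 : ∀ t, t ∉ Ioo s' (T + 3) → deriv θ t + C * θ t = 0 := fun t ht => by
      have h1 : θ t = 0 := image_eq_zero_of_notMem_tsupport fun hm => ht (tθ hm)
      have h2 : deriv θ t = 0 := by
        by_contra hne
        exact ht (tθ (support_deriv_subset hne))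
      rw [h1, h2, mul_zero, add_zero]
    calc ∫ t, ∫ x, (deriv θ (x, t).2 + C * θ (x, t).2) * u (x, t) ^ 2
        ≤ ∫ t, m t * E' := ?_
      _ = (∫ t, m t) * E' := integral_mul_const _ _
      _ ≤ A * E' := mul_le_mul_of_nonneg_right hmA hE'0
    refine integral_mono hj.integral_prod_right (hm.mul_const E') fun t => ?_
    simp only
    rw [integral_const_mul]
    have hu0 : 0 ≤ ∫ x, u (x, t) ^ 2 := integral_nonneg fun x => sq_nonneg _
    by_cases ht : t ∈ Ioo s' (T + 3)
    · have h1 : ∫ x, u (x, t) ^ 2 ≤ E' := by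
        have h2 := (hE _ Γ h.measurable h.bound t).2
        have h3 : ∫ x, u (x, t) ^ 2 = ∫ x, ‖datumIntegral Γ s φ (x, t)‖ ^ 2 := by
          refine integral_congr_ae (Eventually.of_forall fun x => ?_)
          simp only [hu, slabExtend_of_mem (p := (x, t)) ht, Real.norm_eq_abs, sq_abs]
        rw [h3]
        refine h2.trans (mul_le_mul_of_nonneg_right ?_ hE0)
        have := ht.2
        gcongr
      exact (mul_le_mul_of_nonneg_right (hle t) hu0).trans (mul_le_mul_of_nonneg_left h1 (hm0 t))
    · rw [hd0 t ht, zero_mul]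
      exact mul_nonneg (hm0 t) hE'0
  have hlow : ∫ p : Space d × ℝ, θ p.2 * ‖V p‖ ^ 2 ≤ lam * (A * E') := by
    have := hen.trans hup
    rwa [inv_mul_le_iff₀ hlam] at this
  have hij : IntegrableOn (fun p => ‖datumIntegral DΓ s φ p‖ ^ 2)
      ((univ : Set (Space d)) ×ˢ Ioo (s + δ) T) := by
    have := (memLp_slabExtend_iff.mp (h.memLp_datumIntegral_grad hb hN hμ hφ hc
      (show s < s + δ by linarith) T)).integrable_norm_pow (by norm_num)
    exact this
  refine ⟨hij, le_trans ?_ hlow⟩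
  rw [← integral_indicator measurableSet_slab]
  refine integral_mono ((integrable_indicator_iff measurableSet_slab).mpr hij) i1 fun p => ?_
  by_cases hp : p.2 ∈ Ioo (s + δ) T
  · rw [indicator_of_mem (show p ∈ univ ×ˢ Ioo (s + δ) T from ⟨mem_univ _, hp⟩)]
    simp only [hV]
    rw [hθ1 _ hp, one_mul, slabExtend_of_mem ⟨by rw [hs']; linarith [hp.1], by linarith [hp.2]⟩]
  · rw [indicator_of_notMem fun hm => hp hm.2]
    exact mul_nonneg (hθ0 _) (sq_nonneg _)

/-- The energy estimate up to the initial time. -/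
lemma memLp_grad (hlam : 0 < lam) (hK : 0 ≤ K) (ha : IsRegularField a lam K)
    (hb : 0 < b) (hN : 0 ≤ N) (hμ : 0 ≤ μ) (h : IsFundamentalKernel a b N μ Γ DΓ)
    (hφ : Continuous φ) (hc : HasCompactSupport φ) (hsT : s < T) :
    MemLp (slabExtend s T (datumIntegral DΓ s φ)) 2 := by
  obtain ⟨A, hA⟩ := h.integral_norm_grad_le hlam hK ha hb hN hμ hφ hc hsT
  rw [memLp_slabExtend_iff, memLp_two_iff_integrable_sq_norm
    (measurable_datumIntegral h.measurable_grad hφ).aestronglyMeasurable]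
  set ρ : Measure (Space d × ℝ) := volume.restrict (univ ×ˢ Ioo s T) with hρ
  have hcov : AECover ρ atTop
      fun n : ℕ => (univ : Set (Space d)) ×ˢ Ioi (s + 1 / ((n : ℝ) + 1)) := by
    refine ⟨?_, fun n => MeasurableSet.univ.prod measurableSet_Ioi⟩
    filter_upwards [ae_restrict_mem measurableSet_slab] with p hp
    have h1 : ∀ᶠ n : ℕ in atTop, (1 : ℝ) / (n + 1) < p.2 - s :=
      tendsto_one_div_add_atTop_nhds_zero_nat.eventually_lt_const (by linarith [hp.2.1])
    filter_upwards [h1] with n hn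
    exact ⟨mem_univ _, by rw [mem_Ioi]; linarith⟩
  have hr : ∀ n : ℕ, ρ.restrict ((univ : Set (Space d)) ×ˢ Ioi (s + 1 / ((n : ℝ) + 1))) =
      volume.restrict (univ ×ˢ Ioo (s + 1 / ((n : ℝ) + 1)) T) := by
    intro n
    have hp : (0 : ℝ) < 1 / (n + 1) := by positivity
    rw [hρ, Measure.restrict_restrict (MeasurableSet.univ.prod measurableSet_Ioi)]
    congr 1
    ext p
    simp only [mem_inter_iff, mem_prod, mem_univ, true_and, mem_Ioi, mem_Ioo]
    constructor
    · rintro ⟨h1, -, h2⟩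
      exact ⟨h1, h2⟩
    · rintro ⟨h1, h2⟩
      exact ⟨h1, by linarith, h2⟩
  refine hcov.integrable_of_integral_bounded_of_nonneg_ae A (fun n => ?_)
    (Eventually.of_forall fun p => by positivity) (Eventually.of_forall fun n => ?_)
  · rw [IntegrableOn, hr]
    exact (hA _ (by positivity)).1
  · rw [hr]
    exact (hA _ (by positivity)).2

end IsFundamentalKernel

end Cauchy

/-! ### The constructed kernel is a weak fundamental solution. -/

section Solution

open Filter Topology

variable {d : ℕ} {a : MatrixField d} {lam K b N μ s T : ℝ} {φ : Space d → ℝ}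
  {Γ : Space d × ℝ → Space d × ℝ → ℝ} {DΓ : Space d × ℝ → Space d × ℝ → Space d}

/-- The weak form of the equation as a joint integral over space-time. -/
lemma IsRegularField.integral_weak_form_slab (hlam : 0 < lam) (hK : 0 ≤ K)
    (h : IsRegularField a lam K) {u : Space d → ℝ → ℝ} {G : Space d → ℝ → Space d}
    (hG : IsWeakGradient s T (slabExtend s T fun p => u p.1 p.2)
      fun i p => slabExtend s T (fun p => G p.1 p.2) p i)
    {η : Space d × ℝ → ℝ} (hη : ContDiff ℝ ∞ η) (hc : HasCompactSupport η) :
    ∫ t in Ioo s T, ∫ x : Space d,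
        (inner ℝ (Matrix.toEuclideanLin (a x t) (G x t)) (gradient (fun z => η (z, t)) x) -
          u x t * deriv (fun τ => η (x, τ)) t) =
      ∫ p, (inner ℝ (slabExtend s T (fun p => G p.1 p.2) p) (testFlux a η p) +
        slabExtend s T (fun p => u p.1 p.2) p * testSource a η p) := by
  have e1 : ∫ p, (inner ℝ (slabExtend s T (fun p => G p.1 p.2) p) (testFlux a η p) +
        slabExtend s T (fun p => u p.1 p.2) p * testSource a η p) =
      ∫ p in (univ : Set (Space d)) ×ˢ Ioo s T,
        (inner ℝ (slabExtend s T (fun p => G p.1 p.2) p) (testFlux a η p) +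
        slabExtend s T (fun p => u p.1 p.2) p * testSource a η p) := by
    refine (setIntegral_eq_integral_of_forall_compl_eq_zero fun p hp => ?_).symm
    have hn : p.2 ∉ Ioo s T := fun hm => hp ⟨mem_univ _, hm⟩
    simp [slabExtend_of_notMem hn]
  rw [e1, ← h.integral_weak_form hlam hK hη hc hG]
  refine setIntegral_congr_fun measurableSet_Ioo fun t ht => ?_
  simp only [fun x => slabExtend_of_mem (f := fun p : Space d × ℝ => u p.1 p.2) (p := (x, t)) ht,
    fun x => slabExtend_of_mem (f := fun p : Space d × ℝ => G p.1 p.2) (p := (x, t)) ht]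
  rfl

namespace IsFundamentalKernel

theorem isWeakSolution (hlam : 0 < lam) (hK : 0 ≤ K) (ha : IsRegularField a lam K)
    (hb : 0 < b) (hN : 0 ≤ N) (hμ : 0 ≤ μ) (h : IsFundamentalKernel a b N μ Γ DΓ)
    (hφ : Continuous φ) (hc : HasCompactSupport φ) (hsT : s < T) :
    IsWeakSolution a s T φ fun x t => datumIntegral Γ s φ (x, t) := by
  have hu := h.memLp_datumIntegral hb hN hμ hφ hc s s T
  have hV := h.memLp_grad hlam hK ha hb hN hμ hφ hc hsT
  have hG := h.isWeakGradient_datumIntegral hb hN hμ hφ hc le_rfl hV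
  obtain ⟨E, hE0, hE⟩ := exists_slice_bound (F := ℝ) hφ hc hb s
  refine ⟨memLp_slabExtend_iff.mp hu, ⟨(N * Real.exp (μ * (T - s))) ^ 2 * E, ?_⟩,
    fun x t => datumIntegral DΓ s φ (x, t), memLp_slabExtend_iff.mp hV, ?_, fun η hη => ?_⟩
  · filter_upwards [ae_restrict_mem measurableSet_Ioo] with t ht
    obtain ⟨h1, h2⟩ := hE _ Γ h.measurable h.bound t
    simp only [Real.norm_eq_abs, sq_abs] at h1 h2
    have hm : AEStronglyMeasurable (fun x => datumIntegral Γ s φ (x, t)) volume :=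
      ((measurable_datumIntegral h.measurable hφ).comp_measurable
        (by fun_prop : Measurable fun x : Space d => (x, t))).aestronglyMeasurable
    refine ⟨(memLp_two_iff_integrable_sq hm).mpr h1, h2.trans ?_⟩
    have := ht.2
    gcongr
  · exact (isWeakGradient_slabExtend_iff (memLp_slabExtend_iff.mp hu)
      (memLp_slabExtend_iff.mp hV)).mp hG
  · rw [ha.integral_weak_form_slab hlam hK hG hη.smooth hη.compact,
      ← h.integral_datum_test hlam hK ha hb hN hφ hc hη s]
    refine integral_congr_ae (Eventually.of_forall fun p => ?_)
    exact testPairing_slabExtend hη p fun hp =>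
      Or.inl ⟨datumIntegral_eq_zero h.bound hp, datumIntegral_eq_zero h.bound_grad hp⟩

theorem isWeakFundamentalSolution (hlam : 0 < lam) (hK : 0 ≤ K) (ha : IsRegularField a lam K)
    (hb : 0 < b) (hN : 0 ≤ N) (hμ : 0 ≤ μ) (h : IsFundamentalKernel a b N μ Γ DΓ) :
    IsWeakFundamentalSolution a T fun x t y s => Γ (x, t) (y, s) where
  continuousOn s _ _ := fun p hp => by
    have h1 : ContinuousAt (fun p : Space d × ℝ × Space d => ((p.1, p.2.1), p.2.2)) p := by
      fun_prop
    exact (ContinuousAt.comp (f := fun p : Space d × ℝ × Space d => ((p.1, p.2.1), p.2.2))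
      (g := fun w : (Space d × ℝ) × Space d => Γ w.1 (w.2, s))
      (h.continuousAt s ((p.1, p.2.1), p.2.2) hp.1) h1).continuousWithinAt
  cauchy s _ hsT φ hφ hc := by
    have h1 := h.isWeakSolution hlam hK ha hb hN hμ hφ hc hsT
    simpa only [datumIntegral, smul_eq_mul, mul_comm] using h1

end IsFundamentalKernel

end Solution

/-! ### Uniqueness in the energy class. -/

section Uniqueness

open Filter Topology
open Real (smoothTransition)

variable {d : ℕ} {a : MatrixField d} {lam K s T : ℝ} {v : Space d × ℝ → ℝ}
  {W : Space d × ℝ → Space d}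

lemma IsWeakGradient.sub {α β : ℝ} {u₁ u₂ : Space d × ℝ → ℝ} {G₁ G₂ : Fin d → Space d × ℝ → ℝ}
    (h₁ : IsWeakGradient α β u₁ G₁) (h₂ : IsWeakGradient α β u₂ G₂) :
    IsWeakGradient α β (fun p => u₁ p - u₂ p) fun i p => G₁ i p - G₂ i p where
  memLp := h₁.memLp.sub h₂.memLp
  memLp_grad i := (h₁.memLp_grad i).sub (h₂.memLp_grad i)
  grad η hη i := by
    have m1 : MemLp (fun p => fderiv ℝ η p (spaceDir i)) 2 :=
      (contDiff_fderiv_const hη.smooth _).continuous.memLp_of_hasCompactSupport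
        (hη.compact.fderiv_apply ℝ _)
    have m2 : MemLp η 2 := hη.smooth.continuous.memLp_of_hasCompactSupport hη.compact
    simp only [mul_sub]
    have i1 : Integrable fun p => fderiv ℝ η p (spaceDir i) * u₁ p := m1.integrable_mul h₁.memLp
    have i2 : Integrable fun p => fderiv ℝ η p (spaceDir i) * u₂ p := m1.integrable_mul h₂.memLp
    have i3 : Integrable fun p => η p * G₁ i p := m2.integrable_mul (h₁.memLp_grad i)
    have i4 : Integrable fun p => η p * G₂ i p := m2.integrable_mul (h₂.memLp_grad i)
    rw [integral_sub i1 i2, integral_sub i3 i4, h₁.grad η hη i, h₂.grad η hη i]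
    ring

/-- The cutoff vanishes up to time `s + 1/n` and equals one from `s + 2/n` on. -/
lemma tendsto_integral_cutoff {f : Space d × ℝ → ℝ} (hf : Integrable f)
    (h0 : ∀ p : Space d × ℝ, p.2 ≤ s → f p = 0) :
    Tendsto (fun n : ℕ => ∫ p, smoothTransition (n * (p.2 - s) - 1) * f p) atTop
      (𝓝 (∫ p, f p)) := by
  refine tendsto_integral_of_dominated_convergence (fun p => ‖f p‖) (fun n => ?_) hf.norm
    (fun n => Eventually.of_forall fun p => ?_) (Eventually.of_forall fun p => ?_)
  · exact (Real.smoothTransition.continuous.comp (by fun_prop)).aestronglyMeasurable.mul hf.1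
  · rw [norm_mul, Real.norm_of_nonneg (Real.smoothTransition.nonneg _)]
    exact mul_le_of_le_one_left (norm_nonneg _) (Real.smoothTransition.le_one _)
  · by_cases hp : p.2 ≤ s
    · simp [h0 p hp]
    · have hr : 0 < p.2 - s := by linarith
      refine tendsto_const_nhds.congr' ?_
      filter_upwards [tendsto_natCast_atTop_atTop.eventually_ge_atTop (2 / (p.2 - s))] with n hn
      rw [div_le_iff₀ hr] at hn
      rw [Real.smoothTransition.one_of_one_le (by linarith), one_mul]

/-- Functions vanishing before the initial time have weak gradients across the initial time. -/
lemma IsWeakGradient.extend {G : Fin d → Space d × ℝ → ℝ} (h : IsWeakGradient s T v G)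
    (hv : ∀ p : Space d × ℝ, p.2 ≤ s → v p = 0) (hG : ∀ i, ∀ p : Space d × ℝ, p.2 ≤ s → G i p = 0)
    (s' : ℝ) : IsWeakGradient s' T v G where
  memLp := h.memLp
  memLp_grad := h.memLp_grad
  grad η hη i := by
    have m1 : MemLp (fun p => fderiv ℝ η p (spaceDir i)) 2 :=
      (contDiff_fderiv_const hη.smooth _).continuous.memLp_of_hasCompactSupport
        (hη.compact.fderiv_apply ℝ _)
    have m2 : MemLp η 2 := hη.smooth.continuous.memLp_of_hasCompactSupport hη.compact
    have i1 : Integrable fun p => fderiv ℝ η p (spaceDir i) * v p := m1.integrable_mul h.memLp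
    have i2 : Integrable fun p => η p * G i p := m2.integrable_mul (h.memLp_grad i)
    have l1 := tendsto_integral_cutoff i1 fun p hp => by rw [hv p hp, mul_zero]
    have l2 := (tendsto_integral_cutoff i2 fun p hp => by rw [hG i p hp, mul_zero]).neg
    -- A cutoff in time commutes with spatial derivatives, so restricting the test function to times
    -- after `s` leaves no error term, and the limit crosses the initial time.
    refine tendsto_nhds_unique l1 (l2.congr' ?_)
    filter_upwards [eventually_gt_atTop 0] with n hn
    have hn' : (0 : ℝ) < n := by exact_mod_cast hn
    set θ : ℝ → ℝ := fun t => smoothTransition (n * (t - s) - 1) with hθ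
    have sθ : ContDiff ℝ ∞ θ := Real.smoothTransition.contDiff.comp
      ((contDiff_const.mul (contDiff_id.sub contDiff_const)).sub contDiff_const)
    have hz : Function.support θ ⊆ Ici (s + 1 / n) := fun t ht => by
      by_contra hm
      refine ht (Real.smoothTransition.zero_of_nonpos ?_)
      rw [mem_Ici, not_le] at hm
      have : (n : ℝ) * (t - s) ≤ n * (1 / n) := by
        refine mul_le_mul_of_nonneg_left ?_ hn'.le
        linarith
      rw [mul_one_div_cancel hn'.ne'] at this
      linarith
    have tη : IsTestFunction (Ioo s T) fun p : Space d × ℝ => θ p.2 * η p := by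
      refine ⟨(sθ.comp contDiff_snd).mul hη.smooth, hη.compact.mul_left, fun p hp => ?_⟩
      have h1 := tsupport_mul_subset_right hp
      have h2 := (hη.support_subset h1).2
      have h3 : p ∈ (Prod.snd : Space d × ℝ → ℝ) ⁻¹' Ici (s + 1 / n) := by
        have hcl : IsClosed ((Prod.snd : Space d × ℝ → ℝ) ⁻¹' Ici (s + 1 / (n : ℝ))) :=
          isClosed_Ici.preimage continuous_snd
        refine closure_minimal (fun q hq => ?_) hcl (tsupport_mul_subset_left hp)
        exact hz hq
      have h4 : (0 : ℝ) < 1 / n := by positivity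
      exact ⟨mem_univ _, by linarith [show s + 1 / (n : ℝ) ≤ p.2 from h3], h2.2⟩
    have e := h.grad _ tη i
    have hd : ∀ p, fderiv ℝ (fun p : Space d × ℝ => θ p.2 * η p) p (spaceDir i) =
        θ p.2 * fderiv ℝ η p (spaceDir i) := fun p => by
      have h1 : HasFDerivAt (fun p : Space d × ℝ => θ p.2 * η p) _ p :=
        ((sθ.differentiable (by simp) p.2).hasFDerivAt.comp p hasFDerivAt_snd).mul
          (hη.smooth.differentiable (by simp) p).hasFDerivAt
      rw [h1.fderiv]
      simp
    simp only [hd, mul_assoc] at e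
    exact e.symm

/-- The factor `e^{-Lt}` supplies the rate `-L`; the nonincreasing factor `expNegInvGlue (T' - t)`
switches the weight off smoothly at `T'` and only helps the sign. The weight rises before `s`, where
the functions it is applied to vanish. -/
lemma exists_decreasing_weight (s : ℝ) {T' L : ℝ} :
    ∃ θ : ℝ → ℝ, ContDiff ℝ ∞ θ ∧ HasCompactSupport θ ∧ tsupport θ ⊆ Icc (s - 1 / 2) T' ∧
      (∀ t, 0 ≤ θ t) ∧ (∀ t ∈ Ioo s T', 0 < θ t) ∧ ∀ t, s < t → deriv θ t ≤ -L * θ t := by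
  set ψ : ℝ → ℝ := fun t => Real.exp (-L * t) * expNegInvGlue (T' - t) with hψ
  set θ : ℝ → ℝ := fun t => smoothTransition (2 * (t - s) + 1) * ψ t with hθ
  have sψ : ContDiff ℝ ∞ ψ := (Real.contDiff_exp.comp (contDiff_const.mul contDiff_id)).mul
    (expNegInvGlue.contDiff.comp (contDiff_const.sub contDiff_id))
  have sθ : ContDiff ℝ ∞ θ := (Real.smoothTransition.contDiff.comp
    ((contDiff_const.mul (contDiff_id.sub contDiff_const)).add contDiff_const)).mul sψ
  have hz : ∀ t, t ∉ Icc (s - 1 / 2) T' → θ t = 0 := by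
    intro t ht
    rw [mem_Icc, not_and_or, not_le, not_le] at ht
    simp only [hθ, hψ]
    rcases ht with h | h
    · rw [Real.smoothTransition.zero_of_nonpos (by linarith), zero_mul]
    · rw [expNegInvGlue.zero_of_nonpos (by linarith), mul_zero, mul_zero]
  have hψ0 : ∀ t, 0 ≤ ψ t := fun t => mul_nonneg (Real.exp_pos _).le (expNegInvGlue.nonneg _)
  have h1 : ∀ t, s ≤ t → smoothTransition (2 * (t - s) + 1) = 1 := fun t ht =>
    Real.smoothTransition.one_of_one_le (by linarith)
  refine ⟨θ, sθ, HasCompactSupport.intro isCompact_Icc hz, closure_minimal (fun t ht => ?_)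
    isClosed_Icc, fun t => mul_nonneg (Real.smoothTransition.nonneg _) (hψ0 t), fun t ht => ?_,
    fun t ht => ?_⟩
  · by_contra hn
    exact ht (hz t hn)
  · simp only [hθ]
    rw [h1 t ht.1.le, one_mul]
    exact mul_pos (Real.exp_pos _) (expNegInvGlue.pos_of_pos (by linarith [ht.2]))
  · have he : θ =ᶠ[𝓝 t] ψ := by
      filter_upwards [Ioi_mem_nhds ht] with r hr
      simp only [hθ]
      rw [h1 r (le_of_lt hr), one_mul]
    rw [he.deriv_eq, he.eq_of_nhds]
    have d1 : HasDerivAt (fun t => Real.exp (-L * t)) (Real.exp (-L * t) * (-L)) t := by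
      simpa using ((hasDerivAt_id t).const_mul (-L)).exp
    have d2 : HasDerivAt (fun t => expNegInvGlue (T' - t)) (deriv expNegInvGlue (T' - t) * (-1)) t :=
      HasDerivAt.comp t ((expNegInvGlue.contDiff (n := 1)).differentiable one_ne_zero
        _).hasDerivAt (by simpa using (hasDerivAt_id t).const_sub T')
    have d3 : HasDerivAt ψ _ t := d1.mul d2
    rw [d3.deriv]
    have h3 : 0 ≤ deriv expNegInvGlue (T' - t) := expNegInvGlue.monotone.deriv_nonneg
    have h4 := mul_nonneg (Real.exp_pos (-L * t)).le h3
    simp only [hψ]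
    linarith

namespace IsRegularField

/-- Uniqueness in the energy class for vanishing data. -/
theorem ae_eq_zero (hlam : 0 < lam) (h : IsRegularField a lam K)
    (hG : IsWeakGradient s T v fun i p => W p i)
    (hv : ∀ p : Space d × ℝ, p.2 ≤ s → v p = 0) (hW : ∀ p : Space d × ℝ, p.2 ≤ s → W p = 0)
    (hweak : ∀ η, IsTestFunction (Iio T) η →
      ∫ p, (inner ℝ (W p) (testFlux a η p) + v p * testSource a η p) = 0)
    {T' : ℝ} (hT : T' < T) : ∀ᵐ p : Space d × ℝ, p.2 ∈ Ioo s T' → v p = 0 := by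
  set C := lam * (d * (d * K)) ^ 2 with hC
  -- The rate exceeds the zero-order constant `C` of the energy inequality by one, so its right-hand
  -- side is at most `-∫ θ v²`.
  obtain ⟨θ, sθ, cθ, tθ, hθ0, hθ1, hθ'⟩ := exists_decreasing_weight s (T' := T') (L := C + 1)
  -- Extended by zero, `v` solves the equation across the initial time because its datum is zero.
  -- Starting the interval at `s - 1` makes `θ`, supported from `s - 1/2` on, an admissible weight.
  have hG' := hG.extend hv (fun i p hp => by rw [hW p hp]; rfl) (s - 1)
  obtain ⟨i1, i2, hen⟩ := h.energy_le hlam hG' (fun η hη => hweak η ⟨hη.smooth, hη.compact,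
    hη.support_subset.trans (prod_mono_right fun t ht => ht.2)⟩) sθ cθ
    (tθ.trans (Icc_subset_Ioo (by linarith) hT)) hθ0
  obtain ⟨c, hc⟩ := cθ.exists_bound_of_continuous sθ.continuous
  have i3 : Integrable fun p : Space d × ℝ => θ p.2 * v p ^ 2 := by
    have := integrable_mul_mul (k := fun p : Space d × ℝ => θ p.2)
      (sθ.continuous.comp continuous_snd).aestronglyMeasurable (fun p => hc p.2) hG.memLp hG.memLp
    simpa only [mul_assoc, ← sq] using this
  have h1 : (0 : ℝ) ≤ ∫ p : Space d × ℝ, θ p.2 * ‖W p‖ ^ 2 :=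
    integral_nonneg fun p => mul_nonneg (hθ0 _) (sq_nonneg _)
  have h2 : ∫ p : Space d × ℝ, (deriv θ p.2 + C * θ p.2) * v p ^ 2 ≤
      ∫ p : Space d × ℝ, -(θ p.2 * v p ^ 2) := by
    refine integral_mono i2 i3.neg fun p => ?_
    by_cases hp : p.2 ≤ s
    · simp [hv p hp]
    · have := mul_le_mul_of_nonneg_right (hθ' p.2 (not_le.mp hp)) (sq_nonneg (v p))
      simp only
      linarith
  rw [integral_neg] at h2
  have h3 := (mul_nonneg (inv_pos.mpr hlam).le h1).trans hen
  have h4 : ∫ p : Space d × ℝ, θ p.2 * v p ^ 2 = 0 :=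
    le_antisymm (by linarith) (integral_nonneg fun p => mul_nonneg (hθ0 _) (sq_nonneg _))
  rw [integral_eq_zero_iff_of_nonneg (fun p => mul_nonneg (hθ0 _) (sq_nonneg _)) i3] at h4
  filter_upwards [h4] with p hp hm
  have := (mul_eq_zero.mp hp).resolve_left (hθ1 _ hm).ne'
  exact pow_eq_zero_iff two_ne_zero |>.mp this

/-- Weak solutions of the Cauchy problem are unique. -/
theorem ae_eq_of_isWeakSolution (hlam : 0 < lam) (hK : 0 ≤ K) (h : IsRegularField a lam K)
    {φ : Space d → ℝ} {u₁ u₂ : Space d → ℝ → ℝ} (h₁ : IsWeakSolution a s T φ u₁)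
    (h₂ : IsWeakSolution a s T φ u₂) {T' : ℝ} (hT : T' < T) :
    ∀ᵐ p : Space d × ℝ, p.2 ∈ Ioo s T' → u₁ p.1 p.2 = u₂ p.1 p.2 := by
  obtain ⟨m₁, -, G₁, n₁, g₁, w₁⟩ := h₁
  obtain ⟨m₂, -, G₂, n₂, g₂, w₂⟩ := h₂
  have k₁ := (isWeakGradient_slabExtend_iff m₁ n₁).mpr g₁
  have k₂ := (isWeakGradient_slabExtend_iff m₂ n₂).mpr g₂
  have hn : ∀ p : Space d × ℝ, p.2 ≤ s → p.2 ∉ Ioo s T := fun p hp hm => (hp.trans_lt hm.1).false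
  have key := h.ae_eq_zero hlam (s := s) (T := T) (T' := T')
    (v := fun p => slabExtend s T (fun p => u₁ p.1 p.2) p - slabExtend s T (fun p => u₂ p.1 p.2) p)
    (W := fun p => slabExtend s T (fun p => G₁ p.1 p.2) p - slabExtend s T (fun p => G₂ p.1 p.2) p)
    (k₁.sub k₂) (fun p hp => by simp [slabExtend_of_notMem (hn p hp)])
    (fun p hp => by simp [slabExtend_of_notMem (hn p hp)]) (fun η hη => ?_) hT
  · filter_upwards [key] with p hp hm
    have hm' : p.2 ∈ Ioo s T := ⟨hm.1, hm.2.trans hT⟩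
    have := hp hm
    rw [slabExtend_of_mem hm', slabExtend_of_mem hm'] at this
    exact sub_eq_zero.mp this
  · have e₁ := w₁ η hη
    have e₂ := w₂ η hη
    rw [h.integral_weak_form_slab hlam hK k₁ hη.smooth hη.compact] at e₁
    rw [h.integral_weak_form_slab hlam hK k₂ hη.smooth hη.compact] at e₂
    have i₁ := h.integrable_weak_form hlam hK hη.smooth hη.compact k₁.memLp k₁.memLp_grad
    have i₂ := h.integrable_weak_form hlam hK hη.smooth hη.compact k₂.memLp k₂.memLp_grad
    rw [← sub_self (∫ x, φ x * η (x, s)), ← e₁]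
    nth_rw 2 [e₁]
    rw [← e₂, ← integral_sub i₁ i₂]
    refine integral_congr_ae (Eventually.of_forall fun p => ?_)
    simp only [inner_sub_left]
    ring

end IsRegularField

end Uniqueness

/-! ### Identification of all weak fundamental solutions. -/

section Main

open Filter Topology

variable {d : ℕ} {a : MatrixField d} {lam K s T : ℝ} {Γ Γ₁ Γ₂ : Space d → ℝ → Space d → ℝ → ℝ}

lemma IsWeakFundamentalSolution.continuous_pole (h : IsWeakFundamentalSolution a T Γ) (hs : 0 ≤ s)
    {t : ℝ} (hst : s < t) (htT : t ≤ T) (x : Space d) : Continuous fun y => Γ x t y s := by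
  have h1 := h.continuousOn s hs (hst.trans_le htT)
  exact h1.comp_continuous (f := fun y : Space d => (x, t, y)) (by fun_prop) fun _ => ⟨hst, htT⟩

/-- A strict inequality at one point persists by continuity on a product neighbourhood. For a bump
datum supported near `y` the two solutions agree almost everywhere, hence at points arbitrarily
close to `(x, t)`; there the integral of a positive difference against the bump would be zero. Here
`t < T`, since uniqueness is available up to any `T' < T`. -/
lemma IsRegularField.not_lt_of_isWeakFundamentalSolution (hlam : 0 < lam) (hK : 0 ≤ K)
    (h : IsRegularField a lam K) (h₁ : IsWeakFundamentalSolution a T Γ₁)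
    (h₂ : IsWeakFundamentalSolution a T Γ₂) (hs : 0 ≤ s) {t : ℝ} (hst : s < t) (htT : t < T)
    (x y : Space d) : ¬ Γ₁ x t y s < Γ₂ x t y s := by
  intro hlt
  set D : Space d × ℝ × Space d → ℝ := fun p => Γ₂ p.1 p.2.1 p.2.2 s - Γ₁ p.1 p.2.1 p.2.2 s with hD
  have hsT := hst.trans htT
  have cD : ContinuousAt D (x, t, y) := by
    refine ContinuousOn.continuousAt (s := {p | s < p.2.1 ∧ p.2.1 ≤ T})
      ((h₂.continuousOn s hs hsT).sub (h₁.continuousOn s hs hsT)) ?_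
    have ho : IsOpen {p : Space d × ℝ × Space d | s < p.2.1 ∧ p.2.1 < T} :=
      isOpen_Ioo.preimage (continuous_fst.comp continuous_snd)
    exact mem_of_superset (ho.mem_nhds ⟨hst, htT⟩) fun p hp => ⟨hp.1, hp.2.le⟩
  have hpos : ∀ᶠ p in 𝓝 (x, t, y), 0 < D p := cD.eventually (lt_mem_nhds (sub_pos.mpr hlt))
  rw [nhds_prod_eq, nhds_prod_eq] at hpos
  obtain ⟨P, hP, Q, hQ, hPQ⟩ := eventually_prod_iff.mp hpos
  obtain ⟨P', hP', Q', hQ', hPQ'⟩ := eventually_prod_iff.mp hQ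
  obtain ⟨r, hr, hball⟩ := Metric.eventually_nhds_iff_ball.mp hQ'
  set χ : ContDiffBump y := ⟨r / 2, r, by positivity, by linarith⟩ with hχ
  have hae := h.ae_eq_of_isWeakSolution hlam hK
    (h₁.cauchy s hs hsT χ χ.continuous χ.hasCompactSupport)
    (h₂.cauchy s hs hsT χ χ.continuous χ.hasCompactSupport)
    (T' := (t + T) / 2) (by linarith)
  have hU : ∀ᶠ p : Space d × ℝ in 𝓝 (x, t), P p.1 ∧ P' p.2 ∧ p.2 ∈ Ioo s ((t + T) / 2) := by
    rw [nhds_prod_eq]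
    have h3 : ∀ᶠ τ in 𝓝 t, P' τ ∧ τ ∈ Ioo s ((t + T) / 2) :=
      hP'.and (Ioo_mem_nhds hst (by linarith))
    exact (hP.prod_mk h3).mono fun p hp => ⟨hp.1, hp.2⟩
  obtain ⟨p, hp4, hp1, hp2, hp3⟩ :=
    ((mem_closure_iff_frequently.mp (Measure.dense_of_ae hae (x, t))).and_eventually hU).exists
  have hpT : p.2 ≤ T := by linarith [hp3.2]
  have e := hp4 hp3
  have c₁ := h₁.continuous_pole hs hp3.1 hpT p.1
  have c₂ := h₂.continuous_pole hs hp3.1 hpT p.1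
  have j₁ : Integrable fun y => Γ₁ p.1 p.2 y s * χ y :=
    (c₁.mul χ.continuous).integrable_of_hasCompactSupport χ.hasCompactSupport.mul_left
  have j₂ : Integrable fun y => Γ₂ p.1 p.2 y s * χ y :=
    (c₂.mul χ.continuous).integrable_of_hasCompactSupport χ.hasCompactSupport.mul_left
  have hDpos : ∀ z, z ∈ Metric.ball y r → 0 < D (p.1, p.2, z) := fun z hz =>
    hPQ hp1 (hPQ' hp2 (hball z hz))
  have hint : 0 < ∫ z, D (p.1, p.2, z) * χ z := by
    refine Continuous.integral_pos_of_hasCompactSupport_nonneg_nonzero (x := y)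
      ((c₂.sub c₁).mul χ.continuous) χ.hasCompactSupport.mul_left (fun z => ?_) ?_
    · by_cases hz : z ∈ Metric.ball y r
      · exact mul_nonneg (hDpos z hz).le χ.nonneg
      · have : χ z = 0 := by
          rw [← Function.notMem_support, χ.support_eq]
          exact hz
        simp [this]
    · have h1 : χ y = 1 := χ.one_of_mem_closedBall (Metric.mem_closedBall_self (by positivity))
      have h2 := hDpos y (Metric.mem_ball_self hr)
      rw [h1, mul_one]
      exact h2.ne'
  have : ∫ z, D (p.1, p.2, z) * χ z = 0 := by
    simp only [hD, sub_mul]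
    rw [integral_sub j₂ j₁, e, sub_self]
  exact hint.ne' this

/-- The weak fundamental solution is unique. -/
theorem IsRegularField.eq_of_isWeakFundamentalSolution (hlam : 0 < lam) (hK : 0 ≤ K)
    (h : IsRegularField a lam K) (h₁ : IsWeakFundamentalSolution a T Γ₁)
    (h₂ : IsWeakFundamentalSolution a T Γ₂) (hs : 0 ≤ s) {t : ℝ} (hst : s < t) (htT : t ≤ T)
    (x y : Space d) : Γ₁ x t y s = Γ₂ x t y s := by
  have key : ∀ τ ∈ Ioo s T, Γ₁ x τ y s = Γ₂ x τ y s := fun τ hτ =>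
    le_antisymm
      (not_lt.mp (h.not_lt_of_isWeakFundamentalSolution hlam hK h₂ h₁ hs hτ.1 hτ.2 x y))
      (not_lt.mp (h.not_lt_of_isWeakFundamentalSolution hlam hK h₁ h₂ hs hτ.1 hτ.2 x y))
  rcases htT.lt_or_eq with hlt | rfl
  · exact key t ⟨hst, hlt⟩
  -- The final time `t = T` is reached by continuity from the left.
  have c : ∀ Γ' : Space d → ℝ → Space d → ℝ → ℝ, IsWeakFundamentalSolution a t Γ' →
      Tendsto (fun τ => Γ' x τ y s) (𝓝[Ioo s t] t) (𝓝 (Γ' x t y s)) := fun Γ' h' => by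
    have h3 := (h'.continuousOn s hs hst).comp (f := fun τ : ℝ => (x, τ, y)) (s := Ioc s t)
      (by fun_prop) fun τ hτ => hτ
    exact ((h3 t ⟨hst, le_rfl⟩).mono Ioo_subset_Ioc_self).tendsto
  have : (𝓝[Ioo s t] t).NeBot := by
    rw [← mem_closure_iff_nhdsWithin_neBot, closure_Ioo hst.ne]
    exact ⟨hst.le, le_rfl⟩
  refine tendsto_nhds_unique (c Γ₁ h₁) ((c Γ₂ h₂).congr' ?_)
  filter_upwards [self_mem_nhdsWithin] with τ hτ
  exact (key τ hτ).symm

/-- The extension of a field to negative times. -/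
def extendField (a : MatrixField d) : MatrixField d := fun x t => a x (max t 0)

/-- Extending by the values at time zero makes all hypotheses hold at every real time, and `max K 0`
provides the nonnegative bound used in the constants. -/
lemma isRegularField_extendField (ha : UniformlyElliptic a lam) (hr : SpatiallyRegular a K) :
    IsRegularField (extendField a) lam (max K 0) where
  lower t x ζ := (ha _ (le_max_right t 0) x ζ).1
  upper t x ζ := (ha _ (le_max_right t 0) x ζ).2
  measurable i j := (hr.measurable i j).comp
    ((by fun_prop : Measurable fun p : Space d × ℝ => (p.1, max p.2 0)).subtype_mk
      (h := fun p => ⟨mem_univ _, le_max_right p.2 0⟩))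
  contDiff t i j := hr.contDiff _ (le_max_right t 0) i j
  norm_fderiv_le t x i j := by
    have h1 := hr.gradient_le _ (le_max_right t 0) x i j
    rw [gradient, LinearIsometryEquiv.norm_map] at h1
    exact h1.trans (le_max_left _ _)

/-- For `s ≥ 0` the weak formulation involves only times in `(s, T)`, where the field and its
extension agree. -/
lemma isWeakFundamentalSolution_extendField_iff :
    IsWeakFundamentalSolution (extendField a) T Γ ↔ IsWeakFundamentalSolution a T Γ := by
  have key : ∀ s, 0 ≤ s → ∀ (φ : Space d → ℝ) (u : Space d → ℝ → ℝ),
      IsWeakSolution (extendField a) s T φ u ↔ IsWeakSolution a s T φ u := by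
    intro s hs φ u
    unfold IsWeakSolution
    have e : ∀ (G : Space d → ℝ → Space d) (η : Space d × ℝ → ℝ), ∫ t in Ioo s T, ∫ x : Space d,
          (inner ℝ (Matrix.toEuclideanLin (extendField a x t) (G x t))
            (gradient (fun z => η (z, t)) x) - u x t * deriv (fun τ => η (x, τ)) t) =
        ∫ t in Ioo s T, ∫ x : Space d,
          (inner ℝ (Matrix.toEuclideanLin (a x t) (G x t))
            (gradient (fun z => η (z, t)) x) - u x t * deriv (fun τ => η (x, τ)) t) := fun G η => by
      refine setIntegral_congr_fun measurableSet_Ioo fun t ht => ?_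
      simp only [extendField, max_eq_left (hs.trans ht.1.le)]
    simp only [e]
  exact ⟨fun h => ⟨h.continuousOn, fun s hs hT φ hφ hc => (key s hs φ _).mp (h.cauchy s hs hT φ hφ hc)⟩,
    fun h => ⟨h.continuousOn, fun s hs hT φ hφ hc => (key s hs φ _).mpr (h.cauchy s hs hT φ hφ hc)⟩⟩

/-- The fundamental kernel built from the frozen Gaussians. -/
theorem exists_fundamentalKernel (d : ℕ) (hlam : 0 < lam) (hK : 0 ≤ K) :
    ∃ ν N : ℝ, 0 < ν ∧ 0 ≤ N ∧ ∀ a : MatrixField d, IsRegularField a lam K →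
      ∃ Γ DΓ, IsFundamentalKernel a (1 / (8 * lam)) N (1 + ν) Γ DΓ := by
  have hM : 0 ≤ frozenConst d lam K := by
    have := gaussConst_pos (d := d) hlam
    unfold frozenConst
    positivity
  obtain ⟨ν, N, hν, hN, H⟩ := exists_levi_kernel d (b := 1 / (8 * lam)) (by positivity) hM
  refine ⟨ν, N, hν, hN, fun a h => ?_⟩
  obtain ⟨Γ, DΓ, m1, m2, b1, b2, hg, hc, hp⟩ := H _ _ _ (h.isParametrix hlam hK)
  exact ⟨Γ, DΓ, m1, m2, b1, b2, hg, hc, fun T η hη q =>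
    hp T η _ _ (h.isAdjointTest hlam hK hη) q⟩

end Main

end AronsonGradient

end

theorem mainTheorem1 (d : ℕ) (hd : 1 ≤ d) (lam : ℝ) (hlam : 0 < lam) :
    ∃ ϖ : ℝ, 0 < ϖ ∧ ∀ K T : ℝ, 0 < T →
      ∃ ϱ : ℝ, 0 < ϱ ∧ ∀ a : AronsonGradient.MatrixField d,
        AronsonGradient.UniformlyElliptic a lam → AronsonGradient.SpatiallyRegular a K →
          (∃ Γ : AronsonGradient.Space d → ℝ → AronsonGradient.Space d → ℝ → ℝ,
            AronsonGradient.IsWeakFundamentalSolution a T Γ) ∧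
          ∀ Γ : AronsonGradient.Space d → ℝ → AronsonGradient.Space d → ℝ → ℝ,
            AronsonGradient.IsWeakFundamentalSolution a T Γ →
              ∀ (s t : ℝ), 0 ≤ s → s < t → t ≤ T → ∀ x y : AronsonGradient.Space d,
                DifferentiableAt ℝ (fun z => Γ z t y s) x ∧
                ‖gradient (fun z => Γ z t y s) x‖ ≤
                  1 / Real.sqrt (t - s) * AronsonGradient.gaussianBound ϱ ϖ (x - y) (t - s) := by
  open AronsonGradient in
  have hb : 0 < 1 / (8 * lam) := by positivity
  refine ⟨1 / (8 * lam), hb, fun K T hT => ?_⟩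
  obtain ⟨ν, N, hν, hN, H⟩ := exists_fundamentalKernel d hlam (le_max_right K 0)
  -- The exponential growth of the time weight is bounded by its value at `T`; the added `1` makes
  -- `ϱ` positive even when `N = 0`.
  refine ⟨N * Real.exp ((1 + ν) * T) + 1, by positivity, fun a ha hr => ?_⟩
  have hreg := isRegularField_extendField ha hr
  obtain ⟨Γ₀, DΓ, hΓ⟩ := H _ hreg
  have hsol := hΓ.isWeakFundamentalSolution (T := T) hlam (le_max_right K 0) hreg hb hN
    (by positivity)
  refine ⟨⟨_, isWeakFundamentalSolution_extendField_iff.mp hsol⟩, fun Γ h s t hs hst htT x y => ?_⟩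
  -- By uniqueness the given `Γ` is the constructed kernel as a function of `z`, so
  -- differentiability and the gradient bound transfer.
  have e : (fun z => Γ z t y s) = fun z => Γ₀ (z, t) (y, s) := funext fun z =>
    hreg.eq_of_isWeakFundamentalSolution hlam (le_max_right K 0)
      (isWeakFundamentalSolution_extendField_iff.mpr h) hsol hs hst htT z y
  have hg := hΓ.hasGradientAt (x, t) (y, s) hst
  rw [e]
  refine ⟨hg.differentiableAt, ?_⟩
  rw [hg.gradient]
  refine (hΓ.bound_grad (x, t) (y, s)).trans ?_
  have hr0 : 0 < t - s := sub_pos.mpr hst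
  rw [gaussKernel_of_lt (p := (x, t)) (q := (y, s)) hst]
  have hg0 := gaussianBound_nonneg (b := 1 / (8 * lam)) zero_le_one (x - y) hr0.le
  have hlin : ∀ c : ℝ, gaussianBound c (1 / (8 * lam)) (x - y) (t - s) =
      c * gaussianBound 1 (1 / (8 * lam)) (x - y) (t - s) := fun c => by
    unfold gaussianBound
    ring
  rw [hlin (_ + 1), ← mul_assoc]
  refine mul_le_mul_of_nonneg_right ?_ hg0
  have h1 : Real.exp ((1 + ν) * (t - s)) ≤ Real.exp ((1 + ν) * T) := by
    have : t - s ≤ T := by linarith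
    gcongr
  have h2 : 0 ≤ (√(t - s))⁻¹ := by positivity
  calc N * timeWeight (1 + ν) (t - s)
      = (√(t - s))⁻¹ * (N * Real.exp ((1 + ν) * (t - s))) := by
        unfold timeWeight
        ring
    _ ≤ (√(t - s))⁻¹ * (N * Real.exp ((1 + ν) * T) + 1) := by
        refine mul_le_mul_of_nonneg_left ?_ h2
        linarith [mul_le_mul_of_nonneg_left h1 hN]
    _ = _ := by rw [one_div]
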